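/- Let $(V, V_{\mathbb R}, V_{\mathbb C})$ be a finite-dimensional mixed super vector space: $V = V_{\bar 0}\oplus V_{\bar 1}$ is a complex super vector space, $V_{\mathbb C}\subseteq V_{\mathbb R}\subseteq V$ are a complex and a real graded subspace whose odd parts are $V_{\bar 1}$, and $\mathbb C\otimes_{\mathbb R} V_{\mathbb R}/V_{\mathbb C}\to V/V_{\mathbb C}$ is an isomorphism. Let $\mathbb A(V_{\mathbb R})$ be the superspace with underlying space $(V_{\mathbb R})_{\bar 0}$ and structure sheaf $\mathcal O\otimes_{\mathbb C}\bigwedge V_{\bar 1}^*$, where $\mathcal O$ is the sheaf of smooth complex-valued functions whose differential is complex linear along $(V_{\mathbb C})_{\bar 0}$. A mixed supermanifold is a locally ringed superspace over $\mathbb C$ with second countable Hausdorff base that is locally isomorphic to open subspaces of such models. Let $J\colon V\otimes V\to\mathbb C$ be an even non-degenerate supersymmetric bilinear form. For a mixed supermanifold $T$ let $GL(V)(T)$ be the group of even $\mathcal O_T$-linear automorphisms of $\mathcal O_T\otimes V$, and let $$OSp(V,J)(T)=\{A\in GL(V)(T)\mid J_T(Ax,Ay)=J_T(x,y)\text{ for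 all }x,y\},$$ where $J_T$ is the $\mathcal O_T$-bilinear extension of $J$ (with the usual signs). For a mixed supermanifold $M$ locally modelled on $(V, V_{\mathbb R}, V_{\mathbb C})$, let $L(M)$ be its frame bundle: its $T$-points are the pairs $(f,\varphi)$ of a morphism $f\colon T\to M$ and an even isomorphism of vector bundles $\varphi\colon \mathcal O_T\otimes V\to f^*TM$. The group $GL(V)(T)$ acts on them from the right by $\varphi\mapsto\varphi\circ A$. A reduction of $L(M)$ to $OSp(V,J)$ is a subsheaf $P\subseteq L(M)$ that is stable under $OSp(V,J)$ and is a locally trivial principal $OSp(V,J)$-bundle over $M$. (a) For every mixed supermanifold $M$ locally modelled on $(V, V_{\mathbb R}, V_{\mathbb C})$, the assignment $$g\longmapsto P_g,\qquad P_g(T)=\{(f,\varphi)\in L(M)(T)\mid (f^*g)(\varphi v,\varphi w)=J(v,w)\ \text{for all } v,w\in V\},$$ is a bijection from the set of even non-degenerate supersymmetric forms $g\colon TM\otimes TM\to\mathcal O_M$ onto the set of reductions of $L(M)$ to $OSp(V,J)$. (b) Let $\mathfrak{osp}(V,J)\subseteq\mathrm{End}(V)$ be the Lie superalgebra of $OSp(V,J)$.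 For $\mathfrak g\subseteq \mathrm{End}(V)$ put $\mathfrak g^{(-1)}=V$, $\mathfrak g^{(0)}=\mathfrak g$ and, for $k\ge 1$, $$\mathfrak g^{(k)}=\{X\in\mathrm{Hom}(V,\mathfrak g^{(k-1)})\mid X(v)(w)=(-1)^{|v||w|}X(w)(v)\text{ for all homogeneous }v,w\in V\}.$$ Then $\mathfrak{osp}(V,J)^{(1)}=0$. In particular $OSp(V,J)\le GL(V)$ is of finite type, i.e. there is a $k$ with $\mathfrak{osp}(V,J)^{(k+l)}=0$ for all $l\ge 0$. -/

import Mathlib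

open TopologicalSpace
open scoped TensorProduct ContDiff

universe u

namespace SuperGeom

noncomputable section

/-! ### Super linear algebra -/

/-- The sign `(-1) ^ p` of a parity `p`. -/
def sgn (p : ZMod 2) : ℂ := if p = 0 then 1 else -1

theorem sgn_zero : sgn 0 = 1 := if_pos rfl

theorem sgn_one : sgn 1 = -1 := if_neg (by decide)

theorem eq_zero_or_one (p : ZMod 2) : p = 0 ∨ p = 1 := by
  revert p
  decide

theorem sgn_add (p q : ZMod 2) : sgn (p + q) = sgn p * sgn q := by
  have h : (1 : ZMod 2) + 1 = 0 := by decide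
  rcases eq_zero_or_one p with rfl | rfl <;> rcases eq_zero_or_one q with rfl | rfl <;>
    simp [sgn_zero, sgn_one, h]

section LinearAlgebra

variable {V₀ V₁ : Type u} [AddCommGroup V₀] [Module ℂ V₀] [AddCommGroup V₁] [Module ℂ V₁]

/-- The parity involution of the complex super vector space `V = V₀ ⊕ V₁`. -/
def vparity (V₀ V₁ : Type u) [AddCommGroup V₀] [Module ℂ V₀] [AddCommGroup V₁] [Module ℂ V₁] :
    (V₀ × V₁) →ₗ[ℂ] (V₀ × V₁) :=
  LinearMap.prodMap LinearMap.id (-LinearMap.id)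

/-- `v` is homogeneous of parity `p`: the first factor is the even and the second factor the
odd part. -/
def IsHomogeneous (p : ZMod 2) (v : V₀ × V₁) : Prop := vparity V₀ V₁ v = sgn p • v

/-- An even non-degenerate supersymmetric bilinear form on `V = V₀ ⊕ V₁`. -/
structure IsEvenMetricForm (J : LinearMap.BilinForm ℂ (V₀ × V₁)) : Prop where
  even : ∀ (p q : ZMod 2) (v w : V₀ × V₁), IsHomogeneous p v → IsHomogeneous q w →
    p ≠ q → J v w = 0
  supersymmetric : ∀ (p q : ZMod 2) (v w : V₀ × V₁), IsHomogeneous p v → IsHomogeneous q w →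
    J v w = sgn (p * q) * J w v
  nondegenerate : J.Nondegenerate

section Points

variable {R : Type*} [Ring R] [Algebra ℂ R]

/-- For a superalgebra `R` with parity involution `σ`, the parity involution of `R ⊗ V`. -/
def tparity (σ : R →ₐ[ℂ] R) : R ⊗[ℂ] (V₀ × V₁) →ₗ[ℂ] R ⊗[ℂ] (V₀ × V₁) :=
  TensorProduct.map σ.toLinearMap (vparity V₀ V₁)

/-- The `R`-points of `GL(V)`: the even `R`-linear automorphisms of `R ⊗ V`. -/
def GLPoints (σ : R →ₐ[ℂ] R) (V₀ V₁ : Type u) [AddCommGroup V₀] [Module ℂ V₀] [AddCommGroup V₁]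
    [Module ℂ V₁] :
    Subgroup ((R ⊗[ℂ] (V₀ × V₁)) ≃ₗ[R] (R ⊗[ℂ] (V₀ × V₁))) where
  carrier := {A | ∀ x, A (tparity σ x) = tparity σ (A x)}
  one_mem' := fun _ => rfl
  mul_mem' := by
    intro A B hA hB x
    have hA' : ∀ x, A (tparity σ x) = tparity σ (A x) := hA
    have hB' : ∀ x, B (tparity σ x) = tparity σ (B x) := hB
    rw [LinearEquiv.mul_apply, hB', hA', LinearEquiv.mul_apply]
  inv_mem' := by
    intro A hA x
    have hA' : ∀ x, A (tparity σ x) = tparity σ (A x) := hA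
    apply A.injective
    have h1 : ∀ y, A (A⁻¹ y) = y := fun y => A.apply_symm_apply y
    rw [hA', h1, h1]

/-- The `R`-bilinear extension of an even form `J` to `R ⊗ V`, with the sign rule
`J (a ⊗ v, b ⊗ w) = (-1) ^ (|v| |b|) a b J (v, w)`. -/
def formExt (σ : R →ₐ[ℂ] R) (J : LinearMap.BilinForm ℂ (V₀ × V₁)) :
    R ⊗[ℂ] (V₀ × V₁) →ₗ[ℂ] R ⊗[ℂ] (V₀ × V₁) →ₗ[ℂ] R :=
  (TensorProduct.map₂ (LinearMap.mul ℂ R)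
      (J ∘ₗ LinearMap.inl ℂ V₀ V₁ ∘ₗ LinearMap.fst ℂ V₀ V₁) +
    TensorProduct.map₂ ((LinearMap.mul ℂ R).compl₂ σ.toLinearMap)
      (J ∘ₗ LinearMap.inr ℂ V₀ V₁ ∘ₗ LinearMap.snd ℂ V₀ V₁)).compr₂
    (TensorProduct.rid ℂ R).toLinearMap

/-- The formula that defines `formExt`. -/
theorem formExt_tmul (σ : R →ₐ[ℂ] R) (J : LinearMap.BilinForm ℂ (V₀ × V₁)) (a b : R)
    (v w : V₀ × V₁) :
    formExt σ J (a ⊗ₜ v) (b ⊗ₜ w) = J (v.1, 0) w • (a * b) + J (0, v.2) w • (a * σ b) := by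
  simp [formExt]

/-- The `R`-points of `OSp(V, J)`: the elements of `GL(V)(R)` that preserve `J`. -/
def OSpPoints (σ : R →ₐ[ℂ] R) (J : LinearMap.BilinForm ℂ (V₀ × V₁)) :
    Subgroup (GLPoints σ V₀ V₁) where
  carrier := {A | ∀ x y, formExt σ J (A.1 x) (A.1 y) = formExt σ J x y}
  one_mem' := fun _ _ => rfl
  mul_mem' := by
    intro A B hA hB x y
    exact (hA (B.1 x) (B.1 y)).trans (hB x y)
  inv_mem' := by
    intro A hA x y
    have h1 : ∀ y, A.1 (A⁻¹.1 y) = y := fun y => A.1.apply_symm_apply y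
    rw [← hA, h1, h1]

end Points

/-- The parity involution of the superalgebra `ℂ[ε]`, `ε ^ 2 = 0`, with `ε` of parity `p`. -/
def dualParity (p : ZMod 2) : DualNumber ℂ →ₐ[ℂ] DualNumber ℂ :=
  TrivSqZeroExt.map (sgn p • LinearMap.id)

/-- The Lie superalgebra of `OSp(V, J)`, as a subspace of `End(V)`. Its part of parity `p`
consists of the endomorphisms `A` of parity `p` such that `1 + ε A` is a point of `OSp(V, J)`
over `ℂ[ε]`, `ε ^ 2 = 0`, `|ε| = p`; these form a vector space for each `p`, and the span is
their direct sum. -/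
def osp (J : LinearMap.BilinForm ℂ (V₀ × V₁)) :
    Submodule ℂ ((V₀ × V₁) →ₗ[ℂ] (V₀ × V₁)) :=
  Submodule.span ℂ {A | ∃ p : ZMod 2,
    (∀ v, A (vparity V₀ V₁ v) = sgn p • vparity V₀ V₁ (A v)) ∧
    ∃ e ∈ OSpPoints (dualParity p) J, ∀ v : V₀ × V₁,
      e.1 ((1 : DualNumber ℂ) ⊗ₜ v) = (1 : DualNumber ℂ) ⊗ₜ v + DualNumber.eps ⊗ₜ A v}

/-- `V`, `Hom(V, V)`, `Hom(V, Hom(V, V))`, ... -/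
def iteratedHom (V₀ V₁ : Type u) [AddCommGroup V₀] [Module ℂ V₀] [AddCommGroup V₁]
    [Module ℂ V₁] : ℕ → ModuleCat.{u} ℂ
  | 0 => ModuleCat.of ℂ (V₀ × V₁)
  | n + 1 => ModuleCat.of ℂ ((V₀ × V₁) →ₗ[ℂ] iteratedHom V₀ V₁ n)

/-- One step of prolongation: the linear maps `X : V → H` with values in the subspace `H` of
`Hom(V, W)` such that `X(v)(w) = (-1) ^ (|v| |w|) X(w)(v)` for homogeneous `v`, `w`. -/
def prolongStep {W : Type u} [AddCommGroup W] [Module ℂ W]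
    (H : Submodule ℂ ((V₀ × V₁) →ₗ[ℂ] W)) :
    Submodule ℂ ((V₀ × V₁) →ₗ[ℂ] ((V₀ × V₁) →ₗ[ℂ] W)) where
  carrier := {X | (∀ v, X v ∈ H) ∧ ∀ (p q : ZMod 2) (v w : V₀ × V₁),
    IsHomogeneous p v → IsHomogeneous q w → X v w = sgn (p * q) • X w v}
  zero_mem' := ⟨fun _ => H.zero_mem, by simp⟩
  add_mem' := by
    rintro X Y ⟨hX, hX'⟩ ⟨hY, hY'⟩
    refine ⟨fun v => H.add_mem (hX v) (hY v), fun p q v w hv hw => ?_⟩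
    simp only [LinearMap.add_apply, smul_add]
    rw [hX' p q v w hv hw, hY' p q v w hv hw]
  smul_mem' := by
    rintro c X ⟨hX, hX'⟩
    refine ⟨fun v => H.smul_mem c (hX v), fun p q v w hv hw => ?_⟩
    simp only [LinearMap.smul_apply]
    rw [hX' p q v w hv hw, smul_comm]

/-- The `k`-th prolongation `𝔤^(k)` of a subspace `𝔤` of `End(V)`. -/
def prolongation (g : Submodule ℂ ((V₀ × V₁) →ₗ[ℂ] (V₀ × V₁))) :
    (k : ℕ) → Submodule ℂ (iteratedHom V₀ V₁ (k + 1))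
  | 0 => g
  | k + 1 => prolongStep (W := iteratedHom V₀ V₁ k) (prolongation g k)

/-- `𝔤` is of finite type: its prolongations vanish from some degree on. -/
def IsFiniteType (g : Submodule ℂ ((V₀ × V₁) →ₗ[ℂ] (V₀ × V₁))) : Prop :=
  ∃ k : ℕ, ∀ l : ℕ, prolongation g (k + l) = ⊥

end LinearAlgebra

/-! ### Superspaces -/

/-- A topological space with a presheaf of complex superalgebras. The `ℤ/2`-grading is recorded by
the parity involution `par`: a section `a` has parity `p` if `par a = (-1) ^ p a`. -/
structure SuperSpace where
  carrier : Type u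
  [top : TopologicalSpace carrier]
  O : Opens carrier → Type u
  [ring : ∀ U, Ring (O U)]
  [algebra : ∀ U, Algebra ℂ (O U)]
  res : ∀ {U U' : Opens carrier}, U' ≤ U → O U →ₐ[ℂ] O U'
  res_self : ∀ {U : Opens carrier} (h : U ≤ U) (a : O U), res h a = a
  res_res : ∀ {U U' U'' : Opens carrier} (h : U' ≤ U) (h' : U'' ≤ U') (a : O U),
    res h' (res h a) = res (h'.trans h) a
  par : ∀ U : Opens carrier, O U →ₐ[ℂ] O U
  par_par : ∀ (U : Opens carrier) (a : O U), par U (par U a) = a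
  par_res : ∀ {U U' : Opens carrier} (h : U' ≤ U) (a : O U), par U' (res h a) = res h (par U a)

namespace SuperSpace

instance : CoeSort SuperSpace.{u} (Type u) := ⟨carrier⟩

attribute [instance] top ring algebra

/-- The presheaf is a sheaf. -/
def IsSheaf (X : SuperSpace.{u}) : Prop :=
  ∀ (ι : Type u) (U : ι → Opens X) (s : ∀ i, X.O (U i)),
    (∀ i j, X.res (inf_le_left : U i ⊓ U j ≤ U i) (s i) =
      X.res (inf_le_right : U i ⊓ U j ≤ U j) (s j)) →
    ∃! t : X.O (⨆ i, U i), ∀ i, X.res (le_iSup U i) t = s i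

/-- The algebras of sections are supercommutative. -/
def IsSupercommutative (X : SuperSpace.{u}) : Prop :=
  ∀ (U : Opens X) (p q : ZMod 2) (a b : X.O U), X.par U a = sgn p • a → X.par U b = sgn q • b →
    a * b = sgn (p * q) • (b * a)

/-- A morphism of locally ringed superspaces over `ℂ`: a continuous map `f` with compatible even
algebra homomorphisms `f^♯ : O_Y(W) → O_X(U)` for all open sets with `f(U) ⊆ W` (that is, with a
morphism `O_Y → f_* O_X`) that is local: a function whose pullback is invertible near `t` is
invertible near the image of `t`. -/
structure Hom (X Y : SuperSpace.{u}) where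
  base : C(X, Y)
  pull : ∀ (W : Opens Y) (U : Opens X), Set.MapsTo base U W → Y.O W →ₐ[ℂ] X.O U
  pull_res : ∀ {W W' : Opens Y} {U U' : Opens X} (hW : W' ≤ W) (hU : U' ≤ U)
    (h : Set.MapsTo base U W) (h' : Set.MapsTo base U' W') (a : Y.O W),
    pull W' U' h' (Y.res hW a) = X.res hU (pull W U h a)
  pull_par : ∀ (W : Opens Y) (U : Opens X) (h : Set.MapsTo base U W) (a : Y.O W),
    pull W U h (Y.par W a) = X.par U (pull W U h a)
  isLocal : ∀ (W : Opens Y) (a : Y.O W) (t : X),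
    (∃ (U : Opens X) (h : Set.MapsTo base U W), t ∈ U ∧ IsUnit (pull W U h a)) →
    ∃ (W' : Opens Y) (h : W' ≤ W), base t ∈ W' ∧ IsUnit (Y.res h a)

/-- The preimage of an open set under a morphism. -/
def Hom.pre {X Y : SuperSpace.{u}} (f : Hom X Y) (W : Opens Y) : Opens X :=
  ⟨f.base ⁻¹' W, W.isOpen.preimage f.base.continuous⟩

theorem Hom.mapsTo_pre {X Y : SuperSpace.{u}} (f : Hom X Y) (W : Opens Y) :
    Set.MapsTo f.base (f.pre W) W := fun _ hx => hx

/-- The identity morphism. -/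
def Hom.id (X : SuperSpace.{u}) : Hom X X where
  base := ContinuousMap.id X
  pull W U h := X.res (show U ≤ W from h)
  pull_res hW hU h h' a := by rw [X.res_res, X.res_res]
  pull_par W U h a := (X.par_res _ a).symm
  isLocal := fun W a t ⟨U, h, ht, hu⟩ => ⟨U, h, ht, hu⟩

/-- Composition of morphisms. -/
def Hom.comp {X Y Z : SuperSpace.{u}} (f : Hom X Y) (g : Hom Y Z) : Hom X Z where
  base := g.base.comp f.base
  pull W U h := (f.pull (g.pre W) U (show Set.MapsTo f.base U (g.pre W) from h)).comp (g.pull W (g.pre W) (g.mapsTo_pre W))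
  pull_res {W W' U U'} hW hU h h' a := by
    have hp : g.pre W' ≤ g.pre W := fun x hx => hW hx
    rw [AlgHom.comp_apply, AlgHom.comp_apply,
      g.pull_res hW hp (g.mapsTo_pre W) (g.mapsTo_pre W') a, f.pull_res hp hU h h']
  pull_par W U h a := by
    rw [AlgHom.comp_apply, AlgHom.comp_apply, g.pull_par, f.pull_par]
  isLocal := fun W a t ⟨U, h, ht, hu⟩ => by
    obtain ⟨U', hU', ht', hu'⟩ := f.isLocal _ (g.pull W _ (g.mapsTo_pre W) a) t ⟨U, h, ht, hu⟩
    refine g.isLocal W a (f.base t) ⟨U', fun x hx => hU' hx, ht', ?_⟩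
    have hpull := g.pull_res le_rfl hU' (g.mapsTo_pre W) (fun x hx => hU' hx) a
    rw [Z.res_self] at hpull
    rwa [hpull]

/-- Open immersions: isomorphisms onto open subspaces. -/
structure Hom.IsOpenImmersion {X Y : SuperSpace.{u}} (f : Hom X Y) : Prop where
  isOpenEmbedding : Topology.IsOpenEmbedding f.base
  bijective : ∀ W : Opens Y, (W : Set Y) ⊆ Set.range f.base →
    Function.Bijective (f.pull W (f.pre W) (f.mapsTo_pre W))

end SuperSpace

open SuperSpace

/-! ### Mixed supermanifolds -/

/-- A (finite-dimensional) mixed super vector space `(V, V_ℝ, V_ℂ)`, where `V = V₀ ⊕ V₁`. Since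
`(V_ℝ)₁ = (V_ℂ)₁ = V₁`, only the even parts `real` of `V_ℝ` and `cplx` of `V_ℂ` are recorded. The
last two fields say that `cplx ⊆ real` and that `ℂ ⊗ V_ℝ / V_ℂ → V / V_ℂ` is injective and
surjective. The norm on `V₀` only serves to speak about smooth functions. -/
structure MixedSuperVectorSpace where
  even : Type u
  odd : Type u
  [normedEven : NormedAddCommGroup even]
  [spaceEven : NormedSpace ℂ even]
  [finEven : FiniteDimensional ℂ even]
  [groupOdd : AddCommGroup odd]
  [moduleOdd : Module ℂ odd]
  [finOdd : FiniteDimensional ℂ odd]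
  real : Submodule ℝ even
  cplx : Submodule ℂ even
  mem_cplx : ∀ v, v ∈ cplx ↔ v ∈ real ∧ Complex.I • v ∈ real
  span_real : Submodule.span ℂ (real : Set even) = ⊤

namespace MixedSuperVectorSpace

attribute [instance] normedEven spaceEven finEven groupOdd moduleOdd finOdd

variable (V : MixedSuperVectorSpace.{u})

/-- The underlying complex super vector space. -/
abbrev Total : Type u := V.even × V.odd

/-- The partially holomorphic functions on an open subset `U` of `V_ℝ`: the smooth functions with
values in `ℂ` whose differential is complex linear on `V_ℂ`. -/
def partHol (U : Opens V.real) : Subalgebra ℂ (U → ℂ) where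
  carrier := {h | ∃ F : V.real → ℂ, (∀ x : U, F x = h x) ∧ ContDiffOn ℝ ∞ F U ∧
    ∀ x ∈ U, ∀ v w : V.real, (v : V.even) ∈ V.cplx → (w : V.even) = Complex.I • (v : V.even) →
      fderiv ℝ F x w = Complex.I * fderiv ℝ F x v}
  mul_mem' := by
    rintro _ _ ⟨F, hF, hF', hF''⟩ ⟨G, hG, hG', hG''⟩
    refine ⟨F * G, fun x => by simp [hF, hG], hF'.mul hG', fun x hx v w hv hw => ?_⟩
    have dF := (hF'.differentiableOn (by simp) x hx).differentiableAt (U.isOpen.mem_nhds hx)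
    have dG := (hG'.differentiableOn (by simp) x hx).differentiableAt (U.isOpen.mem_nhds hx)
    rw [fderiv_mul dF dG]
    simp only [add_apply, smul_apply, smul_eq_mul,
      hF'' x hx v w hv hw, hG'' x hx v w hv hw]
    ring
  add_mem' := by
    rintro _ _ ⟨F, hF, hF', hF''⟩ ⟨G, hG, hG', hG''⟩
    refine ⟨F + G, fun x => by simp [hF, hG], hF'.add hG', fun x hx v w hv hw => ?_⟩
    have dF := (hF'.differentiableOn (by simp) x hx).differentiableAt (U.isOpen.mem_nhds hx)
    have dG := (hG'.differentiableOn (by simp) x hx).differentiableAt (U.isOpen.mem_nhds hx)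
    rw [fderiv_add dF dG]
    simp only [add_apply, hF'' x hx v w hv hw, hG'' x hx v w hv hw]
    ring
  algebraMap_mem' := fun c =>
    ⟨fun _ => c, fun _ => rfl, contDiffOn_const, fun x _ v w _ _ => by simp⟩

/-- Restriction of partially holomorphic functions. -/
def partHolRes {U U' : Opens V.real} (h : U' ≤ U) : V.partHol U →ₐ[ℂ] V.partHol U' where
  toFun f := ⟨fun x => f.1 ⟨x.1, h x.2⟩, by
    obtain ⟨F, hF, hF', hF''⟩ := f.2
    exact ⟨F, fun x => hF ⟨x.1, h x.2⟩, hF'.mono h, fun x hx => hF'' x (h hx)⟩⟩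
  map_one' := rfl
  map_mul' _ _ := rfl
  map_zero' := rfl
  map_add' _ _ := rfl
  commutes' _ := rfl

/-- The partially holomorphic functions with values in the exterior algebra of the dual of
`V₁`. -/
abbrev superFun (U : Opens V.real) : Type u :=
  V.partHol U ⊗[ℂ] ExteriorAlgebra ℂ (Module.Dual ℂ V.odd)

/-- Restriction of superfunctions. -/
def superFunRes {U U' : Opens V.real} (h : U' ≤ U) : V.superFun U →ₐ[ℂ] V.superFun U' :=
  Algebra.TensorProduct.map (V.partHolRes h) (AlgHom.id ℂ _)

/-- The parity involution of superfunctions. -/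
def superFunPar (U : Opens V.real) : V.superFun U →ₐ[ℂ] V.superFun U :=
  Algebra.TensorProduct.map (AlgHom.id ℂ _) CliffordAlgebra.involute

theorem superFunRes_self {U : Opens V.real} (h : U ≤ U) :
    V.superFunRes h = AlgHom.id ℂ _ :=
  Algebra.TensorProduct.ext (AlgHom.ext fun _ => rfl) (AlgHom.ext fun _ => rfl)

theorem superFunRes_comp {U U' U'' : Opens V.real} (h : U' ≤ U) (h' : U'' ≤ U') :
    (V.superFunRes h').comp (V.superFunRes h) = V.superFunRes (h'.trans h) :=
  Algebra.TensorProduct.ext (AlgHom.ext fun _ => rfl) (AlgHom.ext fun _ => rfl)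

theorem superFunPar_comp (U : Opens V.real) :
    (V.superFunPar U).comp (V.superFunPar U) = AlgHom.id ℂ _ := by
  refine Algebra.TensorProduct.ext (AlgHom.ext fun _ => by simp [superFunPar])
    (AlgHom.ext fun _ => by simp [superFunPar])

theorem superFunPar_comp_res {U U' : Opens V.real} (h : U' ≤ U) :
    (V.superFunPar U').comp (V.superFunRes h) = (V.superFunRes h).comp (V.superFunPar U) := by
  refine Algebra.TensorProduct.ext (AlgHom.ext fun _ => by simp [superFunPar, superFunRes])
    (AlgHom.ext fun _ => by simp [superFunPar, superFunRes])

/-- The model superspace `𝔸(V_ℝ)`: the space `V_ℝ` (even part) with the partially holomorphic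
functions tensored with the exterior algebra of the dual of `V₁`. -/
def affine : SuperSpace.{u} where
  carrier := V.real
  O := V.superFun
  res h := V.superFunRes h
  res_self h a := DFunLike.congr_fun (V.superFunRes_self h) a
  res_res h h' a := DFunLike.congr_fun (V.superFunRes_comp h h') a
  par := V.superFunPar
  par_par U a := DFunLike.congr_fun (V.superFunPar_comp U) a
  par_res h a := DFunLike.congr_fun (V.superFunPar_comp_res h) a

end MixedSuperVectorSpace

/-- Near the point `m`, the superspace `X` is isomorphic to an open subspace of `𝔸(V_ℝ)`: there
is a superspace that is isomorphic to an open subspace of `𝔸(V_ℝ)` and to an open subspace of `X`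
that contains `m`. -/
def SuperSpace.IsModelledAt (X : SuperSpace.{u}) (V : MixedSuperVectorSpace.{u}) (m : X) : Prop :=
  ∃ (Z : SuperSpace.{u}) (a : Hom Z V.affine) (b : Hom Z X),
    a.IsOpenImmersion ∧ b.IsOpenImmersion ∧ m ∈ Set.range b.base

/-- Mixed supermanifolds. (The local models are locally ringed, hence so are these superspaces.)
Morphisms of mixed supermanifolds are the morphisms of the underlying superspaces. -/
structure MixedSupermanifold extends SuperSpace.{u} where
  isSheaf : toSuperSpace.IsSheaf
  isSupercommutative : toSuperSpace.IsSupercommutative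
  t2 : T2Space carrier
  secondCountable : SecondCountableTopology carrier
  locallyModelled : ∀ m : toSuperSpace, ∃ V : MixedSuperVectorSpace.{u},
    toSuperSpace.IsModelledAt V m

namespace MixedSupermanifold

/-- `M` is locally modelled on the mixed super vector space `V`. -/
def IsModelledOn (M : MixedSupermanifold.{u}) (V : MixedSuperVectorSpace.{u}) : Prop :=
  ∀ m : M.toSuperSpace, M.toSuperSpace.IsModelledAt V m

end MixedSupermanifold

/-! ### Derivations along a morphism -/

section Derivations

variable {X Y : SuperSpace.{u}}

/-- Pairs of open sets `U' ⊆ U` and `W` with `f(U') ⊆ W`. -/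
structure DerIdx (f : Hom X Y) (U : Opens X) where
  W : Opens Y
  U' : Opens X
  le : U' ≤ U
  mapsTo : Set.MapsTo f.base U' W

/-- Families of linear maps `O_Y(W) → O_X(U')`, where `U' ⊆ U` and `f(U') ⊆ W`. -/
abbrev PreDer (f : Hom X Y) (U : Opens X) : Type u :=
  ∀ i : DerIdx f U, Y.O i.W →ₗ[ℂ] X.O i.U'

/-- Superderivations of parity `p` of `O_Y` along `f`, over the open subset `U` of `X`. -/
structure IsSuperDerivation (f : Hom X Y) (U : Opens X) (p : ZMod 2) (D : PreDer f U) : Prop where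
  natural : ∀ (i j : DerIdx f U) (hW : j.W ≤ i.W) (hU : j.U' ≤ i.U') (a : Y.O i.W),
    D j (Y.res hW a) = X.res hU (D i a)
  parity : ∀ (i : DerIdx f U) (a : Y.O i.W), X.par i.U' (D i a) = sgn p • D i (Y.par i.W a)
  leibniz : ∀ (i : DerIdx f U) (q : ZMod 2) (a b : Y.O i.W), Y.par i.W a = sgn q • a →
    D i (a * b) = D i a * f.pull i.W i.U' i.mapsTo b +
      sgn (p * q) • (f.pull i.W i.U' i.mapsTo a * D i b)

/-- The space of superderivations of parity `p`. -/
def homDer (f : Hom X Y) (U : Opens X) (p : ZMod 2) : Submodule ℂ (PreDer f U) where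
  carrier := {D | IsSuperDerivation f U p D}
  zero_mem' :=
    { natural := fun i j hW hU a => by simp
      parity := fun i a => by simp
      leibniz := fun i q a b h => by simp }
  add_mem' := by
    intro D E hD hE
    refine ⟨fun i j hW hU a => ?_, fun i a => ?_, fun i q a b h => ?_⟩
    · simp only [Pi.add_apply, LinearMap.add_apply, map_add, hD.natural i j hW hU,
        hE.natural i j hW hU]
    · simp only [Pi.add_apply, LinearMap.add_apply, map_add, hD.parity, hE.parity, smul_add]
    · simp only [Pi.add_apply, LinearMap.add_apply, hD.leibniz i q a b h, hE.leibniz i q a b h,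
        add_mul, mul_add, smul_add]
      abel
  smul_mem' := by
    intro c D hD
    refine ⟨fun i j hW hU a => ?_, fun i a => ?_, fun i q a b h => ?_⟩
    · simp only [Pi.smul_apply, LinearMap.smul_apply, map_smul, hD.natural i j hW hU]
    · simp only [Pi.smul_apply, LinearMap.smul_apply, map_smul, hD.parity]
      rw [smul_comm]
    · simp only [Pi.smul_apply, LinearMap.smul_apply, hD.leibniz i q a b h, smul_add,
        smul_mul_assoc, mul_smul_comm]
      rw [smul_comm c]

/-- The sections over `U` of the pullback `f^* TY` of the tangent bundle of `Y`, realized as the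
superderivations of `O_Y` along `f` over `U`: sums of homogeneous ones. For `f = id` these are
the vector fields on `U`. -/
def Der (f : Hom X Y) (U : Opens X) : Submodule ℂ (PreDer f U) := homDer f U 0 ⊔ homDer f U 1

theorem homDer_le (f : Hom X Y) (U : Opens X) (p : ZMod 2) : homDer f U p ≤ Der f U := by
  rcases eq_zero_or_one p with rfl | rfl
  · exact le_sup_left
  · exact le_sup_right

/-- Restriction to a smaller open set. -/
def preDerRes (f : Hom X Y) {U U' : Opens X} (h : U' ≤ U) : PreDer f U →ₗ[ℂ] PreDer f U' where
  toFun D i := D ⟨i.W, i.U', i.le.trans h, i.mapsTo⟩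
  map_add' _ _ := rfl
  map_smul' _ _ := rfl

theorem preDerRes_mem (f : Hom X Y) {U U' : Opens X} (h : U' ≤ U) (p : ZMod 2)
    {D : PreDer f U} (hD : D ∈ homDer f U p) : preDerRes f h D ∈ homDer f U' p := by
  have hD' : IsSuperDerivation f U p D := hD
  refine ⟨fun i j hW hU a => ?_, fun i a => ?_, fun i q a b hq => ?_⟩
  · exact hD'.natural ⟨i.W, i.U', i.le.trans h, i.mapsTo⟩ ⟨j.W, j.U', j.le.trans h, j.mapsTo⟩
      hW hU a
  · exact hD'.parity ⟨i.W, i.U', i.le.trans h, i.mapsTo⟩ a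
  · exact hD'.leibniz ⟨i.W, i.U', i.le.trans h, i.mapsTo⟩ q a b hq

/-- The left multiplication `(h • D)(a) = h D(a)`. -/
def preDerMul (f : Hom X Y) (U : Opens X) : X.O U →ₗ[ℂ] PreDer f U →ₗ[ℂ] PreDer f U :=
  LinearMap.mk₂ ℂ (fun h D i => (LinearMap.mulLeft ℂ (X.res i.le h)).comp (D i))
    (fun h h' D => by funext i; ext a; simp [add_mul])
    (fun c h D => by funext i; ext a; simp)
    (fun h D D' => by funext i; ext a; simp [mul_add])
    (fun c h D => by funext i; ext a; simp)

theorem preDerMul_apply (f : Hom X Y) (U : Opens X) (h : X.O U) (D : PreDer f U)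
    (i : DerIdx f U) (a : Y.O i.W) : preDerMul f U h D i a = X.res i.le h * D i a := rfl

theorem preDerMul_mem (hX : X.IsSupercommutative) (f : Hom X Y) (U : Opens X) {r p : ZMod 2}
    {h : X.O U} (hh : X.par U h = sgn r • h) {D : PreDer f U} (hD : D ∈ homDer f U p) :
    preDerMul f U h D ∈ homDer f U (r + p) := by
  have hD' : IsSuperDerivation f U p D := hD
  have hres : ∀ i : DerIdx f U, X.par i.U' (X.res i.le h) = sgn r • X.res i.le h := fun i => by
    rw [X.par_res, hh, map_smul]
  refine ⟨fun i j hW hU a => ?_, fun i a => ?_, fun i q a b hq => ?_⟩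
  · rw [preDerMul_apply, preDerMul_apply, hD'.natural i j hW hU, map_mul, X.res_res]
  · rw [preDerMul_apply, preDerMul_apply, map_mul, hres, hD'.parity, sgn_add, smul_mul_smul_comm]
  · have hf : X.par i.U' (f.pull i.W i.U' i.mapsTo a) =
        sgn q • f.pull i.W i.U' i.mapsTo a := by rw [← f.pull_par, hq, map_smul]
    rw [preDerMul_apply, preDerMul_apply, preDerMul_apply, hD'.leibniz i q a b hq, mul_add,
      ← mul_assoc, mul_smul_comm, ← mul_assoc (X.res i.le h) (f.pull i.W i.U' i.mapsTo a),
      hX _ r q _ _ (hres i) hf, smul_mul_assoc, mul_assoc (f.pull i.W i.U' i.mapsTo a),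
      smul_smul, add_mul r p q, sgn_add, mul_comm (sgn (p * q))]

theorem map_leibniz {A B : Type*} [Ring A] [Algebra ℂ A] [Ring B] [Algebra ℂ B] (P : A →ₐ[ℂ] B)
    {x y y' z z' : A} {c : ℂ} (h : x = y * z + c • (z' * y')) :
    P x = P y * P z + c • (P z' * P y') := by
  rw [h, map_add, map_smul, map_mul, map_mul]

/-- The pair `W'`, `W' ∩ W` for a pair `W'`, `U'`. -/
def DerIdx.push {f : Hom X Y} {U : Opens X} (i : DerIdx f U) (W : Opens Y) :
    DerIdx (Hom.id Y) W :=
  ⟨i.W, i.W ⊓ W, inf_le_right, fun _ hx => hx.1⟩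

theorem DerIdx.push_mapsTo {f : Hom X Y} {W : Opens Y} {U : Opens X}
    (h : Set.MapsTo f.base U W) (i : DerIdx f U) : Set.MapsTo f.base i.U' (i.push W).U' :=
  fun _ hx => ⟨i.mapsTo hx, h (i.le hx)⟩

/-- The derivation along `f` over `U` that is induced by a vector field `D` on an open set
`W ⊇ f(U)`: the composition `f^♯ ∘ D`. -/
def preDerPush (f : Hom X Y) {W : Opens Y} {U : Opens X} (h : Set.MapsTo f.base U W) :
    PreDer (Hom.id Y) W →ₗ[ℂ] PreDer f U where
  toFun D i := (f.pull (i.push W).U' i.U' (i.push_mapsTo h)).toLinearMap ∘ₗ D (i.push W)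
  map_add' D E := by funext i; exact LinearMap.comp_add _ _ _
  map_smul' c D := by funext i; exact LinearMap.comp_smul _ _ _

theorem preDerPush_mem (f : Hom X Y) {W : Opens Y} {U : Opens X} (h : Set.MapsTo f.base U W)
    (p : ZMod 2) {D : PreDer (Hom.id Y) W} (hD : D ∈ homDer (Hom.id Y) W p) :
    preDerPush f h D ∈ homDer f U p := by
  have hD' : IsSuperDerivation (Hom.id Y) W p D := hD
  refine ⟨fun i j hW hU a => ?_, fun i a => ?_, fun i q a b hq => ?_⟩
  · have hW' : (j.push W).U' ≤ (i.push W).U' := inf_le_inf_right W hW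
    refine (congrArg _ (hD'.natural (i.push W) (j.push W) hW hW' a)).trans ?_
    exact f.pull_res hW' hU (i.push_mapsTo h) (j.push_mapsTo h) _
  · refine (f.pull_par _ _ (i.push_mapsTo h) _).symm.trans ?_
    refine (congrArg _ (hD'.parity (i.push W) a)).trans ?_
    exact map_smul _ _ _
  · have hr : ∀ c : Y.O i.W, f.pull (i.push W).U' i.U' (i.push_mapsTo h)
        ((Hom.id Y).pull i.W (i.push W).U' (i.push W).mapsTo c) =
        f.pull i.W i.U' i.mapsTo c := fun c =>
      (f.pull_res inf_le_left le_rfl i.mapsTo (i.push_mapsTo h) c).trans (X.res_self _ _)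
    have h2 := map_leibniz (f.pull (i.push W).U' i.U' (i.push_mapsTo h))
      (hD'.leibniz (i.push W) q a b hq)
    refine h2.trans ?_
    rw [← hr a, ← hr b]
    rfl

/-- The pair `W`, `f⁻¹(W)` for a pair `W`, `U'`. -/
def DerIdx.pull {Z : SuperSpace.{u}} {k : Hom Z X} {f : Hom X Y} (i : DerIdx (k.comp f) ⊤) :
    DerIdx f ⊤ :=
  ⟨i.W, f.pre i.W, le_top, f.mapsTo_pre i.W⟩

theorem DerIdx.pull_mapsTo {Z : SuperSpace.{u}} {k : Hom Z X} {f : Hom X Y}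
    (i : DerIdx (k.comp f) ⊤) : Set.MapsTo k.base i.U' i.pull.U' :=
  fun _ hx => i.mapsTo hx

/-- The pullback `k^♯ ∘ D` along `k : Z → X` of a global derivation `D` along `f : X → Y`. -/
def preDerPull {Z : SuperSpace.{u}} (k : Hom Z X) (f : Hom X Y) :
    PreDer f ⊤ →ₗ[ℂ] PreDer (k.comp f) ⊤ where
  toFun D i := (k.pull i.pull.U' i.U' i.pull_mapsTo).toLinearMap ∘ₗ D i.pull
  map_add' D E := by funext i; exact LinearMap.comp_add _ _ _
  map_smul' c D := by funext i; exact LinearMap.comp_smul _ _ _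

theorem preDerPull_mem {Z : SuperSpace.{u}} (k : Hom Z X) (f : Hom X Y) (p : ZMod 2)
    {D : PreDer f ⊤} (hD : D ∈ homDer f ⊤ p) : preDerPull k f D ∈ homDer (k.comp f) ⊤ p := by
  have hD' : IsSuperDerivation f ⊤ p D := hD
  refine ⟨fun i j hW hU a => ?_, fun i a => ?_, fun i q a b hq => ?_⟩
  · have hp : j.pull.U' ≤ i.pull.U' := fun _ hx => hW hx
    refine (congrArg _ (hD'.natural i.pull j.pull hW hp a)).trans ?_
    exact k.pull_res hp hU i.pull_mapsTo j.pull_mapsTo _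
  · refine (k.pull_par _ _ i.pull_mapsTo _).symm.trans ?_
    refine (congrArg _ (hD'.parity i.pull a)).trans ?_
    exact map_smul _ _ _
  · exact map_leibniz (k.pull i.pull.U' i.U' i.pull_mapsTo) (hD'.leibniz i.pull q a b hq)

end Derivations

/-! ### Frames -/

section Frames

variable {S T M : MixedSupermanifold.{u}} {V₀ V₁ : Type u} [AddCommGroup V₀] [Module ℂ V₀]
  [AddCommGroup V₁] [Module ℂ V₁]

/-- The `T`-points over `f : T → M` of the bundle `Hom(V, TM)`: the even morphisms of vector
bundles from the trivial bundle with fibre `V` over `T` to `f^* TM`, given by their values on the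
constant sections. -/
structure Jet (f : Hom T.toSuperSpace M.toSuperSpace) (V₀ V₁ : Type u) [AddCommGroup V₀]
    [Module ℂ V₀] [AddCommGroup V₁] [Module ℂ V₁] where
  val : (V₀ × V₁) →ₗ[ℂ] PreDer f ⊤
  val_mem : ∀ (p : ZMod 2) (v : V₀ × V₁), IsHomogeneous p v → val v ∈ homDer f ⊤ p

namespace Jet

variable {f : Hom T.toSuperSpace M.toSuperSpace}

/-- The values over `U` on all sections of the trivial bundle, `h ⊗ v ↦ h φ(v)`. -/
def onSections (φ : Jet f V₀ V₁) (U : Opens T.toSuperSpace) :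
    T.O U ⊗[ℂ] (V₀ × V₁) →ₗ[ℂ] PreDer f U :=
  TensorProduct.lift ((preDerMul f U).compl₂ (preDerRes f le_top ∘ₗ φ.val))

/-- The `T`-points of the frame bundle `L(M)` over `f`: those for which the morphism of vector
bundles is an isomorphism. -/
def IsFrame (φ : Jet f V₀ V₁) : Prop :=
  ∀ U : Opens T.toSuperSpace, Function.Injective (φ.onSections U) ∧
    LinearMap.range (φ.onSections U) = Der f U

/-- Pullback of points along `k : S → T`. -/
def pullback (k : Hom S.toSuperSpace T.toSuperSpace) (φ : Jet f V₀ V₁) :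
    Jet (k.comp f) V₀ V₁ where
  val := preDerPull k f ∘ₗ φ.val
  val_mem p v hv := preDerPull_mem k f p (φ.val_mem p v hv)

theorem onSections_mem (φ : Jet f V₀ V₁) (p : ZMod 2) (x : T.O ⊤ ⊗[ℂ] (V₀ × V₁))
    (hx : tparity (T.par ⊤) x = sgn p • x) : φ.onSections ⊤ x ∈ homDer f ⊤ p := by
  have key : ∀ (r q : ZMod 2) (h : T.O ⊤) (v : V₀ × V₁), T.par ⊤ h = sgn r • h →
      IsHomogeneous q v → φ.onSections ⊤ (h ⊗ₜ v) ∈ homDer f ⊤ (r + q) := fun r q h v hh hv =>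
    preDerMul_mem T.isSupercommutative f ⊤ hh (preDerRes_mem f le_top q (φ.val_mem q v hv))
  have hs : ∀ q : ZMod 2, sgn q * sgn q = 1 := fun q => by
    rcases eq_zero_or_one q with rfl | rfl <;> simp [sgn_zero, sgn_one]
  have hpq : ∀ q : ZMod 2, p + q + q = p := fun q => by
    rcases eq_zero_or_one q with rfl | rfl
    · simp
    · rw [add_assoc, show (1 : ZMod 2) + 1 = 0 by decide, add_zero]
  have hom : ∀ (r : ZMod 2) (h : T.O ⊤),
      T.par ⊤ (h + sgn r • T.par ⊤ h) = sgn r • (h + sgn r • T.par ⊤ h) := fun r h => by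
    rw [map_add, map_smul, T.par_par, smul_add, smul_smul, hs, one_smul, add_comm]
  have main : ∀ y : T.O ⊤ ⊗[ℂ] (V₀ × V₁),
      φ.onSections ⊤ (y + sgn p • tparity (T.par ⊤) y) ∈ homDer f ⊤ p := by
    intro y
    induction y using TensorProduct.induction_on with
    | zero => rw [map_zero, smul_zero, add_zero, map_zero]; exact zero_mem _
    | add y z hy hz =>
      rw [map_add (tparity _), smul_add, add_add_add_comm, map_add]
      exact add_mem hy hz
    | tmul h v =>
      have hv : v = (v.1, 0) + (0, v.2) := by simp
      have h0 : IsHomogeneous (0 : ZMod 2) ((v.1, 0) : V₀ × V₁) := by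
        simp [IsHomogeneous, vparity, sgn_zero]
      have h1 : IsHomogeneous (1 : ZMod 2) ((0, v.2) : V₀ × V₁) := by
        simp [IsHomogeneous, vparity, sgn_one]
      have step : ∀ (q : ZMod 2) (w : V₀ × V₁), IsHomogeneous q w →
          φ.onSections ⊤ (h ⊗ₜ w + sgn p • tparity (T.par ⊤) (h ⊗ₜ w)) ∈ homDer f ⊤ p := by
        intro q w hw
        have hw' : vparity V₀ V₁ w = sgn q • w := hw
        have e : h ⊗ₜ[ℂ] w + sgn p • tparity (T.par ⊤) (h ⊗ₜ w) =
            (h + sgn (p + q) • T.par ⊤ h) ⊗ₜ[ℂ] w := by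
          rw [tparity, TensorProduct.map_tmul, hw', TensorProduct.tmul_smul, smul_smul, ← sgn_add,
            TensorProduct.add_tmul, TensorProduct.smul_tmul', AlgHom.toLinearMap_apply]
        rw [e]
        have := key (p + q) q _ w (hom (p + q) h) hw
        rwa [hpq] at this
      rw [hv, TensorProduct.tmul_add, map_add (tparity _), smul_add, add_add_add_comm, map_add]
      exact add_mem (step 0 _ h0) (step 1 _ h1)
  have h2 := main x
  rw [hx, smul_smul, hs, one_smul, ← two_smul ℂ x, map_smul] at h2
  exact ((homDer f ⊤ p).smul_mem_iff (two_ne_zero)).1 h2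

/-- The right action of `GL(V)(T)` on points over `T`: precomposition. -/
def act (φ : Jet f V₀ V₁) (A : GLPoints (T.par ⊤) V₀ V₁) : Jet f V₀ V₁ where
  val := φ.onSections ⊤ ∘ₗ A.1.toLinearMap.restrictScalars ℂ ∘ₗ
    TensorProduct.mk ℂ (T.O ⊤) (V₀ × V₁) 1
  val_mem p v hv := by
    refine φ.onSections_mem p _ ?_
    have h := A.2 ((1 : T.O ⊤) ⊗ₜ v)
    refine Eq.trans h.symm ?_
    have hv' : vparity V₀ V₁ v = sgn p • v := hv
    rw [tparity, TensorProduct.map_tmul, AlgHom.toLinearMap_apply, map_one, hv',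
      TensorProduct.tmul_smul]
    exact (A.1.toLinearMap.restrictScalars ℂ).map_smul _ _

end Jet

/-- A reduction of the frame bundle `L(M)` to a group-valued functor `G ≤ GL(V)`: a subsheaf of
`L(M)` that is stable under `G` and a principal `G`-bundle. Local triviality over an open
subspace `U` is expressed through the section `s` that corresponds to the unit section of
`U × G`: the isomorphism `U × G → P|_U` is `(k, A) ↦ (k^* s) A`. -/
@[ext]
structure Reduction (M : MixedSupermanifold.{u}) (V₀ V₁ : Type u) [AddCommGroup V₀]
    [Module ℂ V₀] [AddCommGroup V₁] [Module ℂ V₁]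
    (G : ∀ T : MixedSupermanifold.{u}, Subgroup (GLPoints (T.par ⊤) V₀ V₁)) where
  points : ∀ {T : MixedSupermanifold.{u}} (f : Hom T.toSuperSpace M.toSuperSpace),
    Set (Jet f V₀ V₁)
  isFrame : ∀ {T : MixedSupermanifold.{u}} (f : Hom T.toSuperSpace M.toSuperSpace)
    (φ : Jet f V₀ V₁), φ ∈ points f → φ.IsFrame
  pullback_mem : ∀ {S T : MixedSupermanifold.{u}} (k : Hom S.toSuperSpace T.toSuperSpace)
    (f : Hom T.toSuperSpace M.toSuperSpace) (φ : Jet f V₀ V₁), φ ∈ points f →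
    φ.pullback k ∈ points (k.comp f)
  isSheaf : ∀ {T : MixedSupermanifold.{u}} (f : Hom T.toSuperSpace M.toSuperSpace)
    (φ : Jet f V₀ V₁), φ.IsFrame →
    (∀ t : T.toSuperSpace, ∃ (S : MixedSupermanifold.{u}) (j : Hom S.toSuperSpace T.toSuperSpace),
      j.IsOpenImmersion ∧ t ∈ Set.range j.base ∧ φ.pullback j ∈ points (j.comp f)) →
    φ ∈ points f
  act_mem : ∀ {T : MixedSupermanifold.{u}} (f : Hom T.toSuperSpace M.toSuperSpace)
    (φ : Jet f V₀ V₁), φ ∈ points f → ∀ A ∈ G T, φ.act A ∈ points f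
  locallyTrivial : ∀ m : M.toSuperSpace, ∃ (U : MixedSupermanifold.{u})
    (j : Hom U.toSuperSpace M.toSuperSpace) (s : Jet j V₀ V₁),
    j.IsOpenImmersion ∧ m ∈ Set.range j.base ∧ s ∈ points j ∧
    ∀ (T : MixedSupermanifold.{u}) (k : Hom T.toSuperSpace U.toSuperSpace),
      ∀ φ ∈ points (k.comp j), ∃! A, A ∈ G T ∧ (s.pullback k).act A = φ

/-- The group-valued functor `OSp(V, J)` on mixed supermanifolds. -/
def OSp (J : LinearMap.BilinForm ℂ (V₀ × V₁)) (T : MixedSupermanifold.{u}) :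
    Subgroup (GLPoints (T.par ⊤) V₀ V₁) :=
  OSpPoints (T.par ⊤) J

end Frames

/-! ### Metrics -/

section Metrics

variable {T M : MixedSupermanifold.{u}}

/-- Even supersymmetric forms `f^* TM ⊗ f^* TM → O_T`, as families of forms on sections. (The rule
for multiplication by functions in the second argument follows from the one in the first
argument and supersymmetry.) -/
@[ext]
structure SuperForm (f : Hom T.toSuperSpace M.toSuperSpace) where
  form : ∀ U : Opens T.toSuperSpace, Der f U →ₗ[ℂ] Der f U →ₗ[ℂ] T.O U
  form_res : ∀ {U U' : Opens T.toSuperSpace} (h : U' ≤ U) (X Y : Der f U) (X' Y' : Der f U'),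
    X'.1 = preDerRes f h X.1 → Y'.1 = preDerRes f h Y.1 →
    form U' X' Y' = T.res h (form U X Y)
  form_mul : ∀ (U : Opens T.toSuperSpace) (h : T.O U) (X X' Y : Der f U),
    X'.1 = preDerMul f U h X.1 → form U X' Y = h * form U X Y
  even : ∀ (U : Opens T.toSuperSpace) (p q : ZMod 2) (X Y : Der f U), X.1 ∈ homDer f U p →
    Y.1 ∈ homDer f U q → T.par U (form U X Y) = sgn (p + q) • form U X Y
  supersymmetric : ∀ (U : Opens T.toSuperSpace) (p q : ZMod 2) (X Y : Der f U),
    X.1 ∈ homDer f U p → Y.1 ∈ homDer f U q → form U X Y = sgn (p * q) • form U Y X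

/-- `O_T`-linear functionals `f^* TM|_U → O_T|_U`. -/
structure Functional (f : Hom T.toSuperSpace M.toSuperSpace) (U : Opens T.toSuperSpace) where
  val : ∀ U' : Opens T.toSuperSpace, U' ≤ U → Der f U' →ₗ[ℂ] T.O U'
  val_res : ∀ {U₁ U₂ : Opens T.toSuperSpace} (h₁ : U₁ ≤ U) (h₂ : U₂ ≤ U) (h : U₂ ≤ U₁)
    (X : Der f U₁) (X' : Der f U₂), X'.1 = preDerRes f h X.1 →
    val U₂ h₂ X' = T.res h (val U₁ h₁ X)
  val_mul : ∀ (U' : Opens T.toSuperSpace) (h' : U' ≤ U) (h : T.O U') (X X' : Der f U'),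
    X'.1 = preDerMul f U' h X.1 → val U' h' X' = h * val U' h' X

/-- A form is non-degenerate if it induces an isomorphism of sheaves from `f^* TM` to its dual. -/
def SuperForm.Nondegenerate {f : Hom T.toSuperSpace M.toSuperSpace} (B : SuperForm f) : Prop :=
  ∀ (U : Opens T.toSuperSpace) (l : Functional f U), ∃! Y : Der f U,
    ∀ (U' : Opens T.toSuperSpace) (h : U' ≤ U) (X Y' : Der f U'), Y'.1 = preDerRes f h Y.1 →
      B.form U' X Y' = l.val U' h X

/-- The even non-degenerate supersymmetric forms `TM ⊗ TM → O_M`. -/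
def EvenMetric (M : MixedSupermanifold.{u}) : Type u :=
  {g : SuperForm (Hom.id M.toSuperSpace) // g.Nondegenerate}

/-- `B` is the pullback `f^* g`: the form on `f^* TM` with `B(f^* X, f^* Y) = f^♯ g(X, Y)` for local
vector fields `X`, `Y` on `M`. -/
def IsPullbackForm {f : Hom T.toSuperSpace M.toSuperSpace}
    (g : SuperForm (Hom.id M.toSuperSpace)) (B : SuperForm f) : Prop :=
  ∀ (W : Opens M.toSuperSpace) (U : Opens T.toSuperSpace) (h : Set.MapsTo f.base U W)
    (X Y : Der (Hom.id M.toSuperSpace) W) (X' Y' : Der f U),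
    X'.1 = preDerPush f h X.1 → Y'.1 = preDerPush f h Y.1 →
    B.form U X' Y' = f.pull W U h (g.form W X Y)

/-- `φ` is an orthonormal frame: `(f^* g)(φ v, φ w) = J(v, w)`. -/
def IsOrthonormal {V₀ V₁ : Type u} [AddCommGroup V₀] [Module ℂ V₀] [AddCommGroup V₁] [Module ℂ V₁]
    (J : LinearMap.BilinForm ℂ (V₀ × V₁)) (g : EvenMetric M)
    {f : Hom T.toSuperSpace M.toSuperSpace} (φ : Jet f V₀ V₁) : Prop :=
  φ.IsFrame ∧ ∃ B : SuperForm f, IsPullbackForm g.1 B ∧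
    ∀ (v w : V₀ × V₁) (X Y : Der f ⊤), X.1 = φ.val v → Y.1 = φ.val w →
      B.form ⊤ X Y = algebraMap ℂ (T.O ⊤) (J v w)

end Metrics

end

end SuperGeom

namespace SuperGeom

noncomputable section

open SuperSpace

/-! ### Linear algebra over a superalgebra -/

/-! The correspondence in (a) is the classical one between metrics and bundles of orthonormal
frames.

From metrics to reductions. Two orthonormal frames over the same morphism differ by a unique point
of `OSp(V, J)` (`IsOrthonormal.existsUnique_act`), so the orthonormal frames form a principal bundle
as soon as they exist locally on `M` and are stable under pullback and gluing. For local existence,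
write the metric in a coordinate frame as `J(x, S y)`, with an even, invertible, self-adjoint Gram
endomorphism `S` (`SuperForm.exists_gram`, `SuperForm.Nondegenerate.exists_gram_inverse`). If `J(ρ
x, ρ y) = J(x, S y)` for an invertible even `ρ`, then the coordinate frame composed with the inverse
of `ρ` is orthonormal. Such a `ρ` is a square root of `S` up to conjugation, found in two stages
(`Chart.exists_sqrt`). At one point, `S` takes values in the finite-dimensional algebra of
endomorphisms over the exterior algebra, and an invertible element there has a square root that is a
polynomial in it, hence again self-adjoint (`exists_aeval_sq_eq`). After normalization the family is
the identity at that point, and the inverse function theorem gives a holomorphic square root on the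
space of self-adjoint endomorphisms (`exists_holomorphic_sqrt`). A holomorphic function of partially
holomorphic functions is partially holomorphic, so the root is an admissible family.

From reductions to metrics. A frame determines a unique form for which it is orthonormal
(`frameForm`), and the action of `OSp(V, J)` does not change that form (`frameForm_act`). The forms
of the local sections of a reduction therefore agree on overlaps and glue to a form on `TM`
(`Reduction.superForm`). It is non-degenerate because it has orthonormal frames locally
(`SuperForm.nondegenerate_of_local`). The two constructions are mutually inverse because a form is
determined by one frame near each point, and because a subsheaf of a principal bundle that is itself
principal for the same group is the whole bundle.

All this needs the tangent sheaf to be locally free along every morphism `f : T → M`, with frames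
that pull back to frames. In a chart the coordinate fields are a frame of `f^* TM`
(`Chart.isFrame_frame`): a derivation along `f` that kills the coordinates is zero
(`Chart.eq_zero_of_kills`). By Hadamard's lemma a function is, near a point, a constant plus
multiples of functions `x_l - l(q)`. Their pullbacks are nilpotent at a point over `q`, so the
values of the derivation lie in every power of the augmentation ideal of the exterior algebra, and
some power vanishes.

For (b), an element `X` of the first prolongation gives the trilinear expression `J(X(u)(v), w)`,
which is supersymmetric in `u, v` and skew in `v, w`. The exchange of `u` and `w` is a product of
three adjacent transpositions in two ways, with an even and with an odd number of skew ones, so the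
expression equals its own negative (`prolongStep_osp`). Higher prolongations of zero are zero. -/

theorem sgn_mul_self (p : ZMod 2) : sgn p * sgn p = 1 := by
  rcases eq_zero_or_one p with rfl | rfl <;> simp [sgn_zero, sgn_one]

theorem zmod_two_add_self (p : ZMod 2) : p + p = 0 := by
  revert p
  decide

/-! ### Base change of complex vector spaces -/

section BaseChange

variable {R R' R'' : Type*} [Ring R] [Algebra ℂ R] [Ring R'] [Algebra ℂ R'] [Ring R'']
  [Algebra ℂ R''] {W W' : Type*} [AddCommGroup W] [Module ℂ W] [AddCommGroup W'] [Module ℂ W']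

/-- The `R`-linear extension of a `ℂ`-linear map `W → R ⊗ W'`. -/
def extendScalars (A : W →ₗ[ℂ] R ⊗[ℂ] W') : R ⊗[ℂ] W →ₗ[R] R ⊗[ℂ] W' :=
  TensorProduct.AlgebraTensorModule.lift (LinearMap.toSpanSingleton R _ A)

@[simp]
theorem extendScalars_tmul (A : W →ₗ[ℂ] R ⊗[ℂ] W') (r : R) (w : W) :
    extendScalars A (r ⊗ₜ w) = r • A w := by
  simp [extendScalars]

theorem tmul_eq_smul_one_tmul (r : R) (w : W) : r ⊗ₜ[ℂ] w = r • ((1 : R) ⊗ₜ[ℂ] w) := by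
  rw [TensorProduct.smul_tmul', smul_eq_mul, mul_one]

theorem linearMap_ext_one_tmul {N : Type*} [AddCommGroup N] [Module R N]
    {f g : R ⊗[ℂ] W →ₗ[R] N} (h : ∀ w, f ((1 : R) ⊗ₜ w) = g ((1 : R) ⊗ₜ w)) : f = g := by
  ext x
  induction x using TensorProduct.induction_on with
  | zero => simp
  | add x y hx hy => rw [map_add, map_add, hx, hy]
  | tmul r w => rw [tmul_eq_smul_one_tmul, map_smul, map_smul, h]

/-- The change of scalars along an algebra homomorphism. -/
def baseMap (W : Type*) [AddCommGroup W] [Module ℂ W] (P : R →ₐ[ℂ] R') :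
    R ⊗[ℂ] W →ₗ[ℂ] R' ⊗[ℂ] W :=
  TensorProduct.map P.toLinearMap LinearMap.id

@[simp]
theorem baseMap_tmul (P : R →ₐ[ℂ] R') (r : R) (w : W) :
    baseMap W P (r ⊗ₜ w) = P r ⊗ₜ w := rfl

theorem baseMap_smul (P : R →ₐ[ℂ] R') (r : R) (x : R ⊗[ℂ] W) :
    baseMap W P (r • x) = P r • baseMap W P x := by
  induction x using TensorProduct.induction_on with
  | zero => simp
  | add x y hx hy => rw [smul_add, map_add, map_add, hx, hy, smul_add]
  | tmul s w => simp [TensorProduct.smul_tmul']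

theorem baseMap_comp (P : R →ₐ[ℂ] R') (P' : R' →ₐ[ℂ] R'') (x : R ⊗[ℂ] W) :
    baseMap W (P'.comp P) x = baseMap W P' (baseMap W P x) := by
  induction x using TensorProduct.induction_on with
  | zero => simp
  | add x y hx hy => simp only [map_add, hx, hy]
  | tmul s w => simp

theorem baseMap_baseMap {P : R →ₐ[ℂ] R'} {P' : R' →ₐ[ℂ] R''} {P'' : R →ₐ[ℂ] R''}
    (h : ∀ a, P' (P a) = P'' a) (x : R ⊗[ℂ] W) :
    baseMap W P' (baseMap W P x) = baseMap W P'' x := by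
  rw [← baseMap_comp]
  congr 1
  exact congrArg _ (AlgHom.ext h)

theorem baseMap_of_eq_id {P : R →ₐ[ℂ] R} (h : ∀ a, P a = a) (x : R ⊗[ℂ] W) :
    baseMap W P x = x := by
  rw [show P = AlgHom.id ℂ R from AlgHom.ext h]
  simp [baseMap]

theorem baseMap_extendScalars (P : R →ₐ[ℂ] R') (A : W →ₗ[ℂ] R ⊗[ℂ] W') (x : R ⊗[ℂ] W) :
    baseMap W' P (extendScalars A x) = extendScalars (baseMap W' P ∘ₗ A) (baseMap W P x) := by
  induction x using TensorProduct.induction_on with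
  | zero => simp
  | add x y hx hy => simp only [map_add, hx, hy]
  | tmul s w => simp [baseMap_smul]

/-- The coordinates of an element of `R ⊗ W` with respect to a basis of `W`. -/
theorem sum_coord_tmul {ι : Type*} [Fintype ι] (b : Module.Basis ι ℂ W) (x : R ⊗[ℂ] W) :
    x = ∑ i, (Algebra.TensorProduct.basis R b).repr x i ⊗ₜ[ℂ] b i := by
  conv_lhs => rw [← (Algebra.TensorProduct.basis R b).sum_repr x]
  refine Finset.sum_congr rfl fun i _ => ?_
  rw [Algebra.TensorProduct.basis_apply, ← tmul_eq_smul_one_tmul]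

theorem basis_repr_baseMap {ι : Type*} [Fintype ι] (b : Module.Basis ι ℂ W) (P : R →ₐ[ℂ] R')
    (x : R ⊗[ℂ] W) (i : ι) : (Algebra.TensorProduct.basis R' b).repr (baseMap W P x) i =
      P ((Algebra.TensorProduct.basis R b).repr x i) := by
  induction x using TensorProduct.induction_on with
  | zero => simp
  | add x y hx hy => simp only [map_add, Finsupp.add_apply, hx, hy]
  | tmul s w => simp [Algebra.TensorProduct.basis_repr_tmul]

theorem eq_of_forall_repr_eq {ι : Type*} [Fintype ι] (b : Module.Basis ι ℂ W) {x y : R ⊗[ℂ] W}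
    (h : ∀ i, (Algebra.TensorProduct.basis R b).repr x i =
      (Algebra.TensorProduct.basis R b).repr y i) : x = y :=
  (Algebra.TensorProduct.basis R b).repr.injective (Finsupp.ext h)

end BaseChange

theorem prod_eq_inl_add_inr {E F : Type*} [AddCommGroup E] [AddCommGroup F] (v : E × F) :
    v = (v.1, 0) + (0, v.2) := by simp

/-! ### Parity, sign rules and even maps -/

section Parity

variable {V₀ V₁ : Type u} [AddCommGroup V₀] [Module ℂ V₀] [AddCommGroup V₁] [Module ℂ V₁]
  {R R' : Type*} [Ring R] [Algebra ℂ R] [Ring R'] [Algebra ℂ R']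
  {σ : R →ₐ[ℂ] R} {σ' : R' →ₐ[ℂ] R'}

/-- `R` with the parity involution `σ` is supercommutative. -/
def IsSupercomm (σ : R →ₐ[ℂ] R) : Prop :=
  ∀ (p q : ZMod 2) (a b : R), σ a = sgn p • a → σ b = sgn q • b → a * b = sgn (p * q) • (b * a)

theorem isHomogeneous_inl (v : V₀) : IsHomogeneous (0 : ZMod 2) ((v, 0) : V₀ × V₁) := by
  simp [IsHomogeneous, vparity, sgn_zero]

theorem isHomogeneous_inr (v : V₁) : IsHomogeneous (1 : ZMod 2) ((0, v) : V₀ × V₁) := by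
  simp [IsHomogeneous, vparity, sgn_one]

theorem IsHomogeneous.vparity_eq {p : ZMod 2} {v : V₀ × V₁} (h : IsHomogeneous p v) :
    vparity V₀ V₁ v = sgn p • v := h

theorem eq_neg_self_iff_zero {E : Type*} [AddCommGroup E] [Module ℂ E] {v : E} :
    v = -v ↔ v = 0 := by
  constructor
  · intro h
    have h2 : (2 : ℂ) • v = 0 := by rw [two_smul]; nth_rw 1 [h]; simp
    exact (smul_eq_zero.1 h2).resolve_left two_ne_zero
  · rintro rfl
    simp

theorem isHomogeneous_zero_iff {v : V₀ × V₁} : IsHomogeneous (0 : ZMod 2) v ↔ v.2 = 0 := by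
  rw [IsHomogeneous, sgn_zero, one_smul, Prod.ext_iff]
  simp only [vparity, LinearMap.prodMap_apply, LinearMap.id_apply, LinearMap.neg_apply, true_and]
  rw [eq_comm, eq_neg_self_iff_zero]

theorem isHomogeneous_one_iff {v : V₀ × V₁} : IsHomogeneous (1 : ZMod 2) v ↔ v.1 = 0 := by
  rw [IsHomogeneous, sgn_one, neg_smul, one_smul, Prod.ext_iff]
  simp only [vparity, LinearMap.prodMap_apply, LinearMap.id_apply, LinearMap.neg_apply,
    Prod.fst_neg, Prod.snd_neg, and_true]
  rw [eq_neg_self_iff_zero]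

theorem homogeneous_induction {C : V₀ × V₁ → Prop} (hadd : ∀ v w, C v → C w → C (v + w))
    (h : ∀ p v, IsHomogeneous p v → C v) (v : V₀ × V₁) : C v := by
  rw [prod_eq_inl_add_inr v]
  exact hadd _ _ (h 0 _ (isHomogeneous_inl _)) (h 1 _ (isHomogeneous_inr _))

theorem parity_decomp (hσ : ∀ a, σ (σ a) = a) (a : R) : ∃ a₀ a₁ : R,
    a = a₀ + a₁ ∧ σ a₀ = sgn 0 • a₀ ∧ σ a₁ = sgn 1 • a₁ := by
  refine ⟨(1 / 2 : ℂ) • (a + σ a), (1 / 2 : ℂ) • (a - σ a), ?_, ?_, ?_⟩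
  · rw [← smul_add, add_add_sub_cancel, ← two_smul ℂ, smul_smul]
    norm_num
  · rw [map_smul, map_add, hσ, sgn_zero, one_smul, add_comm]
  · rw [map_smul, map_sub, hσ, sgn_one, neg_smul, one_smul, ← smul_neg, neg_sub]

theorem parity_induction (hσ : ∀ a, σ (σ a) = a) {C : R → Prop}
    (hadd : ∀ v w, C v → C w → C (v + w)) (h : ∀ p a, σ a = sgn p • a → C a) (a : R) : C a := by
  obtain ⟨a₀, a₁, rfl, h0, h1⟩ := parity_decomp hσ a
  exact hadd _ _ (h 0 _ h0) (h 1 _ h1)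

@[simp]
theorem tparity_tmul (a : R) (v : V₀ × V₁) :
    tparity σ (a ⊗ₜ[ℂ] v) = σ a ⊗ₜ vparity V₀ V₁ v := rfl

theorem tparity_smul (a : R) (x : R ⊗[ℂ] (V₀ × V₁)) :
    tparity σ (a • x) = σ a • tparity σ x := by
  induction x using TensorProduct.induction_on with
  | zero => simp
  | add x y hx hy => rw [smul_add, map_add, map_add, hx, hy, smul_add]
  | tmul s w => simp [TensorProduct.smul_tmul']

theorem tparity_one_tmul {p : ZMod 2} {v : V₀ × V₁} (hv : IsHomogeneous p v) :
    tparity σ ((1 : R) ⊗ₜ[ℂ] v) = sgn p • ((1 : R) ⊗ₜ[ℂ] v) := by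
  rw [tparity_tmul, map_one, hv.vparity_eq, TensorProduct.tmul_smul]

theorem baseMap_tparity {P : R →ₐ[ℂ] R'} (hP : ∀ a, P (σ a) = σ' (P a))
    (x : R ⊗[ℂ] (V₀ × V₁)) :
    baseMap _ P (tparity σ x) = tparity σ' (baseMap _ P x) := by
  induction x using TensorProduct.induction_on with
  | zero => simp
  | add x y hx hy => simp only [map_add, hx, hy]
  | tmul s w => simp [hP]

/-- A homogeneous element is a sum of homogeneous pure tensors. -/
theorem tparity_induction (hσ : ∀ a, σ (σ a) = a) {C : R ⊗[ℂ] (V₀ × V₁) → Prop} {p : ZMod 2}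
    (hzero : C 0) (hadd : ∀ x y, C x → C y → C (x + y))
    (htmul : ∀ (r q : ZMod 2) (a : R) (v : V₀ × V₁), σ a = sgn r • a → IsHomogeneous q v →
      p = r + q → C (a ⊗ₜ v)) (x : R ⊗[ℂ] (V₀ × V₁)) (hx : tparity σ x = sgn p • x) : C x := by
  -- The averaging operator is the projection onto the part of parity `p`. It sends pure tensors
  -- with homogeneous second factor to homogeneous pure tensors and fixes `x`.
  have main : ∀ y : R ⊗[ℂ] (V₀ × V₁), C ((1 / 2 : ℂ) • (y + sgn p • tparity σ y)) := by
    intro y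
    induction y using TensorProduct.induction_on with
    | zero => simpa using hzero
    | add y z hy hz =>
      rw [map_add, smul_add (sgn p), add_add_add_comm, smul_add]
      exact hadd _ _ hy hz
    | tmul h v =>
      revert v
      refine homogeneous_induction (fun v w hv hw => ?_) (fun q v hv => ?_)
      · rw [TensorProduct.tmul_add, map_add, smul_add (sgn p), add_add_add_comm, smul_add]
        exact hadd _ _ hv hw
      · rw [tparity_tmul, hv.vparity_eq, TensorProduct.tmul_smul, smul_smul, ← sgn_add,
          TensorProduct.smul_tmul', ← TensorProduct.add_tmul, TensorProduct.smul_tmul']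
        refine htmul (p + q) q _ v ?_ hv (by rw [add_assoc, zmod_two_add_self, add_zero])
        rw [map_smul, map_add, map_smul, hσ, smul_comm (sgn (p + q)), smul_add (sgn (p + q)),
          smul_smul, sgn_mul_self, one_smul, add_comm]
  have h := main x
  rwa [hx, smul_smul, sgn_mul_self, one_smul, ← two_smul ℂ, smul_smul, one_div,
    inv_mul_cancel₀ two_ne_zero, one_smul] at h

/-- The `ℂ`-linear map `A : V → R ⊗ V` is even. -/
def IsEvenMap (σ : R →ₐ[ℂ] R) (A : (V₀ × V₁) →ₗ[ℂ] R ⊗[ℂ] (V₀ × V₁)) : Prop :=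
  ∀ v, tparity σ (A v) = A (vparity V₀ V₁ v)

theorem IsEvenMap.extendScalars {A : (V₀ × V₁) →ₗ[ℂ] R ⊗[ℂ] (V₀ × V₁)} (hA : IsEvenMap σ A)
    (x : R ⊗[ℂ] (V₀ × V₁)) :
    extendScalars A (tparity σ x) = tparity σ (extendScalars A x) := by
  induction x using TensorProduct.induction_on with
  | zero => simp
  | add x y hx hy => simp only [map_add, hx, hy]
  | tmul s w => simp [tparity_smul, hA w]

theorem IsEvenMap.tparity_apply {A : (V₀ × V₁) →ₗ[ℂ] R ⊗[ℂ] (V₀ × V₁)} (hA : IsEvenMap σ A)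
    {p : ZMod 2} {v : V₀ × V₁} (hv : IsHomogeneous p v) : tparity σ (A v) = sgn p • A v := by
  rw [hA, hv.vparity_eq, map_smul]

theorem isEvenMap_of_homogeneous {A : (V₀ × V₁) →ₗ[ℂ] R ⊗[ℂ] (V₀ × V₁)}
    (h : ∀ p v, IsHomogeneous p v → tparity σ (A v) = sgn p • A v) : IsEvenMap σ A := by
  refine homogeneous_induction (fun v w hv hw => ?_) (fun p v hv => ?_)
  · rw [map_add, map_add, map_add, map_add, hv, hw]
  · rw [h p v hv, hv.vparity_eq, map_smul]

/-! ### Bilinear forms over a superalgebra -/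

/-- Bilinear in the sense of super linear algebra. -/
structure IsSuperBilin (σ : R →ₐ[ℂ] R)
    (β : R ⊗[ℂ] (V₀ × V₁) →ₗ[ℂ] R ⊗[ℂ] (V₀ × V₁) →ₗ[ℂ] R) : Prop where
  smul_left : ∀ (r : R) x y, β (r • x) y = r * β x y
  smul_inl : ∀ (v : V₀) (r : R) y, β (1 ⊗ₜ (v, 0)) (r • y) = r * β (1 ⊗ₜ (v, 0)) y
  smul_inr : ∀ (v : V₁) (r : R) y, β (1 ⊗ₜ (0, v)) (r • y) = σ r * β (1 ⊗ₜ (0, v)) y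

/-- The constant sections `1 ⊗ v` generate `R ⊗ V` over `R`, and the three rules move all
coefficients out of both arguments. -/
theorem IsSuperBilin.ext {β β' : R ⊗[ℂ] (V₀ × V₁) →ₗ[ℂ] R ⊗[ℂ] (V₀ × V₁) →ₗ[ℂ] R}
    (hβ : IsSuperBilin σ β) (hβ' : IsSuperBilin σ β')
    (h : ∀ v w : V₀ × V₁, β (1 ⊗ₜ v) (1 ⊗ₜ w) = β' (1 ⊗ₜ v) (1 ⊗ₜ w)) (x y) :
    β x y = β' x y := by
  induction x using TensorProduct.induction_on with
  | zero => simp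
  | add x x' hx hx' => simp only [map_add, LinearMap.add_apply, hx, hx']
  | tmul r v =>
    rw [tmul_eq_smul_one_tmul, hβ.smul_left, hβ'.smul_left]
    congr 1
    induction y using TensorProduct.induction_on with
    | zero => simp
    | add x x' hx hx' => simp only [map_add, hx, hx']
    | tmul s w =>
      rw [tmul_eq_smul_one_tmul s, prod_eq_inl_add_inr v]
      simp only [TensorProduct.tmul_add, map_add, LinearMap.add_apply, hβ.smul_inl, hβ.smul_inr,
        hβ'.smul_inl, hβ'.smul_inr, h]

/-- In `β (a ⊗ v, b • y)` the coefficient `b` passes `v` by the defining rules and `a` by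
supercommutativity; the two signs multiply to that of the total parity. -/
theorem IsSuperBilin.smul_right (hσ : ∀ a, σ (σ a) = a) (hR : IsSupercomm σ)
    {β : R ⊗[ℂ] (V₀ × V₁) →ₗ[ℂ] R ⊗[ℂ] (V₀ × V₁) →ₗ[ℂ] R} (hβ : IsSuperBilin σ β)
    {p q : ZMod 2} {x : R ⊗[ℂ] (V₀ × V₁)} (hx : tparity σ x = sgn p • x) {b : R}
    (hb : σ b = sgn q • b) (y : R ⊗[ℂ] (V₀ × V₁)) :
    β x (b • y) = sgn (p * q) • (b * β x y) := by
  have key : ∀ (s : ZMod 2) (v : V₀ × V₁), IsHomogeneous s v →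
      β (1 ⊗ₜ v) (b • y) = sgn (s * q) • (b * β (1 ⊗ₜ v) y) := by
    intro s v hv
    obtain ⟨v0, v1⟩ := v
    rcases eq_zero_or_one s with rfl | rfl
    · obtain rfl : v1 = 0 := isHomogeneous_zero_iff.1 hv
      rw [hβ.smul_inl, zero_mul, sgn_zero, one_smul]
    · obtain rfl : v0 = 0 := isHomogeneous_one_iff.1 hv
      rw [hβ.smul_inr, one_mul, hb, smul_mul_assoc]
  refine tparity_induction hσ (C := fun x => β x (b • y) = sgn (p * q) • (b * β x y)) ?_ ?_ ?_ x hx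
  · simp
  · intro x x' hx hx'
    simp only [map_add, LinearMap.add_apply, hx, hx', mul_add, smul_add]
  · intro r s a v ha hv hp
    rw [tmul_eq_smul_one_tmul, hβ.smul_left, hβ.smul_left, key s v hv, mul_smul_comm, ← mul_assoc,
      hR r q a b ha hb, smul_mul_assoc, smul_smul, ← sgn_add, ← mul_assoc, hp, add_mul, add_comm]

variable {J : LinearMap.BilinForm ℂ (V₀ × V₁)}

theorem formExt_smul_left (r : R) (x y : R ⊗[ℂ] (V₀ × V₁)) :
    formExt σ J (r • x) y = r * formExt σ J x y := by
  induction x using TensorProduct.induction_on with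
  | zero => simp
  | add x x' hx hx' => simp only [smul_add, map_add, LinearMap.add_apply, hx, hx', mul_add]
  | tmul s v =>
    induction y using TensorProduct.induction_on with
    | zero => simp
    | add x x' hx hx' => simp only [map_add, hx, hx', mul_add]
    | tmul s' w => simp [TensorProduct.smul_tmul', formExt_tmul, mul_assoc, mul_add]

theorem isSuperBilin_formExt : IsSuperBilin σ (formExt σ J) where
  smul_left := formExt_smul_left
  smul_inl v r y := by
    induction y using TensorProduct.induction_on with
    | zero => simp
    | add x x' hx hx' => simp only [smul_add, map_add, hx, hx', mul_add]
    | tmul s' w =>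
      simp [TensorProduct.smul_tmul', formExt_tmul, show ((0, 0) : V₀ × V₁) = 0 from rfl]
  smul_inr v r y := by
    induction y using TensorProduct.induction_on with
    | zero => simp
    | add x x' hx hx' => simp only [smul_add, map_add, hx, hx', mul_add]
    | tmul s' w =>
      simp [TensorProduct.smul_tmul', formExt_tmul, show ((0, 0) : V₀ × V₁) = 0 from rfl]

theorem IsSuperBilin.comp_right {β : R ⊗[ℂ] (V₀ × V₁) →ₗ[ℂ] R ⊗[ℂ] (V₀ × V₁) →ₗ[ℂ] R}
    (hβ : IsSuperBilin σ β) (T : R ⊗[ℂ] (V₀ × V₁) →ₗ[R] R ⊗[ℂ] (V₀ × V₁)) :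
    IsSuperBilin σ (β.compl₂ (T.restrictScalars ℂ)) where
  smul_left r x y := by simp [hβ.smul_left]
  smul_inl v r y := by simp [hβ.smul_inl]
  smul_inr v r y := by simp [hβ.smul_inr]

/-- Evenness of `T` makes `T (1 ⊗ v)` homogeneous of the parity of `v`, so that the general sign
rule applies to it. -/
theorem IsSuperBilin.comp_even (hσ : ∀ a, σ (σ a) = a) (hR : IsSupercomm σ)
    {β : R ⊗[ℂ] (V₀ × V₁) →ₗ[ℂ] R ⊗[ℂ] (V₀ × V₁) →ₗ[ℂ] R} (hβ : IsSuperBilin σ β)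
    (T T' : R ⊗[ℂ] (V₀ × V₁) →ₗ[R] R ⊗[ℂ] (V₀ × V₁))
    (hT : ∀ x, T (tparity σ x) = tparity σ (T x)) :
    IsSuperBilin σ (β.compl₁₂ (T.restrictScalars ℂ) (T'.restrictScalars ℂ)) where
  smul_left r x y := by simp [hβ.smul_left]
  smul_inl v r y := by
    have h : tparity σ (T (1 ⊗ₜ (v, 0))) = sgn 0 • T (1 ⊗ₜ (v, 0)) := by
      rw [← hT, tparity_one_tmul (isHomogeneous_inl v), LinearMap.map_smul_of_tower]
    refine parity_induction hσ (C := fun r => (β.compl₁₂ (T.restrictScalars ℂ)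
      (T'.restrictScalars ℂ)) (1 ⊗ₜ (v, 0)) (r • y) = r * β.compl₁₂ (T.restrictScalars ℂ)
      (T'.restrictScalars ℂ) (1 ⊗ₜ (v, 0)) y) ?_ ?_ r
    · intro a b ha hb
      rw [add_smul, map_add, ha, hb, add_mul]
    · intro p b hb
      have := hβ.smul_right hσ hR h hb (T' y)
      rw [zero_mul, sgn_zero, one_smul] at this
      simpa using this
  smul_inr v r y := by
    have h : tparity σ (T (1 ⊗ₜ (0, v))) = sgn 1 • T (1 ⊗ₜ (0, v)) := by
      rw [← hT, tparity_one_tmul (isHomogeneous_inr v), LinearMap.map_smul_of_tower]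
    refine parity_induction hσ (C := fun r => (β.compl₁₂ (T.restrictScalars ℂ)
      (T'.restrictScalars ℂ)) (1 ⊗ₜ (0, v)) (r • y) = σ r * β.compl₁₂ (T.restrictScalars ℂ)
      (T'.restrictScalars ℂ) (1 ⊗ₜ (0, v)) y) ?_ ?_ r
    · intro a b ha hb
      rw [add_smul, map_add, ha, hb, map_add, add_mul]
    · intro p b hb
      have := hβ.smul_right hσ hR h hb (T' y)
      rw [one_mul] at this
      simpa [hb] using this

theorem formExt_baseMap {P : R →ₐ[ℂ] R'} (hP : ∀ a, P (σ a) = σ' (P a))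
    (x y : R ⊗[ℂ] (V₀ × V₁)) :
    formExt σ' J (baseMap _ P x) (baseMap _ P y) = P (formExt σ J x y) := by
  induction x using TensorProduct.induction_on with
  | zero => simp
  | add x x' hx hx' => simp only [map_add, LinearMap.add_apply, hx, hx']
  | tmul s v =>
    induction y using TensorProduct.induction_on with
    | zero => simp
    | add x x' hx hx' => simp only [map_add, hx, hx']
    | tmul s' w => simp [formExt_tmul, hP]

theorem formExt_one_tmul (v w : V₀ × V₁) :
    formExt σ J (1 ⊗ₜ v) (1 ⊗ₜ w) = algebraMap ℂ R (J v w) := by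
  rw [formExt_tmul, map_one, one_mul, ← add_smul, ← LinearMap.add_apply, ← map_add,
    ← prod_eq_inl_add_inr, Algebra.algebraMap_eq_smul_one]

theorem formExt_homogeneous_tmul {p : ZMod 2} {v : V₀ × V₁} (hv : IsHomogeneous p v)
    {q : ZMod 2} {a b : R} (hb : σ b = sgn q • b) (w : V₀ × V₁) :
    formExt σ J (a ⊗ₜ v) (b ⊗ₜ w) = (sgn (p * q) * J v w) • (a * b) := by
  obtain ⟨v0, v1⟩ := v
  rcases eq_zero_or_one p with rfl | rfl
  · obtain rfl : v1 = 0 := isHomogeneous_zero_iff.1 hv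
    rw [formExt_tmul, show ((0, 0) : V₀ × V₁) = 0 from rfl]
    simp [sgn_zero]
  · obtain rfl : v0 = 0 := isHomogeneous_one_iff.1 hv
    rw [formExt_tmul, show ((0, 0) : V₀ × V₁) = 0 from rfl, hb]
    simp [smul_smul, mul_comm]

/-- On pure tensors `a ⊗ v`, `b ⊗ w` both sides vanish when `v` and `w` have different parities,
since `J` is even. Otherwise the signs from exchanging `a, b`, exchanging `v, w` and moving
coefficients past vectors combine to that of the total parities. -/
theorem formExt_supersymmetric (hσ : ∀ a, σ (σ a) = a) (hR : IsSupercomm σ)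
    (hJ : IsEvenMetricForm J) {p q : ZMod 2} {x y : R ⊗[ℂ] (V₀ × V₁)}
    (hx : tparity σ x = sgn p • x) (hy : tparity σ y = sgn q • y) :
    formExt σ J x y = sgn (p * q) • formExt σ J y x := by
  refine tparity_induction hσ (C := fun x => formExt σ J x y = sgn (p * q) • formExt σ J y x)
    (by simp) (fun x x' h h' => by simp only [map_add, LinearMap.add_apply, h, h', smul_add])
    (fun r s a v ha hv hp => ?_) x hx
  refine tparity_induction hσ
    (C := fun y => formExt σ J (a ⊗ₜ v) y = sgn (p * q) • formExt σ J y (a ⊗ₜ v))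
    (by simp) (fun x x' h h' => by simp only [map_add, LinearMap.add_apply, h, h', smul_add])
    (fun r' s' b w hb hw hq => ?_) y hy
  rw [formExt_homogeneous_tmul hv hb, formExt_homogeneous_tmul hw ha, hR r r' a b ha hb,
    smul_smul, smul_smul]
  by_cases hss : s = s'
  · subst hss
    congr 1
    rw [hJ.supersymmetric s s v w hv hw, hp, hq]
    have e : (r + s) * (r' + s) = r * r' + r * s + (s * r' + s * s) := by ring
    rw [e]
    simp only [sgn_add]
    rw [mul_comm r s]
    have h2 := sgn_mul_self (s * r)
    linear_combination (-sgn (s * r') * sgn (s * s) * J w v * sgn (r * r')) * h2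
  · rw [hJ.even s s' v w hv hw hss, hJ.even s' s w v hw hv (Ne.symm hss)]
    simp

/-- Since `J` is even, only the pairings even-even and odd-odd contribute, and in the latter the two
signs cancel. -/
theorem formExt_parity (hJ : IsEvenMetricForm J)
    (x y : R ⊗[ℂ] (V₀ × V₁)) :
    formExt σ J (tparity σ x) (tparity σ y) = σ (formExt σ J x y) := by
  induction x using TensorProduct.induction_on with
  | zero => simp
  | add x x' hx hx' => simp only [map_add, LinearMap.add_apply, hx, hx']
  | tmul s v =>
    induction y using TensorProduct.induction_on with
    | zero => simp
    | add x x' hx hx' => simp only [map_add, hx, hx']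
    | tmul s' w =>
      obtain ⟨v0, v1⟩ := v
      obtain ⟨w0, w1⟩ := w
      have h1 := hJ.even 0 1 (v0, 0) (0, w1) (isHomogeneous_inl _) (isHomogeneous_inr _) (by decide)
      have h2 := hJ.even 1 0 (0, v1) (w0, 0) (isHomogeneous_inr _) (isHomogeneous_inl _) (by decide)
      have e1 : ∀ w1' : V₁, w1' = w1 ∨ w1' = -w1 → J (v0, 0) (w0, w1') = J (v0, 0) (w0, 0) := by
        intro w1' hw1'
        rcases hw1' with rfl | rfl
        · rw [prod_eq_inl_add_inr (w0, w1'), map_add, h1, add_zero]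
        · rw [prod_eq_inl_add_inr (w0, -w1), map_add,
            show ((0 : V₀), (w0, -w1).2) = -(0, w1) by simp, map_neg, h1, neg_zero, add_zero]
      have e2 : J (0, v1) (w0, w1) = J (0, v1) (0, w1) := by
        rw [prod_eq_inl_add_inr (w0, w1), map_add, h2, zero_add]
      have e3 : J (0, -v1) (w0, -w1) = J (0, v1) (0, w1) := by
        rw [prod_eq_inl_add_inr (w0, -w1), map_add,
          show ((0 : V₀), (w0, -w1).2) = -(0, w1) by simp,
          show ((0 : V₀), -v1) = -(0, v1) by simp]
        simp only [map_neg, LinearMap.neg_apply, h2]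
        simp
      simp only [tparity_tmul, formExt_tmul, vparity, LinearMap.prodMap_apply, LinearMap.id_apply,
        LinearMap.neg_apply, e1 _ (Or.inl rfl), e1 _ (Or.inr rfl), e2, e3, map_add, map_smul,
        map_mul]

/-- Even and odd parts of the second factor, with the parity involution on the coefficients of
the odd part. -/
def twist (σ : R →ₐ[ℂ] R) : R ⊗[ℂ] (V₀ × V₁) →ₗ[ℂ] R ⊗[ℂ] (V₀ × V₁) :=
  TensorProduct.map LinearMap.id (LinearMap.inl ℂ V₀ V₁ ∘ₗ LinearMap.fst ℂ V₀ V₁) +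
    TensorProduct.map σ.toLinearMap (LinearMap.inr ℂ V₀ V₁ ∘ₗ LinearMap.snd ℂ V₀ V₁)

theorem twist_twist (hσ : ∀ a, σ (σ a) = a) (x : R ⊗[ℂ] (V₀ × V₁)) :
    twist σ (twist σ x) = x := by
  induction x using TensorProduct.induction_on with
  | zero => simp
  | add x y hx hy => simp only [map_add, hx, hy]
  | tmul s w =>
    simp only [twist, LinearMap.add_apply, TensorProduct.map_tmul, LinearMap.id_apply,
      LinearMap.comp_apply, LinearMap.fst_apply, LinearMap.snd_apply, LinearMap.inl_apply,
      LinearMap.inr_apply, AlgHom.toLinearMap_apply, map_add, hσ]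
    rw [show ((0, 0) : V₀ × V₁) = 0 from rfl]
    simp only [TensorProduct.tmul_zero, add_zero, zero_add]
    rw [ ← TensorProduct.tmul_add, ← prod_eq_inl_add_inr]

/-- The sign rule is absorbed by the involution `twist`. After it, pairing with a constant section
is the plain base change of `J v`, and duality over `R` reduces to duality over `ℂ`. -/
theorem formExt_one_tmul_eq (hJ : IsEvenMetricForm J) (v : V₀ × V₁) (y : R ⊗[ℂ] (V₀ × V₁)) :
    formExt σ J (1 ⊗ₜ v) y =
      TensorProduct.rid ℂ R (TensorProduct.map LinearMap.id (J v) (twist σ y)) := by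
  induction y using TensorProduct.induction_on with
  | zero => simp
  | add x x' hx hx' => simp only [map_add, hx, hx']
  | tmul b w =>
    obtain ⟨v0, v1⟩ := v
    obtain ⟨w0, w1⟩ := w
    have h1 := hJ.even 0 1 (v0, 0) (0, w1) (isHomogeneous_inl _) (isHomogeneous_inr _) (by decide)
    have h2 := hJ.even 1 0 (0, v1) (w0, 0) (isHomogeneous_inr _) (isHomogeneous_inl _) (by decide)
    rw [formExt_tmul]
    simp only [twist, LinearMap.add_apply, TensorProduct.map_tmul, LinearMap.id_apply,
      LinearMap.comp_apply, LinearMap.fst_apply, LinearMap.snd_apply, LinearMap.inl_apply,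
      LinearMap.inr_apply, AlgHom.toLinearMap_apply, map_add, TensorProduct.rid_tmul, one_mul]
    rw [prod_eq_inl_add_inr (w0, w1), prod_eq_inl_add_inr (v0, v1)]
    simp only [map_add, LinearMap.add_apply, h1, h2, add_zero, zero_add]

/-- With `e` the `J`-dual basis of `f`, pairing with `e i` reads off the `f i`-coordinate of the
twisted element, so these coordinates have to be `l (e i)`, and this choice works. -/
theorem formExt_existsUnique [FiniteDimensional ℂ V₀] [FiniteDimensional ℂ V₁]
    (hσ : ∀ a, σ (σ a) = a) (hJ : IsEvenMetricForm J) (l : (V₀ × V₁) →ₗ[ℂ] R) :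
    ∃! y, ∀ v, formExt σ J (1 ⊗ₜ v) y = l v := by
  let f := Module.finBasis ℂ (V₀ × V₁)
  let e := LinearMap.BilinForm.dualBasis J hJ.nondegenerate f
  have hef : ∀ i j, J (e i) (f j) = if j = i then 1 else 0 := fun i j => by
    rw [LinearMap.BilinForm.apply_dualBasis_left]
  refine ⟨twist σ (∑ i, l (e i) ⊗ₜ f i), fun v => ?_, fun y hy => ?_⟩
  · rw [formExt_one_tmul_eq hJ, twist_twist hσ]
    have : ∀ v, TensorProduct.rid ℂ R
        (TensorProduct.map LinearMap.id (J v) (∑ i, l (e i) ⊗ₜ[ℂ] f i)) =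
        (∑ i, (J.flip (f i)).smulRight (l (e i))) v := by
      intro v
      simp [map_sum, LinearMap.sum_apply]
    rw [this]
    congr 1
    refine e.ext fun i => ?_
    simp [LinearMap.sum_apply, hef]
  · rw [← twist_twist hσ y]
    congr 1
    rw [sum_coord_tmul f (twist σ y)]
    refine Finset.sum_congr rfl fun i _ => ?_
    rw [← hy, formExt_one_tmul_eq hJ]
    conv_rhs => rw [sum_coord_tmul f (twist σ y)]
    simp [map_sum, hef]

theorem formExt_eq_zero [FiniteDimensional ℂ V₀] [FiniteDimensional ℂ V₁]
    (hσ : ∀ a, σ (σ a) = a) (hJ : IsEvenMetricForm J) {y z : R ⊗[ℂ] (V₀ × V₁)}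
    (h : ∀ v, formExt σ J (1 ⊗ₜ v) y = formExt σ J (1 ⊗ₜ v) z) : y = z :=
  (formExt_existsUnique hσ hJ
    ((formExt σ J).flip z ∘ₗ TensorProduct.mk ℂ R (V₀ × V₁) 1)).unique h fun _ => rfl

end Parity

/-! ### The Lie superalgebra `osp` and its prolongations -/

section Prolongation

variable {V₀ V₁ : Type u} [AddCommGroup V₀] [Module ℂ V₀] [AddCommGroup V₁] [Module ℂ V₁]
  {J : LinearMap.BilinForm ℂ (V₀ × V₁)}

theorem zmod_two_mul_self (p : ZMod 2) : p * p = p := by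
  revert p
  decide

theorem dualParity_eps (p : ZMod 2) :
    dualParity p DualNumber.eps = sgn p • DualNumber.eps := by
  rw [dualParity, DualNumber.eps, TrivSqZeroExt.map_inr, LinearMap.smul_apply, LinearMap.id_apply,
    TrivSqZeroExt.inr_smul]

/-- This is the coefficient of `ε` in the invariance of `J` under `1 + ε A`. The sign comes from
moving `ε`, of parity `p`, past `v`. -/
theorem osp_generator_skew {p : ZMod 2} {A : (V₀ × V₁) →ₗ[ℂ] (V₀ × V₁)}
    {e : GLPoints (dualParity p) V₀ V₁} (he : e ∈ OSpPoints (dualParity p) J)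
    (h : ∀ v : V₀ × V₁, e.1 ((1 : DualNumber ℂ) ⊗ₜ v) =
      (1 : DualNumber ℂ) ⊗ₜ v + DualNumber.eps ⊗ₜ A v)
    {b : ZMod 2} {v : V₀ × V₁} (hv : IsHomogeneous b v) (w : V₀ × V₁) :
    J (A v) w = -(sgn (b * p) * J v (A w)) := by
  have he' : ∀ x y, formExt (dualParity p) J (e.1 x) (e.1 y) = formExt (dualParity p) J x y := he
  have h1 := he' (1 ⊗ₜ v) (1 ⊗ₜ w)
  have hee : (DualNumber.eps * DualNumber.eps : DualNumber ℂ) = 0 := DualNumber.eps_mul_eps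
  have h2 : formExt (dualParity p) J (DualNumber.eps ⊗ₜ A v) (DualNumber.eps ⊗ₜ A w) = 0 := by
    rw [formExt_tmul, dualParity_eps, mul_smul_comm, hee]
    simp
  have h3 : formExt (dualParity p) J (1 ⊗ₜ v) (DualNumber.eps ⊗ₜ A w) =
      (sgn (b * p) * J v (A w)) • DualNumber.eps := by
    rw [formExt_homogeneous_tmul hv (dualParity_eps p), one_mul]
  have h4 : formExt (dualParity p) J (DualNumber.eps ⊗ₜ A v) (1 ⊗ₜ w) =
      J (A v) w • DualNumber.eps := by
    rw [formExt_tmul, map_one, mul_one, ← add_smul, ← LinearMap.add_apply, ← map_add,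
      ← prod_eq_inl_add_inr]
  rw [h, h] at h1
  simp only [map_add, LinearMap.add_apply, h2, h3, h4, add_zero] at h1
  have h5 : (J (A v) w + sgn (b * p) * J v (A w)) • (DualNumber.eps : DualNumber ℂ) = 0 := by
    rw [add_smul]
    have := congrArg (fun z => z - formExt (dualParity p) J (1 ⊗ₜ v) (1 ⊗ₜ w)) h1
    simp only [sub_self] at this
    rw [← this]
    abel
  have h6 := congrArg TrivSqZeroExt.snd h5
  simp only [TrivSqZeroExt.snd_smul, DualNumber.snd_eps, smul_eq_mul, mul_one,
    TrivSqZeroExt.snd_zero] at h6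
  linear_combination h6

theorem isHomogeneous_of_parity {p b : ZMod 2} {A : (V₀ × V₁) →ₗ[ℂ] (V₀ × V₁)}
    (hA : ∀ v, A (vparity V₀ V₁ v) = sgn p • vparity V₀ V₁ (A v)) {v : V₀ × V₁}
    (hv : IsHomogeneous b v) : IsHomogeneous (p + b) (A v) := by
  have h := hA v
  rw [hv.vparity_eq, map_smul] at h
  have h2 := congrArg (fun z => sgn p • z) h
  simp only [smul_smul, sgn_mul_self, one_smul] at h2
  rw [IsHomogeneous, ← h2, sgn_add]

/-- The elements of `osp` are skew with respect to `J`. -/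
theorem osp_skew (hJ : IsEvenMetricForm J) {A : (V₀ × V₁) →ₗ[ℂ] (V₀ × V₁)} (hA : A ∈ osp J)
    {b c : ZMod 2} {v w : V₀ × V₁} (hv : IsHomogeneous b v) (hw : IsHomogeneous c w) :
    J (A v) w = -(sgn (b * (b + c)) * J v (A w)) := by
  rw [osp] at hA
  induction hA using Submodule.span_induction with
  | mem A h =>
    obtain ⟨p, hp, e, he, h⟩ := h
    -- The sign is expressed by the parities of `v` and `w` alone, so that the identity is linear in
    -- `A` and passes to the span. For a generator of another parity both sides vanish because `J`
    -- is even.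
    by_cases hpb : p = b + c
    · rw [osp_generator_skew he h hv, hpb]
    · rw [hJ.even (p + b) c _ _ (isHomogeneous_of_parity hp hv) hw, hJ.even b (p + c) _ _ hv
        (isHomogeneous_of_parity hp hw)]
      · simp
      · intro h
        apply hpb
        rw [h, add_assoc, zmod_two_add_self, add_zero]
      · intro h
        apply hpb
        rw [← h, add_comm b, add_assoc, zmod_two_add_self, add_zero]
  | zero => simp
  | add A B _ _ hA hB => simp only [LinearMap.add_apply, map_add, hA, hB]; ring
  | smul r A _ hA => simp only [LinearMap.smul_apply, map_smul, smul_eq_mul, hA]; ring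

theorem IsEvenMetricForm.swap (hJ : IsEvenMetricForm J) {b : ZMod 2} {v : V₀ × V₁}
    (hv : IsHomogeneous b v) (y : V₀ × V₁) : J v y = sgn b * J y v := by
  have hbb := zmod_two_mul_self b
  revert y
  refine homogeneous_induction (fun y z hy hz => ?_) (fun q y hy => ?_)
  · simp only [map_add, LinearMap.add_apply, hy, hz, mul_add]
  · by_cases hq : b = q
    · subst hq
      rw [hJ.supersymmetric b b v y hv hy, hbb]
    · rw [hJ.even b q v y hv hy hq, hJ.even q b y v hy hv (Ne.symm hq), mul_zero]

/-- The super version of the argument that makes a torsion-free metric connection unique: a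
trilinear expression symmetric in one pair of adjacent arguments and skew in the other pair
vanishes. -/
theorem prolongStep_osp (hJ : IsEvenMetricForm J) : prolongStep (osp J) = ⊥ := by
  rw [eq_bot_iff]
  rintro X ⟨hX, hX'⟩
  have skew : ∀ (a b c : ZMod 2) (u v w : V₀ × V₁), IsHomogeneous a u → IsHomogeneous b v →
      IsHomogeneous c w → J (X u v) w = -(sgn (b * c) * J (X u w) v) := by
    intro a b c u v w hu hv hw
    have hbb := zmod_two_mul_self b
    rw [osp_skew hJ (hX u) hv hw, hJ.swap hv, mul_add, hbb, sgn_add]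
    linear_combination (-sgn (b * c) * J (X u w) v) * sgn_mul_self b
  have symm : ∀ (a b : ZMod 2) (u v w : V₀ × V₁), IsHomogeneous a u → IsHomogeneous b v →
      J (X u v) w = sgn (a * b) * J (X v u) w := by
    intro a b u v w hu hv
    rw [hX' a b u v hu hv, map_smul, LinearMap.smul_apply, smul_eq_mul]
  have zero : ∀ (a b c : ZMod 2) (u v w : V₀ × V₁), IsHomogeneous a u → IsHomogeneous b v →
      IsHomogeneous c w → J (X u v) w = 0 := by
    intro a b c u v w hu hv hw
    -- The exchange of `u` and `w` as skew, symmetric, skew: two minus signs. In `h2` it is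
    -- symmetric, skew, symmetric, with one minus sign and the same parity signs.
    have h1 : J (X u v) w = -(sgn (b * c) * (sgn (a * c) *
        -(sgn (a * b) * J (X w v) u))) := by
      rw [skew a b c u v w hu hv hw, symm a c u w v hu hw, skew c a b w u v hw hu hv]
    have h2 : J (X u v) w = sgn (a * b) * -(sgn (a * c) * (sgn (b * c) * J (X w v) u)) := by
      rw [symm a b u v w hu hv, skew b a c v u w hv hu hw, symm b c v w u hv hw]
    linear_combination (1 / 2 : ℂ) * h1 + (1 / 2 : ℂ) * h2
  rw [Submodule.mem_bot]
  refine LinearMap.ext fun u => LinearMap.ext fun v => ?_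
  have hnd : ∀ y, (∀ w, J y w = 0) → y = 0 := fun y hy => hJ.nondegenerate.1 y hy
  refine hnd _ fun w => ?_
  revert u
  refine homogeneous_induction (fun u u' h h' => ?_) (fun a u hu => ?_)
  · simp only [map_add, LinearMap.add_apply, h, h', add_zero]
  revert v
  refine homogeneous_induction (fun u u' h h' => ?_) (fun b v hv => ?_)
  · simp only [map_add, LinearMap.add_apply, h, h', add_zero]
  revert w
  refine homogeneous_induction (fun u u' h h' => ?_) (fun c w hw => ?_)
  · simp only [map_add, h, h', add_zero]
  exact zero a b c u v w hu hv hw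

theorem prolongStep_bot {W : Type u} [AddCommGroup W] [Module ℂ W] :
    prolongStep (V₀ := V₀) (V₁ := V₁) (W := W) ⊥ = ⊥ := by
  rw [eq_bot_iff]
  rintro X ⟨hX, -⟩
  rw [Submodule.mem_bot]
  exact LinearMap.ext fun v => (Submodule.mem_bot ℂ).1 (hX v)

theorem prolongation_osp_one (hJ : IsEvenMetricForm J) : prolongation (osp J) 1 = ⊥ :=
  prolongStep_osp hJ

theorem isFiniteType_osp (hJ : IsEvenMetricForm J) : IsFiniteType (osp J) := by
  refine ⟨1, fun l => ?_⟩
  induction l with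
  | zero => exact prolongation_osp_one hJ
  | succ l ih =>
    have : prolongation (osp J) (1 + l + 1) =
        prolongStep (W := iteratedHom V₀ V₁ (1 + l)) (prolongation (osp J) (1 + l)) := rfl
    rw [← add_assoc, this, ih]
    exact prolongStep_bot

end Prolongation

/-! ### Sheaves of superalgebras -/

section Sheaf

variable {X : SuperSpace.{u}}

theorem SuperSpace.IsSheaf.glue (hX : X.IsSheaf) {ι : Type u} {U : Opens X} (Ui : ι → Opens X)
    (hle : ∀ i, Ui i ≤ U) (hcov : ∀ x ∈ U, ∃ i, x ∈ Ui i) (s : ∀ i, X.O (Ui i))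
    (hs : ∀ i j, X.res (inf_le_left : Ui i ⊓ Ui j ≤ Ui i) (s i) =
      X.res (inf_le_right : Ui i ⊓ Ui j ≤ Ui j) (s j)) :
    ∃! t : X.O U, ∀ i, X.res (hle i) t = s i := by
  obtain rfl : U = ⨆ i, Ui i := le_antisymm
    (fun x hx => Opens.mem_iSup.2 (hcov x hx)) (iSup_le hle)
  exact hX ι Ui s hs

theorem SuperSpace.IsSheaf.separated (hX : X.IsSheaf) {U : Opens X} {a b : X.O U}
    (h : ∀ x ∈ U, ∃ (U' : Opens X) (hU : U' ≤ U), x ∈ U' ∧ X.res hU a = X.res hU b) : a = b := by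
  choose U' hU hx hab using h
  -- Both sections glue the local restrictions of `a`, so uniqueness of the glued section identifies
  -- them.
  obtain ⟨t, -, ht⟩ := hX.glue (ι := U) (U := U) (fun x => U' x.1 x.2) (fun x => hU x.1 x.2)
    (fun x h => ⟨⟨x, h⟩, hx x h⟩) (fun x => X.res (hU x.1 x.2) a)
    (fun i j => by rw [X.res_res, X.res_res])
  rw [ht a (fun i => rfl), ht b (fun i => (hab i.1 i.2).symm)]

theorem SuperSpace.IsSheaf.tensor_separated (hX : X.IsSheaf) {W : Type*} [AddCommGroup W]
    [Module ℂ W] [FiniteDimensional ℂ W] {U : Opens X} {a b : X.O U ⊗[ℂ] W}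
    (h : ∀ x ∈ U, ∃ (U' : Opens X) (hU : U' ≤ U), x ∈ U' ∧
      baseMap W (X.res hU) a = baseMap W (X.res hU) b) : a = b := by
  refine eq_of_forall_repr_eq (Module.finBasis ℂ W) fun i => hX.separated fun x hx => ?_
  obtain ⟨U', hU, hx', hab⟩ := h x hx
  exact ⟨U', hU, hx', by rw [← basis_repr_baseMap, ← basis_repr_baseMap, hab]⟩

theorem SuperSpace.IsSheaf.tensor_glue (hX : X.IsSheaf) {W : Type*} [AddCommGroup W]
    [Module ℂ W] [FiniteDimensional ℂ W] {ι : Type u} {U : Opens X} (Ui : ι → Opens X)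
    (hle : ∀ i, Ui i ≤ U) (hcov : ∀ x ∈ U, ∃ i, x ∈ Ui i) (s : ∀ i, X.O (Ui i) ⊗[ℂ] W)
    (hs : ∀ i j, baseMap W (X.res (inf_le_left : Ui i ⊓ Ui j ≤ Ui i)) (s i) =
      baseMap W (X.res (inf_le_right : Ui i ⊓ Ui j ≤ Ui j)) (s j)) :
    ∃ t : X.O U ⊗[ℂ] W, ∀ i, baseMap W (X.res (hle i)) t = s i := by
  let b := Module.finBasis ℂ W
  have h1 : ∀ k, ∃ t : X.O U, ∀ i, X.res (hle i) t =
      (Algebra.TensorProduct.basis (X.O (Ui i)) b).repr (s i) k := fun k => by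
    refine (hX.glue Ui hle hcov
      (fun i => (Algebra.TensorProduct.basis (X.O (Ui i)) b).repr (s i) k) fun i j => ?_).exists
    rw [← basis_repr_baseMap, ← basis_repr_baseMap, hs]
  choose t ht using h1
  refine ⟨∑ k, t k ⊗ₜ b k, fun i => ?_⟩
  rw [map_sum, sum_coord_tmul b (s i)]
  exact Finset.sum_congr rfl fun k _ => by rw [baseMap_tmul, ht]

end Sheaf

/-! ### Derivations along a morphism -/

section Derivations

variable {X Y Z : SuperSpace.{u}} {f : Hom X Y} {U : Opens X}

/-- Compatibility with restrictions. -/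
def IsNatural (D : PreDer f U) : Prop :=
  ∀ (i j : DerIdx f U) (hW : j.W ≤ i.W) (hU : j.U' ≤ i.U') (a : Y.O i.W),
    D j (Y.res hW a) = X.res hU (D i a)

theorem IsNatural.add {D E : PreDer f U} (hD : IsNatural D) (hE : IsNatural E) :
    IsNatural (D + E) := fun i j hW hU a => by
  simp only [Pi.add_apply, LinearMap.add_apply, map_add, hD i j hW hU a, hE i j hW hU a]

/-- The index with a smaller open set of the source. -/
abbrev DerIdx.shrink (i : DerIdx f U) {U'' : Opens X} (h : U'' ≤ i.U') : DerIdx f U :=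
  ⟨i.W, U'', h.trans i.le, fun _ hx => i.mapsTo (h hx)⟩

/-- Composition is defined through the full preimage of `W`. Any open set `Q` between the image of
`U'` and that preimage gives the same pullback. -/
theorem SuperSpace.Hom.comp_pull (k : Hom Z X) (f : Hom X Y) (W : Opens Y) (Q : Opens X) (U' : Opens Z)
    (h : Set.MapsTo (k.comp f).base U' W) (hf : Set.MapsTo f.base Q W)
    (hk : Set.MapsTo k.base U' Q) (a : Y.O W) :
    (k.comp f).pull W U' h a = k.pull Q U' hk (f.pull W Q hf a) := by
  have hQ : Q ≤ f.pre W := fun x hx => hf hx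
  have h1 := f.pull_res le_rfl hQ (f.mapsTo_pre W) hf a
  have h2 := k.pull_res hQ le_rfl (fun x hx => h hx) hk (f.pull W (f.pre W) (f.mapsTo_pre W) a)
  rw [Y.res_self] at h1
  rw [Z.res_self, ← h1] at h2
  exact h2.symm

theorem SuperSpace.Hom.mapsTo_pre_inf (f : Hom X Y) (W : Opens Y) (U : Opens X) :
    Set.MapsTo f.base (f.pre W ⊓ U : Opens X) W := fun _ hx => hx.1

/-- The index `W`, `f⁻¹(W) ∩ U`. -/
abbrev preIdx (f : Hom X Y) (U : Opens X) (W : Opens Y) : DerIdx f U :=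
  ⟨W, f.pre W ⊓ U, inf_le_right, Hom.mapsTo_pre_inf f W U⟩

theorem SuperSpace.Hom.mapsTo_id_inf (W W' : Opens Y) :
    Set.MapsTo (Hom.id Y).base (W ⊓ W' : Opens Y) W := fun _ hx => hx.1

/-- The index `W`, `W ∩ W₀`. -/
abbrev infIdx (W₀ W : Opens Y) : DerIdx (Hom.id Y) W₀ :=
  ⟨W, W ⊓ W₀, inf_le_right, Hom.mapsTo_id_inf W W₀⟩

theorem DerIdx.mapsTo_inf (i : DerIdx f U) {W : Opens Y} (h : Set.MapsTo f.base U W) :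
    Set.MapsTo f.base i.U' (i.W ⊓ W : Opens Y) := fun _ hx => ⟨i.mapsTo hx, h (i.le hx)⟩

theorem DerIdx.mapsTo_pre_inf {k : Hom Z X} {U' : Opens Z} (i : DerIdx (k.comp f) U')
    (h : Set.MapsTo k.base U' U) : Set.MapsTo k.base i.U' (f.pre i.W ⊓ U : Opens X) :=
  fun _ hx => ⟨i.mapsTo hx, h (i.le hx)⟩

theorem IsNatural.res_apply {D : PreDer f U} (hD : IsNatural D) (i : DerIdx f U) {U'' : Opens X}
    (h : U'' ≤ i.U') (a : Y.O i.W) : X.res h (D i a) = D (i.shrink h) a := by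
  rw [← hD i (i.shrink h) le_rfl h a, Y.res_self]

/-- Conjugation with the parity involutions. -/
def parConj (f : Hom X Y) (U : Opens X) : PreDer f U →ₗ[ℂ] PreDer f U where
  toFun D i := (X.par i.U').toLinearMap ∘ₗ D i ∘ₗ (Y.par i.W).toLinearMap
  map_add' D E := by funext i; ext a; simp
  map_smul' c D := by funext i; ext a; simp

theorem parConj_apply (D : PreDer f U) (i : DerIdx f U) (a : Y.O i.W) :
    parConj f U D i a = X.par i.U' (D i (Y.par i.W a)) := rfl

theorem parConj_of_mem {p : ZMod 2} {D : PreDer f U} (hD : D ∈ homDer f U p) :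
    parConj f U D = sgn p • D := by
  have hD' : IsSuperDerivation f U p D := hD
  funext i
  ext a
  rw [parConj_apply, hD'.parity, Y.par_par]
  rfl

theorem parConj_of_mem_zero {D : PreDer f U} (hD : D ∈ homDer f U 0) : parConj f U D = D := by
  rw [parConj_of_mem hD, sgn_zero, one_smul]

theorem parConj_of_mem_one {D : PreDer f U} (hD : D ∈ homDer f U 1) : parConj f U D = -D := by
  rw [parConj_of_mem hD, sgn_one]
  funext i
  ext a
  exact neg_one_smul ℂ (D i a)

theorem exists_of_mem_Der {D : PreDer f U} (hD : D ∈ Der f U) :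
    ∃ D₀ ∈ homDer f U 0, ∃ D₁ ∈ homDer f U 1, D₀ + D₁ = D := Submodule.mem_sup.1 hD

theorem isNatural_of_mem {D : PreDer f U} (hD : D ∈ Der f U) : IsNatural D := by
  obtain ⟨D₀, h0, D₁, h1, rfl⟩ := exists_of_mem_Der hD
  exact IsNatural.add (IsSuperDerivation.natural h0) (IsSuperDerivation.natural h1)

theorem Der_leibniz_even {D : PreDer f U} (hD : D ∈ Der f U) (i : DerIdx f U) (a b : Y.O i.W)
    (ha : Y.par i.W a = sgn 0 • a) :
    D i (a * b) = D i a * f.pull i.W i.U' i.mapsTo b + f.pull i.W i.U' i.mapsTo a * D i b := by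
  obtain ⟨D₀, h0, D₁, h1, rfl⟩ := exists_of_mem_Der hD
  have e0 := IsSuperDerivation.leibniz h0 i 0 a b ha
  have e1 := IsSuperDerivation.leibniz h1 i 0 a b ha
  rw [mul_zero, sgn_zero, one_smul] at e0 e1
  simp only [Pi.add_apply, LinearMap.add_apply, e0, e1, add_mul, mul_add]
  abel

/-- Moving a derivation of parity `p` past an odd function costs `(-1) ^ p`, and on sums of
homogeneous derivations this sign is the conjugation `parConj`. -/
theorem Der_leibniz_odd {D : PreDer f U} (hD : D ∈ Der f U) (i : DerIdx f U) (a b : Y.O i.W)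
    (ha : Y.par i.W a = sgn 1 • a) :
    D i (a * b) = D i a * f.pull i.W i.U' i.mapsTo b +
      f.pull i.W i.U' i.mapsTo a * parConj f U D i b := by
  obtain ⟨D₀, h0, D₁, h1, rfl⟩ := exists_of_mem_Der hD
  have e0 := IsSuperDerivation.leibniz h0 i 1 a b ha
  have e1 := IsSuperDerivation.leibniz h1 i 1 a b ha
  rw [zero_mul, sgn_zero, one_smul] at e0
  rw [one_mul, sgn_one, neg_one_smul] at e1
  rw [map_add, parConj_of_mem_zero h0, parConj_of_mem_one h1]
  simp only [Pi.add_apply, LinearMap.add_apply, e0, e1, add_mul, mul_add,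
    Pi.neg_apply, LinearMap.neg_apply, mul_neg]
  abel

/-- The homogeneous components are recovered as half the sum and half the difference of `D` and its
parity conjugate. This describes `Der` by identities that can be tested locally, as the sheaf
property requires. -/
theorem mem_Der_of_leibniz {D : PreDer f U} (hn : IsNatural D)
    (h0 : ∀ (i : DerIdx f U) (a b : Y.O i.W), Y.par i.W a = sgn 0 • a →
      D i (a * b) = D i a * f.pull i.W i.U' i.mapsTo b + f.pull i.W i.U' i.mapsTo a * D i b)
    (h1 : ∀ (i : DerIdx f U) (a b : Y.O i.W), Y.par i.W a = sgn 1 • a →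
      D i (a * b) = D i a * f.pull i.W i.U' i.mapsTo b +
        f.pull i.W i.U' i.mapsTo a * parConj f U D i b) : D ∈ Der f U := by
  have hn' : IsNatural (parConj f U D) := fun i j hW hU a => by
    rw [parConj_apply, parConj_apply, Y.par_res, ← X.par_res, hn i j hW hU]
  have hp : ∀ (i : DerIdx f U) (a : Y.O i.W), X.par i.U' (D i a) =
      parConj f U D i (Y.par i.W a) := fun i a => by rw [parConj_apply, Y.par_par]
  have h0' : ∀ (i : DerIdx f U) (a b : Y.O i.W), Y.par i.W a = sgn 0 • a →
      parConj f U D i (a * b) = parConj f U D i a * f.pull i.W i.U' i.mapsTo b +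
        f.pull i.W i.U' i.mapsTo a * parConj f U D i b := fun i a b ha => by
    have hpa : Y.par i.W (Y.par i.W a) = sgn 0 • Y.par i.W a := by
      rw [Y.par_par, ha, smul_smul, sgn_mul_self, one_smul]
    rw [parConj_apply, map_mul, h0 i _ _ hpa, map_add, map_mul, map_mul, ← f.pull_par,
      ← f.pull_par, Y.par_par, Y.par_par]
    rfl
  have h1' : ∀ (i : DerIdx f U) (a b : Y.O i.W), Y.par i.W a = sgn 1 • a →
      parConj f U D i (a * b) = parConj f U D i a * f.pull i.W i.U' i.mapsTo b +
        f.pull i.W i.U' i.mapsTo a * D i b := fun i a b ha => by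
    have hpa : Y.par i.W (Y.par i.W a) = sgn 1 • Y.par i.W a := by
      rw [Y.par_par, ha, smul_smul, sgn_mul_self, one_smul]
    rw [parConj_apply, map_mul, h1 i _ _ hpa, map_add, map_mul, map_mul, ← f.pull_par,
      ← f.pull_par, Y.par_par, Y.par_par, parConj_apply, Y.par_par, X.par_par]
    rfl
  refine Submodule.mem_sup.2 ⟨(1 / 2 : ℂ) • (D + parConj f U D), ?_,
    (1 / 2 : ℂ) • (D - parConj f U D), ?_, ?_⟩
  · refine Submodule.smul_mem _ _ ⟨hn.add hn', fun i a => ?_, fun i q a b hq => ?_⟩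
    · simp only [Pi.add_apply, LinearMap.add_apply, map_add, sgn_zero, one_smul, hp]
      rw [parConj_apply, Y.par_par, parConj_apply, X.par_par, add_comm]
    · rw [zero_mul, sgn_zero, one_smul]
      simp only [Pi.add_apply, LinearMap.add_apply]
      rcases eq_zero_or_one q with rfl | rfl
      · rw [h0 i a b hq, h0' i a b hq, add_mul, mul_add]
        abel
      · rw [h1 i a b hq, h1' i a b hq, add_mul, mul_add]
        abel
  · refine Submodule.smul_mem _ _ ⟨fun i j hW hU a => ?_, fun i a => ?_, fun i q a b hq => ?_⟩
    · simp only [Pi.sub_apply, LinearMap.sub_apply, map_sub, hn i j hW hU a, hn' i j hW hU a]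
    · simp only [Pi.sub_apply, LinearMap.sub_apply, map_sub, sgn_one, neg_smul, one_smul, hp]
      rw [parConj_apply, Y.par_par, parConj_apply, X.par_par, neg_sub]
    · rw [one_mul]
      simp only [Pi.sub_apply, LinearMap.sub_apply]
      rcases eq_zero_or_one q with rfl | rfl
      · rw [h0 i a b hq, h0' i a b hq, sgn_zero, one_smul, sub_mul, mul_sub]
        abel
      · rw [h1 i a b hq, h1' i a b hq, sgn_one, neg_smul, one_smul, sub_mul, mul_sub]
        abel
  · rw [← smul_add, add_add_sub_cancel, ← two_smul ℂ, smul_smul]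
    norm_num

theorem mem_homDer_iff {p : ZMod 2} {D : PreDer f U} :
    D ∈ homDer f U p ↔ D ∈ Der f U ∧ parConj f U D = sgn p • D := by
  refine ⟨fun h => ⟨homDer_le f U p h, parConj_of_mem h⟩, ?_⟩
  rintro ⟨hD, h⟩
  obtain ⟨D₀, h0, D₁, h1, rfl⟩ := exists_of_mem_Der hD
  rw [map_add, parConj_of_mem_zero h0, parConj_of_mem_one h1] at h
  rcases eq_zero_or_one p with rfl | rfl
  · rw [sgn_zero, one_smul, add_right_inj, eq_comm, eq_neg_self_iff_zero] at h
    rw [h, add_zero]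
    exact h0
  · have h' : D₀ + -D₁ = -(D₀ + D₁) := by
      rw [h, sgn_one]
      funext i
      ext a
      exact neg_one_smul ℂ ((D₀ + D₁) i a)
    rw [neg_add, add_left_inj, eq_neg_self_iff_zero] at h'
    rw [h', zero_add]
    exact h1

theorem parConj_mem {D : PreDer f U} (hD : D ∈ Der f U) : parConj f U D ∈ Der f U := by
  obtain ⟨D₀, h0, D₁, h1, rfl⟩ := exists_of_mem_Der hD
  rw [map_add, parConj_of_mem h0, parConj_of_mem h1]
  exact add_mem (Submodule.smul_mem _ _ (homDer_le _ _ _ h0))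
    (Submodule.smul_mem _ _ (homDer_le _ _ _ h1))

theorem Der_induction {C : PreDer f U → Prop} (hadd : ∀ D E, C D → C E → C (D + E))
    (h : ∀ p, ∀ D ∈ homDer f U p, C D) {D : PreDer f U} (hD : D ∈ Der f U) : C D := by
  obtain ⟨D₀, h0, D₁, h1, rfl⟩ := exists_of_mem_Der hD
  exact hadd _ _ (h 0 _ h0) (h 1 _ h1)

theorem preDerRes_mem_Der {U' : Opens X} (h : U' ≤ U) {D : PreDer f U} (hD : D ∈ Der f U) :
    preDerRes f h D ∈ Der f U' :=
  Der_induction (C := fun D => preDerRes f h D ∈ Der f U')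
    (fun D E hD hE => by rw [map_add]; exact add_mem hD hE)
    (fun p _ hD => homDer_le _ _ p (preDerRes_mem f h p hD)) hD

theorem preDerRes_preDerRes {U' U'' : Opens X} (h : U' ≤ U) (h' : U'' ≤ U') (D : PreDer f U) :
    preDerRes f h' (preDerRes f h D) = preDerRes f (h'.trans h) D := rfl

theorem preDerRes_apply {U' : Opens X} (h : U' ≤ U) (D : PreDer f U) (i : DerIdx f U') :
    preDerRes f h D i = D ⟨i.W, i.U', i.le.trans h, i.mapsTo⟩ := rfl

theorem parConj_preDerRes {U' : Opens X} (h : U' ≤ U) (D : PreDer f U) :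
    parConj f U' (preDerRes f h D) = preDerRes f h (parConj f U D) := rfl

theorem preDerMul_mem_Der (hX : X.IsSupercommutative) (h : X.O U) {D : PreDer f U}
    (hD : D ∈ Der f U) : preDerMul f U h D ∈ Der f U := by
  refine Der_induction (C := fun D => preDerMul f U h D ∈ Der f U)
    (fun D E hD hE => by rw [map_add]; exact add_mem hD hE) (fun p D hD => ?_) hD
  refine parity_induction (σ := X.par U) (X.par_par U)
    (C := fun h => preDerMul f U h D ∈ Der f U)
    (fun a b ha hb => by rw [map_add, LinearMap.add_apply]; exact add_mem ha hb)
    (fun q a ha => homDer_le _ _ _ (preDerMul_mem hX f U ha hD)) h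

theorem preDerMul_mul (a b : X.O U) (D : PreDer f U) :
    preDerMul f U (a * b) D = preDerMul f U a (preDerMul f U b D) := by
  funext i
  ext c
  rw [preDerMul_apply, preDerMul_apply, preDerMul_apply, map_mul, mul_assoc]

theorem preDerMul_one (D : PreDer f U) : preDerMul f U 1 D = D := by
  funext i
  ext c
  rw [preDerMul_apply, map_one, one_mul]

theorem preDerRes_preDerMul {U' : Opens X} (h : U' ≤ U) (a : X.O U) (D : PreDer f U) :
    preDerRes f h (preDerMul f U a D) = preDerMul f U' (X.res h a) (preDerRes f h D) := by
  funext i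
  ext c
  rw [preDerMul_apply, X.res_res]
  rfl

theorem parConj_preDerMul (a : X.O U) (D : PreDer f U) :
    parConj f U (preDerMul f U a D) = preDerMul f U (X.par U a) (parConj f U D) := by
  funext i
  ext c
  rw [preDerMul_apply, parConj_apply, parConj_apply, preDerMul_apply, map_mul, X.par_res]

theorem preDerPush_mem_Der {W : Opens Y} (h : Set.MapsTo f.base U W) {D : PreDer (Hom.id Y) W}
    (hD : D ∈ Der (Hom.id Y) W) : preDerPush f h D ∈ Der f U :=
  Der_induction (C := fun D => preDerPush f h D ∈ Der f U)
    (fun D E hD hE => by rw [map_add]; exact add_mem hD hE)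
    (fun p _ hD => homDer_le _ _ p (preDerPush_mem f h p hD)) hD

theorem preDerPush_apply {W : Opens Y} (h : Set.MapsTo f.base U W) (D : PreDer (Hom.id Y) W)
    (i : DerIdx f U) (a : Y.O i.W) : preDerPush f h D i a =
      f.pull (i.W ⊓ W) i.U' (i.mapsTo_inf h) (D (infIdx W i.W) a) := rfl

theorem preDerPush_preDerMul {W : Opens Y} (h : Set.MapsTo f.base U W) (a : Y.O W)
    (D : PreDer (Hom.id Y) W) :
    preDerPush f h (preDerMul (Hom.id Y) W a D) =
      preDerMul f U (f.pull W U h a) (preDerPush f h D) := by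
  funext i
  ext c
  rw [preDerPush_apply, preDerMul_apply, preDerMul_apply, map_mul, preDerPush_apply,
    f.pull_res _ i.le h]

theorem preDerPush_res {W W' : Opens Y} {U' : Opens X} (hW : W' ≤ W) (hU : U' ≤ U)
    (h : Set.MapsTo f.base U W) (h' : Set.MapsTo f.base U' W') {D : PreDer (Hom.id Y) W}
    (hD : IsNatural D) :
    preDerPush f h' (preDerRes (Hom.id Y) hW D) = preDerRes f hU (preDerPush f h D) := by
  funext i
  ext c
  rw [preDerPush_apply, preDerRes_apply, preDerRes_apply, preDerPush_apply]
  have h1 := hD (infIdx W i.W) ⟨i.W, i.W ⊓ W', (inf_le_right).trans hW, Hom.mapsTo_id_inf _ _⟩ le_rfl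
    (inf_le_inf_left _ hW) c
  rw [Y.res_self] at h1
  refine (congrArg _ h1).trans ?_
  refine (f.pull_res _ (le_refl i.U')
    (DerIdx.mapsTo_inf ⟨i.W, i.U', i.le.trans hU, i.mapsTo⟩ h) _ _).trans ?_
  rw [X.res_self]

/-- The pullback `k^♯ ∘ D` along `k : Z → X` of a derivation `D` along `f : X → Y`, over an open
set that `k` maps to the domain of `D`. -/
def preDerPullOn (k : Hom Z X) (f : Hom X Y) {U : Opens X} {U' : Opens Z}
    (h : Set.MapsTo k.base U' U) : PreDer f U →ₗ[ℂ] PreDer (k.comp f) U' where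
  toFun D i := (k.pull (f.pre i.W ⊓ U) i.U' (i.mapsTo_pre_inf h)).toLinearMap ∘ₗ
    D (preIdx f U i.W)
  map_add' D E := by funext i; exact LinearMap.comp_add _ _ _
  map_smul' c D := by funext i; exact LinearMap.comp_smul _ _ _

theorem preDerPullOn_apply (k : Hom Z X) {U' : Opens Z} (h : Set.MapsTo k.base U' U)
    (D : PreDer f U) (i : DerIdx (k.comp f) U') (a : Y.O i.W) : preDerPullOn k f h D i a =
      k.pull (f.pre i.W ⊓ U) i.U' (i.mapsTo_pre_inf h)
        (D (preIdx f U i.W) a) := rfl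

/-- The pullback is defined with the largest intermediate open set. Restricting to the intersection
with `j.U'` shows that every intermediate index through which the image passes computes the same
value. -/
theorem preDerPullOn_apply' (k : Hom Z X) {U' : Opens Z} (h : Set.MapsTo k.base U' U)
    {D : PreDer f U} (hD : IsNatural D) (i : DerIdx (k.comp f) U') (j : DerIdx f U)
    (hj : i.W ≤ j.W) (hU : Set.MapsTo k.base i.U' j.U') (a : Y.O j.W) :
    preDerPullOn k f h D i (Y.res hj a) = k.pull j.U' i.U' hU (D j a) := by
  let l : DerIdx f U := ⟨i.W, j.U' ⊓ (f.pre i.W ⊓ U), inf_le_right.trans inf_le_right,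
    fun _ hx => hx.2.1⟩
  have hl : Set.MapsTo k.base i.U' l.U' := fun x hx => ⟨hU hx, i.mapsTo hx, h (i.le hx)⟩
  have h1 := hD j l hj inf_le_left a
  have h2 := hD (preIdx f U i.W) l le_rfl inf_le_right
    (Y.res hj a)
  rw [Y.res_self] at h2
  rw [preDerPullOn_apply]
  have h3 := k.pull_res (inf_le_right : l.U' ≤ f.pre i.W ⊓ U) (le_refl i.U')
    (i.mapsTo_pre_inf h) hl
    (D (preIdx f U i.W) (Y.res hj a))
  have h4 := k.pull_res (inf_le_left : l.U' ≤ j.U') (le_refl i.U') hU hl (D j a)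
  rw [Z.res_self] at h3 h4
  rw [← h3, ← h4, ← h1]
  exact congrArg _ h2.symm

theorem preDerPullOn_mem (k : Hom Z X) {U' : Opens Z} (h : Set.MapsTo k.base U' U) (p : ZMod 2)
    {D : PreDer f U} (hD : D ∈ homDer f U p) :
    preDerPullOn k f h D ∈ homDer (k.comp f) U' p := by
  have hD' : IsSuperDerivation f U p D := hD
  refine ⟨fun i j hW hU a => ?_, fun i a => ?_, fun i q a b hq => ?_⟩
  · have hj : Set.MapsTo k.base j.U' (f.pre i.W ⊓ U : Opens X) :=
      fun x hx => i.mapsTo_pre_inf h (hU hx)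
    refine (preDerPullOn_apply' k h hD'.natural j (preIdx f U i.W) hW hj a).trans ?_
    refine Eq.trans ?_ (k.pull_res le_rfl hU (i.mapsTo_pre_inf h) hj _)
    rw [X.res_self]
  · refine (k.pull_par _ _ (i.mapsTo_pre_inf h) _).symm.trans ?_
    refine (congrArg _ (hD'.parity (preIdx f U i.W) a)).trans ?_
    exact map_smul _ _ _
  · rw [k.comp_pull f i.W (f.pre i.W ⊓ U) i.U' i.mapsTo (Hom.mapsTo_pre_inf f i.W U)
      (i.mapsTo_pre_inf h) a, k.comp_pull f i.W (f.pre i.W ⊓ U) i.U' i.mapsTo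
      (Hom.mapsTo_pre_inf f i.W U) (i.mapsTo_pre_inf h) b]
    exact map_leibniz (k.pull (f.pre i.W ⊓ U) i.U' (i.mapsTo_pre_inf h))
      (hD'.leibniz (preIdx f U i.W) q a b hq)

theorem preDerPullOn_mem_Der (k : Hom Z X) {U' : Opens Z} (h : Set.MapsTo k.base U' U)
    {D : PreDer f U} (hD : D ∈ Der f U) : preDerPullOn k f h D ∈ Der (k.comp f) U' :=
  Der_induction (C := fun D => preDerPullOn k f h D ∈ Der (k.comp f) U')
    (fun D E hD hE => by rw [map_add]; exact add_mem hD hE)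
    (fun p _ hD => homDer_le _ _ p (preDerPullOn_mem k h p hD)) hD

theorem preDerPullOn_preDerMul (k : Hom Z X) {U' : Opens Z} (h : Set.MapsTo k.base U' U)
    (a : X.O U) (D : PreDer f U) : preDerPullOn k f h (preDerMul f U a D) =
      preDerMul (k.comp f) U' (k.pull U U' h a) (preDerPullOn k f h D) := by
  funext i
  ext c
  rw [preDerPullOn_apply, preDerMul_apply, preDerMul_apply, map_mul, preDerPullOn_apply,
    k.pull_res _ i.le h]

theorem preDerPullOn_res (k : Hom Z X) {U₁ : Opens X} {U' U₁' : Opens Z} (hU : U₁ ≤ U)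
    (hU' : U₁' ≤ U') (h : Set.MapsTo k.base U' U) (h' : Set.MapsTo k.base U₁' U₁)
    {D : PreDer f U} (hD : IsNatural D) : preDerPullOn k f h' (preDerRes f hU D) =
      preDerRes (k.comp f) hU' (preDerPullOn k f h D) := by
  funext i
  ext c
  have := preDerPullOn_apply' k h hD ⟨i.W, i.U', i.le.trans hU', i.mapsTo⟩
    ⟨i.W, f.pre i.W ⊓ U₁, inf_le_right.trans hU, Hom.mapsTo_pre_inf _ _ _⟩ le_rfl
    (i.mapsTo_pre_inf h') c
  rw [Y.res_self] at this
  rw [preDerPullOn_apply]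
  exact this.symm

theorem SuperSpace.Hom.mapsTo_top (k : Hom Z X) (U : Opens Z) : Set.MapsTo k.base U (⊤ : Opens X) :=
  fun _ _ => trivial

theorem preDerPull_eq (k : Hom Z X) (f : Hom X Y) {D : PreDer f ⊤} (hD : IsNatural D) :
    preDerPull k f D = preDerPullOn k f (Hom.mapsTo_top k ⊤) D := by
  funext i
  ext c
  have := preDerPullOn_apply' k (Hom.mapsTo_top k ⊤) hD i i.pull le_rfl i.pull_mapsTo c
  exact this.symm.trans (congrArg _ (Y.res_self _ c))

theorem preDerPullOn_preDerPush (k : Hom Z X) {W : Opens Y} {U' : Opens Z}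
    (h : Set.MapsTo f.base U W) (h' : Set.MapsTo k.base U' U)
    (h'' : Set.MapsTo (k.comp f).base U' W) (D : PreDer (Hom.id Y) W) :
    preDerPullOn k f h' (preDerPush f h D) = preDerPush (k.comp f) h'' D := by
  funext i
  ext c
  have hp : f.pre i.W ⊓ U ≤ f.pre (i.W ⊓ W) := fun x hx => ⟨hx.1, h hx.2⟩
  have h1 := f.pull_res le_rfl hp (f.mapsTo_pre (i.W ⊓ W)) ((preIdx f U i.W).mapsTo_inf h)
    (D (infIdx W i.W) c)
  have hk : Set.MapsTo k.base i.U' (f.pre (i.W ⊓ W)) := fun x hx => hp (i.mapsTo_pre_inf h' hx)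
  have h2 := k.pull_res hp le_rfl hk (i.mapsTo_pre_inf h')
    (f.pull (i.W ⊓ W) (f.pre (i.W ⊓ W)) (f.mapsTo_pre (i.W ⊓ W)) (D (infIdx W i.W) c))
  rw [Y.res_self] at h1
  rw [Z.res_self, ← h1] at h2
  exact h2

/-! ### The sheaf property of derivations -/

theorem preDer_separated (hX : X.IsSheaf) {D E : PreDer f U} (hD : IsNatural D)
    (hE : IsNatural E) (h : ∀ x ∈ U, ∃ (U' : Opens X) (hU : U' ≤ U), x ∈ U' ∧
      preDerRes f hU D = preDerRes f hU E) : D = E := by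
  funext i
  ext a
  refine hX.separated fun x hx => ?_
  obtain ⟨U', hU, hx', hDE⟩ := h x (i.le hx)
  refine ⟨i.U' ⊓ U', inf_le_left, ⟨hx, hx'⟩, ?_⟩
  rw [hD.res_apply, hE.res_apply]
  have := congrFun hDE ⟨i.W, i.U' ⊓ U', inf_le_right, fun _ hx => i.mapsTo hx.1⟩
  exact LinearMap.congr_fun this a

/-- The values of the `s α` on a fixed function glue as sections of the structure sheaf. Linearity,
naturality and the Leibniz rules then hold because they hold on the members of the cover. -/
theorem Der_glue (hX : X.IsSheaf) {ι : Type u} (Ui : ι → Opens X) (hle : ∀ i, Ui i ≤ U)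
    (hcov : ∀ x ∈ U, ∃ i, x ∈ Ui i) (s : ∀ i, PreDer f (Ui i)) (hs : ∀ i, s i ∈ Der f (Ui i))
    (hc : ∀ i j, preDerRes f (inf_le_left : Ui i ⊓ Ui j ≤ Ui i) (s i) =
      preDerRes f (inf_le_right : Ui i ⊓ Ui j ≤ Ui j) (s j)) :
    ∃ D ∈ Der f U, ∀ i, preDerRes f (hle i) D = s i := by
  let idx : ∀ (i : DerIdx f U) (α : ι), DerIdx f (Ui α) := fun i α =>
    ⟨i.W, i.U' ⊓ Ui α, inf_le_right, fun _ hx => i.mapsTo hx.1⟩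
  have ex : ∀ (i : DerIdx f U) (a : Y.O i.W), ∃! t : X.O i.U',
      ∀ α, X.res (inf_le_left : i.U' ⊓ Ui α ≤ i.U') t = s α (idx i α) a := fun i a => by
    refine hX.glue (fun α => i.U' ⊓ Ui α) (fun α => inf_le_left)
      (fun x hx => (hcov x (i.le hx)).imp fun α h => ⟨hx, h⟩) (fun α => s α (idx i α) a)
      fun α β => ?_
    have h1 := (isNatural_of_mem (hs α)).res_apply (idx i α)
      (inf_le_left : (i.U' ⊓ Ui α) ⊓ (i.U' ⊓ Ui β) ≤ i.U' ⊓ Ui α) a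
    have h2 := (isNatural_of_mem (hs β)).res_apply (idx i β)
      (inf_le_right : (i.U' ⊓ Ui α) ⊓ (i.U' ⊓ Ui β) ≤ i.U' ⊓ Ui β) a
    refine h1.trans (Eq.trans ?_ h2.symm)
    exact LinearMap.congr_fun (congrFun (hc α β) ⟨i.W, (i.U' ⊓ Ui α) ⊓ (i.U' ⊓ Ui β),
      fun x hx => ⟨hx.1.2, hx.2.2⟩, fun x hx => i.mapsTo hx.1.1⟩) a
  choose t ht using fun i a => (ex i a).exists
  have huniq : ∀ i a t', (∀ α, X.res (inf_le_left : i.U' ⊓ Ui α ≤ i.U') t' =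
      s α (idx i α) a) → t i a = t' := fun i a t' h => (ex i a).unique (ht i a) h
  let D : PreDer f U := fun i =>
    { toFun := t i
      map_add' := fun a b => huniq i _ _ fun α => by rw [map_add, map_add, ht, ht]
      map_smul' := fun c a => huniq i _ _ fun α => by
        rw [RingHom.id_apply, map_smul, map_smul, ht] }
  have hD : ∀ i a α, X.res (inf_le_left : i.U' ⊓ Ui α ≤ i.U') (D i a) = s α (idx i α) a := ht
  have hDsep : ∀ (i : DerIdx f U) (b c : X.O i.U'),
      (∀ α, X.res (inf_le_left : i.U' ⊓ Ui α ≤ i.U') b =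
        X.res (inf_le_left : i.U' ⊓ Ui α ≤ i.U') c) → b = c := fun i b c h =>
    hX.separated fun x hx => by
      obtain ⟨α, hα⟩ := hcov x (i.le hx)
      exact ⟨_, inf_le_left, ⟨hx, hα⟩, h α⟩
  have hpull : ∀ (i : DerIdx f U) (α : ι) (a : Y.O i.W),
      X.res (inf_le_left : i.U' ⊓ Ui α ≤ i.U') (f.pull i.W i.U' i.mapsTo a) =
        f.pull i.W (i.U' ⊓ Ui α) (idx i α).mapsTo a := fun i α a => by
    rw [← f.pull_res le_rfl inf_le_left i.mapsTo (idx i α).mapsTo a, Y.res_self]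
  refine ⟨D, mem_Der_of_leibniz (fun i j hW hU a => hDsep j _ _ fun α => ?_)
    (fun i a b ha => hDsep i _ _ fun α => ?_) (fun i a b ha => hDsep i _ _ fun α => ?_),
    fun α => ?_⟩
  · rw [hD, X.res_res]
    refine (isNatural_of_mem (hs α) (idx i α) (idx j α) hW (inf_le_inf_right _ hU) a).trans ?_
    rw [← hD, X.res_res]
  · rw [hD, map_add, map_mul (X.res _), map_mul (X.res _), hD, hD, hpull, hpull]
    exact Der_leibniz_even (hs α) (idx i α) a b ha
  · rw [hD, map_add, map_mul (X.res _), map_mul (X.res _), hD, hpull, hpull, parConj_apply, ← X.par_res, hD]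
    exact Der_leibniz_odd (hs α) (idx i α) a b ha
  · funext i
    ext a
    let i' : DerIdx f U := ⟨i.W, i.U', i.le.trans (hle α), i.mapsTo⟩
    have h1 := hD i' a α
    have h2 : (preDerRes f (hle α) D) i a = D i' a := rfl
    rw [h2]
    refine hX.separated fun x hx => ⟨i.U' ⊓ Ui α, inf_le_left, ⟨hx, i.le hx⟩, ?_⟩
    rw [(isNatural_of_mem (hs α)).res_apply i]
    exact h1

end Derivations

/-! ### Local frames -/

section LocalJets

variable {X Y Z : SuperSpace.{u}} {V₀ V₁ : Type u} [AddCommGroup V₀] [Module ℂ V₀]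
  [AddCommGroup V₁] [Module ℂ V₁]

/-- The even morphisms of vector bundles over the open set `U` from the trivial bundle with fibre
`V` to the pullback of the tangent bundle. -/
structure LocalJet (f : Hom X Y) (U : Opens X) (V₀ V₁ : Type u) [AddCommGroup V₀]
    [Module ℂ V₀] [AddCommGroup V₁] [Module ℂ V₁] where
  val : (V₀ × V₁) →ₗ[ℂ] PreDer f U
  val_mem : ∀ (p : ZMod 2) (v : V₀ × V₁), IsHomogeneous p v → val v ∈ homDer f U p

namespace LocalJet

variable {f : Hom X Y} {U U' U'' : Opens X}

theorem val_mem_Der (ψ : LocalJet f U V₀ V₁) (v : V₀ × V₁) : ψ.val v ∈ Der f U := by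
  revert v
  refine homogeneous_induction (fun v w hv hw => ?_) fun p v hv =>
    homDer_le _ _ p (ψ.val_mem p v hv)
  rw [map_add]
  exact add_mem hv hw

/-- The values over `U'` on all sections of the trivial bundle. -/
def secs (ψ : LocalJet f U V₀ V₁) (h : U' ≤ U) : X.O U' ⊗[ℂ] (V₀ × V₁) →ₗ[ℂ] PreDer f U' :=
  TensorProduct.lift ((preDerMul f U').compl₂ (preDerRes f h ∘ₗ ψ.val))

theorem secs_tmul (ψ : LocalJet f U V₀ V₁) (h : U' ≤ U) (a : X.O U') (v : V₀ × V₁) :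
    ψ.secs h (a ⊗ₜ v) = preDerMul f U' a (preDerRes f h (ψ.val v)) := by
  rw [secs, TensorProduct.lift.tmul]
  rfl

theorem secs_one_tmul (ψ : LocalJet f U V₀ V₁) (h : U' ≤ U) (v : V₀ × V₁) :
    ψ.secs h (1 ⊗ₜ v) = preDerRes f h (ψ.val v) := by
  rw [secs_tmul, preDerMul_one]

theorem secs_smul (ψ : LocalJet f U V₀ V₁) (h : U' ≤ U) (a : X.O U')
    (x : X.O U' ⊗[ℂ] (V₀ × V₁)) : ψ.secs h (a • x) = preDerMul f U' a (ψ.secs h x) := by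
  induction x using TensorProduct.induction_on with
  | zero => simp
  | add x y hx hy => rw [smul_add, map_add, map_add, map_add, hx, hy]
  | tmul s v => rw [TensorProduct.smul_tmul', smul_eq_mul, secs_tmul, secs_tmul, preDerMul_mul]

theorem secs_res (ψ : LocalJet f U V₀ V₁) (h : U' ≤ U) (h' : U'' ≤ U')
    (x : X.O U' ⊗[ℂ] (V₀ × V₁)) :
    ψ.secs (h'.trans h) (baseMap _ (X.res h') x) = preDerRes f h' (ψ.secs h x) := by
  induction x using TensorProduct.induction_on with
  | zero => simp
  | add x y hx hy => simp only [map_add, hx, hy]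
  | tmul s v =>
    rw [baseMap_tmul, secs_tmul, secs_tmul, preDerRes_preDerMul, preDerRes_preDerRes]

theorem secs_mem_Der (hX : X.IsSupercommutative) (ψ : LocalJet f U V₀ V₁) (h : U' ≤ U)
    (x : X.O U' ⊗[ℂ] (V₀ × V₁)) : ψ.secs h x ∈ Der f U' := by
  induction x using TensorProduct.induction_on with
  | zero => rw [map_zero]; exact zero_mem _
  | add x y hx hy => rw [map_add]; exact add_mem hx hy
  | tmul s v =>
    rw [secs_tmul]
    exact preDerMul_mem_Der hX _ (preDerRes_mem_Der h (ψ.val_mem_Der v))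

theorem parConj_secs (ψ : LocalJet f U V₀ V₁) (h : U' ≤ U) (x : X.O U' ⊗[ℂ] (V₀ × V₁)) :
    parConj f U' (ψ.secs h x) = ψ.secs h (tparity (X.par U') x) := by
  induction x using TensorProduct.induction_on with
  | zero => simp
  | add x y hx hy => simp only [map_add, hx, hy]
  | tmul s v =>
    revert v
    refine homogeneous_induction (fun v w hv hw => ?_) fun p v hv => ?_
    · simp only [TensorProduct.tmul_add, map_add, hv, hw]
    · rw [tparity_tmul, hv.vparity_eq, secs_tmul, secs_tmul, parConj_preDerMul, parConj_preDerRes,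
        parConj_of_mem (ψ.val_mem p v hv), map_smul ψ.val]

theorem secs_mem_homDer (hX : X.IsSupercommutative) (ψ : LocalJet f U V₀ V₁) (h : U' ≤ U)
    {p : ZMod 2} {x : X.O U' ⊗[ℂ] (V₀ × V₁)} (hx : tparity (X.par U') x = sgn p • x) :
    ψ.secs h x ∈ homDer f U' p :=
  mem_homDer_iff.2 ⟨ψ.secs_mem_Der hX h x, by rw [parConj_secs, hx, map_smul]⟩

/-- The morphism of vector bundles is an isomorphism. -/
def IsFrame (ψ : LocalJet f U V₀ V₁) : Prop :=
  ∀ (U' : Opens X) (h : U' ≤ U), Function.Injective (ψ.secs h) ∧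
    LinearMap.range (ψ.secs h) = Der f U'

theorem IsFrame.exists_secs {ψ : LocalJet f U V₀ V₁} (hψ : ψ.IsFrame) (h : U' ≤ U)
    {D : PreDer f U'} (hD : D ∈ Der f U') : ∃ x, ψ.secs h x = D := by
  rw [← (hψ U' h).2] at hD
  exact hD

theorem IsFrame.injective {ψ : LocalJet f U V₀ V₁} (hψ : ψ.IsFrame) (h : U' ≤ U) :
    Function.Injective (ψ.secs h) := (hψ U' h).1

theorem IsFrame.tparity_eq {ψ : LocalJet f U V₀ V₁} (hψ : ψ.IsFrame) (h : U' ≤ U) {p : ZMod 2}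
    {x : X.O U' ⊗[ℂ] (V₀ × V₁)} (hx : ψ.secs h x ∈ homDer f U' p) :
    tparity (X.par U') x = sgn p • x := by
  apply hψ.injective h
  rw [← parConj_secs, parConj_of_mem hx, map_smul]

@[ext]
theorem ext {ψ χ : LocalJet f U V₀ V₁} (h : ψ.val = χ.val) : ψ = χ := by
  cases ψ
  cases χ
  cases h
  rfl

/-- Restriction to a smaller open set. -/
def restrict (ψ : LocalJet f U V₀ V₁) (h : U' ≤ U) : LocalJet f U' V₀ V₁ where
  val := preDerRes f h ∘ₗ ψ.val
  val_mem p v hv := preDerRes_mem f h p (ψ.val_mem p v hv)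

theorem restrict_secs (ψ : LocalJet f U V₀ V₁) (h : U' ≤ U) (h' : U'' ≤ U') :
    (ψ.restrict h).secs h' = ψ.secs (h'.trans h) := rfl

theorem IsFrame.restrict {ψ : LocalJet f U V₀ V₁} (hψ : ψ.IsFrame) (h : U' ≤ U) :
    (ψ.restrict h).IsFrame := fun U'' h' => hψ U'' (h'.trans h)

/-- Being a frame is a local property. -/
theorem isFrame_of_local [FiniteDimensional ℂ V₀] [FiniteDimensional ℂ V₁] (hX : X.IsSheaf)
    (hX' : X.IsSupercommutative) (ψ : LocalJet f U V₀ V₁)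
    (hψ : ∀ x ∈ U, ∃ (U' : Opens X) (h : U' ≤ U), x ∈ U' ∧ (ψ.restrict h).IsFrame) :
    ψ.IsFrame := by
  choose N hN hxN hF using hψ
  have inj : ∀ (U' : Opens X) (h : U' ≤ U), Function.Injective (ψ.secs h) := by
    intro U' h x y hxy
    refine hX.tensor_separated fun p hp => ⟨U' ⊓ N p (h hp), inf_le_left, ⟨hp, hxN p _⟩, ?_⟩
    apply (hF p (h hp)).injective inf_le_right
    rw [restrict_secs]
    exact (ψ.secs_res h inf_le_left x).trans ((congrArg _ hxy).trans
      (ψ.secs_res h inf_le_left y).symm)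
  refine fun U' h => ⟨inj U' h, le_antisymm ?_ fun D hD => ?_⟩
  · rintro _ ⟨x, rfl⟩
    exact ψ.secs_mem_Der hX' h x
  · have h1 : ∀ p : U', ∃ x, ψ.secs (inf_le_left.trans h : U' ⊓ N p.1 (h p.2) ≤ U) x =
        preDerRes f inf_le_left D := fun p =>
      (hF p.1 (h p.2)).exists_secs inf_le_right (preDerRes_mem_Der _ hD)
    choose x hx using h1
    obtain ⟨t, ht⟩ := hX.tensor_glue (ι := U') (U := U') (fun p => U' ⊓ N p.1 (h p.2))
      (fun p => inf_le_left) (fun p hp => ⟨⟨p, hp⟩, hp, hxN p _⟩) x (fun p q => by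
        apply inj _ ((inf_le_left.trans inf_le_left).trans h)
        rw [ψ.secs_res (inf_le_left.trans h), ψ.secs_res (inf_le_left.trans h), hx, hx]
        rfl)
    refine ⟨t, preDer_separated hX (isNatural_of_mem (ψ.secs_mem_Der hX' h t))
      (isNatural_of_mem hD) fun p hp =>
      ⟨U' ⊓ N p (h hp), inf_le_left, ⟨hp, hxN p _⟩, ?_⟩⟩
    rw [← ψ.secs_res h inf_le_left, ht ⟨p, hp⟩, hx ⟨p, hp⟩]

/-- Pullback along a morphism. -/
def pull (ψ : LocalJet f U V₀ V₁) (k : Hom Z X) {U' : Opens Z} (h : Set.MapsTo k.base U' U) :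
    LocalJet (k.comp f) U' V₀ V₁ where
  val := preDerPullOn k f h ∘ₗ ψ.val
  val_mem p v hv := preDerPullOn_mem k h p (ψ.val_mem p v hv)

theorem pull_secs (ψ : LocalJet f U V₀ V₁) (k : Hom Z X) {U' U'' : Opens Z} {Q : Opens X}
    (h : Set.MapsTo k.base U' U) (h' : U'' ≤ U') (hQ : Q ≤ U) (hk : Set.MapsTo k.base U'' Q)
    (x : X.O Q ⊗[ℂ] (V₀ × V₁)) :
    (ψ.pull k h).secs h' (baseMap _ (k.pull Q U'' hk) x) = preDerPullOn k f hk (ψ.secs hQ x) := by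
  induction x using TensorProduct.induction_on with
  | zero => simp
  | add x y hx hy => simp only [map_add, hx, hy]
  | tmul s v =>
    rw [baseMap_tmul, secs_tmul, secs_tmul, preDerPullOn_preDerMul,
      preDerPullOn_res k hQ h' h hk (isNatural_of_mem (ψ.val_mem_Der v))]
    rfl

/-- Composition with an even endomorphism of the trivial bundle. -/
def precomp (ψ : LocalJet f U V₀ V₁) (hX : X.IsSupercommutative)
    (A : (V₀ × V₁) →ₗ[ℂ] X.O U ⊗[ℂ] (V₀ × V₁)) (hA : IsEvenMap (X.par U) A) :
    LocalJet f U V₀ V₁ where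
  val := ψ.secs le_rfl ∘ₗ A
  val_mem _ _ hv := ψ.secs_mem_homDer hX le_rfl (hA.tparity_apply hv)

theorem precomp_secs (ψ : LocalJet f U V₀ V₁) (hX : X.IsSupercommutative)
    (A : (V₀ × V₁) →ₗ[ℂ] X.O U ⊗[ℂ] (V₀ × V₁)) (hA : IsEvenMap (X.par U) A) (h : U' ≤ U)
    (x : X.O U' ⊗[ℂ] (V₀ × V₁)) : (ψ.precomp hX A hA).secs h x =
      ψ.secs h (extendScalars (baseMap _ (X.res h) ∘ₗ A) x) := by
  induction x using TensorProduct.induction_on with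
  | zero => simp
  | add x y hx hy => simp only [map_add, hx, hy]
  | tmul s v =>
    rw [secs_tmul, extendScalars_tmul, secs_smul]
    congr 1
    exact (ψ.secs_res le_rfl h (A v)).symm

theorem extendScalars_comp_baseMap {R R' : Type*} [Ring R] [Algebra ℂ R] [Ring R'] [Algebra ℂ R']
    {W : Type*} [AddCommGroup W] [Module ℂ W] {A C : W →ₗ[ℂ] R ⊗[ℂ] W}
    (h : ∀ w, extendScalars A (C w) = 1 ⊗ₜ w) (P : R →ₐ[ℂ] R') (x : R' ⊗[ℂ] W) :
    extendScalars (baseMap W P ∘ₗ A) (extendScalars (baseMap W P ∘ₗ C) x) = x := by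
  have : (extendScalars (baseMap W P ∘ₗ A)).comp (extendScalars (baseMap W P ∘ₗ C)) =
      LinearMap.id := by
    refine linearMap_ext_one_tmul fun w => ?_
    rw [LinearMap.comp_apply, extendScalars_tmul, one_smul, LinearMap.comp_apply,
      ← baseMap_extendScalars, h, baseMap_tmul, map_one, LinearMap.id_apply]
  exact LinearMap.congr_fun this x

theorem IsFrame.precomp {ψ : LocalJet f U V₀ V₁} (hψ : ψ.IsFrame) (hX : X.IsSupercommutative)
    {A C : (V₀ × V₁) →ₗ[ℂ] X.O U ⊗[ℂ] (V₀ × V₁)} (hA : IsEvenMap (X.par U) A)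
    (hAC : ∀ v, extendScalars A (C v) = 1 ⊗ₜ v) (hCA : ∀ v, extendScalars C (A v) = 1 ⊗ₜ v) :
    (ψ.precomp hX A hA).IsFrame := by
  refine fun U' h => ⟨fun x y hxy => ?_, le_antisymm ?_ fun D hD => ?_⟩
  · rw [precomp_secs, precomp_secs] at hxy
    rw [← extendScalars_comp_baseMap hCA (X.res h) x, hψ.injective h hxy,
      extendScalars_comp_baseMap hCA (X.res h) y]
  · rintro _ ⟨x, rfl⟩
    exact secs_mem_Der hX _ h x
  · obtain ⟨x, rfl⟩ := hψ.exists_secs h hD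
    exact ⟨extendScalars (baseMap _ (X.res h) ∘ₗ C) x, by
      rw [precomp_secs, extendScalars_comp_baseMap hAC (X.res h) x]⟩

theorem IsFrame.exists_precomp {ψ : LocalJet f U V₀ V₁} (hψ : ψ.IsFrame)
    (hX : X.IsSupercommutative) (χ : LocalJet f U V₀ V₁) :
    ∃ (A : (V₀ × V₁) →ₗ[ℂ] X.O U ⊗[ℂ] (V₀ × V₁)) (hA : IsEvenMap (X.par U) A),
      ψ.precomp hX A hA = χ := by
  let e := LinearEquiv.ofInjective (ψ.secs le_rfl) (hψ.injective le_rfl)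
  let A : (V₀ × V₁) →ₗ[ℂ] X.O U ⊗[ℂ] (V₀ × V₁) := e.symm.toLinearMap ∘ₗ
    χ.val.codRestrict (LinearMap.range (ψ.secs le_rfl)) fun v => by
      rw [(hψ U le_rfl).2]
      exact χ.val_mem_Der v
  have hA : ∀ v, ψ.secs le_rfl (A v) = χ.val v := fun v =>
    congrArg Subtype.val (e.apply_symm_apply _)
  have hA' : IsEvenMap (X.par U) A := isEvenMap_of_homogeneous fun p v hv =>
    hψ.tparity_eq le_rfl (by rw [hA]; exact χ.val_mem p v hv)
  exact ⟨A, hA', LocalJet.ext (LinearMap.ext hA)⟩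

/-- Two frames differ by an invertible even endomorphism of the trivial bundle. -/
theorem IsFrame.exists_precomp_inverse {ψ χ : LocalJet f U V₀ V₁} (hψ : ψ.IsFrame)
    (hχ : χ.IsFrame) (hX : X.IsSupercommutative) :
    ∃ (A C : (V₀ × V₁) →ₗ[ℂ] X.O U ⊗[ℂ] (V₀ × V₁)) (hA : IsEvenMap (X.par U) A),
      ψ.precomp hX A hA = χ ∧ (∀ v, extendScalars A (C v) = 1 ⊗ₜ v) ∧
      ∀ v, extendScalars C (A v) = 1 ⊗ₜ v := by
  obtain ⟨A, hA, rfl⟩ := hψ.exists_precomp hX χ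
  obtain ⟨C, hC, hC'⟩ := hχ.exists_precomp hX ψ
  have self : ∀ B : (V₀ × V₁) →ₗ[ℂ] X.O U ⊗[ℂ] (V₀ × V₁), baseMap _ (X.res le_rfl) ∘ₗ B = B :=
    fun B => LinearMap.ext fun v => baseMap_of_eq_id (X.res_self le_rfl) _
  have key : ∀ x, ψ.secs le_rfl (extendScalars A (extendScalars C x)) = ψ.secs le_rfl x := by
    intro x
    have h1 := precomp_secs (ψ.precomp hX A hA) hX C hC le_rfl x
    rw [hC', self, precomp_secs, self] at h1
    exact h1.symm
  have h2 : ∀ x, extendScalars A (extendScalars C x) = x := fun x => hψ.injective le_rfl (key x)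
  refine ⟨A, C, hA, rfl, fun v => ?_, fun v => ?_⟩
  · have := h2 (1 ⊗ₜ v)
    rwa [extendScalars_tmul, one_smul] at this
  · have hinj : Function.Injective (extendScalars A) := fun x y hxy => by
      apply hχ.injective le_rfl
      rw [precomp_secs, precomp_secs, self, hxy]
    apply hinj
    rw [h2, extendScalars_tmul, one_smul]

theorem precomp_pull (ψ : LocalJet f U V₀ V₁) (hX : X.IsSupercommutative)
    (hZ : Z.IsSupercommutative) (A : (V₀ × V₁) →ₗ[ℂ] X.O U ⊗[ℂ] (V₀ × V₁))
    (hA : IsEvenMap (X.par U) A) (k : Hom Z X) {U' : Opens Z} (h : Set.MapsTo k.base U' U)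
    (hA' : IsEvenMap (Z.par U') (baseMap _ (k.pull U U' h) ∘ₗ A)) :
    (ψ.precomp hX A hA).pull k h =
      (ψ.pull k h).precomp hZ (baseMap _ (k.pull U U' h) ∘ₗ A) hA' := by
  refine LocalJet.ext (LinearMap.ext fun v => ?_)
  exact (ψ.pull_secs k h le_rfl le_rfl h (A v)).symm

theorem IsEvenMap.baseMap {R R' : Type*} [Ring R] [Algebra ℂ R] [Ring R'] [Algebra ℂ R']
    {σ : R →ₐ[ℂ] R} {σ' : R' →ₐ[ℂ] R'} {A : (V₀ × V₁) →ₗ[ℂ] R ⊗[ℂ] (V₀ × V₁)}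
    (hA : IsEvenMap σ A) {P : R →ₐ[ℂ] R'} (hP : ∀ a, P (σ a) = σ' (P a)) :
    IsEvenMap σ' (SuperGeom.baseMap _ P ∘ₗ A) := fun v => by
  rw [LinearMap.comp_apply, ← baseMap_tparity hP, hA, LinearMap.comp_apply]

/-- If one frame stays a frame after pullback, then so does every frame. -/
theorem IsFrame.pull_of_pull {ψ χ : LocalJet f U V₀ V₁} (hψ : ψ.IsFrame) (hχ : χ.IsFrame)
    (hX : X.IsSupercommutative) (hZ : Z.IsSupercommutative) (k : Hom Z X) {U' : Opens Z}
    (h : Set.MapsTo k.base U' U) (hk : (ψ.pull k h).IsFrame) : (χ.pull k h).IsFrame := by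
  obtain ⟨A, C, hA, rfl, hAC, hCA⟩ := hψ.exists_precomp_inverse hχ hX
  have hA' : IsEvenMap (Z.par U') (baseMap _ (k.pull U U' h) ∘ₗ A) :=
    IsEvenMap.baseMap hA (k.pull_par U U' h)
  rw [ψ.precomp_pull hX hZ A hA k h hA']
  refine hk.precomp hZ (C := baseMap _ (k.pull U U' h) ∘ₗ C) hA' (fun v => ?_) (fun v => ?_)
  · have := extendScalars_comp_baseMap hAC (k.pull U U' h) (1 ⊗ₜ v)
    rwa [extendScalars_tmul, one_smul] at this
  · have := extendScalars_comp_baseMap hCA (k.pull U U' h) (1 ⊗ₜ v)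
    rwa [extendScalars_tmul, one_smul] at this

theorem pull_restrict (ψ : LocalJet f U V₀ V₁) (k : Hom Z X) {Q : Opens X} {U' U'' : Opens Z}
    (h : Set.MapsTo k.base U' U) (hU : U'' ≤ U') (hQ : Q ≤ U) (hk : Set.MapsTo k.base U'' Q) :
    (ψ.pull k h).restrict hU = (ψ.restrict hQ).pull k hk :=
  LocalJet.ext (LinearMap.ext fun v =>
    (preDerPullOn_res k hQ hU h hk (isNatural_of_mem (ψ.val_mem_Der v))).symm)

/-- The coordinates of sections of the pulled back tangent bundle with respect to a frame. -/
def coord (ψ : LocalJet f U V₀ V₁) (hψ : ψ.IsFrame) (h : U' ≤ U) :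
    Der f U' ≃ₗ[ℂ] X.O U' ⊗[ℂ] (V₀ × V₁) :=
  (LinearEquiv.ofEq _ _ (hψ U' h).2.symm).trans
    (LinearEquiv.ofInjective (ψ.secs h) (hψ.injective h)).symm

theorem secs_coord (ψ : LocalJet f U V₀ V₁) (hψ : ψ.IsFrame) (h : U' ≤ U) (D : Der f U') :
    ψ.secs h (ψ.coord hψ h D) = D.1 := by
  have := (LinearEquiv.ofInjective (ψ.secs h) (hψ.injective h)).apply_symm_apply
    ((LinearEquiv.ofEq _ _ (hψ U' h).2.symm) D)
  exact congrArg Subtype.val this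

theorem coord_eq (ψ : LocalJet f U V₀ V₁) (hψ : ψ.IsFrame) (h : U' ≤ U) {D : Der f U'}
    {x : X.O U' ⊗[ℂ] (V₀ × V₁)} (hx : ψ.secs h x = D.1) : ψ.coord hψ h D = x :=
  hψ.injective h (by rw [secs_coord, hx])

end LocalJet

end LocalJets

/-! ### Integrals along segments -/

section SegmentIntegral

variable {E : Type u} [NormedAddCommGroup E] [NormedSpace ℝ E] {G : Type u} [NormedAddCommGroup G]
  [NormedSpace ℝ G]

/-- The integral of `w(t) φ(q + t (x - q))` over `0 ≤ t ≤ 1`. -/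
def segmentIntegral (q : E) (w : ℝ → ℝ) (φ : E → G) (x : E) : G :=
  ∫ t in (0 : ℝ)..1, w t • φ (q + t • (x - q))

variable {q : E} {U : Set E} {w : ℝ → ℝ} {φ : E → G}

theorem segment_mem (hU : StarConvex ℝ q U) {x : E} (hx : x ∈ U) {t : ℝ}
    (ht : t ∈ Set.Icc (0 : ℝ) 1) : q + t • (x - q) ∈ U :=
  hU.add_smul_sub_mem hx ht.1 ht.2

theorem continuousOn_segment (hU : StarConvex ℝ q U) (hw : Continuous w) (hφ : ContinuousOn φ U) :
    ContinuousOn (fun p : E × ℝ => w p.2 • φ (q + p.2 • (p.1 - q))) (U ×ˢ Set.Icc (0 : ℝ) 1) := by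
  refine ContinuousOn.smul (by fun_prop) (hφ.comp (by fun_prop) ?_)
  rintro ⟨x, t⟩ ⟨hx, ht⟩
  exact segment_mem hU hx ht

theorem continuousOn_segment_right (hU : StarConvex ℝ q U) (hw : Continuous w)
    (hφ : ContinuousOn φ U) {x : E} (hx : x ∈ U) :
    ContinuousOn (fun t : ℝ => w t • φ (q + t • (x - q))) (Set.Icc (0 : ℝ) 1) :=
  (continuousOn_segment hU hw hφ).comp (f := fun t : ℝ => (x, t)) (by fun_prop)
    fun _ ht => ⟨hx, ht⟩

theorem intervalIntegrable_segment (hU : StarConvex ℝ q U) (hw : Continuous w)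
    (hφ : ContinuousOn φ U) {x : E} (hx : x ∈ U) :
    IntervalIntegrable (fun t : ℝ => w t • φ (q + t • (x - q))) MeasureTheory.volume 0 1 := by
  apply ContinuousOn.intervalIntegrable
  rw [Set.uIcc_of_le zero_le_one]
  exact continuousOn_segment_right hU hw hφ hx

theorem _root_.IntervalIntegrable.clm_apply_const {G : Type*} [NormedAddCommGroup G]
    [NormedSpace ℝ G] {a b : ℝ} {φ : ℝ → E →L[ℝ] G}
    (hφ : IntervalIntegrable φ MeasureTheory.volume a b) (v : E) :
    IntervalIntegrable (fun t => φ t v) MeasureTheory.volume a b :=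
  ⟨hφ.1.apply_continuousLinearMap v, hφ.2.apply_continuousLinearMap v⟩

theorem continuousOn_segmentIntegral (hU : StarConvex ℝ q U) (hw : Continuous w)
    (hφ : ContinuousOn φ U) : ContinuousOn (segmentIntegral q w φ) U := by
  rw [continuousOn_iff_continuous_domRestrict]
  -- Clamping `t` to `[0, 1]` keeps the segment inside `U` and makes the integrand continuous for
  -- all real `t`, without changing the integral.
  have h : Continuous (fun p : U × ℝ => w (Set.projIcc (0 : ℝ) 1 zero_le_one p.2) •
      φ (q + (Set.projIcc (0 : ℝ) 1 zero_le_one p.2 : ℝ) • ((p.1 : E) - q))) := by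
    refine (continuousOn_segment hU hw hφ).comp_continuous
      (f := fun p : U × ℝ => ((p.1 : E), (Set.projIcc (0 : ℝ) 1 zero_le_one p.2 : ℝ))) ?_ ?_
    · exact (continuous_subtype_val.comp continuous_fst).prodMk
        (continuous_subtype_val.comp (continuous_projIcc.comp continuous_snd))
    · intro p
      exact ⟨p.1.2, (Set.projIcc (0 : ℝ) 1 zero_le_one p.2).2⟩
  have h2 := intervalIntegral.continuous_parametric_intervalIntegral_of_continuous'
    (μ := MeasureTheory.volume) (f := fun (x : U) (t : ℝ) =>
      w (Set.projIcc (0 : ℝ) 1 zero_le_one t) •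
      φ (q + (Set.projIcc (0 : ℝ) 1 zero_le_one t : ℝ) • ((x : E) - q))) h 0 1
  refine h2.congr fun x => ?_
  rw [Set.domRestrict_apply, segmentIntegral]
  refine intervalIntegral.integral_congr fun t ht => ?_
  rw [Set.uIcc_of_le zero_le_one] at ht
  simp only [Set.projIcc_of_mem zero_le_one ht]

/-- Differentiation under the integral sign. The chain rule for `q + t (x - q)` contributes the
additional factor `t` in the weight. -/
theorem hasFDerivAt_segmentIntegral [FiniteDimensional ℝ E] (hU : StarConvex ℝ q U)
    (hUo : IsOpen U) (hw : Continuous w) {φ' : E → E →L[ℝ] G}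
    (hφ : ∀ x ∈ U, HasFDerivAt φ (φ' x) x) (hφ' : ContinuousOn φ' U) {x : E} (hx : x ∈ U) :
    HasFDerivAt (segmentIntegral q w φ) (segmentIntegral q (fun t => w t * t) φ' x) x := by
  have hφc : ContinuousOn φ U := fun y hy => (hφ y hy).continuousAt.continuousWithinAt
  have hwt : Continuous fun t => w t * t := hw.mul continuous_id
  -- A closed ball is compact in finite dimension, so the derivative of the integrand has a constant
  -- bound over it and over `0 ≤ t ≤ 1`.
  obtain ⟨r, hr, hrU⟩ := Metric.nhds_basis_closedBall.mem_iff.1 (hUo.mem_nhds hx)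
  obtain ⟨C, hC⟩ := ((isCompact_closedBall x r).prod isCompact_Icc).exists_bound_of_continuousOn
    ((continuousOn_segment hU hwt hφ').mono (Set.prod_mono hrU le_rfl))
  have hI : Set.uIoc (0 : ℝ) 1 ⊆ Set.Icc 0 1 := by
    rw [Set.uIoc_of_le zero_le_one]
    exact Set.Ioc_subset_Icc_self
  refine intervalIntegral.hasFDerivAt_integral_of_dominated_of_fderiv_le
    (s := Metric.closedBall x r) (bound := fun _ => C)
    (F := fun x t => w t • φ (q + t • (x - q)))
    (F' := fun x t => (w t * t) • φ' (q + t • (x - q)))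
    (Metric.closedBall_mem_nhds x hr) ?_ ?_ ?_ ?_ ?_ ?_
  · filter_upwards [hUo.mem_nhds hx] with y hy
    exact ((continuousOn_segment_right hU hw hφc hy).mono hI).aestronglyMeasurable
      measurableSet_uIoc
  · exact intervalIntegrable_segment hU hw hφc hx
  · exact ((continuousOn_segment_right hU hwt hφ' hx).mono hI).aestronglyMeasurable
      measurableSet_uIoc
  · exact Filter.Eventually.of_forall fun t ht y hy => hC (y, t) ⟨hy, hI ht⟩
  · exact intervalIntegrable_const
  · refine Filter.Eventually.of_forall fun t ht y hy => ?_
    have h1 : HasFDerivAt (fun y : E => q + t • (y - q)) (t • ContinuousLinearMap.id ℝ E) y :=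
      (((hasFDerivAt_id y).sub_const q).const_smul t).const_add q
    have h2 := ((hφ _ (segment_mem hU (hrU hy) (hI ht))).comp y h1).const_smul (w t)
    refine h2.congr_fderiv ?_
    ext v
    simp [mul_smul]

/-- The derivative of a segment integral is a segment integral of the derivative with another
weight, so the induction runs over all weights and all target spaces. -/
theorem contDiffOn_segmentIntegral [FiniteDimensional ℝ E] (hU : StarConvex ℝ q U)
    (hUo : IsOpen U) (n : ℕ) : ∀ {G : Type u} [NormedAddCommGroup G] [NormedSpace ℝ G]
    {w : ℝ → ℝ} {φ : E → G}, Continuous w → ContDiffOn ℝ n φ U →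
    ContDiffOn ℝ n (segmentIntegral q w φ) U := by
  induction n with
  | zero =>
    intro G _ _ w φ hw hφ
    rw [Nat.cast_zero, contDiffOn_zero] at hφ ⊢
    exact continuousOn_segmentIntegral hU hw hφ
  | succ n ih =>
    intro G _ _ w φ hw hφ
    rw [Nat.cast_succ, contDiffOn_succ_iff_fderiv_of_isOpen hUo] at hφ ⊢
    have hd : ∀ x ∈ U, HasFDerivAt φ (fderiv ℝ φ x) x := fun x hx =>
      (hφ.1.differentiableAt (hUo.mem_nhds hx)).hasFDerivAt
    have hd' := fun x (hx : x ∈ U) =>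
      hasFDerivAt_segmentIntegral hU hUo hw hd hφ.2.2.continuousOn hx
    refine ⟨fun x hx => (hd' x hx).differentiableAt.differentiableWithinAt, by simp, ?_⟩
    exact (ih (hw.mul continuous_id) hφ.2.2).congr fun x hx => (hd' x hx).fderiv

/-- The first order Taylor expansion with remainder on a star-shaped set. -/
theorem exists_segment_remainder [FiniteDimensional ℝ E] (hU : StarConvex ℝ q U)
    (hUo : IsOpen U) {F : E → ℂ} (hF : ContDiffOn ℝ ∞ F U) :
    ∃ L : E → E →L[ℝ] ℂ, ContDiffOn ℝ ∞ L U ∧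
      (∀ x ∈ U, ∀ v, L x v = ∫ t in (0 : ℝ)..1, fderiv ℝ F (q + t • (x - q)) v) ∧
      (∀ x ∈ U, ∀ e v, fderiv ℝ (fun x => L x e) x v =
        ∫ t in (0 : ℝ)..1, t • fderiv ℝ (fderiv ℝ F) (q + t • (x - q)) v e) ∧
      ∀ x ∈ U, F x = F q + L x (x - q) := by
  have hc := ((contDiffOn_infty_iff_fderiv_of_isOpen hUo).1 hF).2
  have hdd : ∀ x ∈ U, HasFDerivAt (fderiv ℝ F) (fderiv ℝ (fderiv ℝ F) x) x := fun x hx =>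
    ((hc.differentiableOn (by simp) x hx).differentiableAt (hUo.mem_nhds hx)).hasFDerivAt
  have hcc : ContinuousOn (fderiv ℝ (fderiv ℝ F)) U :=
    ((contDiffOn_infty_iff_fderiv_of_isOpen hUo).1 hc).2.continuousOn
  have h1c : Continuous fun _ : ℝ => (1 : ℝ) := continuous_const
  have htc : Continuous fun t : ℝ => (1 : ℝ) * t := by fun_prop
  let L := segmentIntegral q (fun _ => 1) (fderiv ℝ F)
  have happ : ∀ x ∈ U, ∀ v, L x v = ∫ t in (0 : ℝ)..1, fderiv ℝ F (q + t • (x - q)) v :=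
    fun x hx v => by
      have := ContinuousLinearMap.intervalIntegral_apply
        (intervalIntegrable_segment hU h1c hc.continuousOn hx) v
      simp only [one_smul] at this
      rw [← this]
      simp only [L, segmentIntegral, one_smul]
  have hL : ∀ x ∈ U, HasFDerivAt L
      (segmentIntegral q (fun t => 1 * t) (fderiv ℝ (fderiv ℝ F)) x) x := fun x hx =>
    hasFDerivAt_segmentIntegral hU hUo h1c hdd hcc hx
  refine ⟨L, contDiffOn_infty.2 fun n =>
    contDiffOn_segmentIntegral hU hUo n h1c (contDiffOn_infty.1 hc n), happ,
    fun x hx e v => ?_, fun x hx => ?_⟩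
  · have h1 : HasFDerivAt (fun x => L x e) _ x := (hL x hx).clm_apply (hasFDerivAt_const e x)
    have hint := intervalIntegrable_segment (G := E →L[ℝ] E →L[ℝ] ℂ) hU htc hcc hx
    rw [h1.fderiv]
    have e1 := ContinuousLinearMap.intervalIntegral_apply hint v
    have hint2 : IntervalIntegrable (fun t : ℝ =>
        ((1 * t) • fderiv ℝ (fderiv ℝ F) (q + t • (x - q))) v) MeasureTheory.volume 0 1 :=
      hint.clm_apply_const v
    have e2 := ContinuousLinearMap.intervalIntegral_apply hint2 e
    simp only [ContinuousLinearMap.comp_zero, zero_add, ContinuousLinearMap.flip_apply,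
      segmentIntegral]
    rw [e1, e2]
    simp
  · have hder : ∀ t ∈ Set.uIcc (0 : ℝ) 1, HasDerivAt (fun t : ℝ => F (q + t • (x - q)))
        (fderiv ℝ F (q + t • (x - q)) (x - q)) t := fun t ht => by
      rw [Set.uIcc_of_le zero_le_one] at ht
      have h1 : HasDerivAt (fun t : ℝ => q + t • (x - q)) (x - q) t := by
        simpa using ((hasDerivAt_id t).smul_const (x - q)).const_add q
      have h2 : DifferentiableAt ℝ F (q + t • (x - q)) :=
        (hF.differentiableOn (by simp) _ (segment_mem hU hx ht)).differentiableAt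
          (hUo.mem_nhds (segment_mem hU hx ht))
      exact h2.hasFDerivAt.comp_hasDerivAt t h1
    have hint := intervalIntegrable_segment hU h1c hc.continuousOn hx
    have hint2 : IntervalIntegrable (fun t : ℝ => fderiv ℝ F (q + t • (x - q)) (x - q))
        MeasureTheory.volume 0 1 := by
      simpa using hint.clm_apply_const (x - q)
    have h3 := intervalIntegral.integral_eq_sub_of_hasDerivAt hder hint2
    rw [← happ x hx] at h3
    simp only [one_smul, zero_smul, add_zero, add_sub_cancel] at h3
    rw [h3, add_sub_cancel]

end SegmentIntegral

/-! ### Partially holomorphic functions -/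

namespace MixedSuperVectorSpace

variable (V : MixedSuperVectorSpace.{u})

instance : FiniteDimensional ℝ V.real := by
  have : FiniteDimensional ℝ V.even := FiniteDimensional.complexToReal V.even
  infer_instance

/-- The complex linearity of a real linear map `V_ℝ → ℂ` along `V_ℂ`. -/
def IsCplxLinear (L : V.real →L[ℝ] ℂ) : Prop :=
  ∀ v w : V.real, (v : V.even) ∈ V.cplx → (w : V.even) = Complex.I • (v : V.even) →
    L w = Complex.I * L v

/-- A basis of `V₀` that consists of elements of `V_ℝ`. -/
theorem exists_real_basis : ∃ b : Module.Basis (Fin (Module.finrank ℂ V.even)) ℂ V.even,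
    ∀ i, b i ∈ V.real := by
  let b := Module.Basis.ofSpan (K := ℂ) (s := (V.real : Set V.even)) V.span_real.ge
  have hb : ∀ i, b i ∈ V.real := fun i =>
    Module.Basis.ofSpan_subset V.span_real.ge (Set.mem_range_self i)
  have : Finite _ := Module.Finite.finite_basis b
  have := Fintype.ofFinite ((linearIndepOn_empty ℂ (id : V.even → V.even)).extend
    (Set.empty_subset (V.real : Set V.even)))
  exact ⟨b.reindex (Fintype.equivFinOfCardEq (Module.finrank_eq_card_basis b).symm), fun i => by
    rw [Module.Basis.reindex_apply]
    exact hb _⟩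

/-- A basis of `V₀` that consists of elements of `V_ℝ`. -/
def realBasis : Module.Basis (Fin (Module.finrank ℂ V.even)) ℂ V.even :=
  V.exists_real_basis.choose

theorem realBasis_mem (i) : V.realBasis i ∈ V.real := V.exists_real_basis.choose_spec i

/-- The basis vectors as elements of `V_ℝ`. -/
def realVec (i : Fin (Module.finrank ℂ V.even)) : V.real := ⟨V.realBasis i, V.realBasis_mem i⟩

variable {V}

/-- A map on `V_ℝ` that is complex linear only along `V_ℂ` is nevertheless given by complex
coordinates with respect to a complex basis inside `V_ℝ`. This is where the injectivity of `ℂ ⊗ V_ℝ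
/ V_ℂ → V / V_ℂ` enters. -/
theorem IsCplxLinear.apply_eq {L : V.real →L[ℝ] ℂ} (hL : V.IsCplxLinear L) (w : V.real) :
    L w = ∑ i, V.realBasis.repr w i * L (V.realVec i) := by
  let c := fun i => V.realBasis.repr (w : V.even) i
  let u : V.real := ∑ i, (c i).im • V.realVec i
  let a : V.real := ∑ i, (c i).re • V.realVec i
  have hcoe : ∀ d : Fin (Module.finrank ℂ V.even) → ℝ, ((∑ i, d i • V.realVec i : V.real) : V.even) =
      ∑ i, d i • V.realBasis i := fun d => by
    rw [AddSubmonoidClass.coe_finsetSum]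
    rfl
  -- Here `a` collects the real and `u` the imaginary parts of the coordinates of `w`. Both `u` and
  -- `i u = w - a` lie in `V_ℝ`, hence `u` lies in `V_ℂ`.
  have hw : ((w - a : V.real) : V.even) = Complex.I • (u : V.even) := by
    have h1 : (w : V.even) = ∑ i, c i • V.realBasis i := (V.realBasis.sum_repr _).symm
    rw [Submodule.coe_sub, hcoe, hcoe, h1, ← Finset.sum_sub_distrib, Finset.smul_sum]
    refine Finset.sum_congr rfl fun i _ => ?_
    have h2 : c i • V.realBasis i =
        (c i).re • V.realBasis i + Complex.I • (c i).im • V.realBasis i := by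
      rw [← Complex.coe_smul (c i).re, ← Complex.coe_smul (c i).im, smul_smul, ← add_smul,
        mul_comm, Complex.re_add_im]
    rw [h2, add_sub_cancel_left]
  have hu : (u : V.even) ∈ V.cplx := (V.mem_cplx _).2 ⟨u.2, by rw [← hw]; exact (w - a).2⟩
  have h2 := hL u (w - a) hu hw
  rw [map_sub, sub_eq_iff_eq_add] at h2
  rw [h2, map_sum, map_sum, Finset.mul_sum, ← Finset.sum_add_distrib]
  refine Finset.sum_congr rfl fun i _ => ?_
  rw [map_smul, map_smul, Complex.real_smul, Complex.real_smul]
  conv_rhs => rw [← Complex.re_add_im (V.realBasis.repr (w : V.even) i)]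
  ring

/-- `F` is partially holomorphic on `U`. -/
def IsPartHolOn (F : V.real → ℂ) (U : Set V.real) : Prop :=
  ContDiffOn ℝ ∞ F U ∧ ∀ x ∈ U, V.IsCplxLinear (fderiv ℝ F x)

theorem IsPartHolOn.differentiableAt {F : V.real → ℂ} {U : Set V.real} (hF : IsPartHolOn F U)
    (hU : IsOpen U) {x : V.real} (hx : x ∈ U) : DifferentiableAt ℝ F x :=
  (hF.1.differentiableOn (by simp) x hx).differentiableAt (hU.mem_nhds hx)

theorem IsPartHolOn.contDiffOn_fderiv {F : V.real → ℂ} {U : Set V.real} (hF : IsPartHolOn F U)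
    (hU : IsOpen U) : ContDiffOn ℝ ∞ (fderiv ℝ F) U :=
  ((contDiffOn_infty_iff_fderiv_of_isOpen hU).1 hF.1).2

/-- Differentiate the Cauchy-Riemann condition `dF(w) = i dF(v)`, which holds near `x`, in the
direction `e`, and use the symmetry of the second derivative. -/
theorem IsPartHolOn.second_fderiv {F : V.real → ℂ} {U : Set V.real} (hF : IsPartHolOn F U)
    (hU : IsOpen U) {x : V.real} (hx : x ∈ U) (e : V.real) {v w : V.real}
    (hv : (v : V.even) ∈ V.cplx) (hw : (w : V.even) = Complex.I • (v : V.even)) :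
    fderiv ℝ (fderiv ℝ F) x w e = Complex.I * fderiv ℝ (fderiv ℝ F) x v e := by
  have hd : DifferentiableAt ℝ (fderiv ℝ F) x :=
    ((hF.contDiffOn_fderiv hU).differentiableOn (by simp) x hx).differentiableAt (hU.mem_nhds hx)
  have hs : IsSymmSndFDerivAt ℝ F x :=
    (hF.1.contDiffAt (hU.mem_nhds hx)).isSymmSndFDerivAt (by
      rw [minSmoothness_of_isRCLikeNormedField]
      exact WithTop.coe_le_coe.2 le_top)
  rw [hs.eq w e, hs.eq v e]
  have h1 : fderiv ℝ (fun y => fderiv ℝ F y w) x = (fderiv ℝ (fderiv ℝ F) x).flip w := by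
    rw [fderiv_clm_apply hd (differentiableAt_const w)]
    simp
  have h2 : fderiv ℝ (fun y => Complex.I * fderiv ℝ F y v) x =
      Complex.I • (fderiv ℝ (fderiv ℝ F) x).flip v := by
    rw [fderiv_const_mul (hd.clm_apply (differentiableAt_const v)),
      fderiv_clm_apply hd (differentiableAt_const v)]
    simp
  have h3 : (fun y => fderiv ℝ F y w) =ᶠ[nhds x] fun y => Complex.I * fderiv ℝ F y v := by
    filter_upwards [hU.mem_nhds hx] with y hy
    exact hF.2 y hy v w hv hw
  have h4 := h3.fderiv_eq (𝕜 := ℝ)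
  rw [h1, h2] at h4
  have h5 := DFunLike.congr_fun h4 e
  simpa using h5

/-- Directional derivatives of partially holomorphic functions. -/
theorem IsPartHolOn.fderiv_apply {F : V.real → ℂ} {U : Set V.real} (hF : IsPartHolOn F U)
    (hU : IsOpen U) (e : V.real) : IsPartHolOn (fun x => fderiv ℝ F x e) U := by
  refine ⟨(hF.contDiffOn_fderiv hU).clm_apply contDiffOn_const, fun x hx v w hv hw => ?_⟩
  have hd : DifferentiableAt ℝ (fderiv ℝ F) x :=
    ((hF.contDiffOn_fderiv hU).differentiableOn (by simp) x hx).differentiableAt (hU.mem_nhds hx)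
  rw [fderiv_clm_apply hd (differentiableAt_const e)]
  simpa using hF.second_fderiv hU hx e hv hw

/-- Hadamard's lemma. -/
theorem IsPartHolOn.hadamard {F : V.real → ℂ} {U : Set V.real} (hF : IsPartHolOn F U)
    (hU : IsOpen U) {q : V.real} (hq : StarConvex ℝ q U) :
    ∃ G : Fin (Module.finrank ℂ V.even) → V.real → ℂ, (∀ i, IsPartHolOn (G i) U) ∧
      ∀ x ∈ U, F x = F q + ∑ i, (V.realBasis.repr x i - V.realBasis.repr q i) * G i x := by
  obtain ⟨L, hL, happ, hder, hFL⟩ := exists_segment_remainder hq hU hF.1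
  refine ⟨fun i x => L x (V.realVec i), fun i => ⟨hL.clm_apply contDiffOn_const,
    fun x hx v w hv hw => ?_⟩, fun x hx => ?_⟩
  -- The remainder coefficients are partially holomorphic because the second derivatives under the
  -- integral are complex linear along `V_ℂ`.
  · rw [hder x hx, hder x hx, ← intervalIntegral.integral_const_mul]
    refine intervalIntegral.integral_congr fun t ht => ?_
    rw [Set.uIcc_of_le zero_le_one] at ht
    rw [hF.second_fderiv hU (segment_mem hq hx ht) (V.realVec i) hv hw, mul_smul_comm]
  -- An average of the differentials of `F` is again complex linear along `V_ℂ`, so it expands in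
  -- the complex coordinates.
  · have hLc : V.IsCplxLinear (L x) := fun v w hv hw => by
      rw [happ x hx, happ x hx, ← intervalIntegral.integral_const_mul]
      refine intervalIntegral.integral_congr fun t ht => ?_
      rw [Set.uIcc_of_le zero_le_one] at ht
      exact hF.2 _ (segment_mem hq hx ht) v w hv hw
    rw [hFL x hx, hLc.apply_eq]
    congr 1
    refine Finset.sum_congr rfl fun i _ => ?_
    rw [Submodule.coe_sub, map_sub, Finsupp.sub_apply]

end MixedSuperVectorSpace

/-! ### Finite-dimensional exterior algebras -/

section Exterior

variable {E : Type*} [AddCommGroup E] [Module ℂ E]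

instance [FiniteDimensional ℂ E] : FiniteDimensional ℂ (ExteriorAlgebra ℂ E) :=
  Module.Finite.of_basis (Module.finBasis ℂ E).ExteriorAlgebra

/-- The augmentation ideal of the exterior algebra. -/
def augIdeal (E : Type*) [AddCommGroup E] [Module ℂ E] : Submodule ℂ (ExteriorAlgebra ℂ E) :=
  LinearMap.ker (ExteriorAlgebra.algebraMapInv (R := ℂ) (M := E)).toLinearMap

theorem mem_augIdeal {x : ExteriorAlgebra ℂ E} :
    x ∈ augIdeal E ↔ ExteriorAlgebra.algebraMapInv x = 0 := Iff.rfl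

/-- Vectors anticommute with vectors, so a vector on the right of a product can be moved to the left
up to sign. -/
theorem range_ι_mul_top_comm : (⊤ : Submodule ℂ (ExteriorAlgebra ℂ E)) *
    LinearMap.range (ExteriorAlgebra.ι ℂ (M := E)) ≤
    LinearMap.range (ExteriorAlgebra.ι ℂ (M := E)) * ⊤ := by
  rw [Submodule.mul_le]
  rintro x - y hy
  induction x using ExteriorAlgebra.induction generalizing y with
  | algebraMap r =>
    rw [Algebra.commutes]
    exact Submodule.mul_mem_mul hy trivial
  | ι m =>
    obtain ⟨n, rfl⟩ := hy
    rw [eq_neg_of_add_eq_zero_left (ExteriorAlgebra.ι_add_mul_swap m n)]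
    exact neg_mem (Submodule.mul_mem_mul ⟨n, rfl⟩ trivial)
  | mul a b ha hb =>
    have key : ∀ z ∈ LinearMap.range (ExteriorAlgebra.ι ℂ (M := E)) *
        (⊤ : Submodule ℂ (ExteriorAlgebra ℂ E)),
        a * z ∈ LinearMap.range (ExteriorAlgebra.ι ℂ (M := E)) * ⊤ := fun z hz => by
      refine Submodule.mul_induction_on hz (fun l hl t _ => ?_) fun u v hu hv => ?_
      · have h2 := Submodule.mul_mem_mul (ha l hl) (show t ∈ (⊤ : Submodule ℂ _) from trivial)
        rw [mul_assoc] at h2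
        rw [← mul_assoc]
        exact (mul_le_mul' (le_refl (LinearMap.range (ExteriorAlgebra.ι ℂ (M := E)))) le_top) h2
      · rw [mul_add]
        exact add_mem hu hv
    rw [mul_assoc]
    exact key _ (hb y hy)
  | add a b ha hb =>
    rw [add_mul]
    exact add_mem (ha y hy) (hb y hy)

/-- Every element minus its scalar part is a sum of products that start with a vector. -/
theorem augIdeal_le : augIdeal E ≤ LinearMap.range (ExteriorAlgebra.ι ℂ (M := E)) * ⊤ := by
  have key : ∀ x : ExteriorAlgebra ℂ E, x - algebraMap ℂ _ (ExteriorAlgebra.algebraMapInv x) ∈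
      LinearMap.range (ExteriorAlgebra.ι ℂ (M := E)) * ⊤ := fun x => by
    induction x using CliffordAlgebra.left_induction with
    | algebraMap r =>
      rw [AlgHom.commutes]
      simp
    | add a b ha hb =>
      rw [map_add, map_add, add_sub_add_comm]
      exact add_mem ha hb
    | ι_mul a m ha =>
      have : ExteriorAlgebra.algebraMapInv (CliffordAlgebra.ι 0 m * a : ExteriorAlgebra ℂ E) = 0 := by
        rw [map_mul]
        change ExteriorAlgebra.algebraMapInv (ExteriorAlgebra.ι ℂ m) * _ = 0
        simp [ExteriorAlgebra.algebraMapInv]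
      rw [this, map_zero, sub_zero]
      exact Submodule.mul_mem_mul ⟨m, rfl⟩ trivial
  intro x hx
  have := key x
  rwa [mem_augIdeal.1 hx, map_zero, sub_zero] at this

/-- Collecting the vectors on the left puts the `n`-th power of the ideal into `Λ^n · Λ`, and `Λ^n =
0` for `n` above the dimension. -/
theorem exists_augIdeal_pow_eq_bot [FiniteDimensional ℂ E] : ∃ n, augIdeal E ^ n = ⊥ := by
  have h1 : ∀ n, augIdeal E ^ n ≤ LinearMap.range (ExteriorAlgebra.ι ℂ (M := E)) ^ n * ⊤ := by
    intro n
    induction n with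
    | zero => rw [pow_zero, pow_zero, one_mul]; exact le_top
    | succ n ih =>
      calc augIdeal E ^ (n + 1) = augIdeal E ^ n * augIdeal E := pow_succ _ _
        _ ≤ (LinearMap.range (ExteriorAlgebra.ι ℂ (M := E)) ^ n * ⊤) *
            (LinearMap.range (ExteriorAlgebra.ι ℂ (M := E)) * ⊤) := mul_le_mul' ih augIdeal_le
        _ = LinearMap.range (ExteriorAlgebra.ι ℂ (M := E)) ^ n *
            (⊤ * LinearMap.range (ExteriorAlgebra.ι ℂ (M := E))) * ⊤ := by simp only [mul_assoc]
        _ ≤ LinearMap.range (ExteriorAlgebra.ι ℂ (M := E)) ^ n *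
            (LinearMap.range (ExteriorAlgebra.ι ℂ (M := E)) * ⊤) * ⊤ :=
          mul_le_mul' (mul_le_mul' le_rfl range_ι_mul_top_comm) le_rfl
        _ = LinearMap.range (ExteriorAlgebra.ι ℂ (M := E)) ^ (n + 1) * (⊤ * ⊤) := by
          simp only [pow_succ, mul_assoc]
        _ ≤ _ := mul_le_mul' le_rfl le_top
  have h2 : LinearMap.range (ExteriorAlgebra.ι ℂ (M := E)) ^ (Module.finrank ℂ E + 1) = ⊥ := by
    have h3 := exteriorPower.finrank_eq ℂ (M := E) (n := Module.finrank ℂ E + 1)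
    rw [Nat.choose_succ_self] at h3
    exact Submodule.finrank_eq_zero.1 h3
  refine ⟨Module.finrank ℂ E + 1, eq_bot_iff.2 ((h1 _).trans ?_)⟩
  rw [h2, Submodule.bot_mul]

theorem augIdeal_pow_succ_mul_top {n : ℕ} {x y : ExteriorAlgebra ℂ E} (hx : x ∈ augIdeal E)
    (hy : y ∈ augIdeal E ^ n * ⊤) : x * y ∈ augIdeal E ^ (n + 1) * ⊤ := by
  rw [pow_succ', mul_assoc]
  exact Submodule.mul_mem_mul hx hy

/-- The odd derivation of the exterior algebra defined by a linear form. -/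
def contract : Module.Dual ℂ E →ₗ[ℂ] ExteriorAlgebra ℂ E →ₗ[ℂ] ExteriorAlgebra ℂ E :=
  CliffordAlgebra.contractLeft

theorem contract_one (d : Module.Dual ℂ E) : contract d 1 = 0 :=
  CliffordAlgebra.contractLeft_one (Q := 0) d

theorem contract_ι (d : Module.Dual ℂ E) (m : E) :
    contract d (ExteriorAlgebra.ι ℂ m) = algebraMap ℂ _ (d m) :=
  CliffordAlgebra.contractLeft_ι (Q := 0) d m

/-- The parity involution of the exterior algebra. -/
def extPar (E : Type*) [AddCommGroup E] [Module ℂ E] :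
    ExteriorAlgebra ℂ E →ₐ[ℂ] ExteriorAlgebra ℂ E := CliffordAlgebra.involute

theorem contract_mul (d : Module.Dual ℂ E) (a b : ExteriorAlgebra ℂ E) :
    contract d (a * b) = contract d a * b + extPar E a * contract d b := by
  change CliffordAlgebra.contractLeft d (a * b) = CliffordAlgebra.contractLeft d a * b +
      CliffordAlgebra.involute a * CliffordAlgebra.contractLeft d b
  induction a using CliffordAlgebra.left_induction with
  | algebraMap r => simp [CliffordAlgebra.contractLeft_algebraMap_mul,
      CliffordAlgebra.contractLeft_algebraMap]
  | add a c ha hc =>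
    rw [add_mul, map_add, ha, hc, map_add, map_add, add_mul, add_mul]
    abel
  | ι_mul a m ha =>
    rw [mul_assoc, CliffordAlgebra.contractLeft_ι_mul, CliffordAlgebra.contractLeft_ι_mul, ha,
      map_mul, CliffordAlgebra.involute_ι, mul_add, sub_mul, smul_mul_assoc, neg_mul, neg_mul]
    simp only [mul_assoc]
    abel

theorem extPar_contract (d : Module.Dual ℂ E) (a : ExteriorAlgebra ℂ E) :
    extPar E (contract d a) = -contract d (extPar E a) := by
  change CliffordAlgebra.involute (CliffordAlgebra.contractLeft d a) =
      -CliffordAlgebra.contractLeft d (CliffordAlgebra.involute a)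
  induction a using CliffordAlgebra.left_induction with
  | algebraMap r => simp [CliffordAlgebra.contractLeft_algebraMap]
  | add a c ha hc =>
    rw [map_add, map_add, ha, hc, map_add, map_add]
    abel
  | ι_mul a m ha =>
    have h1 : ∀ x : CliffordAlgebra (0 : QuadraticForm ℂ E), CliffordAlgebra.contractLeft d
        (-CliffordAlgebra.ι 0 m * x) =
        -CliffordAlgebra.contractLeft d (CliffordAlgebra.ι 0 m * x) := fun x => by
      rw [neg_mul, map_neg]
    rw [CliffordAlgebra.contractLeft_ι_mul, map_sub, map_smul, map_mul, map_mul, ha,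
      CliffordAlgebra.involute_ι]
    refine Eq.trans ?_ (congrArg _ (h1 _)).symm
    rw [CliffordAlgebra.contractLeft_ι_mul]
    simp

theorem algebraMapInv_ι (m : E) :
    ExteriorAlgebra.algebraMapInv (ExteriorAlgebra.ι ℂ m) = 0 := by
  simp [ExteriorAlgebra.algebraMapInv]

end Exterior

/-! ### Derivations, coordinates and evaluations on a tensor product of algebras -/

section TensorDerivations

variable {A B : Type*} [Ring A] [Algebra ℂ A] [Ring B] [Algebra ℂ B]

theorem map_id_leibniz (D : A →ₗ[ℂ] A) (hD : ∀ a b, D (a * b) = D a * b + a * D b)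
    (x y : A ⊗[ℂ] B) : TensorProduct.map D LinearMap.id (x * y) =
      TensorProduct.map D LinearMap.id x * y + x * TensorProduct.map D LinearMap.id y := by
  induction x using TensorProduct.induction_on with
  | zero => simp
  | add x x' hx hx' => rw [add_mul, map_add, hx, hx', map_add, add_mul, add_mul, add_add_add_comm]
  | tmul a b =>
    induction y using TensorProduct.induction_on with
    | zero => simp
    | add y y' hy hy' =>
      rw [mul_add, map_add, hy, hy', map_add, mul_add, mul_add, add_add_add_comm]
    | tmul a' b' =>
      simp only [Algebra.TensorProduct.tmul_mul_tmul, TensorProduct.map_tmul, LinearMap.id_apply,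
        hD, TensorProduct.add_tmul]

theorem id_map_leibniz (D : B →ₗ[ℂ] B) (σ : B →ₐ[ℂ] B)
    (hD : ∀ a b, D (a * b) = D a * b + σ a * D b) (x y : A ⊗[ℂ] B) :
    TensorProduct.map LinearMap.id D (x * y) = TensorProduct.map LinearMap.id D x * y +
      Algebra.TensorProduct.map (AlgHom.id ℂ A) σ x * TensorProduct.map LinearMap.id D y := by
  induction x using TensorProduct.induction_on with
  | zero => simp
  | add x x' hx hx' =>
    rw [add_mul, map_add, hx, hx', map_add, map_add, add_mul, add_mul, add_add_add_comm]
  | tmul a b =>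
    induction y using TensorProduct.induction_on with
    | zero => simp
    | add y y' hy hy' =>
      rw [mul_add, map_add, hy, hy', map_add, mul_add, mul_add, add_add_add_comm]
    | tmul a' b' =>
      simp only [Algebra.TensorProduct.tmul_mul_tmul, TensorProduct.map_tmul, LinearMap.id_apply,
        hD, TensorProduct.tmul_add, Algebra.TensorProduct.map_tmul, AlgHom.id_apply]

theorem map_par_commutes (D : A →ₗ[ℂ] A) (σ : B →ₐ[ℂ] B) (x : A ⊗[ℂ] B) :
    Algebra.TensorProduct.map (AlgHom.id ℂ A) σ (TensorProduct.map D LinearMap.id x) =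
      TensorProduct.map D LinearMap.id (Algebra.TensorProduct.map (AlgHom.id ℂ A) σ x) := by
  induction x using TensorProduct.induction_on with
  | zero => simp
  | add x x' hx hx' => simp only [map_add, hx, hx']
  | tmul a b => simp

theorem map_par_anticommutes (D : B →ₗ[ℂ] B) (σ : B →ₐ[ℂ] B) (hD : ∀ b, σ (D b) = -D (σ b))
    (x : A ⊗[ℂ] B) :
    Algebra.TensorProduct.map (AlgHom.id ℂ A) σ (TensorProduct.map LinearMap.id D x) =
      -TensorProduct.map LinearMap.id D (Algebra.TensorProduct.map (AlgHom.id ℂ A) σ x) := by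
  induction x using TensorProduct.induction_on with
  | zero => simp
  | add x x' hx hx' => simp only [map_add, hx, hx', neg_add]
  | tmul a b => simp [hD, TensorProduct.tmul_neg]

variable {A' : Type*} [Ring A'] [Algebra ℂ A'] {E F : Type u} [AddCommGroup E] [Module ℂ E]
  [AddCommGroup F] [Module ℂ F]

/-- The sum of the derivations of a tensor product defined by derivations of the factors. -/
def tensorDeriv (D : E →ₗ[ℂ] A →ₗ[ℂ] A) (D' : F →ₗ[ℂ] B →ₗ[ℂ] B) :
    E × F →ₗ[ℂ] A ⊗[ℂ] B →ₗ[ℂ] A ⊗[ℂ] B :=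
  (LinearMap.rTensorHom B ∘ₗ D).coprod (LinearMap.lTensorHom A ∘ₗ D')

theorem tensorDeriv_inl (D : E →ₗ[ℂ] A →ₗ[ℂ] A) (D' : F →ₗ[ℂ] B →ₗ[ℂ] B) (e : E) :
    tensorDeriv D D' (e, 0) = TensorProduct.map (D e) LinearMap.id := by
  rw [tensorDeriv, LinearMap.coprod_apply, map_zero, add_zero]
  rfl

theorem tensorDeriv_inr (D : E →ₗ[ℂ] A →ₗ[ℂ] A) (D' : F →ₗ[ℂ] B →ₗ[ℂ] B) (e : F) :
    tensorDeriv D D' (0, e) = TensorProduct.map LinearMap.id (D' e) := by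
  rw [tensorDeriv, LinearMap.coprod_apply, map_zero, zero_add]
  rfl

theorem tensorDeriv_tmul (D : E →ₗ[ℂ] A →ₗ[ℂ] A) (D' : F →ₗ[ℂ] B →ₗ[ℂ] B) (e : E × F) (a : A)
    (b : B) : tensorDeriv D D' e (a ⊗ₜ b) = D e.1 a ⊗ₜ b + a ⊗ₜ D' e.2 b := rfl

theorem tensorDeriv_inl_mul {D : E →ₗ[ℂ] A →ₗ[ℂ] A} (D' : F →ₗ[ℂ] B →ₗ[ℂ] B)
    (hD : ∀ e a b, D e (a * b) = D e a * b + a * D e b) (e : E) (x y : A ⊗[ℂ] B) :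
    tensorDeriv D D' (e, 0) (x * y) =
      tensorDeriv D D' (e, 0) x * y + x * tensorDeriv D D' (e, 0) y := by
  rw [tensorDeriv_inl]
  exact map_id_leibniz _ (hD e) x y

theorem tensorDeriv_inr_mul (D : E →ₗ[ℂ] A →ₗ[ℂ] A) {D' : F →ₗ[ℂ] B →ₗ[ℂ] B} {σ : B →ₐ[ℂ] B}
    (hD : ∀ e a b, D' e (a * b) = D' e a * b + σ a * D' e b) (e : F) (x y : A ⊗[ℂ] B) :
    tensorDeriv D D' (0, e) (x * y) = tensorDeriv D D' (0, e) x * y +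
      Algebra.TensorProduct.map (AlgHom.id ℂ A) σ x * tensorDeriv D D' (0, e) y := by
  rw [tensorDeriv_inr]
  exact id_map_leibniz _ σ (hD e) x y

theorem tensorDeriv_par (D : E →ₗ[ℂ] A →ₗ[ℂ] A) {D' : F →ₗ[ℂ] B →ₗ[ℂ] B} {σ : B →ₐ[ℂ] B}
    (hD : ∀ e b, σ (D' e b) = -D' e (σ b)) {p : ZMod 2} {v : E × F} (hv : IsHomogeneous p v)
    (x : A ⊗[ℂ] B) : Algebra.TensorProduct.map (AlgHom.id ℂ A) σ (tensorDeriv D D' v x) =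
      sgn p • tensorDeriv D D' v (Algebra.TensorProduct.map (AlgHom.id ℂ A) σ x) := by
  obtain ⟨v0, v1⟩ := v
  rcases eq_zero_or_one p with rfl | rfl
  · obtain rfl : v1 = 0 := isHomogeneous_zero_iff.1 hv
    rw [tensorDeriv_inl, sgn_zero, one_smul]
    exact map_par_commutes _ _ x
  · obtain rfl : v0 = 0 := isHomogeneous_one_iff.1 hv
    rw [tensorDeriv_inr, sgn_one, neg_smul, one_smul]
    exact map_par_anticommutes _ _ (hD v1) x

theorem tensorDeriv_natural {D : E →ₗ[ℂ] A →ₗ[ℂ] A} {C : E →ₗ[ℂ] A' →ₗ[ℂ] A'}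
    (D' : F →ₗ[ℂ] B →ₗ[ℂ] B) {P : A →ₐ[ℂ] A'} (hP : ∀ e a, C e (P a) = P (D e a)) (v : E × F)
    (x : A ⊗[ℂ] B) : tensorDeriv C D' v (Algebra.TensorProduct.map P (AlgHom.id ℂ B) x) =
      Algebra.TensorProduct.map P (AlgHom.id ℂ B) (tensorDeriv D D' v x) := by
  induction x using TensorProduct.induction_on with
  | zero => simp
  | add x x' hx hx' => simp only [map_add, hx, hx']
  | tmul a b => simp [tensorDeriv_tmul, hP]

/-- The sum of linear maps to the factors of a tensor product. -/
def tensorCoord (X : Module.Dual ℂ E →ₗ[ℂ] A) (Y : Module.Dual ℂ F →ₗ[ℂ] B) :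
    Module.Dual ℂ (E × F) →ₗ[ℂ] A ⊗[ℂ] B :=
  ((TensorProduct.mk ℂ A B).flip 1 ∘ₗ X) ∘ₗ (LinearMap.inl ℂ E F).dualMap +
    (TensorProduct.mk ℂ A B 1 ∘ₗ Y) ∘ₗ (LinearMap.inr ℂ E F).dualMap

theorem tensorCoord_apply (X : Module.Dual ℂ E →ₗ[ℂ] A) (Y : Module.Dual ℂ F →ₗ[ℂ] B)
    (l : Module.Dual ℂ (E × F)) : tensorCoord X Y l =
      X (l ∘ₗ LinearMap.inl ℂ E F) ⊗ₜ 1 + 1 ⊗ₜ Y (l ∘ₗ LinearMap.inr ℂ E F) := rfl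

theorem tensorCoord_natural {X : Module.Dual ℂ E →ₗ[ℂ] A} {X' : Module.Dual ℂ E →ₗ[ℂ] A'}
    (Y : Module.Dual ℂ F →ₗ[ℂ] B) {P : A →ₐ[ℂ] A'} (hP : ∀ l, P (X l) = X' l)
    (l : Module.Dual ℂ (E × F)) :
    Algebra.TensorProduct.map P (AlgHom.id ℂ B) (tensorCoord X Y l) = tensorCoord X' Y l := by
  simp [tensorCoord_apply, hP]

theorem tensorCoord_par (X : Module.Dual ℂ E →ₗ[ℂ] A) {Y : Module.Dual ℂ F →ₗ[ℂ] B}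
    {σ : B →ₐ[ℂ] B} (hσ : ∀ l, σ (Y l) = -Y l) (l : Module.Dual ℂ (E × F)) :
    Algebra.TensorProduct.map (AlgHom.id ℂ A) σ (tensorCoord X Y l) =
      tensorCoord X Y (l ∘ₗ vparity E F) := by
  have h1 : (l ∘ₗ vparity E F) ∘ₗ LinearMap.inl ℂ E F = l ∘ₗ LinearMap.inl ℂ E F := by
    ext v
    simp [vparity]
  have h2 : (l ∘ₗ vparity E F) ∘ₗ LinearMap.inr ℂ E F = -(l ∘ₗ LinearMap.inr ℂ E F) := by
    ext v
    simp [vparity, ← map_neg]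
  rw [tensorCoord_apply, tensorCoord_apply, h1, h2, map_neg, TensorProduct.tmul_neg]
  simp [hσ, TensorProduct.tmul_neg]

theorem tensorDeriv_tensorCoord {D : E →ₗ[ℂ] A →ₗ[ℂ] A} {D' : F →ₗ[ℂ] B →ₗ[ℂ] B}
    {X : Module.Dual ℂ E →ₗ[ℂ] A} {Y : Module.Dual ℂ F →ₗ[ℂ] B} (h1 : ∀ e, D e 1 = 0)
    (h1' : ∀ e, D' e 1 = 0) (hX : ∀ e l, D e (X l) = algebraMap ℂ A (l e))
    (hY : ∀ e l, D' e (Y l) = algebraMap ℂ B (l e)) (v : E × F) (l : Module.Dual ℂ (E × F)) :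
    tensorDeriv D D' v (tensorCoord X Y l) = algebraMap ℂ _ (l v) := by
  have hv : l v = l (v.1, 0) + l (0, v.2) := by rw [← map_add, ← prod_eq_inl_add_inr v]
  rw [tensorCoord_apply, map_add, tensorDeriv_tmul, tensorDeriv_tmul, h1, h1', hX, hY, hv,
    TensorProduct.tmul_zero, TensorProduct.zero_tmul, add_zero, zero_add]
  simp [Algebra.algebraMap_eq_smul_one, TensorProduct.tmul_smul, ← TensorProduct.smul_tmul',
    add_smul, Algebra.TensorProduct.one_def]

/-- The evaluation of the first factor of a tensor product. -/
def tensorEval (B : Type*) [Ring B] [Algebra ℂ B] (P : A →ₐ[ℂ] ℂ) : A ⊗[ℂ] B →ₐ[ℂ] B :=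
  (Algebra.TensorProduct.lid ℂ B).toAlgHom.comp (Algebra.TensorProduct.map P (AlgHom.id ℂ B))

theorem tensorEval_tmul (P : A →ₐ[ℂ] ℂ) (a : A) (b : B) : tensorEval B P (a ⊗ₜ b) = P a • b := by
  simp [tensorEval]

theorem tensorEval_natural {P : A →ₐ[ℂ] ℂ} {P' : A' →ₐ[ℂ] ℂ} {Q : A →ₐ[ℂ] A'}
    (h : ∀ a, P' (Q a) = P a) (x : A ⊗[ℂ] B) :
    tensorEval B P' (Algebra.TensorProduct.map Q (AlgHom.id ℂ B) x) = tensorEval B P x := by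
  induction x using TensorProduct.induction_on with
  | zero => simp
  | add a b ha hb => simp only [map_add, ha, hb]
  | tmul a b => simp [tensorEval_tmul, h]

theorem tensorEval_par (P : A →ₐ[ℂ] ℂ) (σ : B →ₐ[ℂ] B) (x : A ⊗[ℂ] B) :
    tensorEval B P (Algebra.TensorProduct.map (AlgHom.id ℂ A) σ x) = σ (tensorEval B P x) := by
  induction x using TensorProduct.induction_on with
  | zero => simp
  | add a b ha hb => simp only [map_add, ha, hb]
  | tmul a b => simp [tensorEval_tmul]

theorem repr_tensorEval {ι : Type*} [Fintype ι] (b : Module.Basis ι ℂ B) (P : A →ₐ[ℂ] ℂ)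
    (x : A ⊗[ℂ] B) (i : ι) :
    b.repr (tensorEval B P x) i = P ((Algebra.TensorProduct.basis A b).repr x i) := by
  induction x using TensorProduct.induction_on with
  | zero => simp
  | add x y hx hy => simp only [map_add, Finsupp.add_apply, hx, hy]
  | tmul a l => simp [tensorEval_tmul]

/-- The coordinates with respect to a basis of `B` lie in `A` and are separated by the characters `P
i`, which are applied coordinatewise. -/
theorem tensorEval_ext [FiniteDimensional ℂ B] {I : Type*} {P : I → A →ₐ[ℂ] ℂ}
    (hP : ∀ a b, (∀ i, P i a = P i b) → a = b) {x y : A ⊗[ℂ] B}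
    (h : ∀ i, tensorEval B (P i) x = tensorEval B (P i) y) : x = y :=
  eq_of_forall_repr_eq (Module.finBasis ℂ B) fun j => hP _ _ fun i => by
    rw [← repr_tensorEval, ← repr_tensorEval, h]

theorem tensorEval_tensorCoord (P : A →ₐ[ℂ] ℂ) (X : Module.Dual ℂ E →ₗ[ℂ] A)
    (Y : Module.Dual ℂ F →ₗ[ℂ] B) (l : Module.Dual ℂ (E × F)) : tensorEval B P (tensorCoord X Y l) =
      algebraMap ℂ B (P (X (l ∘ₗ LinearMap.inl ℂ E F))) + Y (l ∘ₗ LinearMap.inr ℂ E F) := by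
  rw [tensorCoord_apply, map_add, tensorEval_tmul, tensorEval_tmul, map_one, one_smul,
    Algebra.algebraMap_eq_smul_one]

end TensorDerivations

/-! ### Superfunctions -/

namespace MixedSuperVectorSpace

variable {V : MixedSuperVectorSpace.{u}} {U U' : Opens V.real}

/-- A partially holomorphic function as an element of the algebra `partHol`. -/
def IsPartHolOn.toPartHol {F : V.real → ℂ} (hF : IsPartHolOn F U) : V.partHol U :=
  ⟨fun x => F x, F, fun _ => rfl, hF.1, hF.2⟩

theorem exists_isPartHolOn (h : V.partHol U) :
    ∃ (F : V.real → ℂ) (hF : IsPartHolOn F U), hF.toPartHol = h := by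
  obtain ⟨F, h1, h2, h3⟩ := h.2
  exact ⟨F, ⟨h2, h3⟩, Subtype.ext (funext fun x => h1 x)⟩

@[ext]
theorem partHol_ext {h h' : V.partHol U} (H : ∀ x, h.1 x = h'.1 x) : h = h' :=
  Subtype.ext (funext H)

/-- The extension by zero of a function. -/
def extendZero (h : U → ℂ) (x : V.real) : ℂ :=
  open Classical in if hx : x ∈ U then h ⟨x, hx⟩ else 0

theorem extendZero_of_mem (h : U → ℂ) {x : V.real} (hx : x ∈ U) : extendZero h x = h ⟨x, hx⟩ :=
  dif_pos hx

theorem isPartHolOn_extendZero (h : V.partHol U) : IsPartHolOn (extendZero h.1) U := by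
  obtain ⟨F, hF, rfl⟩ := exists_isPartHolOn h
  have he : ∀ x ∈ U, extendZero hF.toPartHol.1 x = F x := fun x hx => extendZero_of_mem _ hx
  refine ⟨hF.1.congr he, fun x hx => ?_⟩
  have : extendZero hF.toPartHol.1 =ᶠ[nhds x] F := by
    filter_upwards [U.isOpen.mem_nhds hx] with y hy
    exact he y hy
  rw [this.fderiv_eq]
  exact hF.2 x hx

theorem fderiv_extendZero_res (h : V.partHol U) (hU : U' ≤ U) {x : V.real} (hx : x ∈ U') :
    fderiv ℝ (extendZero (V.partHolRes hU h).1) x = fderiv ℝ (extendZero h.1) x := by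
  apply Filter.EventuallyEq.fderiv_eq
  filter_upwards [U'.isOpen.mem_nhds hx] with y hy
  rw [extendZero_of_mem _ hy, extendZero_of_mem _ (hU hy)]
  rfl

theorem fderiv_extendZero_add (h h' : V.partHol U) (x : U) :
    fderiv ℝ (extendZero (h + h').1) x =
      fderiv ℝ (extendZero h.1) x + fderiv ℝ (extendZero h'.1) x := by
  have dh := (isPartHolOn_extendZero h).differentiableAt U.isOpen x.2
  have dh' := (isPartHolOn_extendZero h').differentiableAt U.isOpen x.2
  rw [← fderiv_add dh dh']
  apply Filter.EventuallyEq.fderiv_eq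
  filter_upwards [U.isOpen.mem_nhds x.2] with y hy
  simp only [Pi.add_apply, extendZero_of_mem _ hy]
  rfl

theorem fderiv_extendZero_mul (h h' : V.partHol U) (x : U) :
    fderiv ℝ (extendZero (h * h').1) x =
      h.1 x • fderiv ℝ (extendZero h'.1) x + h'.1 x • fderiv ℝ (extendZero h.1) x := by
  have dh := (isPartHolOn_extendZero h).differentiableAt U.isOpen x.2
  have dh' := (isPartHolOn_extendZero h').differentiableAt U.isOpen x.2
  have h1 := fderiv_mul dh dh'
  rw [extendZero_of_mem _ x.2, extendZero_of_mem _ x.2] at h1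
  rw [← h1]
  apply Filter.EventuallyEq.fderiv_eq
  filter_upwards [U.isOpen.mem_nhds x.2] with y hy
  simp only [Pi.mul_apply, extendZero_of_mem _ hy]
  rfl

theorem fderiv_extendZero_smul (c : ℂ) (h : V.partHol U) (x : U) :
    fderiv ℝ (extendZero (c • h).1) x = c • fderiv ℝ (extendZero h.1) x := by
  have dh := (isPartHolOn_extendZero h).differentiableAt U.isOpen x.2
  rw [← fderiv_const_smul dh c]
  apply Filter.EventuallyEq.fderiv_eq
  filter_upwards [U.isOpen.mem_nhds x.2] with y hy
  simp only [Pi.smul_apply, extendZero_of_mem _ hy]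
  rfl

/-- The partial derivatives of partially holomorphic functions. -/
def partHolPartial (U : Opens V.real) (i : Fin (Module.finrank ℂ V.even)) :
    V.partHol U →ₗ[ℂ] V.partHol U where
  toFun h := ((isPartHolOn_extendZero h).fderiv_apply U.isOpen (V.realVec i)).toPartHol
  map_add' h h' := partHol_ext fun x => by
    exact DFunLike.congr_fun (fderiv_extendZero_add h h' x) _
  map_smul' c h := partHol_ext fun x => by
    exact DFunLike.congr_fun (fderiv_extendZero_smul c h x) _

theorem partHolPartial_apply (i : Fin (Module.finrank ℂ V.even)) (h : V.partHol U) (x : U) :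
    (partHolPartial U i h).1 x = fderiv ℝ (extendZero h.1) x (V.realVec i) := rfl

theorem partHolPartial_mul (i : Fin (Module.finrank ℂ V.even)) (h h' : V.partHol U) :
    partHolPartial U i (h * h') = partHolPartial U i h * h' + h * partHolPartial U i h' := by
  refine partHol_ext fun x => ?_
  rw [partHolPartial_apply, fderiv_extendZero_mul]
  change h.1 x * _ + h'.1 x * _ = _ * h'.1 x + h.1 x * _
  rw [mul_comm (h'.1 x), add_comm]
  rfl

theorem partHolPartial_res (i : Fin (Module.finrank ℂ V.even)) (hU : U' ≤ U) (h : V.partHol U) :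
    partHolPartial U' i (V.partHolRes hU h) = V.partHolRes hU (partHolPartial U i h) :=
  partHol_ext fun x => by
    rw [partHolPartial_apply, fderiv_extendZero_res h hU x.2]
    rfl

/-- The derivative of partially holomorphic functions along a vector. -/
def partHolDeriv (U : Opens V.real) : V.even →ₗ[ℂ] V.partHol U →ₗ[ℂ] V.partHol U :=
  V.realBasis.constr ℂ (partHolPartial U)

theorem partHolDeriv_eq (v : V.even) (h : V.partHol U) :
    partHolDeriv U v h = ∑ i, V.realBasis.repr v i • partHolPartial U i h := by
  rw [partHolDeriv, Module.Basis.constr_apply_fintype, LinearMap.sum_apply]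
  rfl

theorem partHolDeriv_mul (v : V.even) (h h' : V.partHol U) :
    partHolDeriv U v (h * h') = partHolDeriv U v h * h' + h * partHolDeriv U v h' := by
  simp only [partHolDeriv_eq, partHolPartial_mul, smul_add, Finset.sum_add_distrib,
    Finset.sum_mul, Finset.mul_sum, smul_mul_assoc, mul_smul_comm]

theorem partHolDeriv_res (v : V.even) (hU : U' ≤ U) (h : V.partHol U) :
    partHolDeriv U' v (V.partHolRes hU h) = V.partHolRes hU (partHolDeriv U v h) := by
  simp only [partHolDeriv_eq, partHolPartial_res, map_sum, map_smul]

/-- The restrictions of complex linear forms are partially holomorphic. -/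
theorem isPartHolOn_linear (l : Module.Dual ℂ V.even) (U : Set V.real) :
    IsPartHolOn (fun x => l x) U ∧ ∀ x v, fderiv ℝ (fun x : V.real => l x) x v = l v := by
  let L : V.real →L[ℝ] ℂ := LinearMap.toContinuousLinearMap (l.restrictScalars ℝ ∘ₗ V.real.subtype)
  have hL : ∀ x v, fderiv ℝ (fun x : V.real => l x) x v = l v := fun x v =>
    DFunLike.congr_fun (L.fderiv (x := x)) v
  refine ⟨⟨L.contDiff.contDiffOn, fun x _ v w _ hw => ?_⟩, hL⟩
  rw [hL, hL, hw, map_smul, smul_eq_mul]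

/-- The partially holomorphic function defined by a linear form. -/
def partHolLin (U : Opens V.real) : Module.Dual ℂ V.even →ₗ[ℂ] V.partHol U where
  toFun l := (isPartHolOn_linear l U).1.toPartHol
  map_add' _ _ := rfl
  map_smul' _ _ := rfl

theorem partHolLin_res (hU : U' ≤ U) (l : Module.Dual ℂ V.even) :
    V.partHolRes hU (partHolLin U l) = partHolLin U' l := rfl

theorem partHolDeriv_partHolLin (v : V.even) (l : Module.Dual ℂ V.even) :
    partHolDeriv U v (partHolLin U l) = algebraMap ℂ _ (l v) := by
  have h1 : ∀ i, partHolPartial U i (partHolLin U l) = algebraMap ℂ _ (l (V.realBasis i)) := by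
    refine fun i => partHol_ext fun x => ?_
    rw [partHolPartial_apply]
    have h2 : extendZero (partHolLin U l).1 =ᶠ[nhds (x : V.real)] fun x => l x := by
      filter_upwards [U.isOpen.mem_nhds x.2] with y hy
      rw [extendZero_of_mem _ hy]
      rfl
    rw [h2.fderiv_eq, (isPartHolOn_linear l U).2]
    rfl
  rw [partHolDeriv_eq]
  conv_rhs => rw [← V.realBasis.sum_repr v]
  simp only [h1, map_sum, map_smul, Algebra.algebraMap_eq_smul_one, smul_assoc]

end MixedSuperVectorSpace

namespace MixedSuperVectorSpace

variable {V : MixedSuperVectorSpace.{u}} {U U' : Opens V.real}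

variable (V) in
/-- The exterior algebra of the dual of `V₁`. -/
abbrev oddFun : Type u := ExteriorAlgebra ℂ (Module.Dual ℂ V.odd)

/-! ### Derivations and values of superfunctions -/

theorem partHolDeriv_one (v : V.even) : partHolDeriv U v 1 = 0 := by
  have := partHolDeriv_mul v (1 : V.partHol U) 1
  rw [mul_one, one_mul, mul_one] at this
  exact left_eq_add.1 this

variable (V) in
/-- The odd derivations of the exterior algebra of the dual of `V₁`. -/
def oddDeriv : V.odd →ₗ[ℂ] ExteriorAlgebra ℂ (Module.Dual ℂ V.odd) →ₗ[ℂ]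
    ExteriorAlgebra ℂ (Module.Dual ℂ V.odd) :=
  contract ∘ₗ Module.Dual.eval ℂ V.odd

/-- The constant vector fields on the model space. -/
def superFunDeriv (U : Opens V.real) : V.Total →ₗ[ℂ] V.superFun U →ₗ[ℂ] V.superFun U :=
  tensorDeriv (partHolDeriv U) V.oddDeriv

theorem superFunDeriv_res (v : V.Total) (hU : U' ≤ U) (a : V.superFun U) :
    superFunDeriv U' v (V.superFunRes hU a) = V.superFunRes hU (superFunDeriv U v a) :=
  tensorDeriv_natural (A := V.partHol U) (A' := V.partHol U') (B := V.oddFun)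
    (D := partHolDeriv U) (C := partHolDeriv U') V.oddDeriv (P := V.partHolRes hU)
    (fun e a => partHolDeriv_res e hU a) v a

theorem superFunPar_deriv {p : ZMod 2} {v : V.Total} (hv : IsHomogeneous p v)
    (a : V.superFun U) : V.superFunPar U (superFunDeriv U v a) =
      sgn p • superFunDeriv U v (V.superFunPar U a) :=
  tensorDeriv_par (A := V.partHol U) (B := V.oddFun) (partHolDeriv U) (D' := V.oddDeriv)
    (σ := extPar (Module.Dual ℂ V.odd))
    (fun e a => extPar_contract (Module.Dual.eval ℂ V.odd e) a) hv a

/-- The coordinate functions of the model space. -/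
def coordFun (U : Opens V.real) : Module.Dual ℂ V.Total →ₗ[ℂ] V.superFun U :=
  tensorCoord (partHolLin U) (ExteriorAlgebra.ι ℂ)

theorem coordFun_res (hU : U' ≤ U) (l : Module.Dual ℂ V.Total) :
    V.superFunRes hU (coordFun U l) = coordFun U' l :=
  tensorCoord_natural (A := V.partHol U) (A' := V.partHol U') (B := V.oddFun)
    (X := partHolLin U) (X' := partHolLin U') (ExteriorAlgebra.ι ℂ) (P := V.partHolRes hU)
    (partHolLin_res hU) l

theorem coordFun_par (l : Module.Dual ℂ V.Total) :
    V.superFunPar U (coordFun U l) = coordFun U (l ∘ₗ vparity V.even V.odd) :=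
  tensorCoord_par (A := V.partHol U) (B := V.oddFun) (partHolLin U) (Y := ExteriorAlgebra.ι ℂ)
    (σ := extPar (Module.Dual ℂ V.odd)) (fun l => CliffordAlgebra.involute_ι l) l

theorem superFunDeriv_coordFun (v : V.Total) (l : Module.Dual ℂ V.Total) :
    superFunDeriv U v (coordFun U l) = algebraMap ℂ _ (l v) :=
  tensorDeriv_tensorCoord (A := V.partHol U) (B := V.oddFun) (D := partHolDeriv U)
    (D' := V.oddDeriv) (X := partHolLin U) (Y := ExteriorAlgebra.ι ℂ)
    (partHolDeriv_one (V := V) (U := U))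
    (fun e => contract_one (Module.Dual.eval ℂ V.odd e)) (partHolDeriv_partHolLin (V := V) (U := U))
    (fun e l => contract_ι (Module.Dual.eval ℂ V.odd e) l) v l

/-- Evaluation of partially holomorphic functions. -/
def partHolEval (x : U) : V.partHol U →ₐ[ℂ] ℂ :=
  (Pi.evalAlgHom ℂ (fun _ : U => ℂ) x).comp (V.partHol U).val

/-- Evaluation of superfunctions at a point. -/
def superFunEval (x : U) : V.superFun U →ₐ[ℂ] ExteriorAlgebra ℂ (Module.Dual ℂ V.odd) :=
  tensorEval (A := V.partHol U) V.oddFun (partHolEval x)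

theorem superFunEval_tmul (x : U) (h : V.partHol U)
    (l : ExteriorAlgebra ℂ (Module.Dual ℂ V.odd)) :
    superFunEval x (h ⊗ₜ l) = h.1 x • l := 
  tensorEval_tmul (A := V.partHol U) (B := V.oddFun) (partHolEval x) h l

theorem superFunEval_res (hU : U' ≤ U) (x : U') (a : V.superFun U) :
    superFunEval x (V.superFunRes hU a) = superFunEval ⟨x.1, hU x.2⟩ a :=
  tensorEval_natural (A := V.partHol U) (A' := V.partHol U') (B := V.oddFun)
    (P := partHolEval ⟨x.1, hU x.2⟩) (P' := partHolEval x) (Q := V.partHolRes hU)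
    (fun _ => rfl) a

theorem superFunEval_par (x : U) (a : V.superFun U) : superFunEval x (V.superFunPar U a) =
    extPar _ (superFunEval x a) :=
  tensorEval_par (A := V.partHol U) (B := V.oddFun) (partHolEval x) (extPar _) a

theorem superFun_ext {a b : V.superFun U} (h : ∀ x, superFunEval x a = superFunEval x b) :
    a = b :=
  tensorEval_ext (A := V.partHol U) (B := V.oddFun) (P := partHolEval)
    (fun _ _ h => partHol_ext h) h

/-- The values of superfunctions modulo nilpotents. -/
def superFunBody (x : U) : V.superFun U →ₐ[ℂ] ℂ :=
  ExteriorAlgebra.algebraMapInv.comp (superFunEval x)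

theorem superFunBody_coordFun (x : U) (l : Module.Dual ℂ V.Total) :
    superFunBody x (coordFun U l) = l ((x : V.real), 0) := by
  have h := tensorEval_tensorCoord (A := V.partHol U) (B := V.oddFun) (partHolEval x)
    (partHolLin U) (ExteriorAlgebra.ι ℂ (M := Module.Dual ℂ V.odd)) l
  refine (congrArg ExteriorAlgebra.algebraMapInv h).trans ?_
  rw [map_add, algebraMapInv_ι, add_zero, AlgHom.commutes]
  rfl

end MixedSuperVectorSpace

/-! ### Units and Hadamard expansions in a tensor product -/

section TensorBody

variable {A B : Type*} [Ring A] [Algebra ℂ A] [Ring B] [Algebra ℂ B]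

/-- The body map of a tensor product with an augmented algebra. -/
def tensorBody (A : Type*) [Ring A] [Algebra ℂ A] (ε : B →ₐ[ℂ] ℂ) : A ⊗[ℂ] B →ₐ[ℂ] A :=
  (Algebra.TensorProduct.rid ℂ ℂ A).toAlgHom.comp (Algebra.TensorProduct.map (AlgHom.id ℂ A) ε)

theorem apply_tensorBody (ε : B →ₐ[ℂ] ℂ) (P : A →ₐ[ℂ] ℂ) (x : A ⊗[ℂ] B) :
    P (tensorBody A ε x) = ε (tensorEval B P x) := by
  induction x using TensorProduct.induction_on with
  | zero => simp
  | add x y hx hy => simp only [map_add, hx, hy]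
  | tmul a b => simp [tensorBody, tensorEval_tmul, mul_comm]

/-- The difference of `x` and its body `h ⊗ 1` is nilpotent, since its values lie in the nilpotent
ideal `ker ε`. A unit plus a commuting nilpotent is a unit. -/
theorem isUnit_of_tensorBody [FiniteDimensional ℂ B] {ε : B →ₐ[ℂ] ℂ} {I : Type*}
    {P : I → A →ₐ[ℂ] ℂ} (hP : ∀ a b, (∀ i, P i a = P i b) → a = b) {n : ℕ}
    (hε : LinearMap.ker ε.toLinearMap ^ n = ⊥) {x : A ⊗[ℂ] B}
    (hcomm : ∀ a : A, tensorBody A ε x * a = a * tensorBody A ε x)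
    (hx : IsUnit (tensorBody A ε x)) : IsUnit x := by
  set h := tensorBody A ε x
  have hu : IsUnit (h ⊗ₜ[ℂ] (1 : B)) := hx.map (Algebra.TensorProduct.includeLeft (S := ℂ))
  have hker : ∀ i, tensorEval B (P i) (x - h ⊗ₜ 1) ∈ LinearMap.ker ε.toLinearMap := fun i => by
    rw [LinearMap.mem_ker, AlgHom.toLinearMap_apply, map_sub, map_sub, ← apply_tensorBody,
      tensorEval_tmul, map_smul, map_one, smul_eq_mul, mul_one, sub_self]
  have hn : IsNilpotent (x - h ⊗ₜ[ℂ] (1 : B)) := ⟨n, tensorEval_ext hP fun i => by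
    have h2 := Submodule.pow_mem_pow _ (hker i) n
    rw [hε, Submodule.mem_bot] at h2
    rw [map_pow, h2, map_zero]⟩
  have hc : Commute (x - h ⊗ₜ[ℂ] (1 : B)) (h ⊗ₜ[ℂ] (1 : B)) := by
    refine Commute.sub_left ?_ (Commute.refl _)
    change x * _ = _ * x
    generalize x = y
    induction y using TensorProduct.induction_on with
    | zero => simp
    | add y z hy hz => rw [add_mul, mul_add, hy, hz]
    | tmul a b => simp only [Algebra.TensorProduct.tmul_mul_tmul, hcomm, mul_one, one_mul]
  have := hn.isUnit_add_left_of_commute hu hc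
  rwa [add_sub_cancel] at this

theorem tensorCoord_fst {E F : Type u} [AddCommGroup E] [Module ℂ E]
    [AddCommGroup F] [Module ℂ F] (X : Module.Dual ℂ E →ₗ[ℂ] A) (Y : Module.Dual ℂ F →ₗ[ℂ] B)
    (l : Module.Dual ℂ E) : tensorCoord X Y (l ∘ₗ LinearMap.fst ℂ E F) = X l ⊗ₜ 1 := by
  rw [tensorCoord_apply, LinearMap.comp_assoc, LinearMap.comp_assoc, LinearMap.fst_comp_inl,
    LinearMap.fst_comp_inr, LinearMap.comp_zero, map_zero, TensorProduct.tmul_zero, add_zero,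
    LinearMap.comp_id]

theorem tensorCoord_snd {E F : Type u} [AddCommGroup E] [Module ℂ E]
    [AddCommGroup F] [Module ℂ F] (X : Module.Dual ℂ E →ₗ[ℂ] A) (Y : Module.Dual ℂ F →ₗ[ℂ] B)
    (l : Module.Dual ℂ F) : tensorCoord X Y (l ∘ₗ LinearMap.snd ℂ E F) = 1 ⊗ₜ Y l := by
  rw [tensorCoord_apply, LinearMap.comp_assoc, LinearMap.comp_assoc, LinearMap.snd_comp_inl,
    LinearMap.snd_comp_inr, LinearMap.comp_zero, map_zero, TensorProduct.zero_tmul, zero_add,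
    LinearMap.comp_id]

/-- The span of `1` and of the multiples of `x_l - l(q)` for homogeneous `l`. -/
def hadamardSpan {E F : Type u} [AddCommGroup E] [Module ℂ E] [AddCommGroup F] [Module ℂ F]
    {R : Type*} [Ring R] [Algebra ℂ R] (x : Module.Dual ℂ (E × F) →ₗ[ℂ] R) (q : E) :
    Submodule ℂ R :=
  Submodule.span ℂ ({1} ∪ {z | ∃ (p : ZMod 2) (l : Module.Dual ℂ (E × F)) (b : R),
    l ∘ₗ vparity E F = sgn p • l ∧ z = (x l - algebraMap ℂ R (l (q, 0))) * b})

theorem one_mem_hadamardSpan {E F : Type u} [AddCommGroup E] [Module ℂ E] [AddCommGroup F]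
    [Module ℂ F] {R : Type*} [Ring R] [Algebra ℂ R] (x : Module.Dual ℂ (E × F) →ₗ[ℂ] R) (q : E) :
    1 ∈ hadamardSpan x q := Submodule.subset_span (Or.inl rfl)

theorem mul_mem_hadamardSpan {E F : Type u} [AddCommGroup E] [Module ℂ E] [AddCommGroup F]
    [Module ℂ F] {R : Type*} [Ring R] [Algebra ℂ R] (x : Module.Dual ℂ (E × F) →ₗ[ℂ] R) (q : E)
    {p : ZMod 2} {l : Module.Dual ℂ (E × F)} (hl : l ∘ₗ vparity E F = sgn p • l) (b : R) :
    (x l - algebraMap ℂ R (l (q, 0))) * b ∈ hadamardSpan x q :=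
  Submodule.subset_span (Or.inr ⟨p, l, b, hl, rfl⟩)

theorem fst_comp_vparity {E F : Type u} [AddCommGroup E] [Module ℂ E] [AddCommGroup F]
    [Module ℂ F] (l : Module.Dual ℂ E) : (l ∘ₗ LinearMap.fst ℂ E F) ∘ₗ vparity E F =
      sgn 0 • (l ∘ₗ LinearMap.fst ℂ E F) := by
  refine LinearMap.ext fun v => ?_
  simp [sgn_zero, vparity]

theorem snd_comp_vparity {E F : Type u} [AddCommGroup E] [Module ℂ E] [AddCommGroup F]
    [Module ℂ F] (l : Module.Dual ℂ F) : (l ∘ₗ LinearMap.snd ℂ E F) ∘ₗ vparity E F =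
      sgn 1 • (l ∘ₗ LinearMap.snd ℂ E F) := by
  refine LinearMap.ext fun v => ?_
  simp [sgn_one, vparity]

/-- In `a ⊗ m`, expand `a` at `q`: the non-constant terms are multiples of even coordinates minus
their values. A constant times `m` is a scalar plus terms that begin with an odd generator, which is
an odd coordinate and has value zero at `(q, 0)`. -/
theorem mem_hadamardSpan_of_left {E F : Type u} [AddCommGroup E] [Module ℂ E]
    [AddCommGroup F] [Module ℂ F] {X : Module.Dual ℂ E →ₗ[ℂ] A} {q : E}
    (hX : ∀ a : A, ∃ (ι : Type) (_ : Fintype ι) (c : ℂ) (l : ι → Module.Dual ℂ E) (b : ι → A),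
      a = algebraMap ℂ A c + ∑ i, (X (l i) - algebraMap ℂ A (l i q)) * b i)
    (x : A ⊗[ℂ] ExteriorAlgebra ℂ (Module.Dual ℂ F)) :
    x ∈ hadamardSpan (tensorCoord X (ExteriorAlgebra.ι ℂ (M := Module.Dual ℂ F))) q := by
  induction x using TensorProduct.induction_on with
  | zero => exact zero_mem _
  | add x y hx hy => exact add_mem hx hy
  | tmul a m =>
    obtain ⟨ι, _, c, l, b, rfl⟩ := hX a
    rw [TensorProduct.add_tmul, TensorProduct.sum_tmul]
    refine add_mem ?_ (Submodule.sum_mem _ fun i _ => ?_)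
    · rw [Algebra.algebraMap_eq_smul_one, ← TensorProduct.smul_tmul']
      refine Submodule.smul_mem _ _ ?_
      induction m using CliffordAlgebra.left_induction with
      | algebraMap r =>
        have h := one_mem_hadamardSpan
          (tensorCoord X (ExteriorAlgebra.ι ℂ (M := Module.Dual ℂ F))) q
        rw [Algebra.algebraMap_eq_smul_one, TensorProduct.tmul_smul]
        exact Submodule.smul_mem _ _ h
      | add m m' hm hm' => rw [TensorProduct.tmul_add]; exact add_mem hm hm'
      | ι_mul m f hm =>
        have h := mul_mem_hadamardSpan
          (tensorCoord X (ExteriorAlgebra.ι ℂ (M := Module.Dual ℂ F))) q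
          (snd_comp_vparity (E := E) f) ((1 : A) ⊗ₜ m)
        rw [tensorCoord_snd, LinearMap.comp_apply, LinearMap.snd_apply, map_zero, map_zero,
          sub_zero, Algebra.TensorProduct.tmul_mul_tmul, one_mul] at h
        exact h
    · have h := mul_mem_hadamardSpan
        (tensorCoord X (ExteriorAlgebra.ι ℂ (M := Module.Dual ℂ F))) q
        (fst_comp_vparity (F := F) (l i)) (b i ⊗ₜ m)
      have h2 : (X (l i) ⊗ₜ[ℂ] (1 : ExteriorAlgebra ℂ (Module.Dual ℂ F)) -
          algebraMap ℂ (A ⊗[ℂ] ExteriorAlgebra ℂ (Module.Dual ℂ F)) (l i q)) * b i ⊗ₜ m =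
          ((X (l i) - algebraMap ℂ A (l i q)) * b i) ⊗ₜ m := by
        rw [Algebra.TensorProduct.algebraMap_apply, ← TensorProduct.sub_tmul,
          Algebra.TensorProduct.tmul_mul_tmul, one_mul]
      rw [tensorCoord_fst, LinearMap.comp_apply, LinearMap.fst_apply, h2] at h
      exact h

end TensorBody

namespace MixedSuperVectorSpace

variable {V : MixedSuperVectorSpace.{u}} {U U' : Opens V.real}

theorem superFun_hadamard {q : V.real} (hq : StarConvex ℝ q (U : Set V.real))
    (a : V.superFun U) : a ∈ hadamardSpan (coordFun U) (q : V.even) := by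
  refine mem_hadamardSpan_of_left (A := V.partHol U) (F := V.odd) (X := partHolLin U)
    (fun h => ?_) a
  obtain ⟨F, hF, rfl⟩ := exists_isPartHolOn h
  obtain ⟨G, hG, hFG⟩ := hF.hadamard U.isOpen hq
  refine ⟨Fin (Module.finrank ℂ V.even), inferInstance, F q, fun i => V.realBasis.coord i,
    fun i => (hG i).toPartHol, partHol_ext fun x => ?_⟩
  refine (hFG x x.2).trans ?_
  have h1 := map_sum (partHolEval x) (fun i => (partHolLin U (V.realBasis.coord i) -
    algebraMap ℂ _ (V.realBasis.coord i q)) * (hG i).toPartHol) Finset.univ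
  refine congrArg (F q + ·) (Eq.trans ?_ h1.symm)
  refine Finset.sum_congr rfl fun i _ => ?_
  rw [map_mul, map_sub, AlgHom.commutes]
  rfl

/-- The body is a continuous function that does not vanish at `x`. It is invertible on a smaller
neighbourhood, and the superfunction differs from it by nilpotents. So the model spaces are locally
ringed, with residue fields `ℂ`. -/
theorem exists_superFun_isUnit (x : U) {a : V.superFun U} (ha : superFunBody x a ≠ 0) :
    ∃ (U' : Opens V.real) (hU : U' ≤ U), x.1 ∈ U' ∧ IsUnit (V.superFunRes hU a) := by
  obtain ⟨n, hn⟩ := exists_augIdeal_pow_eq_bot (E := Module.Dual ℂ V.odd)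
  let β := fun U : Opens V.real => tensorBody (B := V.oddFun) (V.partHol U)
    ExteriorAlgebra.algebraMapInv
  have hβ : ∀ (U : Opens V.real) (y : U) (a : V.superFun U), (β U a).1 y = superFunBody y a :=
    fun U y a => apply_tensorBody (B := V.oddFun) _ (partHolEval y) a
  obtain ⟨F, hF, hFa⟩ := exists_isPartHolOn (β U a)
  have hFa' : ∀ y : U, F y = superFunBody y a := fun y => by
    rw [← hβ, ← hFa]
    rfl
  let U' : Opens V.real := ⟨U ∩ F ⁻¹' {0}ᶜ,
    hF.1.continuousOn.isOpen_inter_preimage U.isOpen isOpen_compl_singleton⟩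
  have hU : U' ≤ U := fun _ hy => hy.1
  refine ⟨U', hU, ⟨x.2, fun h => ha ((hFa' x).symm.trans h)⟩, ?_⟩
  -- The derivative of `1/F` is `-F⁻² dF`, which is complex linear where `dF` is.
  have hG : IsPartHolOn (fun y => (F y)⁻¹) U' := by
    refine ⟨(hF.1.mono hU).inv fun y hy => hy.2, fun y hy v w hv hw => ?_⟩
    have hd := hF.differentiableAt U.isOpen hy.1
    have h1 : HasFDerivAt (fun y => (F y)⁻¹) _ y :=
      (hasFDerivAt_inv' (𝕜 := ℝ) hy.2).comp y hd.hasFDerivAt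
    rw [h1.fderiv]
    have h2 := hF.2 y hy.1 v w hv hw
    simp only [ContinuousLinearMap.comp_apply, neg_apply, ContinuousLinearMap.mulLeftRight_apply,
      h2]
    ring
  refine isUnit_of_tensorBody (A := V.partHol U') (B := V.oddFun) (P := partHolEval)
    (ε := ExteriorAlgebra.algebraMapInv) (fun _ _ h => partHol_ext h) hn (fun b => mul_comm _ b)
    (IsUnit.of_mul_eq_one hG.toPartHol (partHol_ext fun y => ?_))
  have h3 : (β U' (V.superFunRes hU a)).1 y = F y := by
    rw [hβ, hFa' ⟨y.1, hU y.2⟩]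
    exact congrArg ExteriorAlgebra.algebraMapInv (superFunEval_res hU y a)
  change (β U' (V.superFunRes hU a)).1 y * (F y)⁻¹ = 1
  rw [h3, mul_inv_cancel₀ y.2.2]

end MixedSuperVectorSpace

/-! ### Charts -/

/-- An isomorphism of the open subspace `dom` of `X` with an open subspace of `𝔸(V_ℝ)`. -/
structure Chart (X : SuperSpace.{u}) (V : MixedSuperVectorSpace.{u}) where
  dom : Opens X
  pt : X → V.real
  im : Opens X → Opens V.real
  mem_im : ∀ U ≤ dom, ∀ y, y ∈ im U ↔ ∃ x ∈ U, pt x = y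
  injOn : Set.InjOn pt dom
  exists_im : ∀ U ≤ dom, ∀ B ≤ im U, ∃ U' ≤ U, im U' = B
  κ : ∀ U ≤ dom, X.O U ≃ₐ[ℂ] V.superFun (im U)
  κ_res : ∀ (U U' : Opens X) (hU : U ≤ dom) (h : U' ≤ U) (hi : im U' ≤ im U) (a : X.O U),
    κ U' (h.trans hU) (X.res h a) = V.superFunRes hi (κ U hU a)
  κ_par : ∀ (U : Opens X) (hU : U ≤ dom) (a : X.O U),
    κ U hU (X.par U a) = V.superFunPar (im U) (κ U hU a)

theorem SuperSpace.Hom.IsOpenImmersion.bijective_pull {X Y : SuperSpace.{u}} {f : Hom X Y}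
    (hf : f.IsOpenImmersion) {W : Opens Y} {U : Opens X} (h : Set.MapsTo f.base U W)
    (hU : f.pre W ≤ U) (hW : (W : Set Y) ⊆ Set.range f.base) :
    Function.Bijective (f.pull W U h) := by
  obtain rfl : U = f.pre W := le_antisymm h hU
  exact hf.bijective W hW

namespace Chart

variable {X : SuperSpace.{u}} {V : MixedSuperVectorSpace.{u}}

theorem mem_im_pt (C : Chart X V) {U : Opens X} (hU : U ≤ C.dom) {x : X} (hx : x ∈ U) :
    C.pt x ∈ C.im U := (C.mem_im U hU _).2 ⟨x, hx, rfl⟩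

theorem mem_of_pt_mem (C : Chart X V) {U : Opens X} (hU : U ≤ C.dom) {x : X} (hx : x ∈ C.dom)
    (h : C.pt x ∈ C.im U) : x ∈ U := by
  obtain ⟨y, hy, hxy⟩ := (C.mem_im U hU _).1 h
  rwa [← C.injOn (hU hy) hx hxy]

theorem im_mono (C : Chart X V) {U U' : Opens X} (hU : U ≤ C.dom) (h : U' ≤ U) :
    C.im U' ≤ C.im U := fun y hy => by
  obtain ⟨x, hx, rfl⟩ := (C.mem_im U' (h.trans hU) y).1 hy
  exact C.mem_im_pt hU (h hx)

/-- The value at a point of the domain. -/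
def ev (C : Chart X V) {U : Opens X} {x : X} (hx : x ∈ U) (hx' : x ∈ C.dom) :
    X.O U →ₐ[ℂ] V.oddFun :=
  (MixedSuperVectorSpace.superFunEval ⟨C.pt x, C.mem_im_pt (inf_le_right : U ⊓ C.dom ≤ C.dom)
    ⟨hx, hx'⟩⟩).comp
    ((C.κ (U ⊓ C.dom) inf_le_right).toAlgHom.comp (X.res (inf_le_left : U ⊓ C.dom ≤ U)))

theorem ev_eq (C : Chart X V) {U : Opens X} (hU : U ≤ C.dom) {x : X} (hx : x ∈ U)
    (hx' : x ∈ C.dom) (a : X.O U) : C.ev hx hx' a =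
      MixedSuperVectorSpace.superFunEval ⟨C.pt x, C.mem_im_pt hU hx⟩ (C.κ U hU a) := by
  have h := C.κ_res U (U ⊓ C.dom) hU inf_le_left (C.im_mono hU inf_le_left) a
  refine (congrArg (MixedSuperVectorSpace.superFunEval _) h).trans ?_
  exact MixedSuperVectorSpace.superFunEval_res _ _ _

theorem ev_res (C : Chart X V) {U U' : Opens X} (h : U' ≤ U) {x : X} (hx : x ∈ U')
    (hx' : x ∈ C.dom) (a : X.O U) : C.ev hx hx' (X.res h a) = C.ev (h hx) hx' a := by
  have hd : U' ⊓ C.dom ≤ U ⊓ C.dom := inf_le_inf_right _ h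
  have h1 := C.κ_res (U ⊓ C.dom) (U' ⊓ C.dom) inf_le_right hd (C.im_mono inf_le_right hd)
    (X.res inf_le_left a)
  rw [X.res_res] at h1
  change MixedSuperVectorSpace.superFunEval _ (C.κ (U' ⊓ C.dom) inf_le_right
    (X.res (inf_le_left : U' ⊓ C.dom ≤ U') (X.res h a))) = _
  rw [X.res_res]
  refine (congrArg _ h1).trans ?_
  exact MixedSuperVectorSpace.superFunEval_res _ _ _

theorem ev_par (C : Chart X V) {U : Opens X} {x : X} (hx : x ∈ U) (hx' : x ∈ C.dom) (a : X.O U) :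
    C.ev hx hx' (X.par U a) = extPar _ (C.ev hx hx' a) := by
  change MixedSuperVectorSpace.superFunEval _ (C.κ (U ⊓ C.dom) inf_le_right
    (X.res (inf_le_left : U ⊓ C.dom ≤ U) (X.par U a))) = _
  rw [← X.par_res, C.κ_par]
  exact MixedSuperVectorSpace.superFunEval_par _ _

theorem eq_of_ev (C : Chart X V) {U : Opens X} (hU : U ≤ C.dom) {a b : X.O U}
    (h : ∀ (x : X) (hx : x ∈ U), C.ev hx (hU hx) a = C.ev hx (hU hx) b) : a = b := by
  apply (C.κ U hU).injective
  refine MixedSuperVectorSpace.superFun_ext fun y => ?_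
  obtain ⟨y, hy⟩ := y
  obtain ⟨x, hx, rfl⟩ := (C.mem_im U hU y).1 hy
  have := h x hx
  rwa [C.ev_eq hU, C.ev_eq hU] at this

/-- The value of a function at a point modulo nilpotents. -/
def body (C : Chart X V) {U : Opens X} {x : X} (hx : x ∈ U) (hx' : x ∈ C.dom) :
    X.O U →ₐ[ℂ] ℂ := ExteriorAlgebra.algebraMapInv.comp (C.ev hx hx')

theorem body_res (C : Chart X V) {U U' : Opens X} (h : U' ≤ U) {x : X} (hx : x ∈ U')
    (hx' : x ∈ C.dom) (a : X.O U) : C.body hx hx' (X.res h a) = C.body (h hx) hx' a :=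
  congrArg _ (C.ev_res h hx hx' a)

/-- Small open sets around a point of the domain. -/
theorem exists_ball (C : Chart X V) {U : Opens X} {x : X} (hx : x ∈ U) (hx' : x ∈ C.dom) :
    ∃ Q ≤ U, Q ≤ C.dom ∧ x ∈ Q ∧ StarConvex ℝ (C.pt x) (C.im Q : Set V.real) := by
  obtain ⟨r, hr, hB⟩ := Metric.isOpen_iff.1 (C.im (U ⊓ C.dom)).isOpen (C.pt x)
    (C.mem_im_pt inf_le_right ⟨hx, hx'⟩)
  obtain ⟨Q, hQ, hQB⟩ := C.exists_im (U ⊓ C.dom) inf_le_right ⟨Metric.ball (C.pt x) r,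
    Metric.isOpen_ball⟩ hB
  refine ⟨Q, hQ.trans inf_le_left, hQ.trans inf_le_right,
    C.mem_of_pt_mem (hQ.trans inf_le_right) hx' ?_, ?_⟩
  · rw [hQB]
    exact Metric.mem_ball_self hr
  · rw [hQB]
    exact (convex_ball _ _).starConvex (Metric.mem_ball_self hr)

theorem exists_isUnit (C : Chart X V) {U : Opens X} {x : X} (hx : x ∈ U) (hx' : x ∈ C.dom)
    {a : X.O U} (ha : C.body hx hx' a ≠ 0) :
    ∃ (U' : Opens X) (h : U' ≤ U), x ∈ U' ∧ IsUnit (X.res h a) := by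
  have hd : U ⊓ C.dom ≤ C.dom := inf_le_right
  obtain ⟨B, hB, hxB, hu⟩ := MixedSuperVectorSpace.exists_superFun_isUnit
    (a := C.κ _ hd (X.res (inf_le_left : U ⊓ C.dom ≤ U) a))
    ⟨C.pt x, C.mem_im_pt hd ⟨hx, hx'⟩⟩ ha
  obtain ⟨Q, hQ, rfl⟩ := C.exists_im _ hd B hB
  refine ⟨Q, hQ.trans inf_le_left, C.mem_of_pt_mem (hQ.trans hd) hx' hxB, ?_⟩
  rw [← C.κ_res _ Q hd hQ hB, X.res_res] at hu
  have h2 := hu.map (C.κ Q (hQ.trans hd)).symm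
  rwa [AlgEquiv.symm_apply_apply] at h2

/-- Morphisms of locally ringed superspaces preserve values. -/
theorem body_pull {T : SuperSpace.{u}} {V' : MixedSuperVectorSpace.{u}} (C' : Chart T V')
    (C : Chart X V) (f : Hom T X) {W : Opens X} {U : Opens T} (h : Set.MapsTo f.base U W) {t : T}
    (ht : t ∈ U) (ht' : t ∈ C'.dom) (hx : f.base t ∈ C.dom) (a : X.O W) :
    C'.body ht ht' (f.pull W U h a) = C.body (h ht) hx a := by
  by_contra hne
  -- Let `c` be the value of the pullback at `t`. If `a` had another value at the image point, `a -
  -- c` would be a unit near it, and its pullback would be a unit with value zero at `t`.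
  obtain ⟨W', hW, htW, hu⟩ := C.exists_isUnit (h ht) hx
    (a := a - algebraMap ℂ _ (C'.body ht ht' (f.pull W U h a))) (by
      rw [map_sub, AlgHom.commutes]
      exact sub_ne_zero.2 (Ne.symm hne))
  let U' : Opens T := U ⊓ f.pre W'
  have hU' : Set.MapsTo f.base U' W' := fun _ hy => hy.2
  have htU' : t ∈ U' := ⟨ht, htW⟩
  have h1 := hu.map (f.pull W' U' hU')
  rw [f.pull_res hW inf_le_left h hU'] at h1
  have h2 := h1.map (C'.body htU' ht')
  rw [C'.body_res inf_le_left htU' ht', map_sub, map_sub, AlgHom.commutes, AlgHom.commutes] at h2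
  simp at h2

/-- The coordinate functions of a chart. -/
def coord (C : Chart X V) {U : Opens X} (hU : U ≤ C.dom) : Module.Dual ℂ V.Total →ₗ[ℂ] X.O U :=
  (C.κ U hU).symm.toLinearMap ∘ₗ MixedSuperVectorSpace.coordFun (C.im U)

theorem κ_coord (C : Chart X V) {U : Opens X} (hU : U ≤ C.dom) (l : Module.Dual ℂ V.Total) :
    C.κ U hU (C.coord hU l) = MixedSuperVectorSpace.coordFun (C.im U) l :=
  (C.κ U hU).apply_symm_apply _

theorem coord_res (C : Chart X V) {U U' : Opens X} (hU : U ≤ C.dom) (h : U' ≤ U)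
    (l : Module.Dual ℂ V.Total) : X.res h (C.coord hU l) = C.coord (h.trans hU) l := by
  apply (C.κ U' (h.trans hU)).injective
  rw [C.κ_res U U' hU h (C.im_mono hU h), κ_coord, κ_coord,
    MixedSuperVectorSpace.coordFun_res]

theorem coord_par (C : Chart X V) {U : Opens X} (hU : U ≤ C.dom) {p : ZMod 2}
    {l : Module.Dual ℂ V.Total} (hl : l ∘ₗ vparity V.even V.odd = sgn p • l) :
    X.par U (C.coord hU l) = sgn p • C.coord hU l := by
  apply (C.κ U hU).injective
  rw [C.κ_par, map_smul, κ_coord, MixedSuperVectorSpace.coordFun_par, hl, map_smul]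

theorem body_coord (C : Chart X V) {U : Opens X} (hU : U ≤ C.dom) {x : X} (hx : x ∈ U)
    (l : Module.Dual ℂ V.Total) : C.body hx (hU hx) (C.coord hU l) = l ((C.pt x : V.even), 0) := by
  rw [body, AlgHom.comp_apply, C.ev_eq hU, κ_coord]
  exact MixedSuperVectorSpace.superFunBody_coordFun _ l

theorem mem_hadamardSpan (C : Chart X V) {U : Opens X} (hU : U ≤ C.dom) {x : X}
    (hs : StarConvex ℝ (C.pt x) (C.im U : Set V.real)) (a : X.O U) :
    a ∈ hadamardSpan (C.coord hU) (C.pt x : V.even) := by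
  have h := MixedSuperVectorSpace.superFun_hadamard hs (C.κ U hU a)
  have key : ∀ b : V.superFun (C.im U),
      b ∈ hadamardSpan (MixedSuperVectorSpace.coordFun (C.im U)) (C.pt x : V.even) →
      (C.κ U hU).symm b ∈ hadamardSpan (C.coord hU) (C.pt x : V.even) := fun b hb => by
    refine Submodule.span_induction (p := fun b _ => (C.κ U hU).symm b ∈
      hadamardSpan (C.coord hU) (C.pt x : V.even)) ?_ ?_ ?_ ?_ hb
    · rintro b (rfl | ⟨p, l, b, hl, rfl⟩)
      · rw [map_one]
        exact one_mem_hadamardSpan _ _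
      · rw [map_mul, map_sub, AlgEquiv.commutes]
        exact mul_mem_hadamardSpan (C.coord hU) _ hl _
    · rw [map_zero]
      exact zero_mem _
    · intro b c _ _ hb hc
      rw [map_add]
      exact add_mem hb hc
    · intro r b _ hb
      rw [map_smul]
      exact Submodule.smul_mem _ _ hb
  have h2 := key _ h
  rwa [AlgEquiv.symm_apply_apply] at h2

end Chart

/-- The isomorphism between open subspaces of two superspaces to which a third one is
isomorphic. -/
theorem SuperSpace.exists_local_iso {X Y Z : SuperSpace.{u}} [Nonempty Z] {a : Hom Z Y}
    {b : Hom Z X} (ha : a.IsOpenImmersion) (hb : b.IsOpenImmersion) :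
    ∃ (dom : Opens X) (pt : X → Y) (im : Opens X → Opens Y)
      (κ : ∀ U ≤ dom, X.O U ≃ₐ[ℂ] Y.O (im U)), (dom : Set X) = Set.range b.base ∧
      (∀ U ≤ dom, ∀ y, y ∈ im U ↔ ∃ x ∈ U, pt x = y) ∧ Set.InjOn pt dom ∧
      (∀ U ≤ dom, ∀ B ≤ im U, ∃ U' ≤ U, im U' = B) ∧
      (∀ (U U' : Opens X) (hU : U ≤ dom) (h : U' ≤ U) (hi : im U' ≤ im U) (a : X.O U),
        κ U' (h.trans hU) (X.res h a) = Y.res hi (κ U hU a)) ∧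
      ∀ (U : Opens X) (hU : U ≤ dom) (a : X.O U), κ U hU (X.par U a) = Y.par (im U) (κ U hU a) := by
  let dom : Opens X := ⟨Set.range b.base, hb.isOpenEmbedding.isOpen_range⟩
  let im : Opens X → Opens Y := fun U =>
    ⟨a.base '' (b.pre U), ha.isOpenEmbedding.isOpenMap _ (b.pre U).isOpen⟩
  let pt : X → Y := fun x => a.base (Function.invFun b.base x)
  have hpt : ∀ z, pt (b.base z) = a.base z := fun z =>
    congrArg a.base (Function.leftInverse_invFun hb.isOpenEmbedding.injective z)
  have hma : ∀ U : Opens X, Set.MapsTo a.base (b.pre U) (im U) := fun U z hz => ⟨z, hz, rfl⟩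
  have hba : ∀ U : Opens X, Function.Bijective (a.pull (im U) (b.pre U) (hma U)) := fun U => by
    refine ha.bijective_pull (hma U) ?_ ?_
    · rintro z ⟨z', hz', hzz⟩
      rwa [← ha.isOpenEmbedding.injective hzz]
    · rintro _ ⟨z, _, rfl⟩
      exact ⟨z, rfl⟩
  -- Pull back along `b`, then invert the pullback along `a`; both are bijective on these open sets.
  let κ : ∀ U ≤ dom, X.O U ≃ₐ[ℂ] Y.O (im U) := fun U hU =>
    (AlgEquiv.ofBijective _ (hb.bijective U hU)).trans
      (AlgEquiv.ofBijective (a.pull (im U) (b.pre U) (hma U)) (hba U)).symm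
  have hκ : ∀ U (hU : U ≤ dom) (s : X.O U), a.pull (im U) (b.pre U) (hma U) (κ U hU s) =
      b.pull U (b.pre U) (b.mapsTo_pre U) s := fun U hU s =>
    (AlgEquiv.ofBijective (a.pull (im U) (b.pre U) (hma U)) (hba U)).apply_symm_apply _
  refine ⟨dom, pt, im, κ, rfl, ?_, ?_, ?_, ?_, ?_⟩
  · intro U hU y
    constructor
    · rintro ⟨z, hz, rfl⟩
      exact ⟨b.base z, hz, hpt z⟩
    · rintro ⟨x, hx, rfl⟩
      obtain ⟨z, rfl⟩ := hU hx
      rw [hpt]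
      exact ⟨z, hx, rfl⟩
  · rintro _ ⟨z, rfl⟩ _ ⟨w, rfl⟩ h
    rw [hpt, hpt] at h
    rw [ha.isOpenEmbedding.injective h]
  · intro U hU B hB
    refine ⟨⟨b.base '' (a.pre B), hb.isOpenEmbedding.isOpenMap _ (a.pre B).isOpen⟩, ?_, ?_⟩
    · rintro _ ⟨z, hz, rfl⟩
      obtain ⟨w, hw, hwz⟩ := hB hz
      rw [← ha.isOpenEmbedding.injective hwz]
      exact hw
    · refine Opens.ext (Set.ext fun y => ⟨?_, fun hy => ?_⟩)
      · rintro ⟨z, ⟨w, hw, hwz⟩, rfl⟩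
        rw [← hb.isOpenEmbedding.injective hwz]
        exact hw
      · obtain ⟨z, hz, rfl⟩ := hB hy
        exact ⟨z, ⟨z, hy, rfl⟩, rfl⟩
  · intro U U' hU h hi s
    apply (hba U').injective
    have hp : b.pre U' ≤ b.pre U := fun _ hz => h hz
    rw [hκ U' (h.trans hU), b.pull_res h hp (b.mapsTo_pre U), ← hκ U hU]
    exact (a.pull_res hi hp (hma U) (hma U') (κ U hU s)).symm
  · intro U hU s
    apply (hba U).injective
    rw [hκ U hU, b.pull_par, ← hκ U hU]
    exact (a.pull_par (im U) (b.pre U) (hma U) (κ U hU s)).symm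

/-- A superspace that is modelled on `V` at a point has a chart around that point. -/
theorem SuperSpace.IsModelledAt.exists_chart {X : SuperSpace.{u}} {V : MixedSuperVectorSpace.{u}}
    {m : X} (h : X.IsModelledAt V m) : ∃ C : Chart X V, m ∈ C.dom := by
  obtain ⟨Z, a, b, ha, hb, hm⟩ := h
  have : Nonempty Z := ⟨hm.choose⟩
  obtain ⟨dom, pt, im, κ, hdom, h1, h2, h3, h4, h5⟩ := exists_local_iso ha hb
  refine ⟨⟨dom, pt, im, h1, h2, h3, κ, h4, h5⟩, ?_⟩
  change m ∈ (dom : Set X)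
  rwa [hdom]

theorem MixedSupermanifold.exists_chart (X : MixedSupermanifold.{u}) (x : X.toSuperSpace) :
    ∃ (V : MixedSuperVectorSpace.{u}) (C : Chart X.toSuperSpace V), x ∈ C.dom := by
  obtain ⟨V, hV⟩ := X.locallyModelled x
  exact ⟨V, hV.exists_chart⟩

/-- Functions on a mixed supermanifold are determined by their values. -/
theorem MixedSupermanifold.ext_ev (X : MixedSupermanifold.{u}) {U : Opens X.toSuperSpace}
    {a b : X.O U} (h : ∀ (V : MixedSuperVectorSpace.{u}) (C : Chart X.toSuperSpace V)
      (x : X.toSuperSpace) (hx : x ∈ U) (hx' : x ∈ C.dom), C.ev hx hx' a = C.ev hx hx' b) :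
    a = b := by
  refine X.isSheaf.separated fun x hx => ?_
  obtain ⟨V, C, hC⟩ := X.exists_chart x
  refine ⟨U ⊓ C.dom, inf_le_left, ⟨hx, hC⟩, C.eq_of_ev inf_le_right fun y hy => ?_⟩
  rw [C.ev_res, C.ev_res]
  exact h V C y hy.1 hy.2

/-! ### Coordinate frames -/

section CoordinateFrames

variable {X : SuperSpace.{u}} {V : MixedSuperVectorSpace.{u}}

theorem Der_apply_one {Y : SuperSpace.{u}} {f : Hom X Y} {U : Opens X} {D : PreDer f U}
    (hD : D ∈ Der f U) (i : DerIdx f U) : D i 1 = 0 := by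
  have h := Der_leibniz_even hD i 1 1 (by rw [map_one, sgn_zero, one_smul])
  rw [mul_one, map_one (f.pull i.W i.U' i.mapsTo), mul_one, one_mul] at h
  exact left_eq_add.1 h

theorem Der_apply_algebraMap {Y : SuperSpace.{u}} {f : Hom X Y} {U : Opens X} {D : PreDer f U}
    (hD : D ∈ Der f U) (i : DerIdx f U) (c : ℂ) : D i (algebraMap ℂ _ c) = 0 := by
  rw [Algebra.algebraMap_eq_smul_one, map_smul, Der_apply_one hD, smul_zero]

/-- The derivation `D` kills the coordinate functions of the chart. -/
def Chart.Kills (C : Chart X V) {T : SuperSpace.{u}} {f : Hom T X} {U : Opens T}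
    (D : PreDer f U) : Prop :=
  ∀ (i : DerIdx f U) (hW : i.W ≤ C.dom) (l : Module.Dual ℂ V.Total), D i (C.coord hW l) = 0

theorem Chart.Kills.parConj {C : Chart X V} {T : SuperSpace.{u}} {f : Hom T X} {U : Opens T}
    {D : PreDer f U} (h : C.Kills D) : C.Kills (parConj f U D) := by
  intro i hW l
  have h1 : X.par i.W (C.coord hW l) = C.coord hW (l ∘ₗ vparity V.even V.odd) := by
    apply (C.κ i.W hW).injective
    rw [C.κ_par, C.κ_coord, C.κ_coord, MixedSuperVectorSpace.coordFun_par]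
  rw [parConj_apply, h1, h, map_zero]

/-- The power of the augmentation ideal grows by one with each use of Hadamard's lemma: `D ((x_l -
l(q)) b)` is the pullback of `x_l - l(q)`, whose value at `t` lies in the ideal, times a value of
`D` or of its parity conjugate. The induction therefore ranges over all derivations that kill the
coordinates. -/
theorem Chart.ev_mem_of_kills (C : Chart X V) {T : SuperSpace.{u}} {f : Hom T X} {U : Opens T}
    (hU : Set.MapsTo f.base U C.dom) {V' : MixedSuperVectorSpace.{u}} (C' : Chart T V') (n : ℕ) :
    ∀ {D : PreDer f U}, D ∈ Der f U → C.Kills D → ∀ (i : DerIdx f U) (a : X.O i.W) (t : T)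
      (ht : t ∈ i.U') (ht' : t ∈ C'.dom),
      C'.ev ht ht' (D i a) ∈ augIdeal (Module.Dual ℂ V'.odd) ^ n * ⊤ := by
  induction n with
  | zero =>
    intro D _ _ i a t ht ht'
    rw [pow_zero, one_mul]
    trivial
  | succ n ih =>
    intro D hD hk i a t ht ht'
    -- Hadamard's lemma needs a domain that is star-shaped about the image of `t`; the value at `t`
    -- is not affected by shrinking to it.
    obtain ⟨Q, hQ, hQd, htQ, hs⟩ := C.exists_ball (i.mapsTo ht) (hU (i.le ht))
    let j : DerIdx f U := ⟨Q, i.U' ⊓ f.pre Q, inf_le_left.trans i.le, fun _ hx => hx.2⟩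
    have htj : t ∈ j.U' := ⟨ht, htQ⟩
    have h1 : C'.ev ht ht' (D i a) = C'.ev htj ht' (D j (X.res hQ a)) := by
      rw [isNatural_of_mem hD i j hQ inf_le_left a, C'.ev_res inf_le_left htj ht']
    rw [h1]
    refine Submodule.span_induction (p := fun b _ => C'.ev htj ht' (D j b) ∈
      augIdeal (Module.Dual ℂ V'.odd) ^ (n + 1) * ⊤) ?_ ?_ ?_ ?_
      (C.mem_hadamardSpan hQd hs (X.res hQ a))
    · rintro b (rfl | ⟨p, l, b, hl, rfl⟩)
      · rw [Der_apply_one hD, map_zero]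
        exact zero_mem _
      · set q : V.even := (C.pt (f.base t) : V.even)
        have hy0 : D j (C.coord hQd l - algebraMap ℂ _ (l (q, 0))) = 0 := by
          rw [map_sub, hk j hQd l, Der_apply_algebraMap hD, sub_zero]
        have hyp : X.par Q (C.coord hQd l - algebraMap ℂ _ (l (q, 0))) =
            sgn p • (C.coord hQd l - algebraMap ℂ _ (l (q, 0))) := by
          have hq : l (q, 0) = sgn p * l (q, 0) := by
            have := LinearMap.congr_fun hl (q, 0)
            rw [LinearMap.comp_apply, (isHomogeneous_inl q).vparity_eq, sgn_zero, one_smul] at this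
            exact this
          have hq' : sgn p • algebraMap ℂ (X.O Q) (l (q, 0)) = algebraMap ℂ (X.O Q) (l (q, 0)) := by
            rw [Algebra.algebraMap_eq_smul_one, smul_smul]
            exact congrArg (· • (1 : X.O Q)) hq.symm
          rw [map_sub, AlgHom.commutes, C.coord_par hQd hl, smul_sub, hq']
        -- The body of `x_l - l(q)` vanishes at the image of `t`, and pullbacks preserve bodies.
        have hbody : C'.ev htj ht' (f.pull j.W j.U' j.mapsTo
            (C.coord hQd l - algebraMap ℂ _ (l (q, 0)))) ∈ augIdeal (Module.Dual ℂ V'.odd) := by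
          rw [mem_augIdeal]
          have h2 := Chart.body_pull C' C f j.mapsTo htj ht' (hU (i.le ht))
            (C.coord hQd l - algebraMap ℂ _ (l (q, 0)))
          refine h2.trans ((map_sub _ _ _).trans ?_)
          exact sub_eq_zero.2 ((C.body_coord hQd htQ l).trans
            (AlgHom.commutes (C.body htQ (hU (i.le ht))) (l (q, 0))).symm)
        rcases eq_zero_or_one p with rfl | rfl
        · rw [Der_leibniz_even hD j _ b hyp, hy0, zero_mul, zero_add, map_mul]
          exact augIdeal_pow_succ_mul_top hbody (ih hD hk j b t htj ht')
        · rw [Der_leibniz_odd hD j _ b hyp, hy0, zero_mul, zero_add, map_mul]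
          exact augIdeal_pow_succ_mul_top hbody (ih (parConj_mem hD) hk.parConj j b t htj ht')
    · rw [map_zero, map_zero]
      exact zero_mem _
    · intro b c _ _ hb hc
      rw [map_add, map_add]
      exact add_mem hb hc
    · intro r b _ hb
      rw [map_smul, map_smul]
      exact Submodule.smul_mem _ _ hb

/-- The values of `D` lie in every power of the augmentation ideal. Some power is zero, and
functions on `T` are determined by their values in exterior algebras. -/
theorem Chart.eq_zero_of_kills (C : Chart X V) {T : MixedSupermanifold.{u}}
    {f : Hom T.toSuperSpace X} {U : Opens T.toSuperSpace} (hU : Set.MapsTo f.base U C.dom)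
    {D : PreDer f U} (hD : D ∈ Der f U) (h : C.Kills D) : D = 0 := by
  funext i
  ext a
  refine T.ext_ev fun V' C' t ht ht' => ?_
  obtain ⟨n, hn⟩ := exists_augIdeal_pow_eq_bot (E := Module.Dual ℂ V'.odd)
  have h1 := C.ev_mem_of_kills hU C' n hD h i a t ht ht'
  rw [hn, Submodule.bot_mul, Submodule.mem_bot] at h1
  rw [h1]
  exact (map_zero _).symm

/-- The coordinate vector fields of a chart. -/
def Chart.coordDeriv (C : Chart X V) : V.Total →ₗ[ℂ] PreDer (Hom.id X) C.dom where
  toFun v i := (C.κ i.U' i.le).symm.toLinearMap ∘ₗ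
    MixedSuperVectorSpace.superFunDeriv (C.im i.U') v ∘ₗ
    (C.κ i.U' i.le).toLinearMap ∘ₗ ((Hom.id X).pull i.W i.U' i.mapsTo).toLinearMap
  map_add' v w := by
    funext i
    ext a
    simp
  map_smul' c v := by
    funext i
    ext a
    simp

theorem Chart.κ_coordDeriv (C : Chart X V) (v : V.Total) (i : DerIdx (Hom.id X) C.dom)
    (a : X.O i.W) : C.κ i.U' i.le (C.coordDeriv v i a) =
      MixedSuperVectorSpace.superFunDeriv (C.im i.U') v
        (C.κ i.U' i.le ((Hom.id X).pull i.W i.U' i.mapsTo a)) :=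
  (C.κ i.U' i.le).apply_symm_apply _

theorem par_symm_deriv {A B : Type*} [Ring A] [Algebra ℂ A] [Ring B] [Algebra ℂ B]
    {κ : A ≃ₐ[ℂ] B} {σ : A →ₐ[ℂ] A} {σ' : B →ₐ[ℂ] B} (hκ : ∀ a, κ (σ a) = σ' (κ a))
    {D : B →ₗ[ℂ] B} {c : ℂ} (hD : ∀ b, σ' (D b) = c • D (σ' b)) (a : A) :
    σ (κ.symm (D (κ a))) = c • κ.symm (D (κ (σ a))) := by
  apply κ.injective
  rw [hκ, κ.apply_symm_apply, hD, map_smul, κ.apply_symm_apply, hκ]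

/-- The Leibniz rule for a superderivation of parity `p`. -/
def IsSuperLeibniz {B : Type*} [Ring B] [Algebra ℂ B] (σ : B →ₐ[ℂ] B) (p : ZMod 2)
    (D : B → B) : Prop :=
  ∀ (q : ZMod 2) (a b : B), σ a = sgn q • a → D (a * b) = D a * b + sgn (p * q) • (a * D b)

theorem IsSuperLeibniz.symm_apply {A B : Type*} [Ring A] [Algebra ℂ A] [Ring B] [Algebra ℂ B]
    {κ : A ≃ₐ[ℂ] B} {σ : A →ₐ[ℂ] A} {σ' : B →ₐ[ℂ] B} (hκ : ∀ a, κ (σ a) = σ' (κ a)) {p : ZMod 2}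
    {D : B → B} (hD : IsSuperLeibniz σ' p D) {q : ZMod 2} {a : A} (ha : σ a = sgn q • a)
    (b : A) : κ.symm (D (κ (a * b))) =
      κ.symm (D (κ a)) * b + sgn (p * q) • (a * κ.symm (D (κ b))) := by
  apply κ.injective
  rw [κ.apply_symm_apply, map_mul, hD q _ _ (by rw [← hκ, ha, map_smul]), map_add, map_mul,
    map_smul, map_mul, κ.apply_symm_apply, κ.apply_symm_apply]

theorem isSuperLeibniz_tensorDeriv {A B E F : Type u} [Ring A] [Algebra ℂ A] [Ring B] [Algebra ℂ B]
    [AddCommGroup E] [Module ℂ E] [AddCommGroup F] [Module ℂ F] {D : E →ₗ[ℂ] A →ₗ[ℂ] A}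
    {D' : F →ₗ[ℂ] B →ₗ[ℂ] B} {σ : B →ₐ[ℂ] B}
    (hD : ∀ e a b, D e (a * b) = D e a * b + a * D e b)
    (hD' : ∀ e a b, D' e (a * b) = D' e a * b + σ a * D' e b) {p : ZMod 2} {v : E × F}
    (hv : IsHomogeneous p v) :
    IsSuperLeibniz (Algebra.TensorProduct.map (AlgHom.id ℂ A) σ) p fun x => tensorDeriv D D' v x := by
  dsimp only [IsSuperLeibniz]
  intro q x y hx
  obtain ⟨v0, v1⟩ := v
  rcases eq_zero_or_one p with rfl | rfl
  · obtain rfl : v1 = 0 := isHomogeneous_zero_iff.1 hv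
    rw [zero_mul, sgn_zero, one_smul, tensorDeriv_inl_mul D' hD]
  · obtain rfl : v0 = 0 := isHomogeneous_one_iff.1 hv
    rw [one_mul, ← smul_mul_assoc, ← hx, tensorDeriv_inr_mul D hD']

theorem MixedSuperVectorSpace.isSuperLeibniz_superFunDeriv (U : Opens V.real) {p : ZMod 2}
    {v : V.Total} (hv : IsHomogeneous p v) :
    IsSuperLeibniz (V.superFunPar U) p fun a => superFunDeriv U v a :=
  isSuperLeibniz_tensorDeriv (A := V.partHol U) (B := V.oddFun) (D := partHolDeriv U)
    (D' := V.oddDeriv) (σ := extPar (Module.Dual ℂ V.odd)) (partHolDeriv_mul (V := V) (U := U))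
    (fun e a b => contract_mul (Module.Dual.eval ℂ V.odd e) a b) hv

theorem Chart.symm_superFunDeriv_mul (C : Chart X V) {p q : ZMod 2} {v : V.Total}
    (hv : IsHomogeneous p v) {U : Opens X} (hU : U ≤ C.dom) {a : X.O U}
    (ha : X.par U a = sgn q • a) (b : X.O U) :
    (C.κ U hU).symm (MixedSuperVectorSpace.superFunDeriv (C.im U) v (C.κ U hU (a * b))) =
      (C.κ U hU).symm (MixedSuperVectorSpace.superFunDeriv (C.im U) v (C.κ U hU a)) * b +
        sgn (p * q) • (a * (C.κ U hU).symm
          (MixedSuperVectorSpace.superFunDeriv (C.im U) v (C.κ U hU b))) := by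
  have h2 := MixedSuperVectorSpace.isSuperLeibniz_superFunDeriv (C.im U) hv
  have h3 := @IsSuperLeibniz.symm_apply (X.O U) (V.superFun (C.im U)) _ _ _ _ (C.κ U hU) (X.par U)
    (V.superFunPar (C.im U)) (C.κ_par U hU) p
    (fun a => MixedSuperVectorSpace.superFunDeriv (C.im U) v a)
  exact h3 h2 ha b

set_option maxHeartbeats 1000000 in
theorem Chart.coordDeriv_mem (C : Chart X V) {p : ZMod 2} {v : V.Total} (hv : IsHomogeneous p v) :
    C.coordDeriv v ∈ homDer (Hom.id X) C.dom p := by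
  refine ⟨fun i j hW hU a => ?_, fun i a => ?_, fun i q a b hq => ?_⟩
  · apply (C.κ j.U' j.le).injective
    rw [C.κ_coordDeriv, C.κ_res i.U' j.U' i.le hU (C.im_mono i.le hU), C.κ_coordDeriv,
      ← MixedSuperVectorSpace.superFunDeriv_res,
      ← C.κ_res i.U' j.U' i.le hU (C.im_mono i.le hU), (Hom.id X).pull_res hW hU i.mapsTo]
  · refine (par_symm_deriv (A := X.O i.U') (B := V.superFun (C.im i.U')) (κ := C.κ i.U' i.le)
      (C.κ_par i.U' i.le) (MixedSuperVectorSpace.superFunPar_deriv hv) _).trans ?_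
    exact congrArg (fun z => sgn p • (C.κ i.U' i.le).symm
      (MixedSuperVectorSpace.superFunDeriv (C.im i.U') v (C.κ i.U' i.le z)))
      ((Hom.id X).pull_par i.W i.U' i.mapsTo a).symm
  · have hq' : X.par i.U' ((Hom.id X).pull i.W i.U' i.mapsTo a) =
        sgn q • (Hom.id X).pull i.W i.U' i.mapsTo a := by
      rw [← (Hom.id X).pull_par, hq]
      exact map_smul ((Hom.id X).pull i.W i.U' i.mapsTo) _ _
    have e : C.coordDeriv v i (a * b) = (C.κ i.U' i.le).symm
      (MixedSuperVectorSpace.superFunDeriv (C.im i.U') v (C.κ i.U' i.le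
        ((Hom.id X).pull i.W i.U' i.mapsTo a * (Hom.id X).pull i.W i.U' i.mapsTo b))) :=
      congrArg (fun z => (C.κ i.U' i.le).symm
        (MixedSuperVectorSpace.superFunDeriv (C.im i.U') v (C.κ i.U' i.le z)))
        (map_mul ((Hom.id X).pull i.W i.U' i.mapsTo) a b)
    exact e.trans (C.symm_superFunDeriv_mul hv i.le hq' _)

theorem Chart.coordDeriv_coord (C : Chart X V) (v : V.Total) (i : DerIdx (Hom.id X) C.dom)
    (hW : i.W ≤ C.dom) (l : Module.Dual ℂ V.Total) :
    C.coordDeriv v i (C.coord hW l) = algebraMap ℂ _ (l v) := by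
  apply (C.κ i.U' i.le).injective
  have h : (Hom.id X).pull i.W i.U' i.mapsTo (C.coord hW l) = C.coord i.le l :=
    C.coord_res hW _ l
  rw [C.κ_coordDeriv, h, C.κ_coord, MixedSuperVectorSpace.superFunDeriv_coordFun,
    AlgEquiv.commutes]

/-- The coordinate frame of the pullback of the tangent bundle. -/
def Chart.frame (C : Chart X V) {T : SuperSpace.{u}} (f : Hom T X) {U : Opens T}
    (hU : Set.MapsTo f.base U C.dom) : LocalJet f U V.even V.odd where
  val := preDerPush f hU ∘ₗ C.coordDeriv
  val_mem p _ hv := preDerPush_mem f hU p (C.coordDeriv_mem hv)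

theorem Chart.frame_val_coord (C : Chart X V) {T : SuperSpace.{u}} (f : Hom T X) {U : Opens T}
    (hU : Set.MapsTo f.base U C.dom) (v : V.Total) (i : DerIdx f U) (hW : i.W ≤ C.dom)
    (l : Module.Dual ℂ V.Total) :
    (C.frame f hU).val v i (C.coord hW l) = algebraMap ℂ _ (l v) := by
  change preDerPush f hU (C.coordDeriv v) i (C.coord hW l) = _
  rw [preDerPush_apply, C.coordDeriv_coord v (infIdx C.dom i.W) hW]
  exact AlgHom.commutes _ _

theorem Chart.frame_secs_coord (C : Chart X V) {T : SuperSpace.{u}} (f : Hom T X) {U U' : Opens T}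
    (hU : Set.MapsTo f.base U C.dom) (h : U' ≤ U) {ι : Type*} [Fintype ι]
    (b : Module.Basis ι ℂ V.Total) (x : T.O U' ⊗[ℂ] V.Total) (i : DerIdx f U') (hW : i.W ≤ C.dom)
    (k : ι) : (C.frame f hU).secs h x i (C.coord hW (b.coord k)) =
      T.res i.le ((Algebra.TensorProduct.basis (T.O U') b).repr x k) := by
  induction x using TensorProduct.induction_on with
  | zero => simp
  | add x y hx hy =>
    rw [map_add, Pi.add_apply, LinearMap.add_apply, hx, hy, map_add, Finsupp.add_apply, map_add]
  | tmul s v =>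
    rw [LocalJet.secs_tmul, preDerMul_apply, preDerRes_apply, C.frame_val_coord f hU v _ hW,
      Algebra.TensorProduct.basis_repr_tmul]
    simp [Algebra.algebraMap_eq_smul_one]

/-- Applying a section to the coordinate functions reads off its coefficients, which gives
injectivity. For surjectivity, subtract from `D` the combination with coefficients `D(x_k)`; the
rest kills all coordinates and is zero. -/
theorem Chart.isFrame_frame (C : Chart X V) {T : MixedSupermanifold.{u}}
    (f : Hom T.toSuperSpace X) {U : Opens T.toSuperSpace} (hU : Set.MapsTo f.base U C.dom) :
    (C.frame f hU).IsFrame := by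
  let b := Module.finBasis ℂ V.Total
  have kills : ∀ {U' : Opens T.toSuperSpace} (hU' : Set.MapsTo f.base U' C.dom) {D : PreDer f U'},
      D ∈ Der f U' → (∀ k, D ⟨C.dom, U', le_rfl, hU'⟩ (C.coord le_rfl (b.coord k)) = 0) →
      C.Kills D := by
    intro U' hU' D hD h0 i hW l
    have h1 : ∀ k, D i (C.coord hW (b.coord k)) = 0 := fun k => by
      have h2 := isNatural_of_mem hD ⟨C.dom, U', le_rfl, hU'⟩ i hW i.le (C.coord le_rfl (b.coord k))
      rw [h0, map_zero, C.coord_res] at h2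
      exact h2
    have h3 : l = ∑ k, l (b k) • b.coord k := b.ext fun j => by simp
    rw [h3]
    simp only [map_sum, map_smul, h1, smul_zero, Finset.sum_const_zero]
  intro U' h
  have hU' : Set.MapsTo f.base U' C.dom := fun _ hx => hU (h hx)
  refine ⟨fun x y hxy => ?_, le_antisymm ?_ fun D hD => ?_⟩
  · refine eq_of_forall_repr_eq b fun k => ?_
    have h1 := C.frame_secs_coord f hU h b x ⟨C.dom, U', le_rfl, hU'⟩ le_rfl k
    have h2 := C.frame_secs_coord f hU h b y ⟨C.dom, U', le_rfl, hU'⟩ le_rfl k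
    rw [T.res_self] at h1 h2
    rw [← h1, ← h2, hxy]
  · rintro _ ⟨x, rfl⟩
    exact LocalJet.secs_mem_Der T.isSupercommutative _ h x
  · let x : T.O U' ⊗[ℂ] V.Total := (Algebra.TensorProduct.basis (T.O U') b).equivFun.symm
      fun k => D ⟨C.dom, U', le_rfl, hU'⟩ (C.coord le_rfl (b.coord k))
    have hx : ∀ k, (Algebra.TensorProduct.basis (T.O U') b).repr x k =
        D ⟨C.dom, U', le_rfl, hU'⟩ (C.coord le_rfl (b.coord k)) := fun k =>
      congrFun ((Algebra.TensorProduct.basis (T.O U') b).equivFun.apply_symm_apply _) k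
    have hmem : D - (C.frame f hU).secs h x ∈ Der f U' :=
      sub_mem hD (LocalJet.secs_mem_Der T.isSupercommutative _ h x)
    refine ⟨x, (sub_eq_zero.1 (C.eq_zero_of_kills hU' hmem (kills hU' hmem fun k => ?_))).symm⟩
    rw [Pi.sub_apply, LinearMap.sub_apply, C.frame_secs_coord f hU h b x _ le_rfl k, hx,
      T.res_self, sub_self]

theorem Chart.frame_pull (C : Chart X V) {T S : SuperSpace.{u}} (f : Hom T X) {U : Opens T}
    (hU : Set.MapsTo f.base U C.dom) (k : Hom S T) {U' : Opens S} (h : Set.MapsTo k.base U' U)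
    (hU' : Set.MapsTo (k.comp f).base U' C.dom) :
    (C.frame f hU).pull k h = C.frame (k.comp f) hU' :=
  LocalJet.ext (LinearMap.ext fun v => preDerPullOn_preDerPush k hU h hU' (C.coordDeriv v))

end CoordinateFrames

/-- Frames stay frames after pullback. -/
theorem LocalJet.IsFrame.pull {T S : MixedSupermanifold.{u}} {X : SuperSpace.{u}}
    {V : MixedSuperVectorSpace.{u}} (hX : ∀ x : X, X.IsModelledAt V x) {f : Hom T.toSuperSpace X}
    {U : Opens T.toSuperSpace} {ψ : LocalJet f U V.even V.odd} (hψ : ψ.IsFrame)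
    (k : Hom S.toSuperSpace T.toSuperSpace) {U' : Opens S.toSuperSpace}
    (h : Set.MapsTo k.base U' U) : (ψ.pull k h).IsFrame := by
  refine LocalJet.isFrame_of_local S.isSheaf S.isSupercommutative _ fun s hs => ?_
  obtain ⟨C, hC⟩ := (hX (f.base (k.base s))).exists_chart
  let Q : Opens T.toSuperSpace := U ⊓ f.pre C.dom
  let N : Opens S.toSuperSpace := U' ⊓ (k.comp f).pre C.dom
  have hk : Set.MapsTo k.base N Q := fun x hx => ⟨h hx.1, hx.2⟩
  have hQ : Set.MapsTo f.base Q C.dom := fun x hx => hx.2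
  have hN : Set.MapsTo (k.comp f).base N C.dom := fun x hx => hx.2
  refine ⟨N, inf_le_left, ⟨hs, hC⟩, ?_⟩
  rw [ψ.pull_restrict k h inf_le_left (inf_le_left : Q ≤ U) hk]
  -- The given frame is the coordinate frame times an invertible matrix, and the coordinate frame
  -- along `f` pulls back to the coordinate frame along the composition.
  refine (C.isFrame_frame f hQ).pull_of_pull (hψ.restrict inf_le_left) T.isSupercommutative
    S.isSupercommutative k hk ?_
  rw [C.frame_pull f hQ k hk hN]
  exact C.isFrame_frame _ hN

/-! ### Square roots -/

section SquareRoots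

open Polynomial in
/-- An invertible element of a finite-dimensional complex algebra has a square root that is a
polynomial in it. -/
theorem exists_aeval_sq_eq {E : Type*} [Ring E] [Algebra ℂ E] [FiniteDimensional ℂ E] {a : E}
    (ha : IsUnit a) : ∃ q : ℂ[X], aeval a q * aeval a q = a := by
  have hint : IsIntegral ℂ a := Algebra.IsIntegral.isIntegral a
  set m := minpoly ℂ a
  have hm0 : m ≠ 0 := minpoly.ne_zero hint
  -- If `X` divided `m`, the quotient would annihilate `a`, as `a` is a unit, and have smaller
  -- degree than the minimal polynomial.
  have hc : m.coeff 0 ≠ 0 := by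
    intro h0
    obtain ⟨d, hd⟩ := X_dvd_iff.2 h0
    have hd0 : d ≠ 0 := by
      rintro rfl
      exact hm0 (by rw [hd, mul_zero])
    have h1 : a * aeval a d = 0 := by
      have := minpoly.aeval ℂ a
      change aeval a m = 0 at this
      rwa [hd, map_mul, aeval_X] at this
    have h2 := minpoly.degree_le_of_ne_zero ℂ a hd0 (ha.mul_right_eq_zero.1 h1)
    change m.degree ≤ d.degree at h2
    rw [hd, degree_mul, degree_X, degree_eq_natDegree hd0] at h2
    norm_cast at h2
    omega
  choose s hs using fun z : ℂ => IsAlgClosed.exists_pow_nat_eq z two_pos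
  -- Interpolating square roots of the roots of `m` gives a square root of `X` modulo the radical of
  -- `m`. It is then corrected to a square root modulo `m`.
  let q₀ : ℂ[X] := Lagrange.interpolate m.roots.toFinset id s
  have hq₀ : ∀ z ∈ m.roots, X - C z ∣ q₀ ^ 2 - X := fun z hz => by
    rw [dvd_iff_isRoot, IsRoot, eval_sub, eval_pow, eval_X]
    have h := Lagrange.eval_interpolate_at_node (s := m.roots.toFinset) (v := id) s
      Function.injective_id.injOn (Multiset.mem_toFinset.2 hz)
    change eval z q₀ = s z at h
    rw [h, hs, sub_self]
  have hdvd : m ∣ (q₀ ^ 2 - X) ^ Multiset.card m.roots := by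
    have h := Multiset.prod_dvd_prod_of_dvd (S := m.roots) (fun z => X - C z)
      (fun _ => q₀ ^ 2 - X) hq₀
    rw [Multiset.map_const', Multiset.prod_replicate] at h
    rw [← (IsAlgClosed.splits m).eq_prod_roots_of_monic (minpoly.monic hint)] at h
    exact h
  have hnil : IsNilpotent (AdjoinRoot.mk m q₀ ^ 2 - AdjoinRoot.root m) := by
    refine ⟨Multiset.card m.roots, ?_⟩
    rw [← AdjoinRoot.mk_X, ← map_pow, ← map_sub, ← map_pow, AdjoinRoot.mk_eq_zero]
    exact hdvd
  have hroot : IsUnit (AdjoinRoot.root m) := by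
    have h1 : AdjoinRoot.mk m (divX m * X + C (m.coeff 0)) = 0 := by
      rw [divX_mul_X_add, AdjoinRoot.mk_self]
    rw [map_add, map_mul, AdjoinRoot.mk_X, add_eq_zero_iff_eq_neg, ← map_neg, ← C_neg] at h1
    have h2 : IsUnit (AdjoinRoot.mk m (C (-m.coeff 0))) :=
      ((isUnit_iff_ne_zero.2 (neg_ne_zero.2 hc)).map C).map (AdjoinRoot.mk m)
    rw [← h1] at h2
    exact isUnit_of_mul_isUnit_right h2
  have hunit : IsUnit (AdjoinRoot.mk m q₀) := by
    have h1 := hnil.isUnit_add_left_of_commute hroot (mul_comm _ _)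
    rw [add_sub_cancel] at h1
    exact (isUnit_pow_iff two_ne_zero).1 h1
  -- Newton iteration in `ℂ[X]/(m)`: the value of `P` at `q₀` is nilpotent and its derivative `2 q₀`
  -- is a unit, so `P` has an exact root there.
  let P : (AdjoinRoot m)[X] := X ^ 2 - C (AdjoinRoot.root m)
  obtain ⟨r, ⟨-, hr⟩, -⟩ := existsUnique_nilpotent_sub_and_aeval_eq_zero (P := P)
    (x := AdjoinRoot.mk m q₀) (by simpa [P] using hnil) (by
      have h2 : IsUnit (1 + 1 : AdjoinRoot m) := by
        have : IsUnit (algebraMap ℂ (AdjoinRoot m) 2) := (isUnit_iff_ne_zero.2 two_ne_zero).map _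
        rwa [map_ofNat, ← one_add_one_eq_two] at this
      simpa [P] using h2.mul hunit)
  obtain ⟨q, rfl⟩ := AdjoinRoot.mk_surjective r
  refine ⟨q, ?_⟩
  have h3 : m ∣ q ^ 2 - X := by
    rw [← AdjoinRoot.mk_eq_zero]
    simpa [P] using hr
  have h4 := (minpoly.dvd_iff.1 h3)
  rw [map_sub, map_pow, aeval_X, sq] at h4
  exact sub_eq_zero.1 h4

/-- Square roots near `1`, in a linear subspace that contains `1` and the squares of its
elements, depend holomorphically on the element. -/
theorem exists_holomorphic_sqrt {E : Type*} [Ring E] [Algebra ℂ E] {n : ℕ}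
    {L : (Fin n → ℂ) →ₗ[ℂ] E} (hL : Function.Injective L) {e : Fin n → ℂ} (he : L e = 1)
    (hsq : ∀ x, L x * L x ∈ LinearMap.range L) :
    ∃ (G : (Fin n → ℂ) → Fin n → ℂ) (N : Set (Fin n → ℂ)), IsOpen N ∧ e ∈ N ∧
      (∀ x ∈ N, ContDiffAt ℂ ω G x) ∧ ∀ x ∈ N, L (G x) * L (G x) = L x := by
  obtain ⟨φ, hφ⟩ := LinearMap.exists_leftInverse_of_injective L (LinearMap.ker_eq_bot.2 hL)
  have hφL : ∀ x, φ (L x) = x := fun x => LinearMap.congr_fun hφ x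
  have hLφ : ∀ y ∈ LinearMap.range L, L (φ y) = y := by
    rintro _ ⟨x, rfl⟩
    rw [hφL]
  -- In the coordinates of the subspace squaring is `x ↦ B x x`, although products of two different
  -- elements may leave the subspace.
  let B : (Fin n → ℂ) →L[ℂ] (Fin n → ℂ) →L[ℂ] (Fin n → ℂ) :=
    (((LinearMap.mul ℂ E).compl₁₂ L L).compr₂ φ).toContinuousBilinearMap
  have hB : ∀ x y, B x y = φ (L x * L y) := fun _ _ => rfl
  let f : (Fin n → ℂ) → Fin n → ℂ := fun x => B x x
  have hf : ContDiff ℂ ω f := B.isBoundedBilinearMap.contDiff.comp (contDiff_id.prodMk contDiff_id)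
  -- The derivative of squaring at the identity is multiplication by `2`, hence invertible; the
  -- inverse function theorem supplies the root.
  let f' : (Fin n → ℂ) ≃L[ℂ] (Fin n → ℂ) :=
    ContinuousLinearEquiv.smulLeft (Units.mk0 (2 : ℂ) two_ne_zero)
  have hf' : HasFDerivAt f (f' : (Fin n → ℂ) →L[ℂ] (Fin n → ℂ)) e := by
    have h1 := B.hasFDerivAt_of_bilinear (hasFDerivAt_id e) (hasFDerivAt_id e)
    refine h1.congr_fderiv (ContinuousLinearMap.ext fun x => ?_)
    have h2 : B e x + B x e = (2 : ℂ) • x := by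
      rw [hB, hB, he, one_mul, mul_one, hφL, two_smul]
    exact h2
  have hn : (ω : WithTop ℕ∞) ≠ 0 := by simp
  have hfe : f e = e := by
    change φ (L e * L e) = e
    rw [he, one_mul, ← he, hφL]
  have hC : ContDiffAt ℂ ω (hf.contDiffAt.localInverse hf' hn) e := by
    have := hf.contDiffAt.to_localInverse (a := e) hf' hn
    rwa [hfe] at this
  have hR : ∀ᶠ y in nhds e, f (hf.contDiffAt.localInverse hf' hn y) = y := by
    have := (hf.contDiffAt.hasStrictFDerivAt' hf' hn).eventually_right_inverse
    rwa [hfe] at this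
  obtain ⟨N, hN, hNo, heN⟩ := eventually_nhds_iff.1 ((hC.eventually (by simp)).and hR)
  refine ⟨_, N, hNo, heN, fun x hx => (hN x hx).1, fun x hx => ?_⟩
  rw [← hLφ _ (hsq _)]
  exact congrArg L (hN x hx).2

end SquareRoots

/-! ### Families of endomorphisms -/

section Endomorphisms

section

variable {R R' : Type*} [Ring R] [Algebra ℂ R] [Ring R'] [Algebra ℂ R'] {W : Type*}
  [AddCommGroup W] [Module ℂ W]

/-- The value of an endomorphism of `R ⊗ W` under a base change `R → R'`. -/
def endMap (P : R →ₐ[ℂ] R') (A : W →ₗ[ℂ] R ⊗[ℂ] W) : Module.End R' (R' ⊗[ℂ] W) :=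
  extendScalars (baseMap W P ∘ₗ A)

theorem endMap_one_tmul (P : R →ₐ[ℂ] R') (A : W →ₗ[ℂ] R ⊗[ℂ] W) (w : W) :
    endMap P A (1 ⊗ₜ w) = baseMap W P (A w) := by
  rw [endMap, extendScalars_tmul, one_smul, LinearMap.comp_apply]

theorem endMap_mul (P : R →ₐ[ℂ] R') (A B : W →ₗ[ℂ] R ⊗[ℂ] W) :
    endMap P ((extendScalars A).restrictScalars ℂ ∘ₗ B) = endMap P A * endMap P B := by
  refine linearMap_ext_one_tmul fun w => ?_
  rw [endMap_one_tmul, Module.End.mul_apply, endMap_one_tmul, LinearMap.comp_apply,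
    LinearMap.restrictScalars_apply, baseMap_extendScalars]
  rfl

theorem endMap_eq_one {P : R →ₐ[ℂ] R'} {A : W →ₗ[ℂ] R ⊗[ℂ] W} (h : ∀ w, A w = 1 ⊗ₜ w) :
    endMap P A = 1 := by
  refine linearMap_ext_one_tmul fun w => ?_
  rw [endMap_one_tmul, h, baseMap_tmul, map_one, Module.End.one_apply]

-- Finite dimension over `ℂ` gives minimal polynomials of these endomorphisms and turns one-sided
-- inverses into two-sided ones.
variable (R W) in
instance finiteDimensional_end [FiniteDimensional ℂ R] [FiniteDimensional ℂ W] :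
    FiniteDimensional ℂ (Module.End R (R ⊗[ℂ] W)) := by
  let F : Module.End R (R ⊗[ℂ] W) →ₗ[ℂ] (R ⊗[ℂ] W →ₗ[ℂ] R ⊗[ℂ] W) :=
    { toFun := fun A => A.restrictScalars ℂ
      map_add' := fun _ _ => rfl
      map_smul' := fun _ _ => rfl }
  have hF : Function.Injective F := fun A B h => by
    have h' : A.restrictScalars ℂ = B.restrictScalars ℂ := h
    exact LinearMap.restrictScalars_injective ℂ h'
  exact Module.Finite.of_injective F hF

/-- The endomorphism that maps a basis vector to `z` and the others to `0`. -/
def endSingle {ι : Type*} (b : Module.Basis ι ℂ W) (j : ι) :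
    R ⊗[ℂ] W →ₗ[ℂ] Module.End R (R ⊗[ℂ] W) where
  toFun z := extendScalars ((LinearMap.toSpanSingleton ℂ _ z) ∘ₗ b.coord j)
  map_add' z z' := linearMap_ext_one_tmul fun w => by simp
  map_smul' c z := linearMap_ext_one_tmul fun w => by simp [smul_comm c]

theorem sum_endSingle {ι : Type*} [Fintype ι] (b : Module.Basis ι ℂ W)
    (A : Module.End R (R ⊗[ℂ] W)) : ∑ j, endSingle b j (A (1 ⊗ₜ b j)) = A := by
  refine linearMap_ext_one_tmul fun w => ?_
  rw [LinearMap.sum_apply]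
  have h : ∀ j, endSingle b j (A (1 ⊗ₜ b j)) (1 ⊗ₜ w) = b.repr w j • A (1 ⊗ₜ b j) := fun j => by
    simp [endSingle]
  simp only [h]
  have h2 : (1 : R) ⊗ₜ[ℂ] w = ∑ j, b.repr w j • ((1 : R) ⊗ₜ[ℂ] b j) := by
    simp only [← TensorProduct.tmul_smul, ← TensorProduct.tmul_sum, b.sum_repr]
  rw [h2, map_sum]
  exact Finset.sum_congr rfl fun j _ => (LinearMap.map_smul_of_tower A _ _).symm

end

variable {V₀ V₁ : Type u} [AddCommGroup V₀] [Module ℂ V₀] [AddCommGroup V₁] [Module ℂ V₁]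
  {R : Type*} [Ring R] [Algebra ℂ R]

/-- The even endomorphisms that are self-adjoint with respect to `J`. -/
def selfAdjointEnd (σ : R →ₐ[ℂ] R) (J : LinearMap.BilinForm ℂ (V₀ × V₁)) :
    Submodule ℂ (Module.End R (R ⊗[ℂ] (V₀ × V₁))) where
  carrier := {A | (∀ x, A (tparity σ x) = tparity σ (A x)) ∧
    ∀ x y, formExt σ J (A x) y = formExt σ J x (A y)}
  zero_mem' := by simp
  add_mem' := by
    rintro A B ⟨hA, hA'⟩ ⟨hB, hB'⟩
    exact ⟨fun x => by simp [hA, hB], fun x y => by simp [hA', hB']⟩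
  smul_mem' := by
    rintro c A ⟨hA, hA'⟩
    exact ⟨fun x => by simp [hA], fun x y => by simp [hA']⟩

variable {σ : R →ₐ[ℂ] R} {J : LinearMap.BilinForm ℂ (V₀ × V₁)}

theorem one_mem_selfAdjointEnd : 1 ∈ selfAdjointEnd σ J := ⟨fun _ => rfl, fun _ _ => rfl⟩

theorem mul_mem_selfAdjointEnd {A B : Module.End R (R ⊗[ℂ] (V₀ × V₁))}
    (hA : A ∈ selfAdjointEnd σ J) (hB : B ∈ selfAdjointEnd σ J) (h : A * B = B * A) :
    A * B ∈ selfAdjointEnd σ J := by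
  refine ⟨fun x => ?_, fun x y => ?_⟩
  · rw [Module.End.mul_apply, hB.1, hA.1, Module.End.mul_apply]
  · rw [Module.End.mul_apply, hA.2, hB.2, ← Module.End.mul_apply, h]

theorem mul_mul_mem_selfAdjointEnd {A B : Module.End R (R ⊗[ℂ] (V₀ × V₁))}
    (hA : A ∈ selfAdjointEnd σ J) (hB : B ∈ selfAdjointEnd σ J) :
    A * B * A ∈ selfAdjointEnd σ J := by
  refine ⟨fun x => ?_, fun x y => ?_⟩
  · simp only [Module.End.mul_apply, hA.1, hB.1]
  · simp only [Module.End.mul_apply, hA.2, hB.2]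

theorem inv_mem_selfAdjointEnd {A B : Module.End R (R ⊗[ℂ] (V₀ × V₁))}
    (hA : A ∈ selfAdjointEnd σ J) (hAB : A * B = 1) (hBA : B * A = 1) :
    B ∈ selfAdjointEnd σ J := by
  have h1 : ∀ x, A (B x) = x := LinearMap.congr_fun hAB
  have h2 : ∀ x, B (A x) = x := LinearMap.congr_fun hBA
  refine ⟨fun x => ?_, fun x y => ?_⟩
  · rw [← h2 (tparity σ (B x)), hA.1, h1]
  · conv_lhs => rw [← h1 y]
    rw [← hA.2, h1]

-- Self-adjoint endomorphisms are not closed under products, but powers of a single one commute.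
-- This is why the square root at a point has to be a polynomial.
open Polynomial in
theorem aeval_mem_selfAdjointEnd {A : Module.End R (R ⊗[ℂ] (V₀ × V₁))}
    (hA : A ∈ selfAdjointEnd σ J) (q : ℂ[X]) : aeval A q ∈ selfAdjointEnd σ J := by
  have hpow : ∀ n : ℕ, A ^ n ∈ selfAdjointEnd σ J := fun n => by
    induction n with
    | zero => rw [pow_zero]; exact one_mem_selfAdjointEnd
    | succ n ih => exact mul_mem_selfAdjointEnd ih hA ((Commute.refl A).pow_left n).eq
  rw [aeval_eq_sum_range]
  exact Submodule.sum_mem _ fun i _ => Submodule.smul_mem _ _ (hpow i)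

theorem mem_selfAdjointEnd (hσ : ∀ a, σ (σ a) = a) (hR : IsSupercomm σ)
    {A : Module.End R (R ⊗[ℂ] (V₀ × V₁))} (hA : ∀ x, A (tparity σ x) = tparity σ (A x))
    (h : ∀ v w : V₀ × V₁, formExt σ J (A (1 ⊗ₜ v)) (1 ⊗ₜ w) =
      formExt σ J (1 ⊗ₜ v) (A (1 ⊗ₜ w))) : A ∈ selfAdjointEnd σ J := by
  have h1 := (isSuperBilin_formExt (σ := σ) (J := J)).comp_even hσ hR A LinearMap.id hA
  have h2 := (isSuperBilin_formExt (σ := σ) (J := J)).comp_right A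
  have h3 := h1.ext h2 fun v w => h v w
  exact ⟨hA, fun x y => h3 x y⟩

end Endomorphisms

/-! ### Square roots of families of self-adjoint endomorphisms -/

section Families

/-- Linear functionals of the exterior-algebra values of a superfunction are again functions in the
first factor, so that matrix entries become partially holomorphic. -/
theorem exists_apply_tensorEval {A B : Type*} [Ring A] [Algebra ℂ A] [Ring B] [Algebra ℂ B]
    (μ : B →ₗ[ℂ] ℂ) (z : A ⊗[ℂ] B) :
    ∃ a : A, ∀ P : A →ₐ[ℂ] ℂ, P a = μ (tensorEval B P z) := by
  refine ⟨TensorProduct.rid ℂ A (TensorProduct.map LinearMap.id μ z), fun P => ?_⟩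
  induction z using TensorProduct.induction_on with
  | zero => simp
  | add x y hx hy => simp only [map_add, hx, hy]
  | tmul a b => simp [tensorEval_tmul, mul_comm]

namespace Chart

variable {X : SuperSpace.{u}} {V : MixedSuperVectorSpace.{u}} (C : Chart X V) {U : Opens X}
  (hU : U ≤ C.dom) {W : Type*} [AddCommGroup W] [Module ℂ W]

theorem exists_partHol_ev (μ : V.oddFun →ₗ[ℂ] ℂ) (a : X.O U) :
    ∃ h : V.partHol (C.im U), ∀ (x : X) (hx : x ∈ U),
      h.1 ⟨C.pt x, C.mem_im_pt hU hx⟩ = μ (C.ev hx (hU hx) a) := by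
  obtain ⟨h, hh⟩ := exists_apply_tensorEval (A := V.partHol (C.im U)) (B := V.oddFun) μ
    (C.κ U hU a)
  exact ⟨h, fun x hx => (hh (MixedSuperVectorSpace.partHolEval ⟨C.pt x, C.mem_im_pt hU hx⟩)).trans
    (congrArg μ (C.ev_eq hU hx (hU hx) a).symm)⟩

theorem exists_partHol_baseMap_ev (μ : V.oddFun ⊗[ℂ] W →ₗ[ℂ] ℂ) (a : X.O U ⊗[ℂ] W) :
    ∃ h : V.partHol (C.im U), ∀ (x : X) (hx : x ∈ U),
      h.1 ⟨C.pt x, C.mem_im_pt hU hx⟩ = μ (baseMap W (C.ev hx (hU hx)) a) := by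
  induction a using TensorProduct.induction_on with
  | zero => exact ⟨0, fun x hx => by rw [map_zero, map_zero]; rfl⟩
  | add a b ha hb =>
    obtain ⟨h, hh⟩ := ha
    obtain ⟨k, hk⟩ := hb
    exact ⟨h + k, fun x hx => by rw [map_add, map_add, ← hh, ← hk]; rfl⟩
  | tmul a w =>
    obtain ⟨h, hh⟩ := C.exists_partHol_ev hU (μ ∘ₗ (TensorProduct.mk ℂ V.oddFun W).flip w) a
    exact ⟨h, hh⟩

theorem exists_partHol_endMap [FiniteDimensional ℂ W]
    (μ : Module.End V.oddFun (V.oddFun ⊗[ℂ] W) →ₗ[ℂ] ℂ) (A : W →ₗ[ℂ] X.O U ⊗[ℂ] W) :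
    ∃ h : V.partHol (C.im U), ∀ (x : X) (hx : x ∈ U),
      h.1 ⟨C.pt x, C.mem_im_pt hU hx⟩ = μ (endMap (C.ev hx (hU hx)) A) := by
  let b := Module.finBasis ℂ W
  choose h hh using fun j => C.exists_partHol_baseMap_ev hU (μ ∘ₗ endSingle b j) (A (b j))
  refine ⟨∑ j, h j, fun x hx => ?_⟩
  have h1 := map_sum (MixedSuperVectorSpace.partHolEval ⟨C.pt x, C.mem_im_pt hU hx⟩) h Finset.univ
  refine h1.trans ?_
  rw [← sum_endSingle b (endMap (C.ev hx (hU hx)) A), map_sum]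
  exact Finset.sum_congr rfl fun j _ => by
    rw [endMap_one_tmul]
    exact hh j x hx

/-- The function with given coordinate representation. -/
def fn (g : V.partHol (C.im U)) : X.O U :=
  (C.κ U hU).symm (Algebra.TensorProduct.includeLeft (S := ℂ) (B := V.oddFun) g)

theorem ev_fn (g : V.partHol (C.im U)) {x : X} (hx : x ∈ U) (hx' : x ∈ C.dom) :
    C.ev hx hx' (C.fn hU g) = algebraMap ℂ _ (g.1 ⟨C.pt x, C.mem_im_pt hU hx⟩) := by
  rw [C.ev_eq hU, fn, AlgEquiv.apply_symm_apply]
  refine (MixedSuperVectorSpace.superFunEval_tmul _ g 1).trans ?_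
  rw [Algebra.algebraMap_eq_smul_one]

/-- The constant functions with values in the exterior algebra. -/
def const : V.oddFun →ₐ[ℂ] X.O U :=
  (C.κ U hU).symm.toAlgHom.comp
    (Algebra.TensorProduct.includeRight (A := V.partHol (C.im U)) (B := V.oddFun))

theorem ev_const (l : V.oddFun) {x : X} (hx : x ∈ U) (hx' : x ∈ C.dom) :
    C.ev hx hx' (C.const hU l) = l := by
  rw [C.ev_eq hU]
  refine (congrArg _ ((C.κ U hU).apply_symm_apply _)).trans ?_
  refine (MixedSuperVectorSpace.superFunEval_tmul _ 1 l).trans ?_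
  exact one_smul _ l

/-- The exterior algebra embeds as constant functions over the chart and inherits supercommutativity
from the structure sheaf by evaluation at a point. -/
theorem isSupercomm_extPar (C : Chart X V) (hU : U ≤ C.dom) (hX : X.IsSupercommutative) {x : X} (hx : x ∈ U) :
    IsSupercomm (extPar (Module.Dual ℂ V.odd)) := by
  have hp : ∀ (r : ZMod 2) (a : V.oddFun), extPar _ a = sgn r • a →
      X.par U (C.const hU a) = sgn r • C.const hU a := fun r a ha => by
    refine C.eq_of_ev hU fun y hy => ?_
    rw [C.ev_par, C.ev_const, map_smul, C.ev_const, ha]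
  intro p q a b ha hb
  have h := congrArg (C.ev hx (hU hx)) (hX U p q _ _ (hp p a ha) (hp q b hb))
  rwa [map_mul, map_smul, map_mul, C.ev_const, C.ev_const] at h

theorem extPar_extPar {E : Type*} [AddCommGroup E] [Module ℂ E] (a : ExteriorAlgebra ℂ E) :
    extPar E (extPar E a) = a := CliffordAlgebra.involute_involute a

theorem tensor_ext_ev [FiniteDimensional ℂ W] {a b : X.O U ⊗[ℂ] W}
    (h : ∀ (x : X) (hx : x ∈ U), baseMap W (C.ev hx (hU hx)) a = baseMap W (C.ev hx (hU hx)) b) :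
    a = b :=
  eq_of_forall_repr_eq (Module.finBasis ℂ W) fun i => C.eq_of_ev hU fun x hx => by
    rw [← basis_repr_baseMap, ← basis_repr_baseMap, h]

/-- Families are rebuilt from their values: a constant endomorphism over the exterior algebra lifts
to one over `O(U)`, and the scalar coefficients lift as functions of the base coordinates. -/
theorem exists_endMap_eq_sum {ι : Type*} [Fintype ι] (g : ι → V.partHol (C.im U))
    (M : ι → Module.End V.oddFun (V.oddFun ⊗[ℂ] W)) :
    ∃ A : W →ₗ[ℂ] X.O U ⊗[ℂ] W, ∀ (x : X) (hx : x ∈ U),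
      endMap (C.ev hx (hU hx)) A = ∑ k, (g k).1 ⟨C.pt x, C.mem_im_pt hU hx⟩ • M k := by
  refine ⟨∑ k, Module.toModuleEnd ℂ (S := X.O U) (X.O U ⊗[ℂ] W) (C.fn hU (g k)) ∘ₗ
    baseMap W (C.const hU) ∘ₗ (M k).restrictScalars ℂ ∘ₗ TensorProduct.mk ℂ V.oddFun W 1,
    fun x hx => linearMap_ext_one_tmul fun w => ?_⟩
  rw [endMap_one_tmul, LinearMap.sum_apply, LinearMap.sum_apply, map_sum]
  refine Finset.sum_congr rfl fun k _ => ?_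
  have h1 : ∀ z, baseMap W (C.ev hx (hU hx)) (baseMap W (C.const hU) z) = z := fun z => by
    rw [baseMap_baseMap (P'' := AlgHom.id ℂ _) fun l => C.ev_const hU l hx (hU hx)]
    exact baseMap_of_eq_id (fun _ => rfl) z
  change baseMap W (C.ev hx (hU hx)) (C.fn hU (g k) • baseMap W (C.const hU)
    (M k (1 ⊗ₜ w))) = _
  rw [baseMap_smul, h1, C.ev_fn, LinearMap.smul_apply, algebraMap_smul]

end Chart

/-- The chain rule: the differential of `G` is complex linear, so complex linearity along `V_ℂ`
passes from the `F k` to the composition. -/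
theorem MixedSuperVectorSpace.IsPartHolOn.comp_holomorphic {V : MixedSuperVectorSpace.{u}}
    {n : ℕ} {F : Fin n → V.real → ℂ} {U : Set V.real} (hU : IsOpen U)
    (hF : ∀ k, IsPartHolOn (F k) U) {G : (Fin n → ℂ) → ℂ}
    (hG : ∀ y ∈ U, ContDiffAt ℂ ω G fun k => F k y) :
    IsPartHolOn (fun y => G fun k => F k y) U := by
  have hd : ContDiffOn ℝ ∞ (fun y k => F k y) U := contDiffOn_pi.2 fun k => (hF k).1
  refine ⟨fun y hy => ?_, fun y hy v w hv hw => ?_⟩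
  · exact ((hG y hy).of_le le_top).restrict_scalars ℝ |>.comp_contDiffWithinAt y (hd y hy)
  · have h1 : HasFDerivAt (𝕜 := ℝ) (fun y k => F k y) (ContinuousLinearMap.pi fun k =>
        fderiv ℝ (F k) y) y :=
      hasFDerivAt_pi.2 fun k => ((hF k).differentiableAt hU hy).hasFDerivAt
    have h2 := (((hG y hy).differentiableAt (by simp)).hasFDerivAt.restrictScalars ℝ).comp y h1
    have h3 := h2.fderiv
    change fderiv ℝ (fun y => G fun k => F k y) y = _ at h3
    rw [h3]
    have h4 : (ContinuousLinearMap.pi fun k => fderiv ℝ (F k) y) w =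
        Complex.I • (ContinuousLinearMap.pi fun k => fderiv ℝ (F k) y) v :=
      funext fun k => (hF k).2 y hy v w hv hw
    change fderiv ℂ G _ ((ContinuousLinearMap.pi fun k => fderiv ℝ (F k) y) w) =
      Complex.I * fderiv ℂ G _ ((ContinuousLinearMap.pi fun k => fderiv ℝ (F k) y) v)
    rw [h4, map_smul, smul_eq_mul]

end Families

/-! ### Square roots of self-adjoint families near a point -/

section SquareRoots

theorem mul_eq_one_of_mul_eq_one {E : Type*} [Ring E] [Algebra ℂ E] [FiniteDimensional ℂ E]
    {a b : E} (h : a * b = 1) : b * a = 1 := by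
  have := IsNoetherianRing.of_finite ℂ E
  exact mul_eq_one_comm.1 h

theorem end_mul_eq_one {R W : Type*} [Ring R] [Algebra ℂ R] [FiniteDimensional ℂ R]
    [AddCommGroup W] [Module ℂ W] [FiniteDimensional ℂ W] {a b : Module.End R (R ⊗[ℂ] W)}
    (h : a * b = 1) : b * a = 1 :=
  mul_eq_one_of_mul_eq_one (E := Module.End R (R ⊗[ℂ] W)) h

theorem exists_parametrization {E : Type*} [Ring E] [Algebra ℂ E] [FiniteDimensional ℂ E]
    (H : Submodule ℂ E) : ∃ (n : ℕ) (L : (Fin n → ℂ) →ₗ[ℂ] E) (φ : E →ₗ[ℂ] Fin n → ℂ),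
      (∀ y, φ (L y) = y) ∧ LinearMap.range L = H := by
  let b := Module.finBasis ℂ H
  have hL : Function.Injective (H.subtype ∘ₗ b.equivFun.symm.toLinearMap) :=
    H.injective_subtype.comp b.equivFun.symm.injective
  obtain ⟨φ, hφ⟩ := LinearMap.exists_leftInverse_of_injective _ (LinearMap.ker_eq_bot.2 hL)
  refine ⟨_, H.subtype ∘ₗ b.equivFun.symm.toLinearMap, φ, fun x => LinearMap.congr_fun hφ x, ?_⟩
  rw [LinearMap.range_comp, LinearEquiv.range, Submodule.map_top, Submodule.range_subtype]

/-- The root is a polynomial in `S`, hence self-adjoint. From `c * c = S` and `S * Y = 1` its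
inverse is `c * Y`, which is self-adjoint as the inverse of a self-adjoint endomorphism. -/
theorem exists_selfAdjoint_sqrt {V₀ V₁ : Type u} [AddCommGroup V₀] [Module ℂ V₀]
    [AddCommGroup V₁] [Module ℂ V₁] [FiniteDimensional ℂ V₀] [FiniteDimensional ℂ V₁]
    {R : Type*} [Ring R] [Algebra ℂ R] [FiniteDimensional ℂ R] {σ : R →ₐ[ℂ] R}
    {J : LinearMap.BilinForm ℂ (V₀ × V₁)} {S Y : Module.End R (R ⊗[ℂ] (V₀ × V₁))}
    (hS : S ∈ selfAdjointEnd σ J) (h : S * Y = 1) :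
    ∃ c ∈ selfAdjointEnd σ J, ∃ c' ∈ selfAdjointEnd σ J, c * c' = 1 ∧ c' * c = 1 ∧ c * c = S := by
  have hu : IsUnit S := ⟨⟨S, Y, h, end_mul_eq_one h⟩, rfl⟩
  obtain ⟨q, hq⟩ := exists_aeval_sq_eq (E := Module.End R (R ⊗[ℂ] (V₀ × V₁))) hu
  set c := Polynomial.aeval S q
  have hc : c ∈ selfAdjointEnd σ J := aeval_mem_selfAdjointEnd hS q
  have h1 : c * (c * Y) = 1 := by rw [← mul_assoc, hq, h]
  have h2 := end_mul_eq_one h1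
  exact ⟨c, hc, c * Y, inv_mem_selfAdjointEnd hc h1 h2, h1, h2, hq⟩

theorem MixedSuperVectorSpace.IsPartHolOn.mono {V : MixedSuperVectorSpace.{u}} {F : V.real → ℂ}
    {U U' : Set V.real} (hF : IsPartHolOn F U) (h : U' ⊆ U) : IsPartHolOn F U' :=
  ⟨hF.1.mono h, fun x hx => hF.2 x (h hx)⟩

namespace Chart

variable {X : SuperSpace.{u}} {V : MixedSuperVectorSpace.{u}} {V₀ V₁ : Type u} [AddCommGroup V₀]
  [Module ℂ V₀] [AddCommGroup V₁] [Module ℂ V₁] {U U' : Opens X}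

theorem isEvenMap_of_ev [FiniteDimensional ℂ V₀] [FiniteDimensional ℂ V₁] (C : Chart X V)
    (hU : U ≤ C.dom) {A : V₀ × V₁ →ₗ[ℂ] X.O U ⊗[ℂ] (V₀ × V₁)}
    (h : ∀ (x : X) (hx : x ∈ U) z, endMap (C.ev hx (hU hx)) A (tparity (extPar _) z) =
      tparity (extPar _) (endMap (C.ev hx (hU hx)) A z)) : IsEvenMap (X.par U) A :=
  fun v => C.tensor_ext_ev hU fun x hx => by
    have h1 := h x hx (1 ⊗ₜ v)
    rw [tparity_tmul, map_one, endMap_one_tmul, endMap_one_tmul] at h1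
    rw [h1]
    exact baseMap_tparity (fun a => C.ev_par hx (hU hx) a) (A v)

theorem tparity_endMap_ev (C : Chart X V) {A : V₀ × V₁ →ₗ[ℂ] X.O U ⊗[ℂ] (V₀ × V₁)}
    (hA : IsEvenMap (X.par U) A) {x : X} (hx : x ∈ U) (hx' : x ∈ C.dom) (z) :
    endMap (C.ev hx hx') A (tparity (extPar _) z) =
      tparity (extPar _) (endMap (C.ev hx hx') A z) :=
  IsEvenMap.extendScalars (LocalJet.IsEvenMap.baseMap hA fun a => C.ev_par hx hx' a) z

theorem extendScalars_eq_of_ev [FiniteDimensional ℂ V₀] [FiniteDimensional ℂ V₁] (C : Chart X V)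
    (hU : U ≤ C.dom) {A B : V₀ × V₁ →ₗ[ℂ] X.O U ⊗[ℂ] (V₀ × V₁)}
    (h : ∀ (x : X) (hx : x ∈ U),
      endMap (C.ev hx (hU hx)) A * endMap (C.ev hx (hU hx)) B = 1) (w : V₀ × V₁) :
    extendScalars A (B w) = 1 ⊗ₜ w :=
  C.tensor_ext_ev hU fun x hx => by
    have h1 := LinearMap.congr_fun (h x hx) (1 ⊗ₜ w)
    rw [Module.End.mul_apply, endMap_one_tmul, Module.End.one_apply] at h1
    rw [baseMap_extendScalars, baseMap_tmul, map_one]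
    exact h1

theorem endMap_mul_ev (C : Chart X V) {A B : V₀ × V₁ →ₗ[ℂ] X.O U ⊗[ℂ] (V₀ × V₁)}
    (h : ∀ w, extendScalars A (B w) = 1 ⊗ₜ w) {x : X} (hx : x ∈ U) (hx' : x ∈ C.dom) :
    endMap (C.ev hx hx') A * endMap (C.ev hx hx') B = 1 := by
  rw [← endMap_mul]
  exact endMap_eq_one h

theorem endMap_res (C : Chart X V) (A : V₀ × V₁ →ₗ[ℂ] X.O U ⊗[ℂ] (V₀ × V₁)) (h : U' ≤ U) {x : X}
    (hx : x ∈ U') (hx' : x ∈ C.dom) :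
    endMap (C.ev hx hx') (baseMap _ (X.res h) ∘ₗ A) = endMap (C.ev (h hx) hx') A := by
  refine linearMap_ext_one_tmul fun w => ?_
  rw [endMap_one_tmul, endMap_one_tmul, LinearMap.comp_apply]
  exact baseMap_baseMap (fun a => C.ev_res h hx hx' a) _

theorem formExt_eq_of_ev (C : Chart X V) (hU : U ≤ C.dom) {J : LinearMap.BilinForm ℂ (V₀ × V₁)}
    {a b c d : X.O U ⊗[ℂ] (V₀ × V₁)}
    (h : ∀ (x : X) (hx : x ∈ U),
      formExt (extPar _) J (baseMap _ (C.ev hx (hU hx)) a) (baseMap _ (C.ev hx (hU hx)) b) =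
      formExt (extPar _) J (baseMap _ (C.ev hx (hU hx)) c) (baseMap _ (C.ev hx (hU hx)) d)) :
    formExt (X.par U) J a b = formExt (X.par U) J c d :=
  C.eq_of_ev hU fun x hx => by
    have h1 := h x hx
    rwa [formExt_baseMap (fun a => C.ev_par hx (hU hx) a),
      formExt_baseMap (fun a => C.ev_par hx (hU hx) a)] at h1

variable {J : LinearMap.BilinForm ℂ (V₀ × V₁)}

theorem endMap_mem_selfAdjointEnd (C : Chart X V) (hX : X.IsSupercommutative) (hU : U ≤ C.dom)
    {S : V₀ × V₁ →ₗ[ℂ] X.O U ⊗[ℂ] (V₀ × V₁)} (hS : IsEvenMap (X.par U) S)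
    (hSJ : ∀ v w, formExt (X.par U) J (S v) (1 ⊗ₜ w) = formExt (X.par U) J (1 ⊗ₜ v) (S w))
    {x : X} (hx : x ∈ U) :
    endMap (C.ev hx (hU hx)) S ∈ selfAdjointEnd (extPar (Module.Dual ℂ V.odd)) J := by
  refine mem_selfAdjointEnd extPar_extPar (C.isSupercomm_extPar hU hX hx)
    (C.tparity_endMap_ev hS hx (hU hx)) fun v w => ?_
  have h := congrArg (C.ev hx (hU hx)) (hSJ v w)
  rw [← formExt_baseMap (fun a => C.ev_par hx (hU hx) a),
    ← formExt_baseMap (fun a => C.ev_par hx (hU hx) a), baseMap_tmul, baseMap_tmul, map_one] at h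
  rwa [endMap_one_tmul, endMap_one_tmul]

/-- A family of elements of a space of endomorphisms that is closed under squares and contains the
identity has a square root near a point where it is the identity. -/
theorem exists_family_sqrt [FiniteDimensional ℂ V₀] [FiniteDimensional ℂ V₁] (C : Chart X V) (hU : U ≤ C.dom) {p : X} (hp : p ∈ U)
    (H : Submodule ℂ (Module.End V.oddFun (V.oddFun ⊗[ℂ] (V₀ × V₁)))) (h1 : 1 ∈ H)
    (hH : ∀ A ∈ H, A * A ∈ H) (S : V₀ × V₁ →ₗ[ℂ] X.O U ⊗[ℂ] (V₀ × V₁))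
    (c : Module.End V.oddFun (V.oddFun ⊗[ℂ] (V₀ × V₁)))
    (hS : ∀ (x : X) (hx : x ∈ U), c * endMap (C.ev hx (hU hx)) S * c ∈ H)
    (hSp : c * endMap (C.ev hp (hU hp)) S * c = 1) :
    ∃ (U' : Opens X) (h : U' ≤ U), p ∈ U' ∧ ∃ (n : ℕ) (g : Fin n → V.partHol (C.im U'))
      (M : Fin n → Module.End V.oddFun (V.oddFun ⊗[ℂ] (V₀ × V₁))), (∀ k, M k ∈ H) ∧
      ∀ (x : X) (hx : x ∈ U'),
        (∑ k, (g k).1 ⟨C.pt x, C.mem_im_pt (h.trans hU) hx⟩ • M k) *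
          (∑ k, (g k).1 ⟨C.pt x, C.mem_im_pt (h.trans hU) hx⟩ • M k) =
        c * endMap (C.ev (h hx) (hU (h hx))) S * c := by
  obtain ⟨n, L, φ, hφL, hLr⟩ :=
    exists_parametrization (E := Module.End V.oddFun (V.oddFun ⊗[ℂ] (V₀ × V₁))) H
  have hL : Function.Injective L := Function.LeftInverse.injective hφL
  have hLH : ∀ y, L y ∈ H := fun y => by
    rw [← hLr]
    exact ⟨y, rfl⟩
  have hHL : ∀ A ∈ H, ∃ y, L y = A := fun A hA => by
    rw [← hLr] at hA
    exact hA
  obtain ⟨e, he⟩ := hHL 1 h1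
  obtain ⟨G, N, hN, heN, hG, hGL⟩ := exists_holomorphic_sqrt (L := L) hL he
    fun x => hHL _ (hH _ (hLH x))
  choose f hf using fun k => C.exists_partHol_endMap hU
    (LinearMap.proj k ∘ₗ φ ∘ₗ LinearMap.mulRight ℂ c ∘ₗ LinearMap.mulLeft ℂ c) S
  choose F hF hFf using fun k => MixedSuperVectorSpace.exists_isPartHolOn (f k)
  -- The functions `F k` are the coordinates in `H` of the normalized family `c S(x) c`, and they
  -- are partially holomorphic.
  have hFS : ∀ (x : X) (hx : x ∈ U), L (fun k => F k (C.pt x)) =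
      c * endMap (C.ev hx (hU hx)) S * c := fun x hx => by
    obtain ⟨y, hy⟩ := hHL _ (hS x hx)
    rw [← hy]
    congr 1
    funext k
    have h2 := hf k x hx
    rw [← hFf k] at h2
    refine h2.trans ?_
    change φ (c * endMap (C.ev hx (hU hx)) S * c) k = y k
    rw [← hy, hφL]
  have hFc : ContinuousOn (fun y k => F k y) (C.im U : Set V.real) :=
    continuousOn_pi.2 fun k => (hF k).1.continuousOn
  obtain ⟨U', hU', hB⟩ := C.exists_im U hU
    ⟨(C.im U : Set V.real) ∩ (fun y k => F k y) ⁻¹' N, hFc.isOpen_inter_preimage (C.im U).isOpen hN⟩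
    fun y hy => hy.1
  have hBN : ∀ y ∈ (C.im U' : Set V.real), (fun k => F k y) ∈ N := fun y hy => by
    rw [hB] at hy
    exact hy.2
  have hFU' : ∀ k, MixedSuperVectorSpace.IsPartHolOn (F k) (C.im U' : Set V.real) := fun k =>
    (hF k).mono (C.im_mono hU hU')
  have hGF : ∀ k, MixedSuperVectorSpace.IsPartHolOn (fun y => G (fun j => F j y) k)
      (C.im U' : Set V.real) := fun k =>
    MixedSuperVectorSpace.IsPartHolOn.comp_holomorphic (G := fun z => G z k) (C.im U').isOpen hFU'
      fun y hy => contDiffAt_pi.1 (hG _ (hBN y hy)) k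
  refine ⟨U', hU', ?_, _, fun k => (hGF k).toPartHol, fun k => L (Pi.single k 1),
    fun k => hLH _, fun x hx => ?_⟩
  · refine C.mem_of_pt_mem (hU'.trans hU) (hU hp) ?_
    rw [hB]
    refine ⟨C.mem_im_pt hU hp, ?_⟩
    have h2 : (fun k => F k (C.pt p)) = e := hL (by rw [hFS p hp, hSp, he])
    rw [Set.mem_preimage, h2]
    exact heN
  -- The sum is `L` applied to the holomorphic root `G` of the coordinates, expanded in the standard
  -- basis.
  · have h2 : (∑ k, ((hGF k).toPartHol).1 ⟨C.pt x, C.mem_im_pt (hU'.trans hU) hx⟩ •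
        L (Pi.single k 1)) = L (G fun j => F j (C.pt x)) := by
      conv_rhs => rw [← LinearMap.sum_single_apply (fun _ => ℂ) (G fun j => F j (C.pt x))]
      rw [map_sum]
      refine Finset.sum_congr rfl fun k _ => ?_
      rw [← map_smul]
      congr 1
      rw [← Pi.single_smul, smul_eq_mul, mul_one]
      rfl
    rw [h2, hGL _ (hBN _ (C.mem_im_pt (hU'.trans hU) hx)), hFS x (hU' hx)]

/-- Local square roots of invertible self-adjoint families. -/
theorem exists_sqrt [FiniteDimensional ℂ V₀] [FiniteDimensional ℂ V₁] (C : Chart X V) (hX : X.IsSupercommutative) (hU : U ≤ C.dom) {p : X}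
    (hp : p ∈ U) {S Y : V₀ × V₁ →ₗ[ℂ] X.O U ⊗[ℂ] (V₀ × V₁)} (hS : IsEvenMap (X.par U) S)
    (hSY : ∀ w, extendScalars S (Y w) = 1 ⊗ₜ w)
    (hSJ : ∀ v w, formExt (X.par U) J (S v) (1 ⊗ₜ w) = formExt (X.par U) J (1 ⊗ₜ v) (S w)) :
    ∃ (U' : Opens X) (h : U' ≤ U), p ∈ U' ∧ ∃ ρ ρ' : V₀ × V₁ →ₗ[ℂ] X.O U' ⊗[ℂ] (V₀ × V₁),
      IsEvenMap (X.par U') ρ ∧ IsEvenMap (X.par U') ρ' ∧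
      (∀ w, extendScalars ρ (ρ' w) = 1 ⊗ₜ w) ∧ (∀ w, extendScalars ρ' (ρ w) = 1 ⊗ₜ w) ∧
      ∀ v w, formExt (X.par U') J (ρ v) (ρ w) =
        formExt (X.par U') J (1 ⊗ₜ v) (baseMap _ (X.res h) (S w)) := by
  have hSx := fun (x : X) (hx : x ∈ U) => C.endMap_mem_selfAdjointEnd hX hU hS hSJ hx
  have hSYx := fun (x : X) (hx : x ∈ U) => C.endMap_mul_ev hSY hx (hU hx)
  -- With `c² = S(p)`, the family `c⁻¹ S(x) c⁻¹` is self-adjoint and equals `1` at `p`, where the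
  -- holomorphic root exists.
  obtain ⟨c, hc, c', hc', hcc', hc'c, hccS⟩ := exists_selfAdjoint_sqrt (hSx p hp) (hSYx p hp)
  obtain ⟨U', hU', hpU', n, g, M, hM, hgM⟩ := C.exists_family_sqrt hU hp
    (selfAdjointEnd (extPar (Module.Dual ℂ V.odd)) J) one_mem_selfAdjointEnd
    (fun A hA => mul_mem_selfAdjointEnd hA hA rfl) S c'
    (fun x hx => mul_mul_mem_selfAdjointEnd hc' (hSx x hx)) (by
      rw [← hccS, ← mul_assoc, hc'c, one_mul, hcc'])
  have hUd := hU'.trans hU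
  let r : ∀ x ∈ U', Module.End V.oddFun (V.oddFun ⊗[ℂ] (V₀ × V₁)) := fun x hx =>
    ∑ k, (g k).1 ⟨C.pt x, C.mem_im_pt hUd hx⟩ • M k
  have hr : ∀ x hx, r x hx ∈ selfAdjointEnd (extPar (Module.Dual ℂ V.odd)) J := fun x hx =>
    Submodule.sum_mem _ fun k _ => Submodule.smul_mem _ _ (hM k)
  -- With `r²` the normalized family, take `ρ = r c`. Its adjoint is `c r`, and `c r r c = S`. No
  -- commutation of `r` with `c` is needed.
  obtain ⟨ρ, hρ⟩ := C.exists_endMap_eq_sum hUd g fun k => M k * c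
  obtain ⟨ρ₁, hρ₁⟩ := C.exists_endMap_eq_sum hUd g fun k => c * M k
  have hρ' : ∀ x (hx : x ∈ U'), endMap (C.ev hx (hUd hx)) ρ = r x hx * c := fun x hx => by
    rw [hρ, Finset.sum_mul]
    exact Finset.sum_congr rfl fun k _ => (smul_mul_assoc _ _ _).symm
  have hρ₁' : ∀ x (hx : x ∈ U'), endMap (C.ev hx (hUd hx)) ρ₁ = c * r x hx := fun x hx => by
    rw [hρ₁, Finset.mul_sum]
    exact Finset.sum_congr rfl fun k _ => (mul_smul_comm _ _ _).symm
  have hS' : ∀ x (hx : x ∈ U'), endMap (C.ev (hU' hx) (hUd hx)) S = c * r x hx * (r x hx * c) :=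
    fun x hx => by
    rw [mul_assoc, ← mul_assoc (r x hx), hgM x hx]
    have h3 : c * (c' * endMap (C.ev (hU' hx) (hUd hx)) S * c' * c) =
        (c * c') * endMap (C.ev (hU' hx) (hUd hx)) S * (c' * c) := by noncomm_ring
    rw [h3, hcc', hc'c, one_mul, mul_one]
  -- The inverse of `ρ` is `Y c r`, because `Y c r r c = Y S = 1`.
  let ρ₂ := (extendScalars (baseMap _ (X.res hU') ∘ₗ Y)).restrictScalars ℂ ∘ₗ ρ₁
  have hρ₂ : ∀ x (hx : x ∈ U'), endMap (C.ev hx (hUd hx)) ρ₂ =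
      endMap (C.ev (hU' hx) (hUd hx)) Y * (c * r x hx) := fun x hx => by
    rw [endMap_mul, C.endMap_res Y hU' hx (hUd hx), hρ₁' x hx]
  have h21 : ∀ x (hx : x ∈ U'), endMap (C.ev hx (hUd hx)) ρ₂ * endMap (C.ev hx (hUd hx)) ρ = 1 :=
    fun x hx => by
    rw [hρ₂ x hx, hρ' x hx, mul_assoc, ← hS' x hx]
    exact end_mul_eq_one (hSYx x (hU' hx))
  have h12 : ∀ x (hx : x ∈ U'), endMap (C.ev hx (hUd hx)) ρ * endMap (C.ev hx (hUd hx)) ρ₂ = 1 :=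
    fun x hx => end_mul_eq_one (h21 x hx)
  have hev : ∀ x (hx : x ∈ U') z, endMap (C.ev hx (hUd hx)) ρ (tparity (extPar _) z) =
      tparity (extPar _) (endMap (C.ev hx (hUd hx)) ρ z) := fun x hx z => by
    rw [hρ' x hx, Module.End.mul_apply, hc.1, (hr x hx).1, Module.End.mul_apply]
  refine ⟨U', hU', hpU', ρ, ρ₂, C.isEvenMap_of_ev hUd hev, C.isEvenMap_of_ev hUd fun x hx z => ?_,
    C.extendScalars_eq_of_ev hUd h12, C.extendScalars_eq_of_ev hUd h21, fun v w => ?_⟩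
  · have h3 : ∀ z, endMap (C.ev hx (hUd hx)) ρ (endMap (C.ev hx (hUd hx)) ρ₂ z) = z :=
      LinearMap.congr_fun (h12 x hx)
    have h4 : ∀ z, endMap (C.ev hx (hUd hx)) ρ₂ (endMap (C.ev hx (hUd hx)) ρ z) = z :=
      LinearMap.congr_fun (h21 x hx)
    conv_lhs => rw [← h3 z, ← hev, h4]
  · refine C.formExt_eq_of_ev hUd fun x hx => ?_
    have hb := baseMap_baseMap (W := V₀ × V₁) (fun a => C.ev_res hU' hx (hUd hx) a) (S w)
    rw [hb, ← endMap_one_tmul, ← endMap_one_tmul, ← endMap_one_tmul, hρ' x hx, hS' x hx, baseMap_tmul,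
      map_one]
    simp only [Module.End.mul_apply]
    rw [(hr x hx).2, hc.2]

end Chart

end SquareRoots

/-! ### Open subspaces and lifts through open immersions -/

section OpenSubspaces

namespace SuperSpace

variable {X Y Z T U : SuperSpace.{u}}

theorem Hom.ext {f g : Hom X Y} (hb : f.base = g.base)
    (h : ∀ (W : Opens Y) (U : Opens X) (hf : Set.MapsTo f.base U W) (hg : Set.MapsTo g.base U W) (a : Y.O W),
      f.pull W U hf a = g.pull W U hg a) : f = g := by
  obtain ⟨b, p, h1, h2, h3⟩ := f
  obtain ⟨b', p', h1', h2', h3'⟩ := g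
  obtain rfl : b = b' := hb
  obtain rfl : p = p' := by
    funext W U hU
    exact AlgHom.ext fun a => h W U hU hU a
  rfl

theorem Hom.comp_id (f : Hom X Y) : f.comp (Hom.id Y) = f :=
  Hom.ext rfl fun W U hf hg a => by
    rw [Hom.comp_pull f (Hom.id Y) W W U hf (fun _ hx => hx) hg]
    exact congrArg _ (Y.res_self _ a)

namespace Hom.IsOpenImmersion

variable {j : Hom U X}

/-- The image of an open set. -/
def image (hj : j.IsOpenImmersion) (W : Opens U) : Opens X :=
  ⟨j.base '' W, hj.isOpenEmbedding.isOpenMap _ W.isOpen⟩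

theorem mapsTo_image (hj : j.IsOpenImmersion) (W : Opens U) :
    Set.MapsTo j.base W (hj.image W) := fun x hx => ⟨x, hx, rfl⟩

theorem pre_image_le (hj : j.IsOpenImmersion) (W : Opens U) : j.pre (hj.image W) ≤ W := by
  rintro z ⟨z', hz', hzz⟩
  rwa [← hj.isOpenEmbedding.injective hzz]

theorem image_mono (hj : j.IsOpenImmersion) {W W' : Opens U} (h : W' ≤ W) :
    hj.image W' ≤ hj.image W := Set.image_mono h

theorem bijective_image (hj : j.IsOpenImmersion) (W : Opens U) :
    Function.Bijective (j.pull (hj.image W) W (hj.mapsTo_image W)) := by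
  refine hj.bijective_pull (hj.mapsTo_image W) (hj.pre_image_le W) ?_
  rintro _ ⟨z, _, rfl⟩
  exact ⟨z, rfl⟩

theorem comp {k : Hom T U} (hk : k.IsOpenImmersion) (hj : j.IsOpenImmersion) :
    (k.comp j).IsOpenImmersion where
  isOpenEmbedding := hj.isOpenEmbedding.comp hk.isOpenEmbedding
  bijective W hW := by
    have hW' : (W : Set X) ⊆ Set.range j.base := fun x hx => by
      obtain ⟨z, rfl⟩ := hW hx
      exact ⟨_, rfl⟩
    refine (hk.bijective (j.pre W) fun x hx => ?_).comp (hj.bijective W hW')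
    obtain ⟨z, hz⟩ := hW (show j.base x ∈ W from hx)
    exact ⟨z, hj.isOpenEmbedding.injective hz⟩

theorem of_comp {k : Hom T U} (hj : j.IsOpenImmersion) (h : (k.comp j).IsOpenImmersion) :
    k.IsOpenImmersion where
  isOpenEmbedding := Topology.IsOpenEmbedding.of_comp _ hj.isOpenEmbedding h.isOpenEmbedding
  bijective W hW := by
    have h1 : Set.MapsTo (k.comp j).base (k.pre W) (hj.image W) := fun x hx => ⟨_, hx, rfl⟩
    have h2 : Function.Bijective ((k.comp j).pull (hj.image W) (k.pre W) h1) := by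
      refine h.bijective_pull h1 (fun x hx => hj.pre_image_le W hx) ?_
      rintro _ ⟨x, hx, rfl⟩
      obtain ⟨z, rfl⟩ := hW hx
      exact ⟨z, rfl⟩
    have h3 : ⇑((k.comp j).pull (hj.image W) (k.pre W) h1) =
        k.pull W (k.pre W) (k.mapsTo_pre W) ∘ j.pull (hj.image W) W (hj.mapsTo_image W) :=
      funext fun a => Hom.comp_pull k j _ _ _ h1 (hj.mapsTo_image W) (k.mapsTo_pre W) a
    rw [h3] at h2
    exact (Function.Bijective.of_comp_iff _ (hj.bijective_image W)).1 h2

/-- A morphism whose image lies in the image of an open immersion factors through it. -/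
theorem exists_lift (hj : j.IsOpenImmersion) (f : Hom T X)
    (h : Set.range f.base ⊆ Set.range j.base) : ∃ k : Hom T U, k.comp j = f := by
  have h0 : ∀ t, ∃ z, j.base z = f.base t := fun t => h ⟨t, rfl⟩
  choose b hb using h0
  have hbc : Continuous b := by
    rw [hj.isOpenEmbedding.isInducing.continuous_iff]
    exact (funext hb : j.base ∘ b = f.base) ▸ f.base.continuous
  -- Functions on `U` are functions on the image in `X`; the lift pulls these back along `f`.
  let e : ∀ W : Opens U, X.O (hj.image W) ≃ₐ[ℂ] U.O W := fun W =>
    AlgEquiv.ofBijective (j.pull (hj.image W) W (hj.mapsTo_image W)) (hj.bijective_image W)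
  have he : ∀ W a, (e W).symm (j.pull (hj.image W) W (hj.mapsTo_image W) a) = a := fun W a =>
    (e W).symm_apply_apply a
  have he' : ∀ W a, j.pull (hj.image W) W (hj.mapsTo_image W) ((e W).symm a) = a := fun W a =>
    (e W).apply_symm_apply a
  have hm : ∀ (W : Opens U) (Q : Opens T), Set.MapsTo b Q W →
      Set.MapsTo f.base Q (hj.image W) := fun W Q hQ t ht => ⟨b t, hQ ht, hb t⟩
  have he_res : ∀ {W W' : Opens U} (hW : W' ≤ W) a, (e W').symm (U.res hW a) =
      X.res (hj.image_mono hW) ((e W).symm a) := fun {W W'} hW a => by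
    apply (e W').injective
    rw [AlgEquiv.apply_symm_apply]
    refine Eq.trans ?_ (j.pull_res (hj.image_mono hW) hW (hj.mapsTo_image W)
      (hj.mapsTo_image W') ((e W).symm a)).symm
    rw [he']
  let k : Hom T U :=
    { base := ⟨b, hbc⟩
      pull := fun W Q hQ => (f.pull (hj.image W) Q (hm W Q hQ)).comp (e W).symm.toAlgHom
      pull_res := fun {W W' Q Q'} hW hQ h h' a => by
        refine (congrArg _ (he_res hW a)).trans ?_
        exact f.pull_res (hj.image_mono hW) hQ (hm W Q h) (hm W' Q' h') _
      pull_par := fun W Q hQ a => by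
        have h1 : (e W).symm (U.par W a) = X.par _ ((e W).symm a) := ?_
        · exact (congrArg _ h1).trans (f.pull_par _ _ (hm W Q hQ) ((e W).symm a))
        apply (e W).injective
        refine ((e W).apply_symm_apply _).trans ?_
        refine Eq.trans ?_ (j.pull_par _ _ (hj.mapsTo_image W) ((e W).symm a)).symm
        rw [he']
      isLocal := fun W a t ⟨Q, hQ, ht, hu⟩ => by
        obtain ⟨W', hW', htW, hu'⟩ := f.isLocal (hj.image W) ((e W).symm a) t
          ⟨Q, hm W Q hQ, ht, hu⟩
        have hle : j.pre W' ≤ W := fun x hx => hj.pre_image_le W (hW' hx)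
        refine ⟨j.pre W', hle, ?_, ?_⟩
        · change j.base (b t) ∈ W'
          rwa [hb]
        · have h2 := j.pull_res hW' hle (hj.mapsTo_image W) (j.mapsTo_pre W') ((e W).symm a)
          rw [he'] at h2
          rw [← h2]
          exact hu'.map _ }
  refine ⟨k, Hom.ext (ContinuousMap.ext hb) fun W Q hk hf a => ?_⟩
  have hQ : Set.MapsTo k.base Q (j.pre W) := hk
  rw [Hom.comp_pull k j W (j.pre W) Q hk (j.mapsTo_pre W) hQ]
  change f.pull (hj.image (j.pre W)) Q _ ((e (j.pre W)).symm _) = _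
  have hle : hj.image (j.pre W) ≤ W := by
    rintro _ ⟨z, hz, rfl⟩
    exact hz
  have h1 : j.pull W (j.pre W) (j.mapsTo_pre W) a = j.pull (hj.image (j.pre W)) (j.pre W)
      (hj.mapsTo_image _) (X.res hle a) :=
    ((j.pull_res hle le_rfl (j.mapsTo_pre W) (hj.mapsTo_image _) a).trans (U.res_self _ _)).symm
  rw [h1, he, f.pull_res hle le_rfl hf, T.res_self]

end Hom.IsOpenImmersion

/-- The image in `X` of an open subset of an open subset. -/
def opensImage {W : Opens X} (Q : Opens W) : Opens X :=
  ⟨Subtype.val '' (Q : Set W), W.isOpen.isOpenMap_subtype_val _ Q.isOpen⟩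

theorem opensImage_mono {W : Opens X} {Q Q' : Opens W} (h : Q' ≤ Q) :
    opensImage Q' ≤ opensImage Q := Set.image_mono h

/-- The open subspace with underlying space `W`. -/
def restrict (X : SuperSpace.{u}) (W : Opens X) : SuperSpace.{u} where
  carrier := W
  O Q := X.O (opensImage Q)
  res h := X.res (opensImage_mono h)
  res_self _ a := X.res_self _ a
  res_res _ _ a := X.res_res _ _ a
  par Q := X.par (opensImage Q)
  par_par _ a := X.par_par _ a
  par_res _ a := X.par_res _ a

/-- The inclusion of an open subspace. -/
def ι (X : SuperSpace.{u}) (W : Opens X) : Hom (X.restrict W) X where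
  base := ⟨Subtype.val, continuous_subtype_val⟩
  pull Q Q' h := X.res (show opensImage Q' ≤ Q by
    rintro _ ⟨x, hx, rfl⟩
    exact h hx)
  pull_res hW hU h h' a := by
    change X.res _ (X.res _ a) = X.res _ (X.res _ a)
    rw [X.res_res, X.res_res]
  pull_par Q Q' h a := (X.par_res _ a).symm
  isLocal := fun Q a t ⟨Q', h, ht, hu⟩ => ⟨opensImage Q', by
    rintro _ ⟨x, hx, rfl⟩
    exact h hx, ⟨t, ht, rfl⟩, hu⟩

theorem range_ι (W : Opens X) : Set.range (X.ι W).base = W := Subtype.range_val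

theorem isOpenImmersion_ι (W : Opens X) : (X.ι W).IsOpenImmersion where
  isOpenEmbedding := W.isOpen.isOpenEmbedding_subtypeVal
  bijective Q hQ := by
    have h : opensImage ((X.ι W).pre Q) = Q := by
      refine Opens.ext (Set.ext fun x => ⟨?_, fun hx => ?_⟩)
      · rintro ⟨z, hz, rfl⟩
        exact hz
      · obtain ⟨z, rfl⟩ := hQ hx
        exact ⟨z, hx, rfl⟩
    have key : ∀ (Q' : Opens X) (e : Q' = Q) (hle : Q' ≤ Q), Function.Bijective (X.res hle) := by
      rintro _ rfl hle
      rw [show ⇑(X.res hle) = id from funext (X.res_self hle)]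
      exact Function.bijective_id
    exact key _ h _

/-- Open subspaces of open subspaces of the models. -/
theorem isModelledAt_restrict {V : MixedSuperVectorSpace.{u}} (W : Opens X) (m : X.restrict W)
    (h : X.IsModelledAt V ((X.ι W).base m)) : (X.restrict W).IsModelledAt V m := by
  obtain ⟨Z, a, b, ha, hb, z, hz⟩ := h
  have hi := isOpenImmersion_ι (b.pre W)
  obtain ⟨k, hk⟩ := (isOpenImmersion_ι W).exists_lift ((Z.ι (b.pre W)).comp b) (by
    rw [range_ι]
    rintro _ ⟨y, rfl⟩
    exact y.2)
  have hkb := hi.comp hb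
  rw [← hk] at hkb
  have hzW : z ∈ b.pre W := by
    change b.base z ∈ W
    rw [hz]
    exact m.2
  refine ⟨Z.restrict (b.pre W), (Z.ι _).comp a, k, hi.comp ha,
    (isOpenImmersion_ι W).of_comp hkb, ⟨z, hzW⟩, Subtype.ext ?_⟩
  have h1 := congrArg (fun f : Hom (Z.restrict (b.pre W)) X => f.base ⟨z, hzW⟩) hk
  exact h1.trans hz

end SuperSpace

/-- The open submanifold with underlying space `W`. -/
def MixedSupermanifold.restrict (M : MixedSupermanifold.{u}) (W : Opens M.toSuperSpace) :
    MixedSupermanifold.{u} where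
  toSuperSpace := M.toSuperSpace.restrict W
  isSheaf := fun I Q s hs => by
    refine M.isSheaf.glue (U := opensImage (⨆ i, Q i)) (fun i => opensImage (Q i))
      (fun i => opensImage_mono (le_iSup Q i)) ?_ s fun i j => ?_
    · rintro _ ⟨x, hx, rfl⟩
      obtain ⟨i, hi⟩ := Opens.mem_iSup.1 hx
      exact ⟨i, x, hi, rfl⟩
    · have hle : opensImage (Q i) ⊓ opensImage (Q j) ≤ opensImage (Q i ⊓ Q j) := by
        rintro _ ⟨⟨x, hx, rfl⟩, ⟨y, hy, hxy⟩⟩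
        obtain rfl : y = x := Subtype.ext hxy
        exact ⟨y, ⟨hx, hy⟩, rfl⟩
      have h := congrArg (M.res hle) (hs i j)
      exact (M.res_res _ _ _).symm.trans (h.trans (M.res_res _ _ _))
  isSupercommutative := fun Q p q a b => M.isSupercommutative (opensImage Q) p q a b
  t2 := by
    have := M.t2
    exact inferInstanceAs (T2Space W)
  secondCountable := by
    have := M.secondCountable
    exact inferInstanceAs (SecondCountableTopology W)
  locallyModelled := fun m => by
    obtain ⟨V, hV⟩ := M.locallyModelled ((M.ι W).base m)
    exact ⟨V, isModelledAt_restrict W m hV⟩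

/-- The inclusion of an open submanifold. -/
def MixedSupermanifold.incl (M : MixedSupermanifold.{u}) (W : Opens M.toSuperSpace) :
    Hom (M.restrict W).toSuperSpace M.toSuperSpace := M.toSuperSpace.ι W

theorem MixedSupermanifold.isOpenImmersion_incl (M : MixedSupermanifold.{u})
    (W : Opens M.toSuperSpace) : (M.incl W).IsOpenImmersion := isOpenImmersion_ι W

theorem MixedSupermanifold.range_incl (M : MixedSupermanifold.{u}) (W : Opens M.toSuperSpace) :
    Set.range (M.incl W).base = W := range_ι W

end OpenSubspaces

/-! ### Forms and frames -/

section Forms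

variable {S T M : MixedSupermanifold.{u}} {V₀ V₁ : Type u} [AddCommGroup V₀] [Module ℂ V₀]
  [AddCommGroup V₁] [Module ℂ V₁] {f : Hom T.toSuperSpace M.toSuperSpace}
  {U U' U'' : Opens T.toSuperSpace}

namespace SuperForm

theorem apply_add_right (B : SuperForm f) {X Y Y₀ Y₁ : Der f U} (h : Y.1 = Y₀.1 + Y₁.1) :
    B.form U X Y = B.form U X Y₀ + B.form U X Y₁ := by
  rw [← map_add]
  exact congrArg _ (Subtype.ext h)

theorem apply_add_left (B : SuperForm f) {X Y Y₀ Y₁ : Der f U} (h : Y.1 = Y₀.1 + Y₁.1) :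
    B.form U Y X = B.form U Y₀ X + B.form U Y₁ X := by
  rw [← LinearMap.add_apply, ← map_add]
  exact congrArg (fun Z => B.form U Z X) (Subtype.ext h)

theorem apply_of_mem_zero (B : SuperForm f) {X : Der f U} (hX : X.1 ∈ homDer f U 0)
    (Y : Der f U) : B.form U X Y = B.form U Y X := by
  obtain ⟨Y₀, h0, Y₁, h1, e⟩ := exists_of_mem_Der Y.2
  let Z₀ : Der f U := ⟨Y₀, homDer_le _ _ _ h0⟩
  let Z₁ : Der f U := ⟨Y₁, homDer_le _ _ _ h1⟩
  rw [B.apply_add_right (Y₀ := Z₀) (Y₁ := Z₁) e.symm, B.apply_add_left (Y₀ := Z₀) (Y₁ := Z₁) e.symm,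
    B.supersymmetric U 0 0 X Z₀ hX h0, B.supersymmetric U 0 1 X Z₁ hX h1, zero_mul, zero_mul,
    sgn_zero, one_smul, one_smul]

/-- Exchanging the arguments against an odd `X` costs the parity sign of the homogeneous components
of `Y`, which is the conjugation `parConj`. It turns linearity in the first argument into the signed
rule in the second. -/
theorem apply_of_mem_one (B : SuperForm f) {X : Der f U} (hX : X.1 ∈ homDer f U 1)
    (Y Y' : Der f U) (hY : Y'.1 = parConj f U Y.1) : B.form U X Y = B.form U Y' X := by
  obtain ⟨Y₀, h0, Y₁, h1, e⟩ := exists_of_mem_Der Y.2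
  let Z₀ : Der f U := ⟨Y₀, homDer_le _ _ _ h0⟩
  let Z₁ : Der f U := ⟨Y₁, homDer_le _ _ _ h1⟩
  have e' : Y'.1 = Z₀.1 + (-Z₁ : Der f U).1 := by
    rw [hY, ← e, map_add, parConj_of_mem_zero h0, parConj_of_mem_one h1]
    rfl
  rw [B.apply_add_right (Y₀ := Z₀) (Y₁ := Z₁) e.symm, B.apply_add_left (Y₀ := Z₀) (Y₁ := -Z₁) e',
    B.supersymmetric U 1 0 X Z₀ hX h0, B.supersymmetric U 1 1 X Z₁ hX h1, mul_zero, mul_one,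
    sgn_zero, sgn_one, one_smul, neg_one_smul]
  exact congrArg _ (LinearMap.map_neg₂ (B.form U) Z₁ X).symm

theorem apply_mul_of_mem_zero (B : SuperForm f) {X : Der f U} (hX : X.1 ∈ homDer f U 0)
    {Y Y' : Der f U} {a : T.O U} (h : Y'.1 = preDerMul f U a Y.1) :
    B.form U X Y' = a * B.form U X Y := by
  rw [B.apply_of_mem_zero hX, B.form_mul U a Y Y' X h, B.apply_of_mem_zero hX]

theorem apply_mul_of_mem_one (B : SuperForm f) {X : Der f U} (hX : X.1 ∈ homDer f U 1)
    {Y Y' : Der f U} {a : T.O U} (h : Y'.1 = preDerMul f U a Y.1) :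
    B.form U X Y' = T.par U a * B.form U X Y := by
  let Z : Der f U := ⟨parConj f U Y.1, parConj_mem Y.2⟩
  let Z' : Der f U := ⟨parConj f U Y'.1, parConj_mem Y'.2⟩
  rw [B.apply_of_mem_one hX Y' Z' rfl, B.apply_of_mem_one hX Y Z rfl,
    B.form_mul U (T.par U a) Z Z' X]
  change parConj f U Y'.1 = _
  rw [h, parConj_preDerMul]

end SuperForm

/-- The sections of the pulled back tangent bundle with given coordinates. -/
def LocalJet.sec (ψ : LocalJet f U V₀ V₁) (h : U' ≤ U) : T.O U' ⊗[ℂ] (V₀ × V₁) →ₗ[ℂ] Der f U' :=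
  (ψ.secs h).codRestrict (Der f U') (ψ.secs_mem_Der T.isSupercommutative h)

theorem LocalJet.sec_val (ψ : LocalJet f U V₀ V₁) (h : U' ≤ U) (x : T.O U' ⊗[ℂ] (V₀ × V₁)) :
    (ψ.sec h x).1 = ψ.secs h x := rfl

theorem SuperForm.isSuperBilin (B : SuperForm f) (ψ : LocalJet f U V₀ V₁) (h : U' ≤ U) :
    IsSuperBilin (T.par U') ((B.form U').compl₁₂ (ψ.sec h) (ψ.sec h)) where
  smul_left r x y := B.form_mul U' r (ψ.sec h x) _ _ (ψ.secs_smul h r x)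
  smul_inl v r y := by
    refine B.apply_mul_of_mem_zero ?_ (ψ.secs_smul h r y)
    rw [LocalJet.sec_val, LocalJet.secs_one_tmul]
    exact preDerRes_mem f h 0 (ψ.val_mem 0 _ (isHomogeneous_inl v))
  smul_inr v r y := by
    refine B.apply_mul_of_mem_one ?_ (ψ.secs_smul h r y)
    rw [LocalJet.sec_val, LocalJet.secs_one_tmul]
    exact preDerRes_mem f h 1 (ψ.val_mem 1 _ (isHomogeneous_inr v))

/-- The frame `ψ` is orthonormal for `B`. -/
def SuperForm.IsOrthonormalOn (B : SuperForm f) (J : LinearMap.BilinForm ℂ (V₀ × V₁))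
    (ψ : LocalJet f U V₀ V₁) : Prop :=
  ∀ (v w : V₀ × V₁) (X Y : Der f U), X.1 = ψ.val v → Y.1 = ψ.val w →
    B.form U X Y = algebraMap ℂ (T.O U) (J v w)

theorem LocalJet.sec_one_tmul_val (ψ : LocalJet f U V₀ V₁) (h : U' ≤ U) (v : V₀ × V₁) :
    (ψ.sec h (1 ⊗ₜ v)).1 = preDerRes f h (ψ.sec le_rfl (1 ⊗ₜ v)).1 := by
  rw [sec_val, sec_val, secs_one_tmul, secs_one_tmul]
  rfl

variable {J : LinearMap.BilinForm ℂ (V₀ × V₁)}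

theorem SuperForm.IsOrthonormalOn.form_eq {B : SuperForm f} {ψ : LocalJet f U V₀ V₁}
    (hB : B.IsOrthonormalOn J ψ) (h : U' ≤ U) {X Y : Der f U'} {x y : T.O U' ⊗[ℂ] (V₀ × V₁)}
    (hx : ψ.secs h x = X.1) (hy : ψ.secs h y = Y.1) :
    B.form U' X Y = formExt (T.par U') J x y := by
  obtain rfl : ψ.sec h x = X := Subtype.ext hx
  obtain rfl : ψ.sec h y = Y := Subtype.ext hy
  refine (B.isSuperBilin ψ h).ext isSuperBilin_formExt (fun v w => ?_) x y
  change B.form U' (ψ.sec h (1 ⊗ₜ v)) (ψ.sec h (1 ⊗ₜ w)) = _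
  rw [B.form_res h _ _ _ _ (ψ.sec_one_tmul_val h v) (ψ.sec_one_tmul_val h w),
    hB v w _ _ (ψ.secs_one_tmul le_rfl v) (ψ.secs_one_tmul le_rfl w), AlgHom.commutes,
    formExt_one_tmul]

/-- Forms are determined by their values on a frame. -/
theorem SuperForm.eq_of_frame {B B' : SuperForm f} {ψ : LocalJet f U V₀ V₁} (hψ : ψ.IsFrame)
    (hB : ∀ v w, B.form U (ψ.sec le_rfl (1 ⊗ₜ v)) (ψ.sec le_rfl (1 ⊗ₜ w)) =
      B'.form U (ψ.sec le_rfl (1 ⊗ₜ v)) (ψ.sec le_rfl (1 ⊗ₜ w))) (h : U' ≤ U) (X Y : Der f U') :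
    B.form U' X Y = B'.form U' X Y := by
  obtain ⟨x, hx⟩ := hψ.exists_secs h X.2
  obtain ⟨y, hy⟩ := hψ.exists_secs h Y.2
  obtain rfl : ψ.sec h x = X := Subtype.ext hx
  obtain rfl : ψ.sec h y = Y := Subtype.ext hy
  refine (B.isSuperBilin ψ h).ext (B'.isSuperBilin ψ h) (fun v w => ?_) x y
  change B.form U' (ψ.sec h (1 ⊗ₜ v)) (ψ.sec h (1 ⊗ₜ w)) =
    B'.form U' (ψ.sec h (1 ⊗ₜ v)) (ψ.sec h (1 ⊗ₜ w))
  rw [B.form_res h _ _ _ _ (ψ.sec_one_tmul_val h v) (ψ.sec_one_tmul_val h w),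
    B'.form_res h _ _ _ _ (ψ.sec_one_tmul_val h v) (ψ.sec_one_tmul_val h w), hB]

theorem LocalJet.coord_eq_baseMap (ψ : LocalJet f U V₀ V₁) (hψ : ψ.IsFrame) (h : U' ≤ U)
    (h' : U'' ≤ U') {X : Der f U'} {X' : Der f U''} (hX : X'.1 = preDerRes f h' X.1) :
    ψ.coord hψ (h'.trans h) X' = baseMap _ (T.res h') (ψ.coord hψ h X) :=
  ψ.coord_eq hψ _ (by rw [ψ.secs_res h h', ψ.secs_coord, hX])

theorem LocalJet.coord_eq_smul (ψ : LocalJet f U V₀ V₁) (hψ : ψ.IsFrame) (h : U' ≤ U)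
    {X X' : Der f U'} {a : T.O U'} (hX : X'.1 = preDerMul f U' a X.1) :
    ψ.coord hψ h X' = a • ψ.coord hψ h X :=
  ψ.coord_eq hψ _ (by rw [ψ.secs_smul h, ψ.secs_coord, hX])

theorem LocalJet.tparity_coord (ψ : LocalJet f U V₀ V₁) (hψ : ψ.IsFrame) (h : U' ≤ U)
    {p : ZMod 2} {X : Der f U'} (hX : X.1 ∈ homDer f U' p) :
    tparity (T.par U') (ψ.coord hψ h X) = sgn p • ψ.coord hψ h X :=
  hψ.tparity_eq h (by rwa [ψ.secs_coord])

/-- The form for which a given global frame is orthonormal. -/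
def frameForm (hJ : IsEvenMetricForm J) (ψ : LocalJet f ⊤ V₀ V₁) (hψ : ψ.IsFrame) :
    SuperForm f where
  form U := (formExt (T.par U) J).compl₁₂ (ψ.coord hψ le_top).toLinearMap
    (ψ.coord hψ le_top).toLinearMap
  form_res h X Y X' Y' hX hY := by
    change formExt _ J (ψ.coord hψ le_top X') (ψ.coord hψ le_top Y') =
      T.res h (formExt _ J (ψ.coord hψ le_top X) (ψ.coord hψ le_top Y))
    rw [ψ.coord_eq_baseMap hψ le_top h hX, ψ.coord_eq_baseMap hψ le_top h hY]
    exact formExt_baseMap (fun a => (T.par_res h a).symm) _ _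
  form_mul U a X X' Y hX := by
    change formExt _ J (ψ.coord hψ le_top X') (ψ.coord hψ le_top Y) =
      a * formExt _ J (ψ.coord hψ le_top X) (ψ.coord hψ le_top Y)
    rw [ψ.coord_eq_smul hψ le_top hX, formExt_smul_left]
  even U p q X Y hX hY := by
    change T.par U (formExt _ J (ψ.coord hψ le_top X) (ψ.coord hψ le_top Y)) =
      sgn (p + q) • formExt _ J (ψ.coord hψ le_top X) (ψ.coord hψ le_top Y)
    rw [← formExt_parity hJ, ψ.tparity_coord hψ le_top hX, ψ.tparity_coord hψ le_top hY, map_smul,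
      map_smul, LinearMap.smul_apply, smul_smul, sgn_add, mul_comm]
  supersymmetric U p q X Y hX hY :=
    formExt_supersymmetric (T.par_par U) (T.isSupercommutative U) hJ
      (ψ.tparity_coord hψ le_top hX) (ψ.tparity_coord hψ le_top hY)

theorem frameForm_eq (hJ : IsEvenMetricForm J) {ψ : LocalJet f ⊤ V₀ V₁} (hψ : ψ.IsFrame)
    {X Y : Der f U} {x y : T.O U ⊗[ℂ] (V₀ × V₁)} (hx : ψ.secs le_top x = X.1)
    (hy : ψ.secs le_top y = Y.1) :
    (frameForm hJ ψ hψ).form U X Y = formExt (T.par U) J x y := by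
  change formExt _ J (ψ.coord hψ le_top X) (ψ.coord hψ le_top Y) = _
  rw [ψ.coord_eq hψ le_top hx, ψ.coord_eq hψ le_top hy]

theorem isOrthonormalOn_frameForm (hJ : IsEvenMetricForm J) {ψ : LocalJet f ⊤ V₀ V₁}
    (hψ : ψ.IsFrame) : (frameForm hJ ψ hψ).IsOrthonormalOn J ψ := fun v w X Y hX hY => by
  rw [frameForm_eq hJ hψ ((ψ.secs_one_tmul le_top v).trans hX.symm)
    ((ψ.secs_one_tmul le_top w).trans hY.symm), formExt_one_tmul]

theorem SuperForm.IsOrthonormalOn.eq_frameForm (hJ : IsEvenMetricForm J)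
    {ψ : LocalJet f ⊤ V₀ V₁} (hψ : ψ.IsFrame) {B : SuperForm f} (hB : B.IsOrthonormalOn J ψ) :
    B = frameForm hJ ψ hψ :=
  SuperForm.ext (funext fun U => LinearMap.ext₂ fun X Y => by
    rw [hB.form_eq le_top (ψ.secs_coord hψ le_top X) (ψ.secs_coord hψ le_top Y)]
    rfl)

/-- Coordinates in the pulled back frame are the pulled back coordinates, and the extension of `J`
commutes with even base change. -/
theorem frameForm_pull (hJ : IsEvenMetricForm J) {ψ : LocalJet f ⊤ V₀ V₁} (hψ : ψ.IsFrame)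
    (k : Hom S.toSuperSpace T.toSuperSpace) {χ : LocalJet (k.comp f) ⊤ V₀ V₁} (hχ : χ.IsFrame)
    (e : χ = ψ.pull k (Hom.mapsTo_top k ⊤)) {Q : Opens S.toSuperSpace}
    (h : Set.MapsTo k.base Q U) {X Y : Der f U} {X' Y' : Der (k.comp f) Q}
    (hX : X'.1 = preDerPullOn k f h X.1) (hY : Y'.1 = preDerPullOn k f h Y.1) :
    (frameForm hJ χ hχ).form Q X' Y' = k.pull U Q h ((frameForm hJ ψ hψ).form U X Y) := by
  subst e
  rw [frameForm_eq hJ hψ (ψ.secs_coord hψ le_top X) (ψ.secs_coord hψ le_top Y),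
    ← formExt_baseMap (k.pull_par U Q h)]
  refine frameForm_eq hJ hχ ?_ ?_
  · rw [ψ.pull_secs k (Hom.mapsTo_top k ⊤) le_top le_top h, ψ.secs_coord, hX]
  · rw [ψ.pull_secs k (Hom.mapsTo_top k ⊤) le_top le_top h, ψ.secs_coord, hY]

/-- Pullbacks of forms can be pulled back further. -/
theorem IsPullbackForm.pull (hJ : IsEvenMetricForm J) {g : SuperForm (Hom.id M.toSuperSpace)}
    {ψ : LocalJet f ⊤ V₀ V₁} {hψ : ψ.IsFrame} (h : IsPullbackForm g (frameForm hJ ψ hψ))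
    (k : Hom S.toSuperSpace T.toSuperSpace) {χ : LocalJet (k.comp f) ⊤ V₀ V₁} (hχ : χ.IsFrame)
    (e : χ = ψ.pull k (Hom.mapsTo_top k ⊤)) : IsPullbackForm g (frameForm hJ χ hχ) := by
  intro W U hU X Y X' Y' hX hY
  have hk : Set.MapsTo k.base U (f.pre W) := hU
  let P : Der (Hom.id M.toSuperSpace) W → Der f (f.pre W) := fun X =>
    ⟨preDerPush f (f.mapsTo_pre W) X.1, preDerPush_mem_Der _ X.2⟩
  rw [frameForm_pull hJ hψ k hχ e hk (X := P X) (Y := P Y)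
    (hX.trans (preDerPullOn_preDerPush k (f.mapsTo_pre W) hk hU X.1).symm)
    (hY.trans (preDerPullOn_preDerPush k (f.mapsTo_pre W) hk hU Y.1).symm),
    h W _ (f.mapsTo_pre W) X Y (P X) (P Y) rfl rfl,
    Hom.comp_pull k f W (f.pre W) U hU (f.mapsTo_pre W) hk]

theorem SuperForm.form_preDerRes (B : SuperForm f) (h : U' ≤ U) (X Y : Der f U) :
    B.form U' ⟨preDerRes f h X.1, preDerRes_mem_Der h X.2⟩
      ⟨preDerRes f h Y.1, preDerRes_mem_Der h Y.2⟩ = T.res h (B.form U X Y) :=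
  B.form_res h _ _ _ _ rfl rfl

/-- A form is a pullback if this holds after restriction to the members of an open cover. -/
theorem isPullbackForm_of_local (hJ : IsEvenMetricForm J)
    {g : SuperForm (Hom.id M.toSuperSpace)} {ψ : LocalJet f ⊤ V₀ V₁} (hψ : ψ.IsFrame)
    (h : ∀ t : T.toSuperSpace, ∃ (S : MixedSupermanifold.{u})
      (j : Hom S.toSuperSpace T.toSuperSpace) (χ : LocalJet (j.comp f) ⊤ V₀ V₁) (hχ : χ.IsFrame),
      χ = ψ.pull j (Hom.mapsTo_top j ⊤) ∧ j.IsOpenImmersion ∧ t ∈ Set.range j.base ∧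
      IsPullbackForm g (frameForm hJ χ hχ)) : IsPullbackForm g (frameForm hJ ψ hψ) := by
  intro W U hU X Y X' Y' hX hY
  refine T.isSheaf.separated fun t ht => ?_
  obtain ⟨S, j, χ, hχ, e, hj, htj, hg⟩ := h t
  let N : Opens T.toSuperSpace := ⟨Set.range j.base, hj.isOpenEmbedding.isOpen_range⟩
  refine ⟨U ⊓ N, inf_le_left, ⟨ht, htj⟩, ?_⟩
  -- Over the image of `j` it suffices to compare after pullback along `j`, where the form of the
  -- pulled back frame is a pullback of `g`.
  apply (hj.bijective (U ⊓ N) fun x hx => hx.2).1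
  have hjU : Set.MapsTo j.base (j.pre (U ⊓ N)) U := fun x hx => hx.1
  have hjW : Set.MapsTo (j.comp f).base (j.pre (U ⊓ N)) W := fun x hx => hU hx.1
  have hr : ∀ a : T.O U, j.pull (U ⊓ N) (j.pre (U ⊓ N)) (j.mapsTo_pre _)
      (T.res inf_le_left a) = j.pull U (j.pre (U ⊓ N)) hjU a := fun a =>
    (j.pull_res inf_le_left le_rfl hjU (j.mapsTo_pre _) a).trans (S.res_self _ _)
  let P : Der f U → Der (j.comp f) (j.pre (U ⊓ N)) := fun X =>
    ⟨preDerPullOn j f hjU X.1, preDerPullOn_mem_Der j hjU X.2⟩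
  rw [hr, hr, ← frameForm_pull hJ hψ j hχ e hjU (X' := P X') (Y' := P Y') rfl rfl,
    ← Hom.comp_pull j f W U _ hjW hU hjU]
  refine hg W _ hjW X Y _ _ ?_ ?_
  · change preDerPullOn j f hjU X'.1 = _
    rw [hX]
    exact preDerPullOn_preDerPush j hU hjU hjW X.1
  · change preDerPullOn j f hjU Y'.1 = _
    rw [hY]
    exact preDerPullOn_preDerPush j hU hjU hjW Y.1

end Forms

/-! ### Pushing forward frames of the tangent bundle -/

section Push

variable {X Y : SuperSpace.{u}} {V₀ V₁ : Type u} [AddCommGroup V₀] [Module ℂ V₀]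
  [AddCommGroup V₁] [Module ℂ V₁]

/-- The pullback of a local frame of the tangent bundle along `f`. -/
def LocalJet.push {W : Opens Y} (ψ : LocalJet (Hom.id Y) W V₀ V₁) (f : Hom X Y) {U : Opens X}
    (h : Set.MapsTo f.base U W) : LocalJet f U V₀ V₁ where
  val := preDerPush f h ∘ₗ ψ.val
  val_mem p v hv := preDerPush_mem f h p (ψ.val_mem p v hv)

theorem LocalJet.push_secs {W Q : Opens Y} (ψ : LocalJet (Hom.id Y) W V₀ V₁) (f : Hom X Y)
    {U U' : Opens X} (h : Set.MapsTo f.base U W) (h' : U' ≤ U) (hQ : Q ≤ W)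
    (hf : Set.MapsTo f.base U' Q) (x : Y.O Q ⊗[ℂ] (V₀ × V₁)) :
    (ψ.push f h).secs h' (baseMap _ (f.pull Q U' hf) x) = preDerPush f hf (ψ.secs hQ x) := by
  induction x using TensorProduct.induction_on with
  | zero => simp
  | add x y hx hy => simp only [map_add, hx, hy]
  | tmul s v =>
    rw [baseMap_tmul, secs_tmul, secs_tmul, preDerPush_preDerMul,
      preDerPush_res hQ h' h hf (isNatural_of_mem (ψ.val_mem_Der v))]
    rfl

/-- Pushing vector fields forward to derivations along `f` is the special case of pulling back
derivations along the identity, so stability of frames under pullback applies. -/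
theorem LocalJet.push_comp_id {W : Opens Y} (ψ : LocalJet (Hom.id Y) W V₀ V₁) (f : Hom X Y)
    {U : Opens X} (h : Set.MapsTo f.base U W) (h' : Set.MapsTo (f.comp (Hom.id Y)).base U W) :
    ψ.push (f.comp (Hom.id Y)) h' = ψ.pull f h := by
  refine LocalJet.ext (LinearMap.ext fun v => ?_)
  change preDerPush (f.comp (Hom.id Y)) h' (ψ.val v) = preDerPullOn f (Hom.id Y) h (ψ.val v)
  funext i
  refine LinearMap.ext fun a => ?_
  exact (Hom.comp_pull f (Hom.id Y) _ _ _ (i.mapsTo_inf h') (fun _ hx => hx) (i.mapsTo_inf h')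
    _).trans (congrArg _ (Y.res_self _ _))

theorem LocalJet.IsFrame.push {T M : MixedSupermanifold.{u}} {V : MixedSuperVectorSpace.{u}}
    (hM : M.IsModelledOn V) {W : Opens M.toSuperSpace}
    {ψ : LocalJet (Hom.id M.toSuperSpace) W V.even V.odd} (hψ : ψ.IsFrame)
    (f : Hom T.toSuperSpace M.toSuperSpace) {U : Opens T.toSuperSpace}
    (h : Set.MapsTo f.base U W) : (ψ.push f h).IsFrame := by
  have h1 := LocalJet.IsFrame.pull hM hψ f h
  rw [← ψ.push_comp_id f h h] at h1
  -- `f.comp (Hom.id _)` equals `f` only propositionally, so the morphism is generalized before the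
  -- equation is substituted.
  have key : ∀ (f' : Hom T.toSuperSpace M.toSuperSpace), f' = f →
      ∀ h' : Set.MapsTo f'.base U W, (ψ.push f' h').IsFrame → (ψ.push f h).IsFrame := by
    rintro _ rfl h' h2
    exact h2
  exact key _ f.comp_id _ h1

end Push

/-! ### Orthonormal frames -/

section Orthonormal

theorem exists_linear_lift {W N E : Type*} [AddCommGroup W] [Module ℂ W] [AddCommGroup N]
    [Module ℂ N] [AddCommGroup E] [Module ℂ E] (L : E →ₗ[ℂ] N) (l : W →ₗ[ℂ] N)
    (h : ∀ w, ∃ y, L y = l w) : ∃ Y : W →ₗ[ℂ] E, ∀ w, L (Y w) = l w := by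
  let b := Module.Free.chooseBasis ℂ W
  choose y hy using fun i => h (b i)
  refine ⟨b.constr ℂ y, fun w => ?_⟩
  have h1 : L ∘ₗ b.constr ℂ y = l := b.ext fun i => by
    rw [LinearMap.comp_apply, Module.Basis.constr_basis, hy]
  exact LinearMap.congr_fun h1 w

variable {T M : MixedSupermanifold.{u}} {V₀ V₁ : Type u} [AddCommGroup V₀] [Module ℂ V₀]
  [AddCommGroup V₁] [Module ℂ V₁] {f : Hom T.toSuperSpace M.toSuperSpace}
  {U U' : Opens T.toSuperSpace} {J : LinearMap.BilinForm ℂ (V₀ × V₁)}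

theorem LocalJet.sec_one_mem (ψ : LocalJet f U V₀ V₁) (h : U' ≤ U) {p : ZMod 2} {v : V₀ × V₁}
    (hv : IsHomogeneous p v) : (ψ.sec h (1 ⊗ₜ v)).1 ∈ homDer f U' p := by
  rw [sec_val, secs_one_tmul]
  exact preDerRes_mem f h p (ψ.val_mem p v hv)

/-- The Gram endomorphism of a form with respect to a local frame. -/
theorem SuperForm.exists_gram [FiniteDimensional ℂ V₀] [FiniteDimensional ℂ V₁]
    (hJ : IsEvenMetricForm J) (B : SuperForm f) (ψ : LocalJet f U V₀ V₁) :
    ∃ S : V₀ × V₁ →ₗ[ℂ] T.O U ⊗[ℂ] (V₀ × V₁), IsEvenMap (T.par U) S ∧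
      (∀ v w, formExt (T.par U) J (S v) (1 ⊗ₜ w) = formExt (T.par U) J (1 ⊗ₜ v) (S w)) ∧
      ∀ (U' : Opens T.toSuperSpace) (h : U' ≤ U) (x y : T.O U' ⊗[ℂ] (V₀ × V₁)),
        B.form U' (ψ.sec h x) (ψ.sec h y) =
          formExt (T.par U') J x (extendScalars (baseMap _ (T.res h) ∘ₗ S) y) := by
  let e : V₀ × V₁ →ₗ[ℂ] T.O U ⊗[ℂ] (V₀ × V₁) := TensorProduct.mk ℂ (T.O U) (V₀ × V₁) 1
  let L : T.O U ⊗[ℂ] (V₀ × V₁) →ₗ[ℂ] V₀ × V₁ →ₗ[ℂ] T.O U := ((formExt (T.par U) J).comp e).flip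
  let l : V₀ × V₁ →ₗ[ℂ] V₀ × V₁ →ₗ[ℂ] T.O U :=
    ((B.form U).compl₁₂ (ψ.sec le_rfl ∘ₗ e) (ψ.sec le_rfl ∘ₗ e)).flip
  -- `S w` is the element that represents `v ↦ B(ψ v, ψ w)` with respect to `J`. Since it is unique,
  -- the evenness of `B` makes `S` even, and the supersymmetry of `B` and `J` makes it self-adjoint.
  obtain ⟨S, hS⟩ := exists_linear_lift L l fun w => by
    obtain ⟨y, hy, -⟩ := formExt_existsUnique (T.par_par U) hJ (l w)
    exact ⟨y, LinearMap.ext hy⟩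
  have hS' : ∀ v w, formExt (T.par U) J (1 ⊗ₜ v) (S w) =
      B.form U (ψ.sec le_rfl (1 ⊗ₜ v)) (ψ.sec le_rfl (1 ⊗ₜ w)) := fun v w =>
    LinearMap.congr_fun (hS w) v
  have heven : IsEvenMap (T.par U) S := isEvenMap_of_homogeneous fun q w hw => by
    refine formExt_eq_zero (T.par_par U) hJ ?_
    refine homogeneous_induction (fun v v' hv hv' => ?_) fun p v hv => ?_
    · rw [TensorProduct.tmul_add, map_add, LinearMap.add_apply, LinearMap.add_apply, hv, hv']
    · have h1 := formExt_parity (σ := T.par U) hJ (1 ⊗ₜ v) (S w)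
      rw [tparity_one_tmul hv, map_smul, LinearMap.smul_apply, hS',
        B.even U p q _ _ (ψ.sec_one_mem le_rfl hv) (ψ.sec_one_mem le_rfl hw), ← hS'] at h1
      rw [map_smul]
      have h2 := congrArg (fun a => sgn p • a) h1
      simp only [smul_smul, sgn_mul_self, one_smul, sgn_add, ← mul_assoc, one_mul] at h2
      exact h2
  refine ⟨S, heven, ?_, fun U' h x y => ?_⟩
  · intro v w
    revert v
    refine homogeneous_induction (fun v v' hv hv' => ?_) fun p v hv => ?_
    · rw [map_add, map_add, LinearMap.add_apply, hv, hv', TensorProduct.tmul_add, map_add,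
        LinearMap.add_apply]
    revert w
    refine homogeneous_induction (fun w w' hw hw' => ?_) fun q w hw => ?_
    · rw [map_add, map_add, TensorProduct.tmul_add, map_add, hw, hw']
    · rw [formExt_supersymmetric (T.par_par U) (T.isSupercommutative U) hJ
        (heven.tparity_apply hv) (tparity_one_tmul hw), hS', hS',
        B.supersymmetric U p q _ _ (ψ.sec_one_mem le_rfl hv) (ψ.sec_one_mem le_rfl hw)]
  · have h1 := (isSuperBilin_formExt (σ := T.par U') (J := J)).comp_right
      (extendScalars (baseMap _ (T.res h) ∘ₗ S))
    refine (B.isSuperBilin ψ h).ext h1 (fun v w => ?_) x y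
    change B.form U' (ψ.sec h (1 ⊗ₜ v)) (ψ.sec h (1 ⊗ₜ w)) =
      formExt (T.par U') J (1 ⊗ₜ v) (extendScalars (baseMap _ (T.res h) ∘ₗ S) (1 ⊗ₜ w))
    rw [B.form_res h _ _ _ _ (ψ.sec_one_tmul_val h v) (ψ.sec_one_tmul_val h w), ← hS',
      extendScalars_tmul, one_smul, LinearMap.comp_apply,
      ← formExt_baseMap (fun a => (T.par_res h a).symm), baseMap_tmul, map_one]

/-- The Gram endomorphism of a non-degenerate form is invertible. -/
theorem SuperForm.Nondegenerate.exists_gram_inverse [FiniteDimensional ℂ V₀]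
    [FiniteDimensional ℂ V₁] (hJ : IsEvenMetricForm J) {B : SuperForm f} (hB : B.Nondegenerate)
    {ψ : LocalJet f U V₀ V₁} (hψ : ψ.IsFrame) {S : V₀ × V₁ →ₗ[ℂ] T.O U ⊗[ℂ] (V₀ × V₁)}
    (hS : ∀ x y, B.form U (ψ.sec le_rfl x) (ψ.sec le_rfl y) =
      formExt (T.par U) J x (extendScalars S y)) :
    ∃ Y : V₀ × V₁ →ₗ[ℂ] T.O U ⊗[ℂ] (V₀ × V₁), ∀ w, extendScalars S (Y w) = 1 ⊗ₜ w := by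
  refine exists_linear_lift ((extendScalars S).restrictScalars ℂ)
    (TensorProduct.mk ℂ (T.O U) (V₀ × V₁) 1) fun w => ?_
  -- The functional `ψ x ↦ J(x, 1 ⊗ w)` is represented by some section `ψ y`, and then `J(x, S y) =
  -- J(x, 1 ⊗ w)` for all `x`, that is, `S y = 1 ⊗ w`.
  let l : Functional f U :=
    { val := fun U' h => (formExt (T.par U') J).flip (1 ⊗ₜ w) ∘ₗ (ψ.coord hψ h).toLinearMap
      val_res := fun {U₁ U₂} h₁ h₂ h X X' hX => by
        change formExt _ J (ψ.coord hψ h₂ X') (1 ⊗ₜ w) =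
          T.res h (formExt _ J (ψ.coord hψ h₁ X) (1 ⊗ₜ w))
        rw [ψ.coord_eq_baseMap hψ h₁ h hX, ← formExt_baseMap (fun a => (T.par_res h a).symm),
          baseMap_tmul, map_one]
      val_mul := fun U' h' a X X' hX => by
        change formExt _ J (ψ.coord hψ h' X') (1 ⊗ₜ w) = a * formExt _ J (ψ.coord hψ h' X) (1 ⊗ₜ w)
        rw [ψ.coord_eq_smul hψ h' hX, formExt_smul_left] }
  obtain ⟨Y, hY, -⟩ := hB U l
  obtain ⟨y, hy⟩ := hψ.exists_secs le_rfl Y.2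
  obtain rfl : ψ.sec le_rfl y = Y := Subtype.ext hy
  refine ⟨y, formExt_eq_zero (T.par_par U) hJ fun v => ?_⟩
  refine (hS (1 ⊗ₜ v) y).symm.trans ?_
  rw [hY U le_rfl (ψ.sec le_rfl (1 ⊗ₜ v)) (ψ.sec le_rfl y) rfl]
  change formExt _ J (ψ.coord hψ le_rfl (ψ.sec le_rfl (1 ⊗ₜ v))) (1 ⊗ₜ w) = _
  rw [ψ.coord_eq hψ le_rfl (x := 1 ⊗ₜ v) rfl]
  rfl

/-- Metrics have orthonormal frames locally. -/
theorem EvenMetric.exists_orthonormal_frame {V : MixedSuperVectorSpace.{u}}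
    (hM : M.IsModelledOn V) {J : LinearMap.BilinForm ℂ (V.even × V.odd)}
    (hJ : IsEvenMetricForm J) (g : EvenMetric M) (p : M.toSuperSpace) :
    ∃ (U : Opens M.toSuperSpace) (χ : LocalJet (Hom.id M.toSuperSpace) U V.even V.odd),
      p ∈ U ∧ χ.IsFrame ∧ g.1.IsOrthonormalOn J χ := by
  obtain ⟨C, hC⟩ := (hM p).exists_chart
  let ψ := C.frame (Hom.id M.toSuperSpace) (le_refl C.dom)
  have hψ : ψ.IsFrame := C.isFrame_frame (Hom.id M.toSuperSpace) (le_refl C.dom)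
  obtain ⟨S, hS, hSJ, hSB⟩ := g.1.exists_gram hJ ψ
  have hres : baseMap _ (M.res (le_refl C.dom)) ∘ₗ S = S :=
    LinearMap.ext fun v => baseMap_of_eq_id (M.res_self le_rfl) _
  obtain ⟨Y, hY⟩ := g.2.exists_gram_inverse hJ hψ (S := S) fun x y => by
    rw [hSB, hres]
  obtain ⟨U, h, hp, ρ, ρ', hρ, hρ', h12, h21, hJρ⟩ :=
    C.exists_sqrt M.isSupercommutative le_rfl hC hS hY hSJ
  -- The coordinate frame composed with `ρ⁻¹`: its Gram form is `J(ρ ρ⁻¹ v, ρ ρ⁻¹ w) = J(v, w)`.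
  let χ := (ψ.restrict h).precomp M.isSupercommutative ρ' hρ'
  refine ⟨U, χ, hp, (hψ.restrict h).precomp M.isSupercommutative hρ' h21 h12, ?_⟩
  have key : ∀ x y, formExt (M.par U) J x (extendScalars (baseMap _ (M.res h) ∘ₗ S) y) =
      formExt (M.par U) J (extendScalars ρ x) (extendScalars ρ y) := fun x y => by
    have h1 := (isSuperBilin_formExt (σ := M.par U) (J := J)).comp_right
      (extendScalars (baseMap _ (M.res h) ∘ₗ S))
    have h2 := (isSuperBilin_formExt (σ := M.par U) (J := J)).comp_even (M.par_par U)
      (M.isSupercommutative U) (extendScalars ρ) (extendScalars ρ) hρ.extendScalars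
    refine h1.ext h2 (fun v w => ?_) x y
    change formExt (M.par U) J (1 ⊗ₜ v) (extendScalars (baseMap _ (M.res h) ∘ₗ S) (1 ⊗ₜ w)) =
      formExt (M.par U) J (extendScalars ρ (1 ⊗ₜ v)) (extendScalars ρ (1 ⊗ₜ w))
    rw [extendScalars_tmul, extendScalars_tmul, extendScalars_tmul, one_smul, one_smul, one_smul,
      hJρ, LinearMap.comp_apply]
  intro v w X Y hX hY
  obtain rfl : ψ.sec h (ρ' v) = X := Subtype.ext hX.symm
  obtain rfl : ψ.sec h (ρ' w) = Y := Subtype.ext hY.symm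
  rw [hSB, key, h12, h12, formExt_one_tmul]

/-- Forms that have orthonormal frames locally are non-degenerate. -/
theorem SuperForm.nondegenerate_of_local [FiniteDimensional ℂ V₀] [FiniteDimensional ℂ V₁]
    (hJ : IsEvenMetricForm J) (B : SuperForm f)
    (h : ∀ t : T.toSuperSpace, ∃ (U : Opens T.toSuperSpace) (ψ : LocalJet f U V₀ V₁),
      t ∈ U ∧ ψ.IsFrame ∧ B.IsOrthonormalOn J ψ) : B.Nondegenerate := by
  intro U l
  choose N ψ hN hψ hB using h
  let IsRep : ∀ Q ≤ U, Der f Q → Prop := fun Q hQ Y =>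
    ∀ (U' : Opens T.toSuperSpace) (h : U' ≤ Q) (X Y' : Der f U'), Y'.1 = preDerRes f h Y.1 →
      B.form U' X Y' = l.val U' (h.trans hQ) X
  have rep_res : ∀ Q (hQ : Q ≤ U) Q' (hQ' : Q' ≤ Q) Y (Y' : Der f Q'), Y'.1 = preDerRes f hQ' Y.1 →
      IsRep Q hQ Y → IsRep Q' (hQ'.trans hQ) Y' := fun Q hQ Q' hQ' Y Y' hY h U' hU' X Z hZ =>
    h U' (hU'.trans hQ') X Z (by rw [hZ, hY]; rfl)
  -- Locally the pairing is `J` in the coordinates of an orthonormal frame, where representing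
  -- elements are unique.
  have uniq : ∀ Q (hQ : Q ≤ U) (Y Y' : Der f Q), IsRep Q hQ Y → IsRep Q hQ Y' → Y = Y' := by
    intro Q hQ Y Y' hY hY'
    refine Subtype.ext (preDer_separated T.isSheaf (isNatural_of_mem Y.2) (isNatural_of_mem Y'.2)
      fun t ht => ⟨Q ⊓ N t, inf_le_left, ⟨ht, hN t⟩, ?_⟩)
    let R : Der f Q → Der f (Q ⊓ N t) := fun Y =>
      ⟨preDerRes f inf_le_left Y.1, preDerRes_mem_Der _ Y.2⟩
    obtain ⟨y, hy⟩ := (hψ t).exists_secs inf_le_right (R Y).2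
    obtain ⟨y', hy'⟩ := (hψ t).exists_secs inf_le_right (R Y').2
    have hyy : y = y' := formExt_eq_zero (T.par_par _) hJ fun v => by
      rw [← (hB t).form_eq inf_le_right (X := (ψ t).sec inf_le_right (1 ⊗ₜ v)) rfl hy,
        ← (hB t).form_eq inf_le_right (X := (ψ t).sec inf_le_right (1 ⊗ₜ v)) rfl hy',
        hY _ inf_le_left _ (R Y) rfl, hY' _ inf_le_left _ (R Y') rfl]
    rw [hyy] at hy
    exact hy.symm.trans hy'
  -- Over the domain of an orthonormal frame, solve `J(v, y) = l(ψ v)` on constant sections.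
  -- Linearity of both sides over functions extends it to all sections, and the local solutions glue
  -- by uniqueness.
  have loc : ∀ t, ∃ Y : Der f (U ⊓ N t), IsRep _ inf_le_left Y := by
    intro t
    obtain ⟨y, hy, -⟩ := formExt_existsUnique (T.par_par (U ⊓ N t)) hJ
      (l.val (U ⊓ N t) inf_le_left ∘ₗ (ψ t).sec inf_le_right ∘ₗ TensorProduct.mk ℂ _ _ 1)
    refine ⟨(ψ t).sec inf_le_right y, fun U' hU' X Y' hY' => ?_⟩
    have hy' : (ψ t).secs (hU'.trans inf_le_right) (baseMap _ (T.res hU') y) = Y'.1 := by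
      rw [(ψ t).secs_res inf_le_right hU', hY']
      rfl
    obtain ⟨x, hx⟩ := (hψ t).exists_secs (hU'.trans inf_le_right) X.2
    obtain rfl : (ψ t).sec (hU'.trans inf_le_right) x = X := Subtype.ext hx
    rw [(hB t).form_eq _ hx hy']
    clear hx
    induction x using TensorProduct.induction_on with
    | zero => simp
    | add x x' hx hx' => simp only [map_add, LinearMap.add_apply, hx, hx']
    | tmul a v =>
      rw [tmul_eq_smul_one_tmul, formExt_smul_left, l.val_mul U' _ a
        ((ψ t).sec (hU'.trans inf_le_right) (1 ⊗ₜ v)) _ ((ψ t).secs_smul _ a _),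
        l.val_res inf_le_left _ hU' ((ψ t).sec inf_le_right (1 ⊗ₜ v)) _]
      · have h1 := hy v
        change _ = l.val (U ⊓ N t) inf_le_left ((ψ t).sec inf_le_right (1 ⊗ₜ v)) at h1
        rw [← h1, ← formExt_baseMap (fun a => (T.par_res hU' a).symm), baseMap_tmul, map_one]
      · rw [LocalJet.sec_val, LocalJet.sec_val, LocalJet.secs_one_tmul, LocalJet.secs_one_tmul]
        rfl
  choose Y hY using loc
  obtain ⟨D, hD, hDY⟩ := Der_glue T.isSheaf (ι := T.toSuperSpace) (U := U) (fun t => U ⊓ N t)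
    (fun t => inf_le_left) (fun t ht => ⟨t, ht, hN t⟩) (fun t => (Y t).1) (fun t => (Y t).2)
    fun t s => by
      let Z : Der f ((U ⊓ N t) ⊓ (U ⊓ N s)) :=
        ⟨preDerRes f inf_le_left (Y t).1, preDerRes_mem_Der _ (Y t).2⟩
      let Z' : Der f ((U ⊓ N t) ⊓ (U ⊓ N s)) :=
        ⟨preDerRes f inf_le_right (Y s).1, preDerRes_mem_Der _ (Y s).2⟩
      exact congrArg Subtype.val (uniq _ (inf_le_left.trans inf_le_left) Z Z'
        (rep_res _ inf_le_left _ inf_le_left (Y t) Z rfl (hY t))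
        (rep_res _ inf_le_left _ inf_le_right (Y s) Z' rfl (hY s)))
  have hrep : IsRep U le_rfl ⟨D, hD⟩ := by
    intro U' hU' X Y' hY'
    refine T.isSheaf.separated fun t ht => ⟨U' ⊓ N t, inf_le_left, ⟨ht, hN t⟩, ?_⟩
    have hle : U' ⊓ N t ≤ U ⊓ N t := inf_le_inf_right _ hU'
    rw [← B.form_preDerRes, hY t _ hle]
    · exact l.val_res _ _ _ _ _ rfl
    · rw [← hDY t]
      change preDerRes f inf_le_left Y'.1 = _
      rw [hY']
      rfl
  exact ⟨⟨D, hD⟩, hrep, fun Y' hY' => uniq U le_rfl _ _ hY' hrep⟩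

/-- Pullbacks of forms are unique. -/
theorem IsPullbackForm.unique {V : MixedSuperVectorSpace.{u}} (hM : M.IsModelledOn V)
    {g : SuperForm (Hom.id M.toSuperSpace)} {B B' : SuperForm f} (hB : IsPullbackForm g B)
    (hB' : IsPullbackForm g B') : B = B' := by
  refine SuperForm.ext (funext fun U => LinearMap.ext₂ fun X Y => ?_)
  refine T.isSheaf.separated fun t ht => ?_
  obtain ⟨C, hC⟩ := (hM (f.base t)).exists_chart
  let ψ := C.frame (Hom.id M.toSuperSpace) (le_refl C.dom)
  have hψ : ψ.IsFrame := C.isFrame_frame (Hom.id M.toSuperSpace) (le_refl C.dom)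
  let Q := f.pre C.dom ⊓ U
  have hQ : Set.MapsTo f.base Q C.dom := fun x hx => hx.1
  refine ⟨Q, inf_le_right, ⟨hC, ht⟩, ?_⟩
  rw [← B.form_preDerRes, ← B'.form_preDerRes]
  -- Near `t` the derivations along `f` have a frame induced by vector fields on `M`, on which the
  -- pullback condition prescribes the values.
  refine SuperForm.eq_of_frame (hψ.push hM f hQ) (fun v w => ?_) le_rfl _ _
  have hv : ∀ v, ((ψ.push f hQ).sec le_rfl (1 ⊗ₜ v)).1 =
      preDerPush f hQ (ψ.sec le_rfl (1 ⊗ₜ v)).1 := fun v => by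
    rw [LocalJet.sec_val, LocalJet.sec_val, LocalJet.secs_one_tmul, LocalJet.secs_one_tmul]
    rfl
  rw [hB C.dom Q hQ _ _ _ _ (hv v) (hv w), hB' C.dom Q hQ _ _ _ _ (hv v) (hv w)]

end Orthonormal

/-! ### The reduction defined by a metric -/

/-! ### Points of `GL(V)` as even maps on `V` -/

section GroupPoints

variable {R : Type*} [Ring R] [Algebra ℂ R] {σ : R →ₐ[ℂ] R} {V₀ V₁ : Type u} [AddCommGroup V₀]
  [Module ℂ V₀] [AddCommGroup V₁] [Module ℂ V₁]

/-- The values of a point of `GL(V)` on the constant sections. -/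
def glMap (A : GLPoints σ V₀ V₁) : V₀ × V₁ →ₗ[ℂ] R ⊗[ℂ] (V₀ × V₁) :=
  A.1.toLinearMap.restrictScalars ℂ ∘ₗ TensorProduct.mk ℂ R (V₀ × V₁) 1

theorem glMap_apply (A : GLPoints σ V₀ V₁) (v : V₀ × V₁) : glMap A v = A.1 (1 ⊗ₜ v) := rfl

theorem extendScalars_glMap (A : GLPoints σ V₀ V₁) : extendScalars (glMap A) = A.1.toLinearMap :=
  linearMap_ext_one_tmul fun w => by
    rw [extendScalars_tmul, one_smul, glMap_apply]
    rfl

theorem isEvenMap_glMap (A : GLPoints σ V₀ V₁) : IsEvenMap σ (glMap A) := fun v => by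
  have h : A.1 (tparity σ (1 ⊗ₜ v)) = tparity σ (A.1 (1 ⊗ₜ v)) := A.2 (1 ⊗ₜ v)
  rw [tparity_tmul, map_one] at h
  exact h.symm

theorem extendScalars_glMap_inv (A : GLPoints σ V₀ V₁) (v : V₀ × V₁) :
    extendScalars (glMap A) (glMap A⁻¹ v) = 1 ⊗ₜ v := by
  rw [extendScalars_glMap]
  exact A.1.apply_symm_apply (1 ⊗ₜ v)

theorem extendScalars_glMap_inv' (A : GLPoints σ V₀ V₁) (v : V₀ × V₁) :
    extendScalars (glMap A⁻¹) (glMap A v) = 1 ⊗ₜ v := by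
  rw [extendScalars_glMap]
  exact A.1.symm_apply_apply (1 ⊗ₜ v)

theorem exists_glMap_eq {A C : V₀ × V₁ →ₗ[ℂ] R ⊗[ℂ] (V₀ × V₁)} (hA : IsEvenMap σ A)
    (hAC : ∀ v, extendScalars A (C v) = 1 ⊗ₜ v) (hCA : ∀ v, extendScalars C (A v) = 1 ⊗ₜ v) :
    ∃ G : GLPoints σ V₀ V₁, glMap G = A := by
  have h : ∀ {A C : V₀ × V₁ →ₗ[ℂ] R ⊗[ℂ] (V₀ × V₁)}, (∀ v, extendScalars A (C v) = 1 ⊗ₜ v) →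
      extendScalars A ∘ₗ extendScalars C = LinearMap.id := fun h =>
    linearMap_ext_one_tmul fun w => by
      rw [LinearMap.comp_apply, extendScalars_tmul, one_smul, h, LinearMap.id_apply]
  refine ⟨⟨LinearEquiv.ofLinearMap (extendScalars A) (extendScalars C) (h hAC) (h hCA),
    fun x => hA.extendScalars x⟩, LinearMap.ext fun v => ?_⟩
  change extendScalars A (1 ⊗ₜ v) = A v
  rw [extendScalars_tmul, one_smul]

theorem glMap_injective : Function.Injective (glMap (σ := σ) (V₀ := V₀) (V₁ := V₁)) :=
  fun A B h => Subtype.ext (LinearEquiv.toLinearMap_injective (by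
    rw [← extendScalars_glMap, h, extendScalars_glMap]))

theorem mem_OSpPoints_of_glMap {J : LinearMap.BilinForm ℂ (V₀ × V₁)} (hσ : ∀ a, σ (σ a) = a)
    (hR : IsSupercomm σ) {A : GLPoints σ V₀ V₁}
    (h : ∀ v w, formExt σ J (glMap A v) (glMap A w) = algebraMap ℂ R (J v w)) :
    A ∈ OSpPoints σ J := by
  have h1 := (isSuperBilin_formExt (σ := σ) (J := J)).comp_even hσ hR A.1.toLinearMap
    A.1.toLinearMap A.2
  exact h1.ext isSuperBilin_formExt fun v w => (h v w).trans (formExt_one_tmul v w).symm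

end GroupPoints

/-! ### Simple transitivity of `OSp(V, J)` on orthonormal frames -/

section Jets

variable {S T M : MixedSupermanifold.{u}} {V₀ V₁ : Type u} [AddCommGroup V₀] [Module ℂ V₀]
  [AddCommGroup V₁] [Module ℂ V₁] {f : Hom T.toSuperSpace M.toSuperSpace}
  {J : LinearMap.BilinForm ℂ (V₀ × V₁)}

namespace Jet

theorem ext {φ χ : Jet f V₀ V₁} (h : φ.val = χ.val) : φ = χ := by
  cases φ
  cases χ
  cases h
  rfl

/-- A jet as a local jet over the whole space. -/
def toLocal (φ : Jet f V₀ V₁) : LocalJet f ⊤ V₀ V₁ := ⟨φ.val, φ.val_mem⟩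

theorem isFrame_iff {φ : Jet f V₀ V₁} : φ.IsFrame ↔ φ.toLocal.IsFrame :=
  ⟨fun h U _ => h U, fun h U => h U le_top⟩

theorem toLocal_pullback (k : Hom S.toSuperSpace T.toSuperSpace) (φ : Jet f V₀ V₁) :
    (φ.pullback k).toLocal = φ.toLocal.pull k (Hom.mapsTo_top k ⊤) :=
  LocalJet.ext (LinearMap.ext fun v =>
    preDerPull_eq k f (isNatural_of_mem (φ.toLocal.val_mem_Der v)))

theorem toLocal_act (φ : Jet f V₀ V₁) (A : GLPoints (T.par ⊤) V₀ V₁) :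
    (φ.act A).toLocal =
      φ.toLocal.precomp T.isSupercommutative (glMap A) (isEvenMap_glMap A) := rfl

theorem IsFrame.act {φ : Jet f V₀ V₁} (hφ : φ.IsFrame) (A : GLPoints (T.par ⊤) V₀ V₁) :
    (φ.act A).IsFrame := by
  rw [isFrame_iff, toLocal_act]
  exact (isFrame_iff.1 hφ).precomp _ _ (C := glMap A⁻¹) (extendScalars_glMap_inv A)
    (extendScalars_glMap_inv' A)

theorem IsFrame.exists_act {φ χ : Jet f V₀ V₁} (hφ : φ.IsFrame) (hχ : χ.IsFrame) :
    ∃ A : GLPoints (T.par ⊤) V₀ V₁, φ.act A = χ := by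
  obtain ⟨A, C, hA, h, hAC, hCA⟩ := (isFrame_iff.1 hφ).exists_precomp_inverse (isFrame_iff.1 hχ)
    T.isSupercommutative
  obtain ⟨G, rfl⟩ := exists_glMap_eq hA hAC hCA
  exact ⟨G, ext (congrArg LocalJet.val h)⟩

theorem IsFrame.act_injective {φ : Jet f V₀ V₁} (hφ : φ.IsFrame) {A B : GLPoints (T.par ⊤) V₀ V₁}
    (h : φ.act A = φ.act B) : A = B :=
  glMap_injective (LinearMap.ext fun v => (isFrame_iff.1 hφ).injective le_rfl
    (LinearMap.congr_fun (congrArg Jet.val h) v))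

end Jet

/-- A local frame over the whole space as a jet. -/
def LocalJet.toJet (ψ : LocalJet f ⊤ V₀ V₁) : Jet f V₀ V₁ := ⟨ψ.val, ψ.val_mem⟩

theorem LocalJet.isOrthonormal_toJet (hJ : IsEvenMetricForm J) {g : EvenMetric M}
    {ψ : LocalJet f ⊤ V₀ V₁} (hψ : ψ.IsFrame) (h : IsPullbackForm g.1 (frameForm hJ ψ hψ)) :
    IsOrthonormal J g ψ.toJet :=
  ⟨fun U => hψ U le_top, _, h, isOrthonormalOn_frameForm hJ hψ⟩

/-- A frame admits only one form for which it is orthonormal, so the existential over pullback forms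
becomes a condition on that explicit form. In particular `f^* g` need not be constructed for general
`f`. -/
theorem isOrthonormal_iff (hJ : IsEvenMetricForm J) {g : EvenMetric M} {φ : Jet f V₀ V₁}
    (hφ : φ.toLocal.IsFrame) :
    IsOrthonormal J g φ ↔ IsPullbackForm g.1 (frameForm hJ φ.toLocal hφ) := by
  constructor
  · rintro ⟨-, B, hB, h⟩
    have h' : B.IsOrthonormalOn J φ.toLocal := h
    rwa [← h'.eq_frameForm hJ hφ]
  · exact fun h => ⟨Jet.isFrame_iff.2 hφ, _, h, isOrthonormalOn_frameForm hJ hφ⟩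

theorem IsOrthonormal.act {g : EvenMetric M} {φ : Jet f V₀ V₁} (h : IsOrthonormal J g φ)
    {A : GLPoints (T.par ⊤) V₀ V₁} (hA : A ∈ OSp J T) : IsOrthonormal J g (φ.act A) := by
  obtain ⟨hφ, B, hB, hB'⟩ := h
  have h' : B.IsOrthonormalOn J φ.toLocal := hB'
  refine ⟨hφ.act A, B, hB, fun v w X Y hX hY => ?_⟩
  rw [h'.form_eq le_rfl (x := A.1 (1 ⊗ₜ v)) (y := A.1 (1 ⊗ₜ w)) hX.symm hY.symm]
  exact (hA _ _).trans (formExt_one_tmul v w)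

/-- By uniqueness both frames are orthonormal for the same pullback form. In coordinates of `φ` that
form is `J`, so `A` preserves `J` on constant sections and hence everywhere. -/
theorem IsOrthonormal.mem_OSp {V : MixedSuperVectorSpace.{u}} (hM : M.IsModelledOn V)
    {g : EvenMetric M} {φ : Jet f V₀ V₁} (h : IsOrthonormal J g φ)
    {A : GLPoints (T.par ⊤) V₀ V₁} (hA : IsOrthonormal J g (φ.act A)) : A ∈ OSp J T := by
  obtain ⟨hφ, B, hB, hB'⟩ := h
  obtain ⟨hφ', C, hC, hC'⟩ := hA
  obtain rfl := hB.unique hM hC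
  have h' : B.IsOrthonormalOn J φ.toLocal := hB'
  refine mem_OSpPoints_of_glMap (T.par_par ⊤) (T.isSupercommutative ⊤) fun v w => ?_
  rw [← hC' v w ⟨_, (φ.act A).toLocal.val_mem_Der v⟩ ⟨_, (φ.act A).toLocal.val_mem_Der w⟩ rfl rfl]
  exact (h'.form_eq le_rfl rfl rfl).symm

/-- Any two frames differ by a unique point of `GL(V)`; for orthonormal ones it lies in `OSp(V, J)`.
-/
theorem IsOrthonormal.existsUnique_act {V : MixedSuperVectorSpace.{u}} (hM : M.IsModelledOn V)
    {g : EvenMetric M} {φ χ : Jet f V₀ V₁} (h : IsOrthonormal J g φ) (h' : IsOrthonormal J g χ) :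
    ∃! A, A ∈ OSp J T ∧ φ.act A = χ := by
  obtain ⟨A, rfl⟩ := h.1.exists_act h'.1
  exact ⟨A, ⟨h.mem_OSp hM h', rfl⟩, fun B hB => h.1.act_injective hB.2⟩

end Jets

/-! ### The bundle of orthonormal frames -/

section MetricReduction

variable {S T M : MixedSupermanifold.{u}} {V : MixedSuperVectorSpace.{u}}
  {f : Hom T.toSuperSpace M.toSuperSpace} {J : LinearMap.BilinForm ℂ (V.even × V.odd)}

theorem Jet.IsFrame.pullback (hM : M.IsModelledOn V) {φ : Jet f V.even V.odd} (hφ : φ.IsFrame)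
    (k : Hom S.toSuperSpace T.toSuperSpace) : (φ.pullback k).IsFrame := by
  rw [isFrame_iff, toLocal_pullback]
  exact LocalJet.IsFrame.pull hM (isFrame_iff.1 hφ) k _

theorem IsOrthonormal.pullback (hM : M.IsModelledOn V) (hJ : IsEvenMetricForm J)
    {g : EvenMetric M} {φ : Jet f V.even V.odd} (h : IsOrthonormal J g φ)
    (k : Hom S.toSuperSpace T.toSuperSpace) : IsOrthonormal J g (φ.pullback k) :=
  (isOrthonormal_iff hJ (Jet.isFrame_iff.1 (h.1.pullback hM k))).2
    (IsPullbackForm.pull hJ ((isOrthonormal_iff hJ (Jet.isFrame_iff.1 h.1)).1 h) k _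
      (φ.toLocal_pullback k))

theorem isOrthonormal_of_local (hJ : IsEvenMetricForm J)
    {g : EvenMetric M} {φ : Jet f V.even V.odd} (hφ : φ.IsFrame)
    (h : ∀ t : T.toSuperSpace, ∃ (S : MixedSupermanifold.{u})
      (j : Hom S.toSuperSpace T.toSuperSpace), j.IsOpenImmersion ∧ t ∈ Set.range j.base ∧
      IsOrthonormal J g (φ.pullback j)) : IsOrthonormal J g φ := by
  refine (isOrthonormal_iff hJ (Jet.isFrame_iff.1 hφ)).2 (isPullbackForm_of_local hJ _ fun t => ?_)
  obtain ⟨S, j, hj, ht, hg⟩ := h t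
  have hF := Jet.isFrame_iff.1 hg.1
  exact ⟨S, j, _, hF, φ.toLocal_pullback j, hj, ht, (isOrthonormal_iff hJ hF).1 hg⟩

/-- Orthonormal local frames of the tangent bundle pull back to orthonormal frames. -/
theorem isPullbackForm_push (hM : M.IsModelledOn V) (hJ : IsEvenMetricForm J)
    {g : SuperForm (Hom.id M.toSuperSpace)} {U : Opens M.toSuperSpace}
    {χ : LocalJet (Hom.id M.toSuperSpace) U V.even V.odd} (hχ : χ.IsFrame)
    (hg : g.IsOrthonormalOn J χ) (h : Set.MapsTo f.base (⊤ : Opens T.toSuperSpace) U) :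
    IsPullbackForm g (frameForm hJ (χ.push f h) (hχ.push hM f h)) := by
  intro W Q hQ X Y X' Y' hX hY
  have hQ' : Set.MapsTo f.base Q (W ⊓ U : Opens M.toSuperSpace) := fun x hx => ⟨hQ hx, h trivial⟩
  let R : Der (Hom.id M.toSuperSpace) W → Der (Hom.id M.toSuperSpace) (W ⊓ U) := fun X =>
    ⟨preDerRes _ inf_le_left X.1, preDerRes_mem_Der _ X.2⟩
  have hR : ∀ X, preDerPush f hQ' (R X).1 = preDerPush f hQ X.1 := fun X =>
    preDerPush_res inf_le_left le_rfl hQ hQ' (isNatural_of_mem X.2)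
  -- The coordinates of a pushed vector field in the pushed frame are the pullbacks of its
  -- coordinates in `χ`, and `J` commutes with this base change.
  have hc : ∀ X, (χ.push f h).secs (le_top : Q ≤ ⊤)
      (baseMap _ (f.pull _ Q hQ') (χ.coord hχ inf_le_right (R X))) = preDerPush f hQ X.1 :=
    fun X => by rw [χ.push_secs f h le_top inf_le_right hQ', χ.secs_coord, hR]
  rw [frameForm_eq hJ _ ((hc X).trans hX.symm) ((hc Y).trans hY.symm),
    formExt_baseMap (f.pull_par _ _ hQ'), ← hg.form_eq inf_le_right (χ.secs_coord hχ _ (R X))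
      (χ.secs_coord hχ _ (R Y)), g.form_preDerRes inf_le_left X Y]
  exact (f.pull_res inf_le_left le_rfl hQ hQ' _).trans (T.res_self _ _)

theorem EvenMetric.exists_local_section (hM : M.IsModelledOn V) (hJ : IsEvenMetricForm J)
    (g : EvenMetric M) (m : M.toSuperSpace) : ∃ (U : MixedSupermanifold.{u})
      (j : Hom U.toSuperSpace M.toSuperSpace) (s : Jet j V.even V.odd),
      j.IsOpenImmersion ∧ m ∈ Set.range j.base ∧ IsOrthonormal J g s := by
  obtain ⟨U, χ, hm, hχ, hg⟩ := g.exists_orthonormal_frame hM hJ m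
  have h : Set.MapsTo (M.incl U).base (⊤ : Opens (M.restrict U).toSuperSpace) U := fun x _ => x.2
  refine ⟨M.restrict U, M.incl U, (χ.push (M.incl U) h).toJet, M.isOpenImmersion_incl U, ?_, ?_⟩
  · rwa [M.range_incl]
  · exact LocalJet.isOrthonormal_toJet hJ (hχ.push hM (M.incl U) h)
      (isPullbackForm_push hM hJ hχ hg h)

/-- The bundle of orthonormal frames of a metric. -/
def EvenMetric.reduction (hM : M.IsModelledOn V) (hJ : IsEvenMetricForm J) (g : EvenMetric M) :
    Reduction M V.even V.odd (OSp J) where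
  points f := {φ | IsOrthonormal J g φ}
  isFrame _ _ h := h.1
  pullback_mem k _ _ h := h.pullback hM hJ k
  isSheaf _ _ hφ h := isOrthonormal_of_local hJ hφ h
  act_mem _ _ h _ hA := h.act hA
  locallyTrivial m := by
    obtain ⟨U, j, s, hj, hm, hs⟩ := g.exists_local_section hM hJ m
    exact ⟨U, j, s, hj, hm, hs, fun T k φ hφ => (hs.pullback hM hJ k).existsUnique_act hM hφ⟩

end MetricReduction

/-! ### The metric defined by a reduction -/

section ReductionMetric

/-- Sections that agree after pullback along the members of an open cover are equal. -/
theorem eq_of_local_pull_eq {M : SuperSpace.{u}} (hM : M.IsSheaf) {Q : Opens M} {a b : M.O Q}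
    (h : ∀ m ∈ Q, ∃ (U : SuperSpace.{u}) (j : Hom U M), j.IsOpenImmersion ∧
      m ∈ Set.range j.base ∧ j.pull Q (j.pre Q) (j.mapsTo_pre Q) a =
        j.pull Q (j.pre Q) (j.mapsTo_pre Q) b) : a = b := by
  refine hM.separated fun m hm => ?_
  obtain ⟨U, j, hj, hmj, hab⟩ := h m hm
  let N : Opens M := ⟨Set.range j.base, hj.isOpenEmbedding.isOpen_range⟩
  refine ⟨Q ⊓ N, inf_le_left, ⟨hm, hmj⟩, (hj.bijective (Q ⊓ N) fun x hx => hx.2).1 ?_⟩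
  have hp : j.pre (Q ⊓ N) ≤ j.pre Q := fun x hx => hx.1
  rw [j.pull_res inf_le_left hp (j.mapsTo_pre Q), j.pull_res inf_le_left hp (j.mapsTo_pre Q), hab]

/-- Morphisms factor locally through open immersions. -/
theorem exists_local_lift {T U M : MixedSupermanifold.{u}} {j : Hom U.toSuperSpace M.toSuperSpace}
    (hj : j.IsOpenImmersion) (f : Hom T.toSuperSpace M.toSuperSpace) {t : T.toSuperSpace}
    (ht : f.base t ∈ Set.range j.base) : ∃ (S : MixedSupermanifold.{u})
      (i : Hom S.toSuperSpace T.toSuperSpace) (k : Hom S.toSuperSpace U.toSuperSpace),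
      i.IsOpenImmersion ∧ t ∈ Set.range i.base ∧ k.comp j = i.comp f := by
  let N : Opens M.toSuperSpace := ⟨Set.range j.base, hj.isOpenEmbedding.isOpen_range⟩
  obtain ⟨k, hk⟩ := hj.exists_lift ((T.incl (f.pre N)).comp f) (by
    rintro _ ⟨x, rfl⟩
    exact x.2)
  exact ⟨_, T.incl (f.pre N), k, T.isOpenImmersion_incl _, by
    rw [T.range_incl]
    exact ht, hk⟩

section

variable {T M : MixedSupermanifold.{u}} {V₀ V₁ : Type u} [AddCommGroup V₀] [Module ℂ V₀]
  [AddCommGroup V₁] [Module ℂ V₁] {f : Hom T.toSuperSpace M.toSuperSpace}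
  {J : LinearMap.BilinForm ℂ (V₀ × V₁)}

/-- The new frame is orthonormal for the old form because `A` preserves `J`. This makes the metric
of a reduction independent of the local section. -/
theorem frameForm_act (hJ : IsEvenMetricForm J) {φ : Jet f V₀ V₁} (hφ : φ.toLocal.IsFrame)
    {A : GLPoints (T.par ⊤) V₀ V₁} (hA : A ∈ OSp J T) (hφA : (φ.act A).toLocal.IsFrame) :
    frameForm hJ φ.toLocal hφ = frameForm hJ (φ.act A).toLocal hφA := by
  refine SuperForm.IsOrthonormalOn.eq_frameForm hJ hφA fun v w X Y hX hY => ?_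
  rw [(isOrthonormalOn_frameForm hJ hφ).form_eq le_rfl (x := A.1 (1 ⊗ₜ v)) (y := A.1 (1 ⊗ₜ w))
    hX.symm hY.symm]
  exact (hA _ _).trans (formExt_one_tmul v w)

end

variable {M : MixedSupermanifold.{u}} {V : MixedSuperVectorSpace.{u}}
  {J : LinearMap.BilinForm ℂ (V.even × V.odd)}

/-- The derivations along `f` that are induced by vector fields. -/
def derPush {T : MixedSupermanifold.{u}} (f : Hom T.toSuperSpace M.toSuperSpace)
    {Q : Opens M.toSuperSpace} {U : Opens T.toSuperSpace} (h : Set.MapsTo f.base U Q) :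
    Der (Hom.id M.toSuperSpace) Q →ₗ[ℂ] Der f U :=
  (preDerPush f h).restrict fun _ hD => preDerPush_mem_Der h hD

theorem derPush_val {T : MixedSupermanifold.{u}} (f : Hom T.toSuperSpace M.toSuperSpace)
    {Q : Opens M.toSuperSpace} {U : Opens T.toSuperSpace} (h : Set.MapsTo f.base U Q)
    (X : Der (Hom.id M.toSuperSpace) Q) : (derPush f h X).1 = preDerPush f h X.1 := rfl

namespace Reduction

variable (P : Reduction M V.even V.odd (OSp J))

/-- `a` is the value on the vector fields `X`, `Y` of a metric for which the points of `P` are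
orthonormal frames. -/
def IsValue (hJ : IsEvenMetricForm J) {Q : Opens M.toSuperSpace}
    (X Y : Der (Hom.id M.toSuperSpace) Q) (a : M.O Q) : Prop :=
  ∀ (T : MixedSupermanifold.{u}) (f : Hom T.toSuperSpace M.toSuperSpace)
    (φ : Jet f V.even V.odd) (hφ : φ.toLocal.IsFrame), φ ∈ P.points f →
    ∀ (U : Opens T.toSuperSpace) (h : Set.MapsTo f.base U Q),
      (frameForm hJ φ.toLocal hφ).form U (derPush f h X) (derPush f h Y) = f.pull Q U h a

variable {P} {hJ : IsEvenMetricForm J} {Q Q' : Opens M.toSuperSpace}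

/-- The local sections of `P` over open subspaces of `M` already prescribe the value locally. -/
theorem IsValue.unique {X Y : Der (Hom.id M.toSuperSpace) Q} {a b : M.O Q}
    (ha : P.IsValue hJ X Y a) (hb : P.IsValue hJ X Y b) : a = b := by
  refine eq_of_local_pull_eq M.isSheaf fun m _ => ?_
  obtain ⟨U, j, s, hj, hm, hs, -⟩ := P.locallyTrivial m
  have hF := Jet.isFrame_iff.1 (P.isFrame j s hs)
  exact ⟨U.toSuperSpace, j, hj, hm, by rw [← ha U j s hF hs, ← hb U j s hF hs]⟩

theorem IsValue.res {X Y : Der (Hom.id M.toSuperSpace) Q} {X' Y' : Der (Hom.id M.toSuperSpace) Q'}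
    {a : M.O Q} (ha : P.IsValue hJ X Y a) (h : Q' ≤ Q) (hX : X'.1 = preDerRes _ h X.1)
    (hY : Y'.1 = preDerRes _ h Y.1) : P.IsValue hJ X' Y' (M.res h a) := by
  intro T f φ hφ hP U hU
  have hU' : Set.MapsTo f.base U Q := fun x hx => h (hU hx)
  have key : ∀ (X : Der (Hom.id M.toSuperSpace) Q) (X' : Der (Hom.id M.toSuperSpace) Q'),
      X'.1 = preDerRes _ h X.1 → derPush f hU X' = derPush f hU' X := fun X X' hX =>
    Subtype.ext (by
      rw [derPush_val, derPush_val, hX]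
      exact preDerPush_res h le_rfl hU' hU (isNatural_of_mem X.2))
  rw [key X X' hX, key Y Y' hY, ha T f φ hφ hP U hU', f.pull_res h le_rfl hU' hU, T.res_self]

/-- A single trivializing section decides the value on all points of `P`: every point over a
morphism through `U` is a pullback of `s` moved by `OSp(V, J)`, which has the same form. -/
theorem isValue_of_trivialization {U : MixedSupermanifold.{u}}
    {j : Hom U.toSuperSpace M.toSuperSpace} {s : Jet j V.even V.odd} (hj : j.IsOpenImmersion)
    (hs : s.toLocal.IsFrame)
    (htriv : ∀ (T : MixedSupermanifold.{u}) (k : Hom T.toSuperSpace U.toSuperSpace),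
      ∀ φ ∈ P.points (k.comp j), ∃! A, A ∈ OSp J T ∧ (s.pullback k).act A = φ)
    (hM : M.IsModelledOn V) (hQ : (Q : Set M.toSuperSpace) ⊆ Set.range j.base)
    {X Y : Der (Hom.id M.toSuperSpace) Q} {a : M.O Q}
    (ha : j.pull Q (j.pre Q) (j.mapsTo_pre Q) a =
      (frameForm hJ s.toLocal hs).form (j.pre Q) (derPush j (j.mapsTo_pre Q) X)
        (derPush j (j.mapsTo_pre Q) Y)) : P.IsValue hJ X Y a := by
  have key : ∀ (S : MixedSupermanifold.{u}) (f : Hom S.toSuperSpace M.toSuperSpace)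
      (k : Hom S.toSuperSpace U.toSuperSpace), k.comp j = f →
      ∀ (φ : Jet f V.even V.odd) (hφ : φ.toLocal.IsFrame), φ ∈ P.points f →
      ∀ (N : Opens S.toSuperSpace) (h : Set.MapsTo f.base N Q),
        (frameForm hJ φ.toLocal hφ).form N (derPush f h X) (derPush f h Y) = f.pull Q N h a := by
    rintro S _ k rfl φ hφ hP N h
    obtain ⟨A, ⟨hA, rfl⟩, -⟩ := htriv S k φ hP
    have hsk := Jet.isFrame_iff.1 ((Jet.isFrame_iff.2 hs).pullback hM k)
    have hN : Set.MapsTo k.base N (j.pre Q) := h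
    rw [← frameForm_act hJ hsk hA hφ, Hom.comp_pull k j Q (j.pre Q) N h (j.mapsTo_pre Q) hN, ha]
    refine frameForm_pull hJ hs k hsk (s.toLocal_pullback k) hN ?_ ?_
    · exact (preDerPullOn_preDerPush k (j.mapsTo_pre Q) hN h X.1).symm
    · exact (preDerPullOn_preDerPush k (j.mapsTo_pre Q) hN h Y.1).symm
  intro T f φ hφ hP N h
  -- A general `f` need not factor through `U`, but it does near each point that it maps into the
  -- image of `j`.
  refine eq_of_local_pull_eq T.isSheaf fun t ht => ?_
  obtain ⟨S, i, k, hi, hti, hk⟩ := exists_local_lift hj f (hQ (h ht))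
  refine ⟨S.toSuperSpace, i, hi, hti, ?_⟩
  have hφi := Jet.isFrame_iff.1 ((Jet.isFrame_iff.2 hφ).pullback hM i)
  have hN : Set.MapsTo (i.comp f).base (i.pre N) Q := fun x hx => h hx
  have h1 := key S (i.comp f) k hk (φ.pullback i) hφi (P.pullback_mem i f φ hP) (i.pre N) hN
  rw [Hom.comp_pull i f Q N _ hN h (i.mapsTo_pre N)] at h1
  rw [← h1]
  refine (frameForm_pull hJ hφ i hφi (φ.toLocal_pullback i) (i.mapsTo_pre N) ?_ ?_).symm
  · exact (preDerPullOn_preDerPush i h (i.mapsTo_pre N) hN X.1).symm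
  · exact (preDerPullOn_preDerPush i h (i.mapsTo_pre N) hN Y.1).symm

/-- Over each trivializing open set the value is read off from the local section; uniqueness makes
these values agree on overlaps, so they glue. -/
theorem exists_isValue (P : Reduction M V.even V.odd (OSp J)) (hM : M.IsModelledOn V)
    (hJ : IsEvenMetricForm J) (X Y : Der (Hom.id M.toSuperSpace) Q) :
    ∃ a, P.IsValue hJ X Y a := by
  choose U j s hj hm hs htriv using P.locallyTrivial
  let N : M.toSuperSpace → Opens M.toSuperSpace := fun m =>
    ⟨Set.range (j m).base, (hj m).isOpenEmbedding.isOpen_range⟩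
  let R : ∀ m, Der (Hom.id M.toSuperSpace) Q → Der (Hom.id M.toSuperSpace) (Q ⊓ N m) := fun m X =>
    ⟨preDerRes _ inf_le_left X.1, preDerRes_mem_Der _ X.2⟩
  have loc : ∀ m, ∃ a, P.IsValue hJ (R m X) (R m Y) a := fun m => by
    have hQ : ((Q ⊓ N m : Opens M.toSuperSpace) : Set M.toSuperSpace) ⊆ Set.range (j m).base :=
      fun x hx => hx.2
    have hF := Jet.isFrame_iff.1 (P.isFrame _ _ (hs m))
    obtain ⟨a, ha⟩ := ((hj m).bijective (Q ⊓ N m) hQ).2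
      ((frameForm hJ (s m).toLocal hF).form _ (derPush (j m) ((j m).mapsTo_pre _) (R m X))
        (derPush (j m) ((j m).mapsTo_pre _) (R m Y)))
    exact ⟨a, isValue_of_trivialization (hj m) hF (htriv m) hM hQ ha⟩
  choose a ha using loc
  obtain ⟨b, hb, -⟩ := M.isSheaf.glue (ι := M.toSuperSpace) (U := Q) (fun m => Q ⊓ N m)
    (fun m => inf_le_left) (fun m hmQ => ⟨m, hmQ, hm m⟩) a fun m n => by
      let R' : Der (Hom.id M.toSuperSpace) Q →
          Der (Hom.id M.toSuperSpace) ((Q ⊓ N m) ⊓ (Q ⊓ N n)) := fun X =>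
        ⟨preDerRes _ (inf_le_left.trans inf_le_left) X.1, preDerRes_mem_Der _ X.2⟩
      exact ((ha m).res inf_le_left (X' := R' X) (Y' := R' Y) rfl rfl).unique
        ((ha n).res inf_le_right rfl rfl)
  refine ⟨b, fun T f φ hφ hP U' h => T.isSheaf.separated fun t ht => ?_⟩
  let O := U' ⊓ f.pre (N (f.base t))
  have hO : Set.MapsTo f.base O (Q ⊓ N (f.base t) : Opens M.toSuperSpace) := fun x hx =>
    ⟨h hx.1, hx.2⟩
  refine ⟨O, inf_le_left, ⟨ht, hm (f.base t)⟩, ?_⟩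
  rw [← f.pull_res inf_le_left inf_le_left h hO b, hb, ← ha (f.base t) T f φ hφ hP O hO]
  refine ((frameForm hJ φ.toLocal hφ).form_res inf_le_left _ _ _ _ ?_ ?_).symm
  · exact preDerPush_res inf_le_left inf_le_left h hO (isNatural_of_mem X.2)
  · exact preDerPush_res inf_le_left inf_le_left h hO (isNatural_of_mem Y.2)

/-- The value on `X`, `Y` of the metric defined by `P`. -/
def value (P : Reduction M V.even V.odd (OSp J)) (hM : M.IsModelledOn V) (hJ : IsEvenMetricForm J)
    (X Y : Der (Hom.id M.toSuperSpace) Q) : M.O Q := (P.exists_isValue hM hJ X Y).choose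

variable {hM : M.IsModelledOn V}

theorem isValue_value (X Y : Der (Hom.id M.toSuperSpace) Q) :
    P.IsValue hJ X Y (P.value hM hJ X Y) := (P.exists_isValue hM hJ X Y).choose_spec

theorem value_eq {X Y : Der (Hom.id M.toSuperSpace) Q} {a : M.O Q} (h : P.IsValue hJ X Y a) :
    P.value hM hJ X Y = a := (isValue_value X Y).unique h

variable (P hM hJ) in
/-- The form defined by a reduction. -/
def superForm : SuperForm (Hom.id M.toSuperSpace) where
  form Q := LinearMap.mk₂ ℂ (P.value hM hJ)
    (fun X X' Y => value_eq fun T f φ hφ hP U h => by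
      rw [map_add, map_add, LinearMap.add_apply, map_add, isValue_value X Y T f φ hφ hP U h,
        isValue_value X' Y T f φ hφ hP U h])
    (fun c X Y => value_eq fun T f φ hφ hP U h => by
      rw [map_smul, map_smul, LinearMap.smul_apply, map_smul, isValue_value X Y T f φ hφ hP U h])
    (fun X Y Y' => value_eq fun T f φ hφ hP U h => by
      rw [map_add, map_add, map_add, isValue_value X Y T f φ hφ hP U h,
        isValue_value X Y' T f φ hφ hP U h])
    (fun c X Y => value_eq fun T f φ hφ hP U h => by
      rw [map_smul, map_smul, map_smul, isValue_value X Y T f φ hφ hP U h])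
  form_res h X Y X' Y' hX hY :=
    value_eq (hM := hM) ((isValue_value (hM := hM) X Y).res h hX hY)
  form_mul Q a X X' Y hX := value_eq (hM := hM) fun T f φ hφ hP U h => by
    rw [map_mul]
    refine ((frameForm hJ φ.toLocal hφ).form_mul U (f.pull Q U h a) (derPush f h X) _ _ ?_).trans
      (congrArg _ (isValue_value (hM := hM) X Y T f φ hφ hP U h))
    rw [derPush_val, hX, preDerPush_preDerMul]
    rfl
  even Q p q X Y hX hY := by
    -- The forms of all frames are even, so the parity conjugate with the expected sign is a value
    -- as well and coincides with the value by uniqueness.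
    have h1 : P.IsValue hJ X Y (sgn (p + q) • M.par Q (P.value hM hJ X Y)) :=
      fun T f φ hφ hP U h => by
        have h2 := (frameForm hJ φ.toLocal hφ).even U p q (derPush f h X) (derPush f h Y)
          (preDerPush_mem f h p hX) (preDerPush_mem f h q hY)
        rw [map_smul, f.pull_par, ← isValue_value X Y T f φ hφ hP U h, h2, smul_smul,
          sgn_mul_self, one_smul]
    have h2 := congrArg (fun a => sgn (p + q) • a) (value_eq (hM := hM) h1)
    simp only [smul_smul, sgn_mul_self, one_smul] at h2
    exact h2.symm
  supersymmetric Q p q X Y hX hY := value_eq (hM := hM) fun T f φ hφ hP U h => by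
    refine ((frameForm hJ φ.toLocal hφ).supersymmetric U p q (derPush f h X) (derPush f h Y)
      (preDerPush_mem f h p hX) (preDerPush_mem f h q hY)).trans ?_
    rw [map_smul]
    exact congrArg (fun a => sgn (p * q) • a) (isValue_value (hM := hM) Y X T f φ hφ hP U h)

theorem isPullbackForm_superForm {T : MixedSupermanifold.{u}}
    {f : Hom T.toSuperSpace M.toSuperSpace} {φ : Jet f V.even V.odd} (hφ : φ.toLocal.IsFrame)
    (h : φ ∈ P.points f) :
    IsPullbackForm (P.superForm hJ hM) (frameForm hJ φ.toLocal hφ) := by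
  intro W U hU X Y X' Y' hX hY
  obtain rfl : derPush f hU X = X' := Subtype.ext hX.symm
  obtain rfl : derPush f hU Y = Y' := Subtype.ext hY.symm
  exact isValue_value (hM := hM) (hJ := hJ) X Y T f φ hφ h U hU

end Reduction

/-- An orthonormal frame over an open subspace is an orthonormal frame of the tangent bundle. -/
theorem exists_orthonormal_of_section (hM : M.IsModelledOn V) (hJ : IsEvenMetricForm J)
    {g : SuperForm (Hom.id M.toSuperSpace)} {U : MixedSupermanifold.{u}}
    {j : Hom U.toSuperSpace M.toSuperSpace} (hj : j.IsOpenImmersion) {s : LocalJet j ⊤ V.even V.odd}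
    (hs : s.IsFrame) (hg : IsPullbackForm g (frameForm hJ s hs)) {m : M.toSuperSpace}
    (hm : m ∈ Set.range j.base) :
    ∃ (W : Opens M.toSuperSpace) (ψ : LocalJet (Hom.id M.toSuperSpace) W V.even V.odd),
      m ∈ W ∧ ψ.IsFrame ∧ g.IsOrthonormalOn J ψ := by
  obtain ⟨C, hC⟩ := (hM m).exists_chart
  let N : Opens M.toSuperSpace := ⟨Set.range j.base, hj.isOpenEmbedding.isOpen_range⟩
  let W := C.dom ⊓ N
  have hW : W ≤ C.dom := inf_le_left
  let ψ := C.frame (Hom.id M.toSuperSpace) hW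
  have hψ : ψ.IsFrame := C.isFrame_frame (Hom.id M.toSuperSpace) hW
  have hp := j.mapsTo_pre W
  have hbij := hj.bijective W fun x hx => hx.2
  let e := AlgEquiv.ofBijective (j.pull W (j.pre W) hp) hbij
  have he : ∀ a, j.pull W (j.pre W) hp (e.symm a) = a := fun a => e.apply_symm_apply a
  have hpar : ∀ a, e.symm.toAlgHom (U.par _ a) = M.par W (e.symm.toAlgHom a) := fun a => by
    apply hbij.1
    refine (he _).trans ?_
    rw [j.pull_par]
    exact congrArg _ (he a).symm
  -- Along `j` the section `s` is the coordinate frame times an invertible matrix `A` over `j⁻¹(W)`.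
  -- The entries of `A` descend to `W` through the isomorphism `e`.
  obtain ⟨A, D, hA, hAs, hAD, hDA⟩ := (hψ.push hM j hp).exists_precomp_inverse
    (hs.restrict (le_top : j.pre W ≤ ⊤)) U.isSupercommutative
  have hA' : IsEvenMap (M.par W) (baseMap _ e.symm.toAlgHom ∘ₗ A) :=
    LocalJet.IsEvenMap.baseMap hA hpar
  have hinv : ∀ {A D : V.even × V.odd →ₗ[ℂ] U.O (j.pre W) ⊗[ℂ] (V.even × V.odd)},
      (∀ v, extendScalars A (D v) = 1 ⊗ₜ v) → ∀ v,
      extendScalars (baseMap _ e.symm.toAlgHom ∘ₗ A) ((baseMap _ e.symm.toAlgHom ∘ₗ D) v) =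
        1 ⊗ₜ v := fun {A D} h v => by
    rw [LinearMap.comp_apply, ← baseMap_extendScalars, h, baseMap_tmul, map_one]
  refine ⟨W, ψ.precomp M.isSupercommutative _ hA', ⟨hC, hm⟩,
    hψ.precomp M.isSupercommutative hA' (hinv hAD) (hinv hDA), fun v w X Y hX hY => ?_⟩
  have key : ∀ (v : V.even × V.odd) (X : Der (Hom.id M.toSuperSpace) W),
      X.1 = ψ.secs le_rfl (baseMap _ e.symm.toAlgHom (A v)) →
      s.secs le_top (1 ⊗ₜ v) = (derPush j hp X).1 := fun v X hX => by
    rw [derPush_val, hX, ← ψ.push_secs j hp le_rfl le_rfl hp,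
      baseMap_baseMap (P'' := AlgHom.id ℂ _) (fun a => he a), baseMap_of_eq_id (fun _ => rfl)]
    exact (s.secs_one_tmul le_top v).trans
      (LinearMap.congr_fun (congrArg LocalJet.val hAs) v).symm
  apply hbij.1
  rw [← hg W _ hp X Y (derPush j hp X) (derPush j hp Y) rfl rfl,
    frameForm_eq hJ hs (key v X hX) (key w Y hY), formExt_one_tmul, AlgHom.commutes]

/-- The metric defined by a reduction. -/
def Reduction.metric (P : Reduction M V.even V.odd (OSp J)) (hM : M.IsModelledOn V)
    (hJ : IsEvenMetricForm J) : EvenMetric M :=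
  ⟨P.superForm hJ hM, SuperForm.nondegenerate_of_local hJ _ fun m => by
    obtain ⟨U, j, s, hj, hm, hs, -⟩ := P.locallyTrivial m
    have hF := Jet.isFrame_iff.1 (P.isFrame j s hs)
    exact exists_orthonormal_of_section hM hJ hj hF
      (Reduction.isPullbackForm_superForm hF hs) hm⟩

/-- The points of `P` are orthonormal by construction. Conversely, an orthonormal frame differs
locally from a pullback of a section of `P` by a point of `OSp(V, J)`, so it lies in `P` locally,
and then globally since `P` is a sheaf. -/
theorem Reduction.reduction_metric (P : Reduction M V.even V.odd (OSp J)) (hM : M.IsModelledOn V)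
    (hJ : IsEvenMetricForm J) : (P.metric hM hJ).reduction hM hJ = P := by
  have hle : ∀ {T : MixedSupermanifold.{u}} (f : Hom T.toSuperSpace M.toSuperSpace)
      (φ : Jet f V.even V.odd), φ ∈ P.points f → IsOrthonormal J (P.metric hM hJ) φ :=
    fun f φ h => by
      have hF := Jet.isFrame_iff.1 (P.isFrame f φ h)
      exact (isOrthonormal_iff hJ hF).2 (isPullbackForm_superForm hF h)
  refine Reduction.ext ?_
  funext T f
  refine Set.Subset.antisymm (fun φ h => ?_) fun φ h => hle f φ h
  have h' : IsOrthonormal J (P.metric hM hJ) φ := h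
  refine P.isSheaf f φ h'.1 fun t => ?_
  obtain ⟨U, j, s, hj, hm, hs, -⟩ := P.locallyTrivial (f.base t)
  obtain ⟨S, i, k, hi, hti, hk⟩ := exists_local_lift hj f hm
  refine ⟨S, i, hi, hti, ?_⟩
  -- Generalizing the morphism allows `i.comp f` to be replaced by `k.comp j`, over which the
  -- section of `P` lives.
  have key : ∀ (f' : Hom S.toSuperSpace M.toSuperSpace), k.comp j = f' →
      ∀ χ : Jet f' V.even V.odd, IsOrthonormal J (P.metric hM hJ) χ → χ ∈ P.points f' := by
    rintro _ rfl χ hχ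
    have hsk := P.pullback_mem k j s hs
    obtain ⟨A, ⟨hA, rfl⟩, -⟩ := (hle _ _ hsk).existsUnique_act hM hχ
    exact P.act_mem _ _ hsk A hA
  exact key _ hk _ (h'.pullback hM hJ i)

/-- A local orthonormal section for one metric is orthonormal for the other. Both metrics then pull
back to the form of that frame, and pullback along an open immersion is injective on functions over
its image. -/
theorem EvenMetric.reduction_injective (hM : M.IsModelledOn V) (hJ : IsEvenMetricForm J) :
    Function.Injective fun g : EvenMetric M => g.reduction hM hJ := by
  intro g g' h
  have hp : ∀ {T : MixedSupermanifold.{u}} (f : Hom T.toSuperSpace M.toSuperSpace)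
      (φ : Jet f V.even V.odd), IsOrthonormal J g φ → IsOrthonormal J g' φ := fun f φ hφ => by
    have h1 : φ ∈ (g.reduction hM hJ).points f := hφ
    have h2 : g.reduction hM hJ = g'.reduction hM hJ := h
    rw [h2] at h1
    exact h1
  refine Subtype.ext (SuperForm.ext (funext fun Q => LinearMap.ext₂ fun X Y => ?_))
  refine eq_of_local_pull_eq M.isSheaf fun m _ => ?_
  obtain ⟨U, j, s, hj, hm, hs⟩ := g.exists_local_section hM hJ m
  have hF := Jet.isFrame_iff.1 hs.1
  have h1 := (isOrthonormal_iff hJ hF).1 hs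
  have h2 := (isOrthonormal_iff hJ hF).1 (hp j s hs)
  refine ⟨U.toSuperSpace, j, hj, hm, ?_⟩
  rw [← h1 Q _ (j.mapsTo_pre Q) X Y (derPush j (j.mapsTo_pre Q) X)
      (derPush j (j.mapsTo_pre Q) Y) rfl rfl,
    ← h2 Q _ (j.mapsTo_pre Q) X Y (derPush j (j.mapsTo_pre Q) X)
      (derPush j (j.mapsTo_pre Q) Y) rfl rfl]

/-- Metrics correspond to reductions of the frame bundle to `OSp(V, J)`. -/
def EvenMetric.equivReduction (hM : M.IsModelledOn V) (hJ : IsEvenMetricForm J) :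
    EvenMetric M ≃ Reduction M V.even V.odd (OSp J) :=
  Equiv.ofBijective (fun g => g.reduction hM hJ)
    ⟨EvenMetric.reduction_injective hM hJ, fun P => ⟨P.metric hM hJ, P.reduction_metric hM hJ⟩⟩

end ReductionMetric

end

end SuperGeom

theorem mainTheorem4 (V : SuperGeom.MixedSuperVectorSpace.{u})
    (J : LinearMap.BilinForm ℂ (V.even × V.odd)) (hJ : SuperGeom.IsEvenMetricForm J) :
    (∀ M : SuperGeom.MixedSupermanifold.{u}, M.IsModelledOn V →
      ∃ e : SuperGeom.EvenMetric M ≃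
          SuperGeom.Reduction M V.even V.odd (SuperGeom.OSp J),
        ∀ (g : SuperGeom.EvenMetric M) (T : SuperGeom.MixedSupermanifold.{u})
          (f : SuperGeom.SuperSpace.Hom T.toSuperSpace M.toSuperSpace)
          (φ : SuperGeom.Jet f V.even V.odd),
          φ ∈ (e g).points f ↔ SuperGeom.IsOrthonormal J g φ) ∧
    SuperGeom.prolongation (SuperGeom.osp J) 1 = ⊥ ∧
    SuperGeom.IsFiniteType (SuperGeom.osp J) :=
  ⟨fun _ hM => ⟨SuperGeom.EvenMetric.equivReduction hM hJ, fun _ _ _ _ => Iff.rfl⟩,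
    SuperGeom.prolongation_osp_one hJ, SuperGeom.isFiniteType_osp hJ⟩
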